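/- **Notation.** Fix $d\in\mathbb N$, $\mathbb N_\omega=\mathbb N\cup\{\omega\}$. For $\mu\in\mathbb N_\omega^d$ let $\Omega(\mu)=\{i:\mu[i]=\omega\}$. Write $\mu\sqsubseteq\nu$ if for every $i$ either $\nu[i]=\omega$ or $\mu[i]=\nu[i]$; write $\mu\parallel\nu$ if for every $i$ we have $\mu[i]=\nu[i]$, $\mu[i]=\omega$ or $\nu[i]=\omega$. **NGVAS.** A *context information* consists of a set $Un\subseteq[1,d]$, a linear set $R=b+P^*\subseteq\mathbb Z^d$ with $P$ finite (the *restriction*) and markings $c_{in},c_{out}\in\mathbb N_\omega^d$. A *weak NGVAS* of nesting depth $0$ is a word of at most two updates from $\mathbb Z^d$ with a context information such that $Un\subseteq\Omega(c_{in})\cap\Omega(c_{out})$. A weak NGVAS $N$ of positive nesting depth consists of a context-free grammar with finitely many nonterminals, finitely many productions, all of the form $A\to\sigma.\tau$ with symbols $\sigma,\tau$, and a start symbol; the terminals are weak NGVAS of smaller depth (the *children*), each occurring in a production; a context information; and *boundedness information*: sets $D_l,D_r\subseteq[1,d]$ and markings $\mathrm{in}(A),\mathrm{out}(A)$ with $\Omega(\mathrm{in}(A))=D_l$,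 $\Omega(\mathrm{out}(A))=D_r$ for all nonterminals $A$. For a child $M$ put $\mathrm{in}(M)=M.c_{in}$, $\mathrm{out}(M)=M.c_{out}$. The grammar is *branching* if some production has two nonterminals on the right; a production is *persisting* if it has at least one, otherwise an *exit production*. Required: $Un\subseteq\Omega(c_{in})\cap\Omega(c_{out})$, $Un\subseteq D_l\cap D_r$, $Un\subseteq M.Un$ for all children $M$; $D_l=D_r$ if branching; $c_{in}\sqsubseteq\mathrm{in}(S)$ and $c_{out}\sqsubseteq\mathrm{out}(S)$ for the start symbol $S$; and for each production $A\to\sigma.\tau$: if it is persisting or the grammar is branching, $\mathrm{in}(A)=\mathrm{in}(\sigma)$, $\mathrm{out}(\sigma)=\mathrm{in}(\tau)$, $\mathrm{out}(\tau)=\mathrm{out}(A)$, and $\Omega(M.c_{in})=\Omega(M.c_{out})=M.Un$ for each child $M\in\{\sigma,\tau\}$; otherwise $\mathrm{in}(\sigma)\sqsubseteq\mathrm{in}(A)$, $\mathrm{out}(\sigma)=\mathrm{in}(\tau)$, $\mathrm{out}(\tau)\sqsubseteq\mathrm{out}(A)$. An *NGVAS* is a weak NGVAS such that, at all levels, the grammar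 is strongly connected, every nonterminal occurs in a derivation of a terminal word from the start symbol, and there is exactly one exit production if the grammar is not branching. It is *non-linear* if its grammar is branching, otherwise *linear* (in particular for depth $0$). **Runs.** Runs are triples $(m,r,m')$ with $m,m'\in\mathbb N^d$, $r\in(\mathbb Z^d)^*$. An update $u$ has the runs $(m,u,m+u)$ with $m,m+u\in\mathbb N^d$; the runs of a word are obtained by concatenation at equal intermediate markings; $\mathrm{Runs}(N)$ consists of the runs $(m,r,m')$ of words of the language of $N$ for which the sum of the updates in $r$ lies in $R$, $m\sqsubseteq c_{in}$ and $m'\sqsubseteq c_{out}$. For a nonterminal $A$, $\mathrm{Runs}(A)$ is the set of runs of terminal words derivable from $A$. **Cycles, ranks.** A cycle is a derivation $A\to^*u.A.v$ with $u,v$ words of children. Its left (right) effects are the sums of one element of the restriction of each child in $u$ (in $v$). A counter is fixed on the left (right) if all left (right) effects of all cycles are $0$ on it; it is rigid on the left (right) if moreover $c_{in}[i]\neq\omega$ ($c_{out}[i]\ne\omega$). *All rigid counters are concretely tracked* if no counter rigid on the left is in $D_l$ and none rigid on the right is in $D_r$. The local rank of $N$ in $\mathbb N^{d+1}$ (ordered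 lexicographically, entries of higher dimension first) is the number of nonterminals in the entry of the dimension of the real span of all left effects of cycles if $N$ is non-linear, and $0$ if $N$ is linear. The system rank $\mathrm{srank}(N)$ is the maximum, over all sequences $N=N_0,\dots,N_m$ with $N_{i+1}$ a child of $N_i$, of the sums of the local ranks. The local index is $0$ for non-linear $N$; for linear $N$ it is the maximum of $1$, the local index of each child of the same system rank as $N$, plus one if the child occurs in a persisting production, and one plus the common local index of the children in the exit production if these have the same local index and both have the system rank of $N$. The non-linear rank is $\mathrm{recrank}(N)=(|[1,d]\setminus Un|,\mathrm{srank}(N),\text{local index})$, ordered lexicographically. **Variants.** Let $N$ be a non-linear NGVAS, $D=D_l=D_r$. For a nonterminal $A$ and $\mu\sqsubseteq\mathrm{in}(A)$, $\nu\sqsubseteq\mathrm{out}(A)$, the variant $[N]_{\mu,A,\nu}$ is $N$ with start symbol $A$ and context information $Un=\Omega(\mu)\cap\Omega(\nu)$, $R=\mathbb Z^d$, $c_{in}=\mu$, $c_{out}=\nu$. It is *relevant* if $\Omega(N.c_{in})\subseteq\Omega(\mu)\subseteq D$ and $\Omega(N.c_{out})\subseteq\Omega(\nu)\subseteq D$.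 **Approximators.** A *post-approximator* assigns to a marking $\mu$ and a symbol $\sigma$ a finite set $\mathrm{post}(\mu,\sigma)\subseteq\mathbb N_\omega^d$ such that, whenever $\Omega(\mu)\subseteq D$: $\nu\sqsubseteq\mathrm{out}(\sigma)$ and $\Omega(\mu)\subseteq\Omega(\nu)$ for all $\nu\in\mathrm{post}(\mu,\sigma)$; for each $(m,r,m')\in\mathrm{Runs}(\sigma)$ with $m\sqsubseteq\mu$ some $\nu\in\mathrm{post}(\mu,\sigma)$ has $m'\sqsubseteq\nu$; for each production $A\to\sigma.\tau$, $\nu\in\mathrm{post}(\mu,\sigma)$ and $\xi\in\mathrm{post}(\nu,\tau)$ some $\xi'\in\mathrm{post}(\mu,A)$ has $\xi\sqsubseteq\xi'$. A *pre-approximator* is defined symmetrically (from targets to sources, right to left, with $\mathrm{in}(\sigma)$ for $\mathrm{out}(\sigma)$). **Coverability grammar.** Its symbols are $((\mu,p),\sigma,(q,\nu),h)$ with $\mu,p,q,\nu\in\mathbb N_\omega^d$, $h\in\mathbb N$ and $\sigma$ a nonterminal or child of $N$, which makes the symbol a nonterminal or terminal. The grammar for $[N]_{\mu_0,A_0,\nu_0}$,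 $\mathrm{post}$, $\mathrm{pre}$ has the start symbol $\mathcal S=((\mu_0,\mathrm{out}(A_0)),A_0,(\mathrm{in}(A_0),\nu_0),0)$ and is built by treating, one at a time, in any order, the nonterminals that still wait for productions, initially $\mathcal S$. "Fresh" symbols have a last component that is not used elsewhere; new nonterminals wait for productions. $V$ can create $W$ if $W$ is reached from $V$ along productions constructed so far. * $\mathcal S$ gets the productions $\mathcal S\to((\mu_0,p),A_0,(q,\nu_0),h)$, fresh, for all $p\in\mathrm{post}(\mu_0,A_0)$, $q\in\mathrm{pre}(\nu_0,A_0)$. * Let $W=((\mu,p),A,(q,\nu),h)\ne\mathcal S$. If some nonterminal $V=((\mu',\cdot),A,(\cdot,\nu'),\cdot)$ can create $W$ in at least one step, $(\mu',\nu')\le(\mu,\nu)$, and some entry of $(\mu,\nu)$ is finite and larger than that of $(\mu',\nu')$, then one such $V$ is chosen and $W$ gets the productions $W\to((\mu_\omega,p''),A,(q'',\nu_\omega),h'')$, fresh, for all $p''\in\mathrm{post}(\mu_\omega,A)$, $q''\in\mathrm{pre}(\nu_\omega,A)$, where $(\mu_\omega,\nu_\omega)$ is $(\mu,\nu)$ with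 $\omega$ at all entries in which $(\mu',\nu')$ is smaller. * Otherwise, $W$ gets a production $W\to((\mu,p'),\sigma,(q'',q'),h').((p',p''),\tau,(q',\nu),h'')$ for all $A\to\sigma.\tau$ in $N$ and all $p'\in\mathrm{post}(\mu,\sigma)$, $p''\in\mathrm{post}(p',\tau)$, $q'\in\mathrm{pre}(\nu,\tau)$, $q''\in\mathrm{pre}(q',\sigma)$ with $p''\sqsubseteq p$, $q''\sqsubseteq q$, $p'\parallel q'$. Here a nonterminal on the right-hand side is an already present nonterminal other than $\mathcal S$ with the same first five components that equals $W$ or can create $W$, if there is one; all other symbols are fresh. The result of a terminated construction is a coverability grammar. It *remains bounded* if it has no nonterminal $((\mathrm{in}(B),\cdot),B,(\cdot,\mathrm{out}(B)),\cdot)$. **Decomposition.** A decomposition of $M$ is a finite set $\mathcal D$ of NGVAS such that $\mathrm{Runs}(M)=\bigcup_{N'\in\mathcal D}\mathrm{Runs}(N')$ and, for all $N'\in\mathcal D$, $M.Un\subseteq N'.Un$, $N'.c_{in}\sqsubseteq M.c_{in}$, $N'.c_{out}\sqsubseteq M.c_{out}$, $N'.R\subseteq M.R$ and $\mathrm{recrank}(N')<\mathrm{recrank}(M)$.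 **Elementary resources.** Programs are those of the language WHILE over binary trees (assignments of expressions built from variables, nil, cons, hd, tl; sequencing; while loops), with the number of executed assignments and tests as running time. NGVAS, markings and coverability grammars are written as trees in the obvious way. A bound is elementary if it is a tower of exponentials of constant height in the number of nodes of the input. **Lemma.** There is a program, running in elementary time, with the following property. Let $d$ be a dimension, $N$ a non-linear NGVAS of dimension $d$ all of whose rigid counters are concretely tracked (in particular, $N$ may be any non-linear NGVAS that is perfect except possibly for the existence of up- and down-pumping runs). Let $[N]_{\mu,A,\nu}$ be a relevant variant, let $\mathrm{post}$ and $\mathrm{pre}$ be any post- and pre-approximators for $N$, and let $G$ be a coverability grammar for $[N]_{\mu,A,\nu}$, $\mathrm{post}$, $\mathrm{pre}$ that remains bounded. Then on input $(d,N,\mu,A,\nu,G)$ the program outputs a decomposition $\mathcal D$ of $[N]_{\mu,A,\nu}$ such that $\mathrm{recrank}(N')<\mathrm{recrank}(N)$ for all $N'\in\mathcal D$. -/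

import Mathlib

namespace NestedVAS

/-! ## Markings and generalized markings -/

/-- Concrete counter valuations. -/
abbrev Marking (d : ℕ) := Fin d → ℕ

/-- Counter valuations in which the value `ω`, written `⊤`, is allowed. -/
abbrev OMarking (d : ℕ) := Fin d → ℕ∞

/-- Counter updates and effects. -/
abbrev Update (d : ℕ) := Fin d → ℤ

/-- The counters at which a generalized marking is `ω`. -/
def omegas {d : ℕ} (μ : OMarking d) : Finset (Fin d) :=
  Finset.univ.filter fun i => μ i = ⊤

/-- `Spec x y`: the marking `x` specializes `y`, it agrees with `y` wherever `y` is not `ω`. -/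
def Spec {d : ℕ} (x y : OMarking d) : Prop := ∀ i, y i = ⊤ ∨ x i = y i

/-- Two generalized markings are compatible if they agree wherever both are concrete. -/
def Compat {d : ℕ} (x y : OMarking d) : Prop := ∀ i, x i = y i ∨ x i = ⊤ ∨ y i = ⊤

/-- A concrete marking as a generalized one. -/
def Marking.lift {d : ℕ} (m : Marking d) : OMarking d := fun i => (m i : ℕ∞)

/-! ## Nested GVAS -/

/-- Context information: unconstrained counters, a linear set of effects (the restriction), given
by a base and finitely many periods, and an input and an output marking. -/
structure Context (d : ℕ) where
  unc : Finset (Fin d)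
  base : Update d
  periods : List (Update d)
  cin : OMarking d
  cout : OMarking d

/-- The linear set `base + periods*`. -/
def Context.restr {d : ℕ} (c : Context d) : Set (Update d) :=
  {v | ∃ y ∈ AddSubmonoid.closure {p | p ∈ c.periods}, v = c.base + y}

/-- Boundedness information for nonterminals `Fin n`. -/
structure Boundedness (d n : ℕ) where
  left : Finset (Fin d)
  right : Finset (Fin d)
  inn : Fin n → OMarking d
  out : Fin n → OMarking d

/-- Everything in an NGVAS of positive nesting depth apart from the children that its terminals
`Fin k` stand for.  A production `A → σ.τ` is the triple `(A, σ, τ)`. -/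
structure Shell (d n k : ℕ) where
  start : Fin n
  prods : List (Fin n × Symbol (Fin k) (Fin n) × Symbol (Fin k) (Fin n))
  ctx : Context d
  bd : Boundedness d n

/-- The underlying context-free grammar. -/
abbrev Shell.cfg {d n k : ℕ} (s : Shell d n k) : ContextFreeGrammar (Fin k) where
  NT := Fin n
  initial := s.start
  rules := (s.prods.map fun p => ⟨p.1, [p.2.1, p.2.2]⟩).toFinset

/-- Raw nested GVAS.  A `leaf` has nesting depth zero: one nonterminal and one production, which
derives the word of updates.  A `node` has the NGVAS `child c` as its terminals. -/
inductive NGVAS (d : ℕ) : Type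
  | leaf (word : List (Update d)) (ctx : Context d) : NGVAS d
  | node {n k : ℕ} (child : Fin k → NGVAS d) (s : Shell d n k) : NGVAS d

/-- The context information of an NGVAS. -/
def NGVAS.ctx {d : ℕ} : NGVAS d → Context d
  | .leaf _ c => c
  | .node _ s => s.ctx

section Grammar

variable {d n k : ℕ}

/-- `A →* w` in the grammar, for a nonterminal `A` and a sentential form `w`. -/
def Shell.Derives (s : Shell d n k) (A : Fin n) (w : List (Symbol (Fin k) (Fin n))) : Prop :=
  s.cfg.Derives [Symbol.nonterminal A] w

/-- The production has a nonterminal on its right-hand side. -/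
def Persisting (p : Fin n × Symbol (Fin k) (Fin n) × Symbol (Fin k) (Fin n)) : Prop :=
  ∃ B, p.2.1 = Symbol.nonterminal B ∨ p.2.2 = Symbol.nonterminal B

/-- Some production has two nonterminals on its right-hand side. -/
def Shell.Branching (s : Shell d n k) : Prop :=
  ∃ p ∈ s.prods, ∃ B C, p.2.1 = Symbol.nonterminal B ∧ p.2.2 = Symbol.nonterminal C

/-- Each nonterminal can be reached from each nonterminal. -/
def Shell.StronglyConnected (s : Shell d n k) : Prop :=
  ∀ A B, ∃ u v, s.Derives A (u ++ [Symbol.nonterminal B] ++ v)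

/-- Each nonterminal occurs in a derivation of a terminal word from the start symbol. -/
def Shell.AllUseful (s : Shell d n k) : Prop :=
  ∀ A, ∃ (u v : List (Symbol (Fin k) (Fin n))) (w : List (Fin k)),
    s.Derives s.start (u ++ [Symbol.nonterminal A] ++ v) ∧
      s.cfg.Derives (u ++ [Symbol.nonterminal A] ++ v) (w.map Symbol.terminal)

/-- Input marking of a symbol; `cc` lists the context information of the children. -/
def Shell.inOf (s : Shell d n k) (cc : Fin k → Context d) : Symbol (Fin k) (Fin n) → OMarking d
  | .terminal c => (cc c).cin
  | .nonterminal A => s.bd.inn A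

/-- Output marking of a symbol. -/
def Shell.outOf (s : Shell d n k) (cc : Fin k → Context d) : Symbol (Fin k) (Fin n) → OMarking d
  | .terminal c => (cc c).cout
  | .nonterminal A => s.bd.out A

/-- Consistency of the boundedness information along a production. -/
def Shell.Consistent (s : Shell d n k) (cc : Fin k → Context d)
    (p : Fin n × Symbol (Fin k) (Fin n) × Symbol (Fin k) (Fin n)) : Prop :=
  ((Persisting p ∨ s.Branching) →
    s.bd.inn p.1 = s.inOf cc p.2.1 ∧ s.outOf cc p.2.1 = s.inOf cc p.2.2 ∧
      s.outOf cc p.2.2 = s.bd.out p.1 ∧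
      ∀ c, (p.2.1 = Symbol.terminal c ∨ p.2.2 = Symbol.terminal c) →
        omegas (cc c).cin = (cc c).unc ∧ omegas (cc c).cout = (cc c).unc) ∧
  (¬ (Persisting p ∨ s.Branching) →
    Spec (s.inOf cc p.2.1) (s.bd.inn p.1) ∧ s.outOf cc p.2.1 = s.inOf cc p.2.2 ∧
      Spec (s.outOf cc p.2.2) (s.bd.out p.1))

/-- The conditions on a weak NGVAS of positive nesting depth, apart from those on its children. -/
structure Shell.Valid (s : Shell d n k) (cc : Fin k → Context d) : Prop where
  occurs : ∀ c, ∃ p ∈ s.prods, p.2.1 = Symbol.terminal c ∨ p.2.2 = Symbol.terminal c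
  unc_ctx : s.ctx.unc ⊆ omegas s.ctx.cin ∩ omegas s.ctx.cout
  unc_child : ∀ c, s.ctx.unc ⊆ (cc c).unc
  unc_bd : s.ctx.unc ⊆ s.bd.left ∩ s.bd.right
  bd_in : ∀ A, omegas (s.bd.inn A) = s.bd.left
  bd_out : ∀ A, omegas (s.bd.out A) = s.bd.right
  bd_mid : s.Branching → s.bd.left = s.bd.right
  start_in : Spec s.ctx.cin (s.bd.inn s.start)
  start_out : Spec s.ctx.cout (s.bd.out s.start)
  consistent : ∀ p ∈ s.prods, s.Consistent cc p

/-- The conditions on the grammar of a strong NGVAS. -/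
structure Shell.Strong (s : Shell d n k) : Prop where
  conn : s.StronglyConnected
  useful : s.AllUseful
  exit : ¬ s.Branching → ∃! p, p ∈ s.prods ∧ ¬ Persisting p

end Grammar

/-- Weak NGVAS. -/
def NGVAS.Weak {d : ℕ} : NGVAS d → Prop
  | .leaf w c => w.length ≤ 2 ∧ c.unc ⊆ omegas c.cin ∩ omegas c.cout
  | .node child s => (∀ c, (child c).Weak) ∧ s.Valid fun c => (child c).ctx

/-- The additional conditions of strong NGVAS, at all levels. -/
def NGVAS.Strong {d : ℕ} : NGVAS d → Prop
  | .leaf _ _ => True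
  | .node child s => (∀ c, (child c).Strong) ∧ s.Strong

/-- NGVAS are strong weak-NGVAS. -/
def NGVAS.IsNGVAS {d : ℕ} (N : NGVAS d) : Prop := N.Weak ∧ N.Strong

/-! ## Runs -/

/-- Candidates for runs: a source marking, a sequence of updates, a target marking. -/
abbrev Run (d : ℕ) := Marking d × List (Update d) × Marking d

/-- The runs of a single update. -/
def updRuns {d : ℕ} (u : Update d) : Set (Run d) :=
  {r | r.2.1 = [u] ∧ ∀ i, (r.2.2 i : ℤ) = (r.1 i : ℤ) + u i}

/-- Concatenation of sets of runs, merging at equal intermediate markings. -/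
def concatRuns {d : ℕ} : List (Set (Run d)) → Set (Run d)
  | [] => {r | r.2.1 = [] ∧ r.1 = r.2.2}
  | R :: L => {r | ∃ m u v, (r.1, u, m) ∈ R ∧ (m, v, r.2.2) ∈ concatRuns L ∧ r.2.1 = u ++ v}

/-- The run has an effect in the restriction and respects the input and output marking. -/
def Context.Admits {d : ℕ} (c : Context d) (r : Run d) : Prop :=
  r.2.1.sum ∈ c.restr ∧ Spec r.1.lift c.cin ∧ Spec r.2.2.lift c.cout

/-- The runs of an NGVAS. -/
def NGVAS.runs {d : ℕ} : NGVAS d → Set (Run d)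
  | .leaf w c => {r | r ∈ concatRuns (w.map updRuns) ∧ c.Admits r}
  | .node child s =>
      {r | (∃ w ∈ s.cfg.language, r ∈ concatRuns (w.map fun c => (child c).runs)) ∧
        s.ctx.Admits r}

/-- The runs of a symbol of an NGVAS. -/
def symRuns {d n k : ℕ} (child : Fin k → NGVAS d) (s : Shell d n k) :
    Symbol (Fin k) (Fin n) → Set (Run d)
  | .terminal c => (child c).runs
  | .nonterminal A => {r | ∃ w : List (Fin k), s.Derives A (w.map Symbol.terminal) ∧
      r ∈ concatRuns (w.map fun c => (child c).runs)}

/-! ## Cycles, rigid counters, ranks -/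

section Cycles

variable {d n k : ℕ}

/-- The effects of a word of children: sums of effects allowed by the restrictions. -/
def ceff (cc : Fin k → Context d) (w : List (Fin k)) : Set (Update d) :=
  {v | ∃ es : List (Update d), List.Forall₂ (fun e c => e ∈ (cc c).restr) es w ∧ v = es.sum}

/-- There is a cycle `A →* u.A.v`. -/
def Shell.Cycle (s : Shell d n k) (A : Fin n) (u v : List (Fin k)) : Prop :=
  s.Derives A (u.map Symbol.terminal ++ [Symbol.nonterminal A] ++ v.map Symbol.terminal)

/-- All cycles have left effect zero on the counter. -/
def Shell.FixedLeft (s : Shell d n k) (cc : Fin k → Context d) (i : Fin d) : Prop :=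
  ∀ A u v, s.Cycle A u v → ∀ e ∈ ceff cc u, e i = 0

/-- All cycles have right effect zero on the counter. -/
def Shell.FixedRight (s : Shell d n k) (cc : Fin k → Context d) (i : Fin d) : Prop :=
  ∀ A u v, s.Cycle A u v → ∀ e ∈ ceff cc v, e i = 0

/-- Rigid counters (fixed on a side, concrete in the marking of that side) are tracked concretely
in the boundedness information of that side. -/
def Shell.RigidTracked (s : Shell d n k) (cc : Fin k → Context d) : Prop :=
  ∀ i, (s.FixedLeft cc i → s.ctx.cin i ≠ ⊤ → i ∉ s.bd.left) ∧
    (s.FixedRight cc i → s.ctx.cout i ≠ ⊤ → i ∉ s.bd.right)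

/-- The vector space spanned by the left effects of cycles. -/
def Shell.lcyclespace (s : Shell d n k) (cc : Fin k → Context d) : Submodule ℝ (Fin d → ℝ) :=
  Submodule.span ℝ {x | ∃ A u v, s.Cycle A u v ∧ ∃ e ∈ ceff cc u, x = fun i => (e i : ℝ)}

/-- Local ranks, ordered lexicographically.  Entry `j` belongs to dimension `d - j`, so that higher
dimensions are more significant. -/
abbrev LRank (d : ℕ) := Lex (Fin (d + 1) → ℕ)

open Classical in
/-- Local rank: the number of nonterminals, in the entry for the dimension of the left cycle
space, if the grammar is branching, and zero otherwise. -/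
noncomputable def Shell.lrank (s : Shell d n k) (cc : Fin k → Context d) : LRank d :=
  if s.Branching then
    toLex (Pi.single ⟨d - Module.finrank ℝ (s.lcyclespace cc), by omega⟩ n)
  else 0

/-- The child can be derived by a persisting production. -/
def Shell.Recurring (s : Shell d n k) (c : Fin k) : Prop :=
  ∃ p ∈ s.prods, Persisting p ∧ (p.2.1 = Symbol.terminal c ∨ p.2.2 = Symbol.terminal c)

end Cycles

open Classical in
/-- The ranks of the branches of an NGVAS: the sums of the local ranks along sequences of NGVAS
that start in it and proceed from an NGVAS to one of its children. -/
noncomputable def NGVAS.branchRanks {d : ℕ} : NGVAS d → Finset (LRank d)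
  | .leaf _ _ => {0}
  | .node child s =>
      let l := s.lrank fun c => (child c).ctx
      insert l ((Finset.univ.biUnion fun c => (child c).branchRanks).image fun x => l + x)

theorem NGVAS.branchRanks_nonempty {d : ℕ} (N : NGVAS d) : N.branchRanks.Nonempty := by
  cases N with
  | leaf w c => exact ⟨0, by simp [NGVAS.branchRanks]⟩
  | node child s => exact ⟨_, by unfold NGVAS.branchRanks; exact Finset.mem_insert_self _ _⟩

/-- System rank: the maximal rank of a branch. -/
noncomputable def NGVAS.srank {d : ℕ} (N : NGVAS d) : LRank d :=
  N.branchRanks.max' N.branchRanks_nonempty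

open Classical in
/-- Local index: zero for non-linear NGVAS; for linear NGVAS the maximum of `1`, the local index of
each child of equal system rank, incremented by one if the child is recurring, and one more than
the common local index of the two children of the exit production if they have equal local index
and the same system rank as the NGVAS. -/
noncomputable def NGVAS.lidx {d : ℕ} : NGVAS d → ℕ
  | .leaf _ _ => 1
  | .node (k := k) child s =>
      if s.Branching then 0 else
        max 1 (max
          (Finset.univ.sup fun c : Fin k =>
            if (child c).srank = (NGVAS.node child s).srank then
              (child c).lidx + (if s.Recurring c then 1 else 0)
            else 0)
          (Finset.univ.sup fun c : Fin k => Finset.univ.sup fun c' : Fin k =>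
            if (∃ p ∈ s.prods, p.2.1 = Symbol.terminal c ∧ p.2.2 = Symbol.terminal c') ∧
                (child c).srank = (NGVAS.node child s).srank ∧
                (child c').srank = (NGVAS.node child s).srank ∧
                (child c).lidx = (child c').lidx then
              (child c).lidx + 1
            else 0))

/-- Non-linear rank, ordered lexicographically: number of constrained counters, system rank, local
index. -/
noncomputable def NGVAS.recrank {d : ℕ} (N : NGVAS d) : ℕ ×ₗ (LRank d ×ₗ ℕ) :=
  toLex (N.ctx.uncᶜ.card, toLex (N.srank, N.lidx))

/-! ## Decompositions -/

/-- The finite set `D` is a decomposition of `N`: a set of NGVAS with the same runs, whose members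
only strengthen the context information, and have a smaller non-linear rank. -/
structure IsDecomposition {d : ℕ} (N : NGVAS d) (D : List (NGVAS d)) : Prop where
  ngvas : ∀ N' ∈ D, N'.IsNGVAS
  runs : N.runs = ⋃ N' ∈ D, N'.runs
  unc : ∀ N' ∈ D, N.ctx.unc ⊆ N'.ctx.unc
  cin : ∀ N' ∈ D, Spec N'.ctx.cin N.ctx.cin
  cout : ∀ N' ∈ D, Spec N'.ctx.cout N.ctx.cout
  restr : ∀ N' ∈ D, N'.ctx.restr ⊆ N.ctx.restr
  rank : ∀ N' ∈ D, N'.recrank < N.recrank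

/-! ## Variants -/

section Variants

variable {d n k : ℕ}

/-- The context information of a variant: all effects are allowed. -/
def variantCtx (μ ν : OMarking d) : Context d where
  unc := omegas μ ∩ omegas ν
  base := 0
  periods := List.ofFn (fun i => Pi.single i (1 : ℤ)) ++ List.ofFn (fun i => Pi.single i (-1 : ℤ))
  cin := μ
  cout := ν

/-- The variant with start symbol `A`, input marking `μ` and output marking `ν`. -/
def Shell.variant (s : Shell d n k) (μ : OMarking d) (A : Fin n) (ν : OMarking d) :
    Shell d n k where
  start := A
  prods := s.prods
  ctx := variantCtx μ ν
  bd := s.bd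

/-- `μ`, `A`, `ν` determine a variant. -/
def Shell.IsVariant (s : Shell d n k) (μ : OMarking d) (A : Fin n) (ν : OMarking d) : Prop :=
  Spec μ (s.bd.inn A) ∧ Spec ν (s.bd.out A)

/-- The markings are relevant: they are `ω` at least where the markings of the context information
are, and at most at the untracked counters. -/
def Shell.Relevant (s : Shell d n k) (μ ν : OMarking d) : Prop :=
  (omegas s.ctx.cin ⊆ omegas μ ∧ omegas μ ⊆ s.bd.left) ∧
    (omegas s.ctx.cout ⊆ omegas ν ∧ omegas ν ⊆ s.bd.right)

/-! ## Approximators -/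

/-- Functions that map a marking and a symbol to a finite set of markings. -/
abbrev Approx (d n k : ℕ) := OMarking d → Symbol (Fin k) (Fin n) → Finset (OMarking d)

/-- Post-approximators, on the inputs that are `ω` at most at the untracked counters. -/
structure IsPostApprox (child : Fin k → NGVAS d) (s : Shell d n k) (post : Approx d n k) :
    Prop where
  sound : ∀ μ σ, omegas μ ⊆ s.bd.left → ∀ ν ∈ post μ σ,
    Spec ν (s.outOf (fun c => (child c).ctx) σ) ∧ omegas μ ⊆ omegas ν
  covers : ∀ μ σ, omegas μ ⊆ s.bd.left → ∀ r ∈ symRuns child s σ, Spec r.1.lift μ →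
    ∃ ν ∈ post μ σ, Spec r.2.2.lift ν
  compat : ∀ p ∈ s.prods, ∀ μ, omegas μ ⊆ s.bd.left →
    ∀ ν ∈ post μ p.2.1, ∀ ξ ∈ post ν p.2.2,
      ∃ ξ' ∈ post μ (Symbol.nonterminal p.1), Spec ξ ξ'

/-- Pre-approximators, on the inputs that are `ω` at most at the untracked counters. -/
structure IsPreApprox (child : Fin k → NGVAS d) (s : Shell d n k) (pre : Approx d n k) :
    Prop where
  sound : ∀ ν σ, omegas ν ⊆ s.bd.right → ∀ μ ∈ pre ν σ,
    Spec μ (s.inOf (fun c => (child c).ctx) σ) ∧ omegas ν ⊆ omegas μ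
  covers : ∀ ν σ, omegas ν ⊆ s.bd.right → ∀ r ∈ symRuns child s σ, Spec r.2.2.lift ν →
    ∃ μ ∈ pre ν σ, Spec r.1.lift μ
  compat : ∀ p ∈ s.prods, ∀ ν, omegas ν ⊆ s.bd.right →
    ∀ μ ∈ pre ν p.2.2, ∀ ξ ∈ pre μ p.2.1,
      ∃ ξ' ∈ pre ν (Symbol.nonterminal p.1), Spec ξ ξ'

end Variants

/-! ## The coverability grammar -/

/-- The first five components of a symbol `((inn, post), sym, (pre, out), hist)`. -/
structure CGLabel (d n k : ℕ) where
  inn : OMarking d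
  post : OMarking d
  sym : Symbol (Fin k) (Fin n)
  pre : OMarking d
  out : OMarking d

/-- Symbols of coverability grammars. -/
structure CGSym (d n k : ℕ) where
  lab : CGLabel d n k
  hist : ℕ

/-- Whether the symbol is a nonterminal. -/
def CGSym.IsNT {d n k : ℕ} (X : CGSym d n k) : Prop := ∃ B, X.lab.sym = Symbol.nonterminal B

/-- Coverability grammars as finite objects. -/
structure CovGrammar (d n k : ℕ) where
  nonterms : List (CGSym d n k)
  terms : List (CGSym d n k)
  start : CGSym d n k
  prods : List (CGSym d n k × List (CGSym d n k))

/-- Intermediate grammars of the construction; `todo` holds the nonterminals that wait for their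
productions. -/
structure CGState (d n k : ℕ) where
  nonterms : Set (CGSym d n k)
  terms : Set (CGSym d n k)
  prods : Set (CGSym d n k × List (CGSym d n k))
  todo : Set (CGSym d n k)

section Coverability

variable {d n k : ℕ}

/-- `V` occurs on the left and `W` on the right-hand side of one production. -/
def CGState.Calls (st : CGState d n k) (V W : CGSym d n k) : Prop :=
  ∃ w, (V, w) ∈ st.prods ∧ W ∈ w

/-- The history component is in use. -/
def CGState.Used (st : CGState d n k) (h : ℕ) : Prop :=
  ∃ X, (X ∈ st.nonterms ∨ X ∈ st.terms) ∧ X.hist = h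

/-- `st'` is obtained from `st` by giving `W` one production for each word of labels in `R`.
A nonterminal on a right-hand side is taken from those allowed by `back` if one of them has the
required label; all other occurrences of symbols become fresh symbols.
The symbols chosen for the word `r` are `inst r`. -/
def CGState.Expand (st : CGState d n k) (W : CGSym d n k) (R : Set (List (CGLabel d n k)))
    (back : CGSym d n k → Prop) (st' : CGState d n k) : Prop :=
  ∃ inst : List (CGLabel d n k) → List (CGSym d n k),
    (∀ r ∈ R, (inst r).map CGSym.lab = r) ∧
    (∀ r ∈ R, ∀ X ∈ inst r,
      ((X.IsNT ∧ ∃ Z, back Z ∧ Z.lab = X.lab) → back X) ∧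
      (¬ (X.IsNT ∧ ∃ Z, back Z ∧ Z.lab = X.lab) → ¬ st.Used X.hist)) ∧
    (∀ r ∈ R, ∀ r' ∈ R, ∀ (i j : ℕ) (X Y : CGSym d n k),
      (inst r)[i]? = some X → (inst r')[j]? = some Y →
      ¬ st.Used X.hist → X.hist = Y.hist → r = r' ∧ i = j) ∧
    st'.nonterms = st.nonterms ∪ {X | X.IsNT ∧ ∃ r ∈ R, X ∈ inst r} ∧
    st'.terms = st.terms ∪ {X | ¬ X.IsNT ∧ ∃ r ∈ R, X ∈ inst r} ∧
    st'.prods = st.prods ∪ {q | ∃ r ∈ R, q = (W, inst r)} ∧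
    st'.todo = (st.todo \ {W}) ∪ {X | (X.IsNT ∧ ∃ r ∈ R, X ∈ inst r) ∧ X ∉ st.nonterms}

/-- The start symbol. -/
def cgStart (s : Shell d n k) (μ : OMarking d) (A : Fin n) (ν : OMarking d) : CGSym d n k :=
  ⟨⟨μ, s.bd.out A, Symbol.nonterminal A, s.bd.inn A, ν⟩, 0⟩

/-- Right-hand sides that consist of one symbol `B` with given input and output marking. -/
def pumpWords (post pre : Approx d n k) (μ : OMarking d) (B : Symbol (Fin k) (Fin n))
    (ν : OMarking d) : Set (List (CGLabel d n k)) :=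
  {r | ∃ p ∈ post μ B, ∃ q ∈ pre ν B, r = [⟨μ, p, B, q, ν⟩]}

/-- Right-hand sides that simulate the productions for the symbol of `W`. -/
def simWords (s : Shell d n k) (post pre : Approx d n k) (W : CGLabel d n k) :
    Set (List (CGLabel d n k)) :=
  {r | ∃ A σ τ, (A, σ, τ) ∈ s.prods ∧ W.sym = Symbol.nonterminal A ∧
    ∃ p' ∈ post W.inn σ, ∃ p'' ∈ post p' τ, ∃ q' ∈ pre W.out τ, ∃ q'' ∈ pre q' σ,
      Spec p'' W.post ∧ Spec q'' W.pre ∧ Compat p' q' ∧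
      r = [⟨W.inn, p', σ, q'', q'⟩, ⟨p', p'', τ, q', W.out⟩]}

/-- The symbols `V` and `W` form a vertical pumping situation, whose acceleration introduces a new
`ω`. -/
def CGState.Pumping (st : CGState d n k) (V W : CGSym d n k) : Prop :=
  V ∈ st.nonterms ∧ Relation.TransGen st.Calls V W ∧ V.lab.sym = W.lab.sym ∧
    V.lab.inn ≤ W.lab.inn ∧ V.lab.out ≤ W.lab.out ∧
    ∃ i, (V.lab.inn i < W.lab.inn i ∧ W.lab.inn i ≠ ⊤) ∨
      (V.lab.out i < W.lab.out i ∧ W.lab.out i ≠ ⊤)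

/-- Acceleration: `ω` where `y` exceeds `x`, otherwise `y`. -/
noncomputable def accel (x y : OMarking d) : OMarking d := fun i => if x i < y i then ⊤ else y i

/-- One step of the construction, for the coverability grammar with start symbol `S`. -/
def CGState.Step (s : Shell d n k) (post pre : Approx d n k) (S : CGSym d n k)
    (st st' : CGState d n k) : Prop :=
  ∃ W ∈ st.todo,
    (W = S ∧ st.Expand W (pumpWords post pre W.lab.inn W.lab.sym W.lab.out) (fun _ => False) st') ∨
    (W ≠ S ∧ ∃ V, st.Pumping V W ∧
      st.Expand W (pumpWords post pre (accel V.lab.inn W.lab.inn) W.lab.sym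
        (accel V.lab.out W.lab.out)) (fun _ => False) st') ∨
    (W ≠ S ∧ (¬ ∃ V, st.Pumping V W) ∧
      st.Expand W (simWords s post pre W.lab)
        (fun Z => Z ∈ st.nonterms ∧ Z ≠ S ∧ Relation.ReflTransGen st.Calls Z W) st')

/-- `G` is a coverability grammar for the variant: the result of a terminated construction. -/
def IsCovGrammar (s : Shell d n k) (post pre : Approx d n k) (μ : OMarking d) (A : Fin n)
    (ν : OMarking d) (G : CovGrammar d n k) : Prop :=
  G.start = cgStart s μ A ν ∧
    ∃ st : CGState d n k,
      Relation.ReflTransGen (CGState.Step s post pre G.start) ⟨{G.start}, ∅, ∅, {G.start}⟩ st ∧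
      st.todo = ∅ ∧ {X | X ∈ G.nonterms} = st.nonterms ∧ {X | X ∈ G.terms} = st.terms ∧
      {q | q ∈ G.prods} = st.prods

/-- There is no nonterminal of the form `((in B, _), B, (_, out B), _)`. -/
def CovGrammar.RemainsBounded (G : CovGrammar d n k) (s : Shell d n k) : Prop :=
  ∀ X ∈ G.nonterms, ∀ B, X.lab.sym = Symbol.nonterminal B →
    ¬ (X.lab.inn = s.bd.inn B ∧ X.lab.out = s.bd.out B)

end Coverability

/-! ## Computation with elementary resources

Programs of the language WHILE over binary trees, with a count of the executed steps. -/

/-- Data are binary trees. -/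
inductive Data : Type
  | nil : Data
  | cons (a b : Data) : Data

/-- Number of nodes. -/
def Data.size : Data → ℕ
  | .nil => 1
  | .cons a b => a.size + b.size + 1

/-- First component. -/
def Data.hd : Data → Data
  | .nil => .nil
  | .cons a _ => a

/-- Second component. -/
def Data.tl : Data → Data
  | .nil => .nil
  | .cons _ b => b

/-- Expressions. -/
inductive Exp : Type
  | var (x : ℕ) : Exp
  | nil : Exp
  | cons (e f : Exp) : Exp
  | hd (e : Exp) : Exp
  | tl (e : Exp) : Exp

/-- The value of an expression in a store. -/
def Exp.eval (σ : ℕ → Data) : Exp → Data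
  | .var x => σ x
  | .nil => .nil
  | .cons e f => .cons (e.eval σ) (f.eval σ)
  | .hd e => (e.eval σ).hd
  | .tl e => (e.eval σ).tl

/-- Programs. -/
inductive Prog : Type
  | assign (x : ℕ) (e : Exp) : Prog
  | seq (P Q : Prog) : Prog
  | loop (e : Exp) (P : Prog) : Prog

/-- `Exec P σ t σ'`: started in the store `σ`, the program `P` terminates after `t` steps, that is,
assignments and tests, in the store `σ'`.  The body of a loop is repeated while the value of its
expression is different from `nil`. -/
inductive Exec : Prog → (ℕ → Data) → ℕ → (ℕ → Data) → Prop
  | assign (x : ℕ) (e : Exp) (σ : ℕ → Data) :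
      Exec (.assign x e) σ 1 (Function.update σ x (e.eval σ))
  | seq {P Q : Prog} {σ σ' σ'' : ℕ → Data} {t u : ℕ} :
      Exec P σ t σ' → Exec Q σ' u σ'' → Exec (.seq P Q) σ (t + u) σ''
  | loopEnd {e : Exp} {P : Prog} {σ : ℕ → Data} :
      e.eval σ = .nil → Exec (.loop e P) σ 1 σ
  | loopStep {e : Exp} {P : Prog} {σ σ' σ'' : ℕ → Data} {t u : ℕ} :
      e.eval σ ≠ .nil → Exec P σ t σ' → Exec (.loop e P) σ' u σ'' →
        Exec (.loop e P) σ (1 + t + u) σ''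

/-- The program computes `y` on input `x` in at most `T` steps.  Input and output are in
variable `0`, all other variables are `nil` initially. -/
def Prog.ComputesWithin (P : Prog) (x y : Data) (T : ℕ) : Prop :=
  ∃ t σ, Exec P (Function.update (fun _ => .nil) 0 x) t σ ∧ t ≤ T ∧ σ 0 = y

/-- Iterated exponentiation; a resource bound is elementary if it is of the form `tower e` for a
constant `e`. -/
def tower : ℕ → ℕ → ℕ
  | 0, n => n
  | e + 1, n => 2 ^ tower e n

/-! ### Encoding of the inputs and outputs -/

namespace Data

/-- Numbers. -/
def ofNat : ℕ → Data
  | 0 => .nil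
  | n + 1 => .cons .nil (ofNat n)

/-- Lists. -/
def ofList : List Data → Data
  | [] => .nil
  | a :: l => .cons a (ofList l)

/-- Integers. -/
def ofInt : ℤ → Data
  | .ofNat n => .cons .nil (ofNat n)
  | .negSucc n => .cons (.cons .nil .nil) (ofNat n)

/-- Numbers or `ω`. -/
def ofENat : ℕ∞ → Data
  | none => .nil
  | some n => .cons .nil (ofNat n)

/-- Sets of counters, as bit vectors. -/
def ofCounters {d : ℕ} (s : Finset (Fin d)) : Data :=
  ofList (List.ofFn fun i => if i ∈ s then .cons .nil .nil else .nil)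

/-- Effects. -/
def ofUpdate {d : ℕ} (u : Update d) : Data := ofList (List.ofFn fun i => ofInt (u i))

/-- Generalized markings. -/
def ofOMarking {d : ℕ} (μ : OMarking d) : Data := ofList (List.ofFn fun i => ofENat (μ i))

/-- Grammar symbols. -/
def ofSymbol {n k : ℕ} : Symbol (Fin k) (Fin n) → Data
  | .terminal c => .cons .nil (ofNat c)
  | .nonterminal A => .cons (.cons .nil .nil) (ofNat A)

/-- Context information. -/
def ofContext {d : ℕ} (c : Context d) : Data :=
  ofList [ofCounters c.unc, ofUpdate c.base, ofList (c.periods.map ofUpdate), ofOMarking c.cin,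
    ofOMarking c.cout]

/-- Shells, together with the numbers of their nonterminals and terminals. -/
def ofShell {d n k : ℕ} (s : Shell d n k) : Data :=
  ofList [ofNat n, ofNat k, ofNat s.start,
    ofList (s.prods.map fun p => ofList [ofNat p.1, ofSymbol p.2.1, ofSymbol p.2.2]),
    ofContext s.ctx, ofCounters s.bd.left, ofCounters s.bd.right,
    ofList (List.ofFn fun A => ofOMarking (s.bd.inn A)),
    ofList (List.ofFn fun A => ofOMarking (s.bd.out A))]

/-- NGVAS. -/
def ofNGVAS {d : ℕ} : NGVAS d → Data
  | .leaf w c => .cons .nil (ofList [ofList (w.map ofUpdate), ofContext c])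
  | .node child s =>
      .cons (.cons .nil .nil) (ofList [ofList (List.ofFn fun c => ofNGVAS (child c)), ofShell s])

/-- Symbols of a coverability grammar. -/
def ofCGSym {d n k : ℕ} (X : CGSym d n k) : Data :=
  ofList [ofOMarking X.lab.inn, ofOMarking X.lab.post, ofSymbol X.lab.sym, ofOMarking X.lab.pre,
    ofOMarking X.lab.out, ofNat X.hist]

/-- Coverability grammars. -/
def ofCovGrammar {d n k : ℕ} (G : CovGrammar d n k) : Data :=
  ofList [ofList (G.nonterms.map ofCGSym), ofList (G.terms.map ofCGSym), ofCGSym G.start,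
    ofList (G.prods.map fun q => ofList [ofCGSym q.1, ofList (q.2.map ofCGSym)])]

/-- The input of the decomposition: the dimension, an NGVAS, the data of a variant, and a
coverability grammar. -/
def ofInput {d n k : ℕ} (N : NGVAS d) (μ : OMarking d) (A : Fin n) (ν : OMarking d)
    (G : CovGrammar d n k) : Data :=
  ofList [ofNat d, ofNGVAS N, ofOMarking μ, ofNat A, ofOMarking ν, ofCovGrammar G]

end Data

end NestedVAS

open NestedVAS

/-! The coverability grammar `G` is itself turned into nested GVAS, and the rank drops because each
branching part of `G` tracks a counter that the cycles of N can change.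

Since `G` remains bounded, each of its nonterminals has a counter i in D that is concrete in its
input or its output marking (`exists_pick`). By relevance, i is also concrete in the corresponding
marking of the context of N. All rigid counters are concretely tracked, so i is not fixed on that
side. Hence the left cycle space of N contains a vector with nonzero entry i; for the output side
this uses that right effects of cycles lie in the left cycle space too when the grammar is branching
(`right_mem_lcyclespace`).

The binary productions of `G` split its nonterminals into strongly connected components. Each
component becomes an NGVAS whose nonterminals are its symbols and in which the symbols outside occur
as children, which are constructed recursively. A unary production only passes on the NGVAS of the
accelerated symbol. The recursion is finite: leaving a component shrinks the set of reachable
symbols, and a unary production behind the start symbol adds an entry ω. Entries ω only spread along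
binary productions, so in a branching component the chosen counter has a finite value before and
after each symbol (`tracked_of_branching`). If the restriction of each new child prescribes the
difference of these values, then the effects telescope along a cycle and vanish on i.

These restrictions must contain the effects of all runs that the symbol may have, and they must not
enlarge the cycle space. Cosets of one lattice achieve both. Two effects of derivations of the same
symbol differ by a lattice element (`Eff.sub_symBase_mem`). The lattice lies in the left cycle space
of N, because a cycle A →* u.A.v.A.w admits any derivation of A in the place of the first A, so
differences of effects are differences of left effects of cycles (`Eff.sub_mem`,
`real_mem_of_mem_lattice`). The elements of a coset with prescribed entry i form a finite union of
linear sets with computable bases and periods (`exists_small_solution`, `exists_coset`). Therefore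
the cycle space of a branching component lies in that of N and in the hyperplane x_i = 0
(`Simulates.lcyclespace_le`), so its dimension is smaller. Linear components have local rank zero.
Thus a branch of a new NGVAS has rank x + z, where x vanishes in all dimensions from that of N
upwards and z is zero or the rank of a branch of an old child. It is beaten by the rank of the
branch of N that continues with z (`GoodPre.srank_lt`).

Concerning runs, the productions of the new NGVAS are labelled by productions of N, so no runs are
added. Conversely, the derivation tree of a run is annotated by the approximators from the leaves
upwards, and the annotated tree is followed through `G` from the root downwards (`Fits.split`,
`exists_nodeRuns`, `covered_tableAt`).

For the resources, the construction is expressed by combinators for WHILE programs that are proved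
for two scales of bounds at once, polynomials and towers. A loop with polynomial body has elementary
cost, and the loops that iterate on their own results, other than those with additive growth, have
polynomial bodies. -/

namespace NestedVAS

/-! ## Scales of resource bounds -/

/-- A family of monotone bounds closed under the operations needed to compose programs. -/
structure Scale (F : ℕ → ℕ → ℕ) : Prop where
  mono : ∀ a, Monotone (F a)
  const : ∀ c, ∃ a, ∀ n, 1 ≤ n → c ≤ F a n
  id : ∃ a, ∀ n, 1 ≤ n → n ≤ F a n
  add : ∀ a b, ∃ c, ∀ n, 1 ≤ n → F a n + F b n ≤ F c n
  mul : ∀ a b, ∃ c, ∀ n, 1 ≤ n → F a n * F b n ≤ F c n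
  comp : ∀ a b, ∃ c, ∀ n, 1 ≤ n → F a (F b n) ≤ F c n

/-- `T` is bounded on the positive numbers by a member of the family. -/
def Bdd (F : ℕ → ℕ → ℕ) (T : ℕ → ℕ) : Prop := ∃ a, ∀ n, 1 ≤ n → T n ≤ F a n

namespace Bdd

variable {F : ℕ → ℕ → ℕ} {T U : ℕ → ℕ}

theorem of_le (hU : Bdd F U) (h : ∀ n, 1 ≤ n → T n ≤ U n) : Bdd F T := by
  obtain ⟨a, ha⟩ := hU
  exact ⟨a, fun n hn => (h n hn).trans (ha n hn)⟩

theorem base (a : ℕ) : Bdd F (F a) := ⟨a, fun _ _ => le_rfl⟩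

theorem const (hF : Scale F) (c : ℕ) : Bdd F fun _ => c := hF.const c

theorem id (hF : Scale F) : Bdd F fun n => n := hF.id

theorem add (hF : Scale F) (hT : Bdd F T) (hU : Bdd F U) : Bdd F fun n => T n + U n := by
  obtain ⟨a, ha⟩ := hT
  obtain ⟨b, hb⟩ := hU
  obtain ⟨c, hc⟩ := hF.add a b
  exact ⟨c, fun n hn => (Nat.add_le_add (ha n hn) (hb n hn)).trans (hc n hn)⟩

theorem mul (hF : Scale F) (hT : Bdd F T) (hU : Bdd F U) : Bdd F fun n => T n * U n := by
  obtain ⟨a, ha⟩ := hT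
  obtain ⟨b, hb⟩ := hU
  obtain ⟨c, hc⟩ := hF.mul a b
  exact ⟨c, fun n hn => (Nat.mul_le_mul (ha n hn) (hb n hn)).trans (hc n hn)⟩

theorem comp (hF : Scale F) (a : ℕ) (hU : Bdd F U) : Bdd F fun n => F a (U n) := by
  obtain ⟨b, hb⟩ := hU
  obtain ⟨c, hc⟩ := hF.comp a b
  exact ⟨c, fun n hn => (hF.mono a (hb n hn)).trans (hc n hn)⟩

end Bdd

/-- Polynomials. -/
def polyScale (a n : ℕ) : ℕ := (n + 1) ^ a

/-- With base n + 1 ≥ 2, a sum costs one more factor, constants are below powers of two, and the + 1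
around an inner polynomial is absorbed by raising its exponent by one. -/
theorem scale_poly : Scale polyScale where
  mono a := fun m n h => Nat.pow_le_pow_left (by omega) a
  const c := ⟨c, fun n hn => by
    have h1 : c < 2 ^ c := Nat.lt_two_pow_self
    have h2 : 2 ^ c ≤ (n + 1) ^ c := Nat.pow_le_pow_left (by omega) c
    unfold polyScale; omega⟩
  id := ⟨1, fun n _ => by simp [polyScale]⟩
  add a b := ⟨max a b + 1, fun n hn => by
    have h1 : (n + 1) ^ a ≤ (n + 1) ^ max a b := Nat.pow_le_pow_right (by omega) (le_max_left _ _)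
    have h2 : (n + 1) ^ b ≤ (n + 1) ^ max a b := Nat.pow_le_pow_right (by omega) (le_max_right _ _)
    have h3 : (n + 1) ^ max a b * 2 ≤ (n + 1) ^ max a b * (n + 1) :=
      Nat.mul_le_mul_left _ (by omega)
    unfold polyScale; rw [pow_succ]; omega⟩
  mul a b := ⟨a + b, fun n _ => by simp [polyScale, pow_add]⟩
  comp a b := ⟨(b + 1) * a, fun n hn => by
    have h1 : 1 ≤ (n + 1) ^ b := Nat.one_le_pow _ _ (by omega)
    have h2 : (n + 1) ^ b + 1 ≤ (n + 1) ^ (b + 1) := by rw [pow_succ]; nlinarith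
    unfold polyScale
    rw [pow_mul]
    exact Nat.pow_le_pow_left h2 a⟩

theorem tower_mono (e : ℕ) : Monotone (tower e) := by
  induction e with
  | zero => exact monotone_id
  | succ e ih => exact fun m n h => Nat.pow_le_pow_right (by omega) (ih h)

theorem le_tower (e n : ℕ) : n ≤ tower e n := by
  induction e with
  | zero => exact le_rfl
  | succ e ih => exact ih.trans Nat.lt_two_pow_self.le

theorem tower_le_tower {a b : ℕ} (h : a ≤ b) (n : ℕ) : tower a n ≤ tower b n := by
  induction h with
  | refl => exact le_rfl
  | step _ ih => exact ih.trans Nat.lt_two_pow_self.le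

theorem tower_tower (a b n : ℕ) : tower a (tower b n) = tower (a + b) n := by
  induction a with
  | zero => simp [tower]
  | succ a ih => rw [Nat.succ_add]; simp [tower, ih]

theorem two_mul_le_two_pow {m : ℕ} (h : 1 ≤ m) : 2 * m ≤ 2 ^ m := by
  induction m, h using Nat.le_induction with
  | base => simp
  | succ m h ih => rw [pow_succ]; omega

/-- Put m = tower (max a b) n. A sum is at most 2m ≤ 2^m, which costs one level. A product is at
most 2^m · 2^m = 2^(2m) ≤ 2^(2^m), which costs two. -/
theorem scale_tower : Scale tower where
  mono := tower_mono
  const c := by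
    refine ⟨c, fun n hn => ?_⟩
    have : ∀ c, c < tower c 1 := fun c => by
      induction c with
      | zero => simp [tower]
      | succ c ih => exact lt_of_le_of_lt ih Nat.lt_two_pow_self
    exact (this c).le.trans (tower_mono c hn)
  id := ⟨0, fun n _ => le_rfl⟩
  add a b := ⟨max a b + 1, fun n hn => by
    have h1 := tower_le_tower (le_max_left a b) n
    have h2 := tower_le_tower (le_max_right a b) n
    have h3 := two_mul_le_two_pow (hn.trans (le_tower (max a b) n))
    simp only [tower]; omega⟩
  mul a b := ⟨max a b + 2, fun n hn => by
    have h1 := tower_le_tower (le_max_left a b) n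
    have h2 := tower_le_tower (le_max_right a b) n
    have h3 := two_mul_le_two_pow (hn.trans (le_tower (max a b) n))
    simp only [tower]
    set m := tower (max a b) n
    calc tower a n * tower b n ≤ 2 ^ m * 2 ^ m :=
          Nat.mul_le_mul (h1.trans Nat.lt_two_pow_self.le) (h2.trans Nat.lt_two_pow_self.le)
      _ = 2 ^ (2 * m) := by rw [← pow_add]; ring_nf
      _ ≤ _ := Nat.pow_le_pow_right (by omega) h3⟩
  comp a b := ⟨a + b, fun n _ => (tower_tower a b n).le⟩

/-- Iterated polynomial growth is elementary. -/
theorem poly_iterate_le (a m k : ℕ) (hm : 1 ≤ m) (u : ℕ → ℕ) (h0 : u 0 ≤ m)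
    (hu : ∀ j < k, u (j + 1) ≤ (u j + 1 + m) ^ a) (j : ℕ) (hj : j ≤ k) :
    u j + 1 + m ≤ (m + 2) ^ ((a + 2) ^ (j + 1)) := by
  induction j with
  | zero =>
    have : (m + 2) ^ 2 ≤ (m + 2) ^ (a + 2) := Nat.pow_le_pow_right (by omega) (by omega)
    simp only [zero_add, pow_one]
    nlinarith
  | succ j ih =>
    have ih := ih (by omega)
    have h1 := hu j (by omega)
    set X := (m + 2) ^ ((a + 2) ^ (j + 1)) with hX
    have hX2 : m + 2 ≤ X := Nat.le_self_pow (by positivity) _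
    have h2 : u (j + 1) ≤ X ^ a := h1.trans (Nat.pow_le_pow_left ih a)
    have h3 : (m + 2) ^ ((a + 2) ^ (j + 1 + 1)) = X ^ (a + 2) := by
      rw [hX, ← pow_mul, ← pow_succ]
    rw [h3, pow_add]
    -- The goal follows from u (j+1) + 1 + m ≤ X^a + X ≤ X^a (X + 1) ≤ X^a · X^2.
    have h4 : 1 ≤ X ^ a := Nat.one_le_pow _ _ (by omega)
    have h5 : X + 1 ≤ X ^ 2 := by nlinarith
    have h6 := Nat.mul_le_mul_left (X ^ a) h5
    have h7 := Nat.mul_le_mul_right X h4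
    rw [mul_add] at h6
    omega

/-- Replacing the bases n + 2 and a + 2 by powers of two bounds the expression by two exponentials
on top of linear functions and products. -/
theorem poly_iterate_elementary (a : ℕ) :
    ∃ e, ∀ n, 1 ≤ n → (n + 2) ^ ((a + 2) ^ (n + 1)) ≤ tower e n := by
  have h : Bdd tower fun n => 2 ^ ((n + 2) * 2 ^ ((a + 2) * (n + 1))) := by
    have hs := scale_tower
    have h1 : Bdd tower fun n => 2 ^ ((a + 2) * (n + 1)) :=
      (hs.const (a + 2) |> fun h => Bdd.comp hs 1 (Bdd.mul hs h (Bdd.add hs (Bdd.id hs)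
        (Bdd.const hs 1))))
    exact Bdd.comp hs 1 (Bdd.mul hs (Bdd.add hs (Bdd.id hs) (Bdd.const hs 2)) h1)
  obtain ⟨e, he⟩ := h
  refine ⟨e, fun n hn => le_trans ?_ (he n hn)⟩
  calc (n + 2) ^ ((a + 2) ^ (n + 1)) ≤ (2 ^ (n + 2)) ^ ((2 ^ (a + 2)) ^ (n + 1)) := by
        refine (Nat.pow_le_pow_left Nat.lt_two_pow_self.le _).trans ?_
        exact Nat.pow_le_pow_right (by positivity)
          (Nat.pow_le_pow_left Nat.lt_two_pow_self.le _)
    _ = _ := by rw [← pow_mul, ← pow_mul]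

/-! ## Feasible functions on binary trees -/

namespace Data

theorem size_pos (x : Data) : 1 ≤ x.size := by cases x <;> simp [size]

theorem size_hd_le (x : Data) : x.hd.size ≤ x.size := by
  cases x <;> simp [hd, size]; omega

theorem size_tl_le (x : Data) : x.tl.size ≤ x.size := by
  cases x <;> simp [tl, size]; omega

@[simp] theorem hd_cons (a b : Data) : (cons a b).hd = a := rfl
@[simp] theorem tl_cons (a b : Data) : (cons a b).tl = b := rfl
@[simp] theorem hd_nil : nil.hd = nil := rfl
@[simp] theorem tl_nil : nil.tl = nil := rfl
@[simp] theorem cons_ne_nil (a b : Data) : cons a b ≠ nil := Data.noConfusion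

end Data

noncomputable instance : DecidableEq Data := Classical.decEq Data

/-- The function is computed by a program with resources in the scale.  Whatever the other
variables contain, the program transforms variable `0` and leaves the variables from some number on
unchanged. -/
def Feasible (F : ℕ → ℕ → ℕ) (f : Data → Data) : Prop :=
  ∃ (P : Prog) (m a : ℕ), 1 ≤ m ∧ ∀ σ : ℕ → Data, ∃ t σ', Exec P σ t σ' ∧
    t ≤ F a (σ 0).size ∧ (σ' 0).size ≤ F a (σ 0).size ∧ σ' 0 = f (σ 0) ∧ ∀ x, m ≤ x → σ' x = σ x

namespace Feasible

variable {F : ℕ → ℕ → ℕ} {f g h : Data → Data}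

theorem intro {P : Prog} {m : ℕ} {T : ℕ → ℕ} (hT : Bdd F T) (hm : 1 ≤ m)
    (H : ∀ σ : ℕ → Data, ∃ t σ', Exec P σ t σ' ∧ t ≤ T (σ 0).size ∧
      (σ' 0).size ≤ T (σ 0).size ∧ σ' 0 = f (σ 0) ∧ ∀ x, m ≤ x → σ' x = σ x) : Feasible F f := by
  obtain ⟨a, ha⟩ := hT
  refine ⟨P, m, a, hm, fun σ => ?_⟩
  obtain ⟨t, σ', h1, h2, h3, h4, h5⟩ := H σ
  exact ⟨t, σ', h1, h2.trans (ha _ (Data.size_pos _)), h3.trans (ha _ (Data.size_pos _)), h4, h5⟩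

/-- Feasible functions have bounded results. -/
theorem size_le (hf : Feasible F f) : ∃ a, ∀ x, (f x).size ≤ F a x.size := by
  obtain ⟨P, m, a, _, H⟩ := hf
  refine ⟨a, fun x => ?_⟩
  obtain ⟨t, σ', -, -, h3, h4, -⟩ := H fun _ => x
  rwa [h4] at h3

theorem congr (hf : Feasible F f) (h : ∀ x, f x = g x) : Feasible F g := by
  rwa [← funext h]

theorem mono_scale {F' : ℕ → ℕ → ℕ} (hf : Feasible F f) (h : ∀ a, Bdd F' (F a)) :
    Feasible F' f := by
  obtain ⟨P, m, a, hm, H⟩ := hf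
  exact intro (h a) hm H

theorem of_exp (hF : Scale F) (e : Exp) (c : ℕ) (hc : ∀ σ, (e.eval σ).size ≤ c * (σ 0).size + c)
    (he : ∀ σ, e.eval σ = f (σ 0)) : Feasible F f := by
  refine intro (P := .assign 0 e) (m := 1) (T := fun n => c * n + c + 1)
    (((Bdd.const hF c).mul hF (Bdd.id hF)).add hF (Bdd.const hF c) |>.add hF (Bdd.const hF 1))
    le_rfl fun σ => ⟨_, _, Exec.assign 0 e σ, by omega, ?_, ?_, ?_⟩
  · simpa using (hc σ).trans (Nat.le_succ _)
  · simpa using he σ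
  · intro x hx
    rw [Function.update_of_ne (by omega)]

theorem id (hF : Scale F) : Feasible F fun x => x :=
  of_exp hF (.var 0) 1 (fun σ => by simp [Exp.eval]) fun σ => rfl

theorem hd (hF : Scale F) : Feasible F Data.hd :=
  of_exp hF (.hd (.var 0)) 1 (fun σ => by
    have := Data.size_hd_le (σ 0)
    simp [Exp.eval]; omega) fun σ => rfl

theorem tl (hF : Scale F) : Feasible F Data.tl :=
  of_exp hF (.tl (.var 0)) 1 (fun σ => by
    have := Data.size_tl_le (σ 0)
    simp [Exp.eval]; omega) fun σ => rfl

theorem nil (hF : Scale F) : Feasible F fun _ => .nil :=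
  of_exp hF .nil 1 (fun σ => by simp [Exp.eval, Data.size]) fun σ => rfl

theorem comp (hF : Scale F) (hg : Feasible F g) (hf : Feasible F f) :
    Feasible F fun x => g (f x) := by
  obtain ⟨P, m, a, hm, H⟩ := hf
  obtain ⟨Q, m', b, hm', H'⟩ := hg
  have hb : Bdd F fun n => F b (F a n) := Bdd.comp hF b (Bdd.base a)
  refine intro (P := .seq P Q) (m := max m m') (T := fun n => F a n + F b (F a n))
    ((Bdd.base a).add hF hb) (by omega) fun σ => ?_
  obtain ⟨t, σ', h1, h2, h3, h4, h5⟩ := H σ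
  obtain ⟨t', σ'', h1', h2', h3', h4', h5'⟩ := H' σ'
  have := hF.mono b h3
  refine ⟨_, _, Exec.seq h1 h1', by omega, by omega, by rw [h4', h4], fun x hx => ?_⟩
  rw [h5' x (by omega), h5 x (by omega)]

/-- The registers M and M + 1 lie above everything that the two programs change. M keeps the input
for the second program, M + 1 keeps the first result. This is why feasibility demands that high
variables are preserved in arbitrary stores. -/
theorem cons (hF : Scale F) (hf : Feasible F f) (hg : Feasible F g) :
    Feasible F fun x => .cons (f x) (g x) := by
  obtain ⟨P, m, a, hm, H⟩ := hf
  obtain ⟨Q, m', b, hm', H'⟩ := hg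
  set M := max m m' with hM
  refine intro (P := .seq (.assign M (.var 0)) (.seq P (.seq (.assign (M + 1) (.var 0))
      (.seq (.assign 0 (.var M)) (.seq Q (.assign 0 (.cons (.var (M + 1)) (.var 0))))))))
    (m := M + 2) (T := fun n => F a n + F b n + 4)
    (((Bdd.base a).add hF (Bdd.base b)).add hF (Bdd.const hF 4)) (by omega) fun σ => ?_
  obtain ⟨t, σ', h1, h2, h3, h4, h5⟩ := H (Function.update σ M (σ 0))
  have e0 : Function.update σ M (σ 0) 0 = σ 0 := Function.update_of_ne (by omega) _ _
  rw [e0] at h2 h3 h4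
  have eM : σ' M = σ 0 := by rw [h5 M (by omega)]; simp
  obtain ⟨t', σ'', h1', h2', h3', h4', h5'⟩ :=
    H' (Function.update (Function.update σ' (M + 1) (σ' 0)) 0 (σ 0))
  have e0' : Function.update (Function.update σ' (M + 1) (σ' 0)) 0 (σ 0) 0 = σ 0 := by simp
  rw [e0'] at h2' h3' h4'
  have eM' : σ'' (M + 1) = f (σ 0) := by
    rw [h5' _ (by omega), Function.update_of_ne (by omega), Function.update_self, h4]
  have hm2 : Exec (.assign 0 (.var M)) (Function.update σ' (M + 1) (σ' 0)) 1
      (Function.update (Function.update σ' (M + 1) (σ' 0)) 0 (σ 0)) := by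
    have := Exec.assign 0 (.var M) (Function.update σ' (M + 1) (σ' 0))
    simp only [Exp.eval] at this
    rwa [Function.update_of_ne (by omega) (σ' 0) σ', eM] at this
  refine ⟨_, _, Exec.seq (Exec.assign _ _ _) (Exec.seq h1 (Exec.seq (Exec.assign _ _ _)
    (Exec.seq hm2 (Exec.seq h1' (Exec.assign _ _ _))))), ?_⟩
  · simp only [Exp.eval, Function.update_self, eM', h4', Data.size]
    rw [h4] at h3
    rw [h4'] at h3'
    refine ⟨by omega, by omega, trivial, fun x hx => ?_⟩
    rw [Function.update_of_ne (by omega), h5' x (by omega), Function.update_of_ne (by omega),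
      Function.update_of_ne (by omega), h5 x (by omega), Function.update_of_ne (by omega)]

/-- The language has no conditional, so two loops replace it, each of which is executed at most
once. Condition and argument are packed into a pair with a copy in M. The flag in M + 1 is cleared
by the first loop, hence the second loop runs exactly if the first one does not. -/
theorem ite (hF : Scale F) (hh : Feasible F h) (hf : Feasible F f) (hg : Feasible F g) :
    Feasible F fun x => if h x ≠ .nil then f x else g x := by
  have key : Feasible F fun x => if x.hd ≠ .nil then f x.tl else g x.tl := by
    obtain ⟨P, m, a, hm, H⟩ := hf
    obtain ⟨Q, m', b, hm', H'⟩ := hg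
    set M := max m m' with hM
    have hT : Bdd F fun n => F a n + F b n + 12 :=
      ((Bdd.base a).add hF (Bdd.base b)).add hF (Bdd.const hF 12)
    refine intro (P := .seq (.assign M (.var 0)) (.seq (.assign (M + 1) (.cons .nil .nil))
      (.seq (.loop (.hd (.var M)) (.seq (.assign 0 (.tl (.var 0))) (.seq P
        (.seq (.assign M .nil) (.assign (M + 1) .nil)))))
        (.loop (.var (M + 1)) (.seq (.assign 0 (.tl (.var 0))) (.seq Q
          (.assign (M + 1) .nil)))))))
      (m := M + 2) hT (by omega) fun σ => ?_
    set σ1 := Function.update (Function.update σ M (σ 0)) (M + 1) (.cons .nil .nil) with hσ1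
    have e1 : σ1 0 = σ 0 := by
      rw [hσ1, Function.update_of_ne (by omega), Function.update_of_ne (by omega)]
    have e2 : σ1 M = σ 0 := by rw [hσ1, Function.update_of_ne (by omega), Function.update_self]
    have e3 : σ1 (M + 1) = .cons .nil .nil := by rw [hσ1, Function.update_self]
    have e4 : ∀ x, M + 2 ≤ x → σ1 x = σ x := fun x hx => by
      rw [hσ1, Function.update_of_ne (by omega), Function.update_of_ne (by omega)]
    have pre : Exec (.assign M (.var 0)) σ 1 (Function.update σ M (σ 0)) := Exec.assign _ _ _
    have pre' : Exec (.assign (M + 1) (.cons .nil .nil)) (Function.update σ M (σ 0)) 1 σ1 :=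
      Exec.assign _ _ _
    have hs := Data.size_tl_le (σ 0)
    by_cases hc : (σ 0).hd = .nil
    · obtain ⟨t, σ', h1, h2, h3, h4, h5⟩ := H' (Function.update σ1 0 (σ 0).tl)
      rw [Function.update_self] at h2 h3 h4
      have hl1 : Exec (.loop (.hd (.var M)) (.seq (.assign 0 (.tl (.var 0))) (.seq P
        (.seq (.assign M .nil) (.assign (M + 1) .nil))))) σ1 1 σ1 :=
        Exec.loopEnd (by simp [Exp.eval, e2, hc])
      have ha : Exec (.assign 0 (.tl (.var 0))) σ1 1 (Function.update σ1 0 (σ 0).tl) := by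
        have := Exec.assign 0 (.tl (.var 0)) σ1
        simpa only [Exp.eval, e1] using this
      have hl2 := Exec.loopStep (e := .var (M + 1)) (σ := σ1) (by simp [Exp.eval, e3])
        (Exec.seq ha (Exec.seq h1 (Exec.assign (M + 1) .nil _)))
        (Exec.loopEnd (by simp [Exp.eval]))
      have := hF.mono b hs
      refine ⟨_, _, Exec.seq pre (Exec.seq pre' (Exec.seq hl1 hl2)), by omega, ?_, ?_, ?_⟩
      · rw [Function.update_of_ne (by omega)]; omega
      · rw [Function.update_of_ne (by omega), h4]; simp [hc]
      · intro x hx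
        rw [Function.update_of_ne (by omega), h5 x (by omega), Function.update_of_ne (by omega),
          e4 x hx]
    · obtain ⟨t, σ', h1, h2, h3, h4, h5⟩ := H (Function.update σ1 0 (σ 0).tl)
      rw [Function.update_self] at h2 h3 h4
      have ha : Exec (.assign 0 (.tl (.var 0))) σ1 1 (Function.update σ1 0 (σ 0).tl) := by
        have := Exec.assign 0 (.tl (.var 0)) σ1
        simpa only [Exp.eval, e1] using this
      have hl1 := Exec.loopStep (e := .hd (.var M)) (σ := σ1) (by simp [Exp.eval, e2, hc])
        (Exec.seq ha (Exec.seq h1 (Exec.seq (Exec.assign M .nil _)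
          (Exec.assign (M + 1) .nil _))))
        (Exec.loopEnd (by
          simp only [Exp.eval]
          rw [Function.update_of_ne (by omega), Function.update_self]; rfl))
      have hl2 := Exec.loopEnd (e := .var (M + 1)) (P := (.seq (.assign 0 (.tl (.var 0))) (.seq Q
          (.assign (M + 1) .nil)))) (σ := Function.update (Function.update σ' M .nil) (M + 1) .nil)
          (by simp [Exp.eval])
      have := hF.mono a hs
      refine ⟨_, _, Exec.seq pre (Exec.seq pre' (Exec.seq hl1 hl2)), by omega, ?_, ?_, ?_⟩
      · rw [Function.update_of_ne (by omega), Function.update_of_ne (by omega)]; omega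
      · rw [Function.update_of_ne (by omega), Function.update_of_ne (by omega), h4]; simp [hc]
      · intro x hx
        rw [Function.update_of_ne (by omega), Function.update_of_ne (by omega), h5 x (by omega),
          Function.update_of_ne (by omega), e4 x hx]
  exact (comp hF key (cons hF hh (id hF))).congr fun x => by
    by_cases hx : h x = .nil <;> simp [hx]

/-- Loops with bounded numbers of rounds and bounded intermediate results. -/
theorem loop (hF : Scale F) (hf : Feasible F f) (N : Data → ℕ) {B : ℕ → ℕ} (hB : Bdd F B)
    (hN : ∀ x, N x ≤ B x.size) (h1 : ∀ x, ∀ j < N x, (f^[j] x).hd ≠ .nil)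
    (h2 : ∀ x, (f^[N x] x).hd = .nil) (h3 : ∀ x, ∀ j ≤ N x, (f^[j] x).size ≤ B x.size) :
    Feasible F fun x => f^[N x] x := by
  obtain ⟨P, m, a, hm, H⟩ := hf
  have hT : Bdd F fun n => B n * (F a (B n) + 1) + B n + 1 :=
    ((hB.mul hF ((Bdd.comp hF a hB).add hF (Bdd.const hF 1))).add hF hB).add hF (Bdd.const hF 1)
  refine intro (P := .loop (.hd (.var 0)) P) (m := m) hT hm fun σ => ?_
  -- One bound S for all intermediate results is fixed before the induction on the number of rounds,
  -- so that each round costs at most F a S + 1.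
  have key : ∀ (S k : ℕ) (σ : ℕ → Data), (∀ j < k, (f^[j] (σ 0)).hd ≠ .nil) →
      (f^[k] (σ 0)).hd = .nil → (∀ j ≤ k, (f^[j] (σ 0)).size ≤ S) →
      ∃ t σ', Exec (.loop (.hd (.var 0)) P) σ t σ' ∧ t ≤ k * (F a S + 1) + 1 ∧
        σ' 0 = f^[k] (σ 0) ∧ ∀ x, m ≤ x → σ' x = σ x := by
    intro S k
    induction k with
    | zero =>
      intro σ _ hk _
      exact ⟨1, σ, Exec.loopEnd (by simpa [Exp.eval] using hk), by omega, rfl, fun _ _ => rfl⟩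
    | succ k ih =>
      intro σ hlt hk hS
      obtain ⟨t, σ', r1, r2, -, r4, r5⟩ := H σ
      obtain ⟨t', σ'', q1, q2, q3, q4⟩ := ih σ' (fun j hj => by
          rw [r4, ← Function.iterate_succ_apply]; exact hlt (j + 1) (by omega))
        (by rw [r4, ← Function.iterate_succ_apply]; exact hk)
        (fun j hj => by rw [r4, ← Function.iterate_succ_apply]; exact hS (j + 1) (by omega))
      have hle : F a (σ 0).size ≤ F a S := hF.mono a (hS 0 (by omega))
      refine ⟨_, _, Exec.loopStep (by simpa [Exp.eval] using hlt 0 (by omega)) r1 q1, ?_, ?_, ?_⟩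
      · rw [Nat.succ_mul]; omega
      · rw [q3, r4, ← Function.iterate_succ_apply]
      · exact fun x hx => (q4 x hx).trans (r5 x hx)
  obtain ⟨t, σ', q1, q2, q3, q4⟩ := key (B (σ 0).size) (N (σ 0)) σ (h1 _) (h2 _) (h3 _)
  have hle := Nat.mul_le_mul_right (F a (B (σ 0).size) + 1) (hN (σ 0))
  refine ⟨t, σ', q1, by omega, ?_, q3, q4⟩
  have := h3 (σ 0) _ le_rfl
  rw [q3]
  omega

/-- Running a program for a feasible function in the required format. -/
theorem computesWithin (hf : Feasible F f) :
    ∃ (P : Prog) (a : ℕ), ∀ x, P.ComputesWithin x (f x) (F a x.size) := by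
  obtain ⟨P, m, a, hm, H⟩ := hf
  refine ⟨P, a, fun x => ?_⟩
  obtain ⟨t, σ', q1, q2, -, q4, -⟩ := H (Function.update (fun _ => .nil) 0 x)
  rw [Function.update_self] at q2 q4
  exact ⟨t, σ', q1, q2, q4⟩

end Feasible
end NestedVAS

namespace NestedVAS

/-! ## Lists as binary trees -/

namespace Data

/-- The list of the first components along the spine. -/
def toL : Data → List Data
  | nil => []
  | cons a b => a :: b.toL

@[simp] theorem toL_ofList (l : List Data) : (ofList l).toL = l := by
  induction l with
  | nil => rfl
  | cons a l ih => simp [ofList, toL, ih]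

@[simp] theorem ofList_toL (x : Data) : ofList x.toL = x := by
  induction x with
  | nil => rfl
  | cons a b _ ih => simp [ofList, toL, ih]

@[simp] theorem toL_nil : nil.toL = [] := rfl
@[simp] theorem toL_cons (a b : Data) : (cons a b).toL = a :: b.toL := rfl
@[simp] theorem ofList_nil : ofList [] = nil := rfl
@[simp] theorem ofList_cons (a : Data) (l : List Data) : ofList (a :: l) = cons a (ofList l) := rfl

theorem ofList_eq_nil {l : List Data} : ofList l = nil ↔ l = [] := by
  cases l <;> simp

theorem size_ofList (l : List Data) : (ofList l).size = (l.map fun a => a.size + 1).sum + 1 := by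
  induction l with
  | nil => rfl
  | cons a l ih => simp [size, ih]; omega

theorem size_eq_sum (x : Data) : x.size = (x.toL.map fun a => a.size + 1).sum + 1 := by
  conv_lhs => rw [← ofList_toL x]
  exact size_ofList _

theorem length_lt_size (x : Data) : x.toL.length < x.size := by
  induction x with
  | nil => simp [size]
  | cons a b _ ih => simp [size]; omega

theorem size_lt_of_mem {a x : Data} (h : a ∈ x.toL) : a.size < x.size := by
  induction x with
  | nil => simp at h
  | cons b c _ ih =>
    simp only [size]
    rcases List.mem_cons.1 h with rfl | h
    · omega
    · have := ih h
      omega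

theorem ofNat_eq (n : ℕ) : ofNat n = ofList (List.replicate n nil) := by
  induction n with
  | zero => rfl
  | succ n ih => simp [ofNat, ih, List.replicate_succ]

theorem toL_ofNat (n : ℕ) : (ofNat n).toL = List.replicate n nil := by simp [ofNat_eq]

theorem toL_tl (x : Data) : x.tl.toL = x.toL.tail := by cases x <;> simp

theorem ofList_drop_succ (l : List Data) (j : ℕ) : ofList (l.drop (j + 1)) = (ofList (l.drop j)).tl := by
  rw [← ofList_toL (ofList (l.drop j)).tl, toL_tl, toL_ofList, List.tail_drop]

end Data

namespace Feasible

open Data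

variable {F : ℕ → ℕ → ℕ} {f g h : Data → Data}

theorem const (hF : Scale F) (c : Data) : Feasible F fun _ => c := by
  induction c with
  | nil => exact nil hF
  | cons a b ha hb => exact cons hF ha hb

/-- The accumulated value of a loop over a list. -/
def foldVal (f : Data → Data) (acc env : Data) (l : List Data) : Data :=
  l.foldl (fun acc a => f (.cons a (.cons acc env))) acc

theorem foldVal_concat (f : Data → Data) (acc env : Data) (l : List Data) (a : Data) :
    foldVal f acc env (l ++ [a]) = f (.cons a (.cons (foldVal f acc env l) env)) := by
  simp [foldVal]

theorem foldVal_cons (f : Data → Data) (acc env : Data) (l : List Data) (a : Data) :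
    foldVal f acc env (a :: l) = foldVal f (f (.cons a (.cons acc env))) env l := rfl

/-- Loops over lists. -/
theorem fold (hF : Scale F) (hf : Feasible F f) {B : ℕ → ℕ} (hB : Bdd F B)
    (hb : ∀ x : Data, ∀ l l', x.hd.toL = l ++ l' →
      (foldVal f x.tl.hd x.tl.tl l).size ≤ B x.size) :
    Feasible F fun x => foldVal f x.tl.hd x.tl.tl x.hd.toL := by
  -- The state is (remaining list, (accumulator, environment)), and the loop ends when the remaining
  -- list is empty.
  set S : Data → Data := fun s =>
    .cons s.hd.tl (.cons (f (.cons s.hd.hd (.cons s.tl.hd s.tl.tl))) s.tl.tl) with hS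
  have hid := id hF
  have hhd := hd hF
  have htl := tl hF
  have hSf : Feasible F S :=
    cons hF (comp hF htl hhd) (cons hF (comp hF hf (cons hF (comp hF hhd hhd)
      (cons hF (comp hF hhd htl) (comp hF htl htl)))) (comp hF htl htl))
  have key : ∀ (x : Data) (j : ℕ), j ≤ x.hd.toL.length →
      (S^[j] x).hd = ofList (x.hd.toL.drop j) ∧
      (S^[j] x).tl.hd = foldVal f x.tl.hd x.tl.tl (x.hd.toL.take j) ∧
      (S^[j] x).tl.tl = x.tl.tl := by
    intro x j
    induction j with
    | zero => intro _; simp [foldVal]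
    | succ j ih =>
      intro hj
      obtain ⟨h1, h2, h3⟩ := ih (by omega)
      have hlt : j < x.hd.toL.length := by omega
      have e1 : (ofList (x.hd.toL.drop j)).hd = x.hd.toL[j] := by
        rw [List.drop_eq_getElem_cons hlt]; rfl
      have e2 : S (S^[j] x) = .cons (ofList (x.hd.toL.drop (j + 1)))
          (.cons (f (.cons x.hd.toL[j] (.cons (foldVal f x.tl.hd x.tl.tl (x.hd.toL.take j))
            x.tl.tl))) x.tl.tl) := by
        rw [ofList_drop_succ, ← e1, ← h1, ← h2, ← h3]
      rw [Function.iterate_succ_apply', e2, List.take_succ_eq_append_getElem hlt, foldVal_concat]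
      exact ⟨rfl, rfl, rfl⟩
  have hT : Bdd F fun n => n + B n + n + 2 :=
    (((Bdd.id hF).add hF hB).add hF (Bdd.id hF)).add hF (Bdd.const hF 2)
  have main : Feasible F fun x => S^[x.hd.toL.length] x := by
    refine loop hF hSf (fun x => x.hd.toL.length) hT (fun x => ?_) (fun x j hj => ?_)
      (fun x => ?_) (fun x j hj => ?_)
    · have := length_lt_size x.hd
      have := size_hd_le x
      omega
    · rw [(key x j hj.le).1]
      simpa [ofList_eq_nil] using hj
    · rw [(key x _ le_rfl).1]
      simp
    · obtain ⟨h1, h2, h3⟩ := key x j hj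
      have hsz : ∀ y : Data, y.size ≤ y.hd.size + y.tl.hd.size + y.tl.tl.size + 2 := fun y => by
        rcases y with _ | ⟨a, _ | ⟨b, c⟩⟩ <;> simp [size]; omega
      have h4 := hsz (S^[j] x)
      rw [h1, h2, h3] at h4
      have h5 : (ofList (x.hd.toL.drop j)).size ≤ x.size := by
        refine le_trans ?_ (size_hd_le x)
        rw [size_ofList, size_eq_sum x.hd]
        exact Nat.succ_le_succ (((List.drop_sublist j _).map _).sum_le_sum (by simp))
      have h6 := hb x _ _ (List.take_append_drop j x.hd.toL).symm
      have h7 := (size_tl_le x.tl).trans (size_tl_le x)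
      omega
  refine (comp hF (comp hF hhd htl) main).congr fun x => ?_
  rw [(key x _ le_rfl).2.1]
  simp

/-- Loops over lists whose steps increase the accumulated value by feasible amounts. -/
theorem fold_additive (hF : Scale F) (hf : Feasible F f) {B : ℕ → ℕ} (hB : Bdd F B)
    (hB' : Monotone B)
    (hb : ∀ a acc env : Data,
      (f (.cons a (.cons acc env))).size ≤ acc.size + B (a.size + env.size)) :
    Feasible F fun x => foldVal f x.tl.hd x.tl.tl x.hd.toL := by
  -- The element and the environment are both at most as large as the input, which gives 2n; there
  -- are at most n rounds, which gives the bound n + n · B (2n) on the accumulator.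
  have h2 : Bdd F fun n => B (2 * n) := by
    obtain ⟨b, hb⟩ := hB
    exact (Bdd.comp hF b ((Bdd.const hF 2).mul hF (Bdd.id hF))).of_le
      fun n hn => hb _ (by omega)
  refine fold hF hf (B := fun n => n + n * B (2 * n))
    ((Bdd.id hF).add hF ((Bdd.id hF).mul hF h2)) fun x l l' hl => ?_
  have : ∀ (l : List Data) (acc : Data), (∀ a ∈ l, a ∈ x.hd.toL) →
      (foldVal f acc x.tl.tl l).size ≤ acc.size + l.length * B (2 * x.size) := by
    intro l
    induction l with
    | nil => intro acc _; simp [foldVal]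
    | cons a l ih =>
      intro acc hl
      have h1 := ih (f (.cons a (.cons acc x.tl.tl))) fun b hb => hl b (List.mem_cons_of_mem _ hb)
      have h2 := hb a acc x.tl.tl
      have h3 : B (a.size + x.tl.tl.size) ≤ B (2 * x.size) := by
        apply hB'
        have := size_lt_of_mem (hl a List.mem_cons_self)
        have := size_hd_le x
        have := (size_tl_le x.tl).trans (size_tl_le x)
        omega
      simp only [foldVal, List.foldl_cons, List.length_cons] at h1 ⊢
      rw [Nat.succ_mul]
      omega
  have h1 := this l x.tl.hd fun a ha => hl ▸ List.mem_append_left _ ha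
  have h3 := (size_hd_le x.tl).trans (size_tl_le x)
  have h4 : l.length ≤ x.size := by
    have h5 := length_lt_size x.hd
    have := size_hd_le x
    rw [hl, List.length_append] at h5
    omega
  have := Nat.mul_le_mul_right (B (2 * x.size)) h4
  show _ ≤ x.size + x.size * B (2 * x.size)
  omega

/-- Loops over lists whose steps are polynomial. -/
theorem fold_elementary (hf : Feasible polyScale f) :
    Feasible tower fun x => foldVal f x.tl.hd x.tl.tl x.hd.toL := by
  obtain ⟨a, ha⟩ := hf.size_le
  have hp : ∀ a, Bdd tower (polyScale a) := fun a => by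
    induction a with
    | zero => exact (Bdd.const scale_tower 1).of_le fun n _ => by simp [polyScale]
    | succ a ih =>
      exact (ih.mul scale_tower ((Bdd.id scale_tower).add scale_tower
        (Bdd.const scale_tower 1))).of_le fun n _ => by simp [polyScale, pow_succ]
  obtain ⟨e, he⟩ := poly_iterate_elementary a
  refine fold scale_tower (hf.mono_scale hp) (B := tower e) (Bdd.base e) fun x l l' hl => ?_
  refine le_trans ?_ (he x.size (size_pos x))
  have hlen : l.length < x.size := by
    have h5 := length_lt_size x.hd
    have := size_hd_le x
    rw [hl, List.length_append] at h5
    omega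
  -- The sequence is the size of the accumulator after j elements. The current element, the
  -- environment and the two constructors contribute at most the size of the input plus one.
  have := poly_iterate_le a x.size l.length (size_pos x)
    (fun j => (foldVal f x.tl.hd x.tl.tl (l.take j)).size)
    (by simpa [foldVal] using (size_hd_le x.tl).trans (size_tl_le x)) (fun j hj => by
      have e1 : foldVal f x.tl.hd x.tl.tl (l.take (j + 1)) =
          f (.cons l[j] (.cons (foldVal f x.tl.hd x.tl.tl (l.take j)) x.tl.tl)) := by
        rw [List.take_succ_eq_append_getElem hj, foldVal_concat]
      simp only [e1]
      refine (ha _).trans (Nat.pow_le_pow_left ?_ a)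
      have h1 : l[j].size < x.hd.size :=
        size_lt_of_mem (hl ▸ List.mem_append_left _ (List.getElem_mem hj))
      have h2 : x.hd.size + x.tl.tl.size + 1 ≤ x.size := by
        rcases x with _ | ⟨y, z⟩
        · simp [size] at h1
          have := size_pos l[j]
          omega
        · have := size_tl_le z
          simp [size]; omega
      have h3 := size_tl_le x.tl.tl
      simp only [size]
      omega) l.length le_rfl
  simp only [List.take_length] at this
  have h2 : (x.size + 2) ^ ((a + 2) ^ (l.length + 1)) ≤
      (x.size + 2) ^ ((a + 2) ^ (x.size + 1)) :=
    Nat.pow_le_pow_right (by omega) (Nat.pow_le_pow_right (by omega) (by omega))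
  omega

/-- Reversal followed by concatenation. -/
theorem revAppend (hF : Scale F) (hf : Feasible F f) (hg : Feasible F g) :
    Feasible F fun x => ofList ((f x).toL.reverse ++ (g x).toL) := by
  have h1 : Feasible F fun y => .cons y.hd y.tl.hd :=
    cons hF (hd hF) (comp hF (hd hF) (tl hF))
  have h2 := fold_additive hF h1 (B := fun n => n + 1)
    ((Bdd.id hF).add hF (Bdd.const hF 1)) (fun m n h => by simpa using h)
    (fun a acc env => by simp [size]; omega)
  refine (comp hF h2 (cons hF hf (cons hF hg (nil hF)))).congr fun x => ?_
  have : ∀ (l : List Data) (acc : Data), foldVal (fun y => .cons y.hd y.tl.hd) acc .nil l =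
      ofList (l.reverse ++ acc.toL) := by
    intro l
    induction l with
    | nil => intro acc; simp [foldVal]
    | cons a l ih => intro acc; simpa [foldVal] using ih (.cons a acc)
  simpa using this (f x).toL (g x)

theorem reverse (hF : Scale F) (hf : Feasible F f) :
    Feasible F fun x => ofList (f x).toL.reverse :=
  (revAppend hF hf (nil hF)).congr fun x => by simp

theorem append (hF : Scale F) (hf : Feasible F f) (hg : Feasible F g) :
    Feasible F fun x => ofList ((f x).toL ++ (g x).toL) :=
  (revAppend hF (reverse hF hf) hg).congr fun x => by simp

/-- The list of each element is put in reversed order in front of the accumulator, and one reversal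
at the end restores the order. The accumulator grows only by the new piece, so the loop stays within
every scale. -/
theorem flatMap (hF : Scale F) (hf : Feasible F f) :
    Feasible F fun x => ofList (x.hd.toL.flatMap fun a => (f (.cons a x.tl)).toL) := by
  obtain ⟨b, hb⟩ := hf.size_le
  have h1 : Feasible F fun y => ofList ((f (.cons y.hd y.tl.tl)).toL.reverse ++ y.tl.hd.toL) :=
    revAppend hF (comp hF hf (cons hF (hd hF) (comp hF (tl hF) (tl hF))))
      (comp hF (hd hF) (tl hF))
  have h2 := fold_additive hF h1 (B := fun n => F b (n + 1))
    (Bdd.comp hF b ((Bdd.id hF).add hF (Bdd.const hF 1)))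
    (fun m n h => hF.mono b (by simpa using h)) (fun a acc env => by
      have := hb (.cons a env)
      simp only [hd_cons, tl_cons, size_ofList, List.map_append, List.map_reverse,
        List.sum_append, List.sum_reverse]
      have e1 := size_eq_sum (f (.cons a env))
      have e2 := size_eq_sum acc
      simp only [size] at this
      omega)
  refine (reverse hF (comp hF h2 (cons hF (hd hF) (cons hF (nil hF) (tl hF))))).congr fun x => ?_
  have : ∀ (l : List Data) (acc env : Data),
      foldVal (fun y => ofList ((f (.cons y.hd y.tl.tl)).toL.reverse ++ y.tl.hd.toL)) acc env l =
      ofList ((l.flatMap fun a => (f (.cons a env)).toL).reverse ++ acc.toL) := by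
    intro l
    induction l with
    | nil => intro acc env; simp [foldVal]
    | cons a l ih =>
      intro acc env
      have := ih (ofList ((f (.cons a env)).toL.reverse ++ acc.toL)) env
      rw [foldVal_cons, hd_cons, tl_cons, tl_cons, hd_cons, this]
      simp
  simp [this]

theorem drop (hF : Scale F) (hf : Feasible F f) (hg : Feasible F g) :
    Feasible F fun x => ofList ((f x).toL.drop (g x).toL.length) := by
  have h1 : Feasible F fun y : Data => y.tl.hd.tl := comp hF (tl hF) (comp hF (hd hF) (tl hF))
  have h2 := fold_additive hF h1 (B := fun n => n) (Bdd.id hF) monotone_id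
    (fun a acc env => by have := size_tl_le acc; simp; omega)
  refine (comp hF h2 (cons hF hg (cons hF hf (nil hF)))).congr fun x => ?_
  have : ∀ (l : List Data) (acc : Data),
      foldVal (fun y : Data => y.tl.hd.tl) acc .nil l = ofList (acc.toL.drop l.length) := by
    intro l
    induction l with
    | nil => intro acc; simp [foldVal]
    | cons a l ih =>
      intro acc
      rw [foldVal_cons, ih]
      simp [toL_tl]
  simpa using this (g x).toL (f x)

/-- Numbering the elements of a list. -/
theorem zipIdx (hF : Scale F) (hf : Feasible F f) :
    Feasible F fun x => ofList ((f x).toL.zipIdx.map fun p => .cons (ofNat p.2) p.1) := by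
  -- The accumulator consists of the current number in unary and the reversed output.
  set S : Data → Data := fun y =>
    .cons (.cons .nil y.tl.hd.hd) (.cons (.cons y.tl.hd.hd y.hd) y.tl.hd.tl) with hS
  have hhd := hd hF
  have htl := tl hF
  have hc : Feasible F fun y : Data => y.tl.hd := comp hF hhd htl
  have h1 : Feasible F S := cons hF (cons hF (nil hF) (comp hF hhd hc))
    (cons hF (cons hF (comp hF hhd hc) hhd) (comp hF htl hc))
  have key : ∀ (l : List Data) (c : ℕ) (out : List Data) (env : Data),
      foldVal S (.cons (ofNat c) (ofList out)) env l = .cons (ofNat (c + l.length))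
        (ofList ((((l.zipIdx c).map fun p => Data.cons (ofNat p.2) p.1)).reverse ++ out)) := by
    intro l
    induction l with
    | nil => intro c out env; simp [foldVal]
    | cons a l ih =>
      intro c out env
      have := ih (c + 1) (.cons (ofNat c) a :: out) env
      simp only [foldVal, ofList_cons, ofNat] at this
      simp only [foldVal, List.foldl_cons, hS, hd_cons, tl_cons] at this ⊢
      rw [this]
      simp [Nat.add_comm, Nat.add_left_comm]
  have hsz : ∀ (l : List Data) (acc env : Data),
      (foldVal S acc env l).hd.size ≤ acc.hd.size + 2 * l.length ∧
      (foldVal S acc env l).tl.size ≤ acc.tl.size + (l.map fun a => a.size + 1).sum +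
        l.length * (acc.hd.size + 2 * l.length + 1) := by
    intro l
    induction l with
    | nil => intro acc env; simp [foldVal]
    | cons a l ih =>
      intro acc env
      have := ih (S (.cons a (.cons acc env))) env
      simp only [foldVal, hS, hd_cons, tl_cons, size] at this
      simp only [foldVal, hS, List.foldl_cons, List.length_cons, hd_cons, tl_cons, List.map_cons,
        List.sum_cons]
      have e : 1 + acc.hd.size + 1 + 2 * l.length + 1 = acc.hd.size + 2 * (l.length + 1) + 1 := by
        omega
      rw [e] at this
      rw [Nat.succ_mul l.length (acc.hd.size + 2 * (l.length + 1) + 1)]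
      omega
  have hT : Bdd F fun n => n + 2 * n + n + n + n * (n + 2 * n + 1) + 1 := by
    have h2 := (Bdd.const hF 2).mul hF (Bdd.id hF)
    exact (((((Bdd.id hF).add hF h2).add hF (Bdd.id hF)).add hF (Bdd.id hF)).add hF
      ((Bdd.id hF).mul hF (((Bdd.id hF).add hF h2).add hF (Bdd.const hF 1)))).add hF
        (Bdd.const hF 1)
  have h2 := fold hF h1 hT fun x l l' hl => by
    obtain ⟨b1, b2⟩ := hsz l x.tl.hd x.tl.tl
    have b3 : ∀ y : Data, y.size ≤ y.hd.size + y.tl.size + 1 := fun y => by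
      cases y <;> simp [size]
    have b3 := b3 (foldVal S x.tl.hd x.tl.tl l)
    have b4 := (size_hd_le x.tl).trans (size_tl_le x)
    have b5 := (size_hd_le x.tl.hd).trans b4
    have b6 := (size_tl_le x.tl.hd).trans b4
    have b7 : l.length ≤ x.size ∧ (l.map fun a => a.size + 1).sum ≤ x.size := by
      have c1 := length_lt_size x.hd
      have c2 := size_hd_le x
      have c3 := size_eq_sum x.hd
      rw [hl, List.length_append] at c1
      rw [hl, List.map_append, List.sum_append] at c3
      omega
    have b8 : l.length * (x.tl.hd.hd.size + 2 * l.length + 1) ≤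
        x.size * (x.size + 2 * x.size + 1) := Nat.mul_le_mul b7.1 (by omega)
    show _ ≤ x.size + 2 * x.size + x.size + x.size + x.size * (x.size + 2 * x.size + 1) + 1
    omega
  refine (reverse hF (comp hF htl (comp hF h2 (cons hF hf (const hF (.cons (.cons .nil .nil)
    .nil)))))).congr fun x => ?_
  simpa [ofNat] using congrArg (fun y : Data => ofList y.tl.toL.reverse)
    (key (f x).toL 0 [] .nil)

/-- One round of the comparison of a list of pairs of trees. -/
noncomputable def eqStep (s : Data) : Data :=
  -- The state consists of a stack of pairs still to be compared and a verdict. Two inner nodes are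
  -- replaced by the pairs of their left and of their right subtrees, two leaves are removed. A
  -- mismatch empties the stack and leaves a verdict different from `nil`.
  if s.hd.hd.hd ≠ .nil then
    if s.hd.hd.tl ≠ .nil then
      .cons (.cons (.cons s.hd.hd.hd.hd s.hd.hd.tl.hd)
        (.cons (.cons s.hd.hd.hd.tl s.hd.hd.tl.tl) s.hd.tl)) s.tl
    else .cons .nil (.cons .nil .nil)
  else if s.hd.hd.tl ≠ .nil then .cons .nil (.cons .nil .nil) else .cons s.hd.tl s.tl

theorem eqStep_feasible (hF : Scale F) : Feasible F eqStep := by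
  have hhd := hd hF
  have htl := tl hF
  have h1 : Feasible F fun s : Data => s.hd.hd.hd := comp hF hhd (comp hF hhd hhd)
  have h2 : Feasible F fun s : Data => s.hd.hd.tl := comp hF htl (comp hF hhd hhd)
  have h3 : Feasible F fun _ : Data => Data.cons .nil (.cons .nil .nil) := const hF _
  have h4 : Feasible F fun s : Data => s.hd.tl := comp hF htl hhd
  exact ite hF h1 (ite hF h2 (cons hF (cons hF (cons hF (comp hF hhd h1) (comp hF hhd h2))
    (cons hF (cons hF (comp hF htl h1) (comp hF htl h2)) h4)) htl) h3)
    (ite hF h2 h3 (cons hF h4 htl))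

/-- Equality of trees. -/
theorem eq (hF : Scale F) (hf : Feasible F f) (hg : Feasible F g) :
    Feasible F fun x => if f x = g x then .cons .nil .nil else .nil := by
  -- The total size of the first trees on the stack. Splitting an inner node saves its root,
  -- removing a leaf saves one, and a mismatch empties the stack, so the measure drops in every
  -- round.
  let M : Data → ℕ := fun s => (s.hd.toL.map fun p => p.hd.size).sum
  have hM : ∀ s : Data, s.hd ≠ .nil → M (eqStep s) < M s := by
    rintro (_ | ⟨_ | ⟨p, t⟩, e⟩) hs
    · simp at hs
    · simp at hs
    · rcases p with _ | ⟨_ | ⟨a1, a2⟩, _ | ⟨b1, b2⟩⟩ <;> simp [M, eqStep, size] <;> omega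
  have hend : ∀ (n : ℕ) (s : Data), M s ≤ n → ∃ j ≤ n, (eqStep^[j] s).hd = .nil := by
    intro n
    induction n with
    | zero =>
      intro s hs
      refine ⟨0, le_rfl, ?_⟩
      by_contra h
      exact absurd (hM s h) (by omega)
    | succ n ih =>
      intro s hs
      by_cases h : s.hd = .nil
      · exact ⟨0, by omega, h⟩
      · obtain ⟨j, hj, hj'⟩ := ih (eqStep s) (by have := hM s h; omega)
        exact ⟨j + 1, by omega, hj'⟩
  have hex : ∀ s : Data, ∃ j, (eqStep^[j] s).hd = .nil := fun s =>
    let ⟨j, _, h⟩ := hend _ s le_rfl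
    ⟨j, h⟩
  have hMs : ∀ s, M s ≤ s.size := fun s => by
    refine le_trans ?_ (size_hd_le s)
    rw [size_eq_sum s.hd]
    have : ∀ l : List Data, (l.map fun p => p.hd.size).sum ≤ (l.map fun p => p.size + 1).sum := by
      intro l
      exact List.sum_le_sum fun p _ => (size_hd_le p).trans (Nat.le_succ _)
    exact (this _).trans (Nat.le_succ _)
  have hsz : ∀ s : Data, s.hd ≠ .nil →
      (eqStep s).size ≤ s.size ∨ eqStep s = .cons .nil (.cons .nil .nil) := by
    rintro (_ | ⟨_ | ⟨p, t⟩, e⟩) hs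
    · simp at hs
    · simp at hs
    · rcases p with _ | ⟨_ | ⟨a1, a2⟩, _ | ⟨b1, b2⟩⟩ <;> simp [eqStep, size] <;> omega
  obtain ⟨N, hN1, hN2, hN3⟩ : ∃ N : Data → ℕ, (∀ x, N x ≤ x.size) ∧
      (∀ x, ∀ j < N x, (eqStep^[j] x).hd ≠ .nil) ∧ ∀ x, (eqStep^[N x] x).hd = .nil := by
    classical
    refine ⟨fun s => Nat.find (hex s), fun x => ?_, fun x j hj => Nat.find_min (hex x) hj,
      fun x => Nat.find_spec (hex x)⟩
    obtain ⟨j, hj, h⟩ := hend _ x le_rfl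
    exact (Nat.find_min' (hex x) h).trans (hj.trans (hMs x))
  have hloop := loop hF (eqStep_feasible hF) N (B := fun n => n + 5)
    ((Bdd.id hF).add hF (Bdd.const hF 5)) (fun x => (hN1 x).trans (by omega)) hN2 hN3
    (fun x j hj => by
      have : (eqStep^[j] x).size ≤ x.size ∨ eqStep^[j] x = .cons .nil (.cons .nil .nil) := by
        induction j with
        | zero => exact Or.inl le_rfl
        | succ j ih =>
          have hne := hN2 x j (by omega)
          rw [Function.iterate_succ_apply']
          rcases ih (by omega) with ih | ih
          · rcases hsz _ hne with h | h
            · exact Or.inl (h.trans ih)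
            · exact Or.inr h
          · rw [ih] at hne
            simp at hne
      rcases this with h | h
      · omega
      · rw [h]; simp [size])
  -- All pairs on the stack are equal and no mismatch has been found. Rounds preserve this in both
  -- directions, so on the final empty stack the verdict decides equality of the initial pair.
  let G : Data → Prop := fun s => s.tl = .nil ∧ ∀ p ∈ s.hd.toL, p.hd = p.tl
  have hG : ∀ s : Data, s.hd ≠ .nil → (G (eqStep s) ↔ G s) := by
    rintro (_ | ⟨_ | ⟨p, t⟩, e⟩) hs
    · simp at hs
    · simp at hs
    · rcases p with _ | ⟨_ | ⟨a1, a2⟩, _ | ⟨b1, b2⟩⟩ <;> simp [G, eqStep, and_assoc]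
  have hGN : ∀ s, G (eqStep^[N s] s) ↔ G s := fun s => by
    have : ∀ j ≤ N s, (G (eqStep^[j] s) ↔ G s) := by
      intro j
      induction j with
      | zero => intro _; rfl
      | succ j ih =>
        intro hj
        rw [Function.iterate_succ_apply', hG _ (hN2 s j (by omega)), ih (by omega)]
    exact this _ le_rfl
  refine (ite hF (comp hF (tl hF) (comp hF hloop (cons hF (cons hF (cons hF hf hg) (nil hF))
    (nil hF)))) (nil hF) (const hF (.cons .nil .nil))).congr fun x => ?_
  have h1 := hGN (.cons (.cons (.cons (f x) (g x)) .nil) .nil)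
  set z : Data := .cons (.cons (.cons (f x) (g x)) .nil) .nil
  have h3 : G z ↔ f x = g x := by simp [G, z]
  have h4 : G (eqStep^[N z] z) ↔ (eqStep^[N z] z).tl = .nil := by simp [G, hN3]
  rw [h4, h3] at h1
  by_cases h : f x = g x
  · rw [if_neg (not_not.2 (h1.2 h)), if_pos h]
  · rw [if_pos (mt h1.1 h), if_neg h]

end Feasible
end NestedVAS

namespace NestedVAS

/-! ## Feasible constructions in a context -/

/-- The value of `G` is computed from the code of the context. -/
def Comp (F : ℕ → ℕ → ℕ) {I : Type*} (enc : I → Data) (G : I → Data) : Prop :=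
  ∃ g, Feasible F g ∧ ∀ i, g (enc i) = G i

/-- Codes of contexts that are extended by a variable. -/
def ext {I : Type*} (enc : I → Data) {α : I → Type*} (ea : ∀ i, α i → Data) :
    (Σ i, α i) → Data := fun p => .cons (ea p.1 p.2) (enc p.1)

/-- Codes of lists. -/
def encL {α : Type*} (ea : α → Data) (l : List α) : Data := .ofList (l.map ea)

open Classical in
/-- Codes of truth values. -/
noncomputable def truth (p : Prop) : Data := if p then .cons .nil .nil else .nil

theorem truth_ne_nil {p : Prop} : truth p ≠ .nil ↔ p := by
  unfold truth; split <;> simp [*]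

/-- The predicate is decided from the code of the context. -/
def CompP (F : ℕ → ℕ → ℕ) {I : Type*} (enc : I → Data) (p : I → Prop) : Prop :=
  Comp F enc fun i => truth (p i)

namespace Comp

open Data

variable {F : ℕ → ℕ → ℕ} {I J : Type*} {enc : I → Data} {G H : I → Data}

theorem congr (hG : Comp F enc G) (h : ∀ i, G i = H i) : Comp F enc H := by
  rwa [← funext h]

theorem app {f : Data → Data} (hF : Scale F) (hf : Feasible F f) (hG : Comp F enc G) :
    Comp F enc fun i => f (G i) := by
  obtain ⟨g, hg, h⟩ := hG
  exact ⟨_, Feasible.comp hF hf hg, fun i => by rw [h]⟩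

/-- A loop can thereby be analysed in a context that holds just its own data, relative to which its
body is polynomial, and then be used where these data are merely known to be elementary. -/
theorem subst {encJ : J → Data} {φ : J → I} (hF : Scale F) (hG : Comp F enc G)
    (h : Comp F encJ fun j => enc (φ j)) : Comp F encJ fun j => G (φ j) := by
  obtain ⟨g, hg, e⟩ := hG
  obtain ⟨g', hg', e'⟩ := h
  exact ⟨_, Feasible.comp hF hg hg', fun j => by rw [e', e]⟩

theorem self (hF : Scale F) : Comp F enc enc := ⟨_, Feasible.id hF, fun _ => rfl⟩

theorem const (hF : Scale F) (c : Data) : Comp F enc fun _ => c :=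
  ⟨_, Feasible.const hF c, fun _ => rfl⟩

theorem cons (hF : Scale F) (hG : Comp F enc G) (hH : Comp F enc H) :
    Comp F enc fun i => .cons (G i) (H i) := by
  obtain ⟨g, hg, e⟩ := hG
  obtain ⟨g', hg', e'⟩ := hH
  exact ⟨_, Feasible.cons hF hg hg', fun j => by rw [e', e]⟩

theorem hd (hF : Scale F) (hG : Comp F enc G) : Comp F enc fun i => (G i).hd :=
  app hF (Feasible.hd hF) hG

theorem tl (hF : Scale F) (hG : Comp F enc G) : Comp F enc fun i => (G i).tl :=
  app hF (Feasible.tl hF) hG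

section Ext

variable {α β : I → Type*} {ea : ∀ i, α i → Data} {eb : ∀ i, β i → Data}

theorem var (hF : Scale F) : Comp F (ext enc ea) fun p => ea p.1 p.2 :=
  hd hF (self hF)

theorem weaken (hF : Scale F) (hG : Comp F enc G) : Comp F (ext enc ea) fun p => G p.1 :=
  subst hF hG (tl hF (self hF))

theorem flatMap (hF : Scale F) {L : ∀ i, List (α i)} {f : ∀ i, α i → List (β i)}
    (hL : Comp F enc fun i => encL (ea i) (L i))
    (hf : Comp F (ext enc ea) fun p => encL (eb p.1) (f p.1 p.2)) :
    Comp F enc fun i => encL (eb i) ((L i).flatMap (f i)) := by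
  obtain ⟨g, hg, e⟩ := hf
  refine (app hF (Feasible.flatMap hF hg) (cons hF hL (self hF))).congr fun i => ?_
  have : ∀ a : α i, g (.cons (ea i a) (enc i)) = encL (eb i) (f i a) := fun a => e ⟨i, a⟩
  simp [encL, List.flatMap_map, this, List.map_flatMap]

theorem listMap (hF : Scale F) {L : ∀ i, List (α i)} {f : ∀ i, α i → Data}
    (hL : Comp F enc fun i => encL (ea i) (L i)) (hf : Comp F (ext enc ea) fun p => f p.1 p.2) :
    Comp F enc fun i => encL (f i) (L i) := by
  obtain ⟨g, hg, e⟩ := hf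
  refine (app hF (Feasible.flatMap hF (Feasible.cons hF hg (Feasible.nil hF)))
    (cons hF hL (self hF))).congr fun i => ?_
  have : ∀ a : α i, g (.cons (ea i a) (enc i)) = f i a := fun a => e ⟨i, a⟩
  simp [encL, List.flatMap_map, this, ← List.map_eq_flatMap]

theorem map (hF : Scale F) {L : ∀ i, List (α i)} {f : ∀ i, α i → β i}
    (hL : Comp F enc fun i => encL (ea i) (L i))
    (hf : Comp F (ext enc ea) fun p => eb p.1 (f p.1 p.2)) :
    Comp F enc fun i => encL (eb i) ((L i).map (f i)) :=
  (listMap hF (f := fun i a => eb i (f i a)) hL hf).congr fun i => by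
    simp [encL, Function.comp_def]

theorem append (hF : Scale F) {L L' : ∀ i, List (α i)}
    (hL : Comp F enc fun i => encL (ea i) (L i)) (hL' : Comp F enc fun i => encL (ea i) (L' i)) :
    Comp F enc fun i => encL (ea i) (L i ++ L' i) := by
  obtain ⟨g, hg, e⟩ := hL
  obtain ⟨g', hg', e'⟩ := hL'
  exact ⟨_, Feasible.append hF hg hg', fun i => by rw [e, e']; simp [encL]⟩

theorem nilL (hF : Scale F) : Comp F enc fun i => encL (ea i) [] := const hF _

theorem consL (hF : Scale F) {a : ∀ i, α i} {L : ∀ i, List (α i)}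
    (ha : Comp F enc fun i => ea i (a i)) (hL : Comp F enc fun i => encL (ea i) (L i)) :
    Comp F enc fun i => encL (ea i) (a i :: L i) := cons hF ha hL

theorem singleton (hF : Scale F) {a : ∀ i, α i} (ha : Comp F enc fun i => ea i (a i)) :
    Comp F enc fun i => encL (ea i) [a i] := cons hF ha (const hF .nil)

theorem ite (hF : Scale F) {p : I → Prop} [∀ i, Decidable (p i)] (hp : CompP F enc p)
    (hG : Comp F enc G) (hH : Comp F enc H) : Comp F enc fun i => if p i then G i else H i := by
  obtain ⟨g, hg, e⟩ := hG
  obtain ⟨g', hg', e'⟩ := hH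
  obtain ⟨t, ht, et⟩ := hp
  refine ⟨_, Feasible.ite hF ht hg hg', fun i => ?_⟩
  rw [et, e, e']
  simp only [truth_ne_nil]

theorem apply_ite' (hF : Scale F) {p : I → Prop} [∀ i, Decidable (p i)] {a b : ∀ i, α i}
    (hp : CompP F enc p) (ha : Comp F enc fun i => ea i (a i))
    (hb : Comp F enc fun i => ea i (b i)) :
    Comp F enc fun i => ea i (if p i then a i else b i) :=
  (ite hF hp ha hb).congr fun i => by split <;> rfl

theorem filter (hF : Scale F) {L : ∀ i, List (α i)} {p : ∀ i, α i → Prop}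
    [∀ i, DecidablePred (p i)] (hL : Comp F enc fun i => encL (ea i) (L i))
    (hp : CompP F (ext enc ea) fun q => p q.1 q.2) :
    Comp F enc fun i => encL (ea i) ((L i).filter fun a => p i a) := by
  have := flatMap hF (eb := ea) hL (f := fun i a => if p i a then [a] else [])
    ((ite hF hp (singleton (enc := ext enc ea) (ea := fun q : (Σ i, α i) => ea q.1)
      (a := fun q => q.2) hF (var hF)) (const hF .nil)).congr fun q => by
        split <;> simp [encL, *])
  refine this.congr fun i => congrArg _ ?_
  induction L i with
  | nil => rfl
  | cons a l ih =>
    rw [List.flatMap_cons, ih, List.filter_cons]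
    split <;> simp_all

theorem take_one (hF : Scale F) {L : ∀ i, List (α i)}
    (hL : Comp F enc fun i => encL (ea i) (L i)) :
    Comp F enc fun i => encL (ea i) ((L i).take 1) := by
  have h : Feasible F fun x : Data => if x ≠ .nil then .cons x.hd .nil else .nil :=
    Feasible.ite hF (Feasible.id hF) (Feasible.cons hF (Feasible.hd hF) (Feasible.nil hF))
      (Feasible.nil hF)
  refine (app hF h hL).congr fun i => ?_
  cases L i <;> simp [encL]

theorem headD (hF : Scale F) {L : ∀ i, List (α i)} {a : ∀ i, α i}
    (hL : Comp F enc fun i => encL (ea i) (L i)) (ha : Comp F enc fun i => ea i (a i)) :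
    Comp F enc fun i => ea i ((L i).headD (a i)) := by
  have h : Feasible F fun x : Data => if x.hd ≠ .nil then x.hd.hd else x.tl :=
    Feasible.ite hF (Feasible.hd hF) (Feasible.comp hF (Feasible.hd hF) (Feasible.hd hF))
      (Feasible.tl hF)
  refine (app hF h (cons hF hL ha)).congr fun i => ?_
  cases L i <;> simp [encL]

theorem length (hF : Scale F) {L : ∀ i, List (α i)}
    (hL : Comp F enc fun i => encL (ea i) (L i)) : Comp F enc fun i => ofNat (L i).length :=
  (listMap hF (f := fun _ _ => Data.nil) hL (const hF .nil)).congr fun i => by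
    simp [encL, ofNat_eq]

theorem zipIdx (hF : Scale F) {L : ∀ i, List (α i)}
    (hL : Comp F enc fun i => encL (ea i) (L i)) :
    Comp F enc fun i => encL (fun p : α i × ℕ => .cons (ofNat p.2) (ea i p.1)) (L i).zipIdx :=
  (app hF (Feasible.zipIdx hF (Feasible.id hF)) hL).congr fun i => by
    simp [encL, List.zipIdx_map, Function.comp_def, Prod.map]

end Ext

section Vectors

variable {α : I → Type*} {ea : ∀ i, α i → Data} {n : I → ℕ}

theorem finRange (hF : Scale F) (hn : Comp F enc fun i => ofNat (n i)) :
    Comp F enc fun i => encL (fun j : Fin (n i) => ofNat j) (List.finRange (n i)) := by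
  have h1 : Comp F enc fun i => encL (fun _ : Unit => Data.nil) (List.replicate (n i) ()) :=
    hn.congr fun i => by simp [encL, ofNat_eq]
  have h2 := zipIdx hF (ea := fun _ (_ : Unit) => Data.nil) h1
  have h3 := listMap hF (ea := fun _ (p : Unit × ℕ) => Data.cons (ofNat p.2) .nil)
    (f := fun _ (p : Unit × ℕ) => ofNat p.2) h2 (hd hF (var hF))
  refine h3.congr fun i => congrArg ofList (List.ext_getElem ?_ fun j h _ => ?_)
  · simp
  · simp

theorem ofFn (hF : Scale F) {f : ∀ i, Fin (n i) → Data} (hn : Comp F enc fun i => ofNat (n i))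
    (hf : Comp F (ext enc fun i (j : Fin (n i)) => ofNat j) fun p => f p.1 p.2) :
    Comp F enc fun i => ofList (List.ofFn (f i)) :=
  (listMap hF (finRange hF hn) hf).congr fun i => by simp [encL, List.ofFn_eq_map]

theorem nth (hF : Scale F) {f : ∀ i, Fin (n i) → Data} {j : ∀ i, Fin (n i)}
    (hf : Comp F enc fun i => ofList (List.ofFn (f i))) (hj : Comp F enc fun i => ofNat (j i)) :
    Comp F enc fun i => f i (j i) := by
  have h := Feasible.comp hF (Feasible.hd hF) (Feasible.drop hF (Feasible.tl hF) (Feasible.hd hF))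
  refine (app hF h (cons hF hj hf)).congr fun i => ?_
  simp only [hd_cons, tl_cons, toL_ofList, toL_ofNat, List.length_replicate]
  rw [List.drop_eq_getElem_cons (by simp)]
  simp

theorem get (hF : Scale F) {L : ∀ i, List (α i)} {j : ∀ i, Fin (L i).length}
    (hL : Comp F enc fun i => encL (ea i) (L i)) (hj : Comp F enc fun i => ofNat (j i)) :
    Comp F enc fun i => ea i ((L i).get (j i)) :=
  nth hF (n := fun i => (L i).length) (f := fun i k => ea i ((L i).get k)) (j := j)
    (hL.congr fun i => by
      rw [encL]
      congr 1
      exact List.ext_getElem (by simp) fun j h _ => by simp) hj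

end Vectors

section Numbers

variable {a b : I → ℕ} {x y : I → ℤ}

theorem nat_add (hF : Scale F) (ha : Comp F enc fun i => ofNat (a i))
    (hb : Comp F enc fun i => ofNat (b i)) : Comp F enc fun i => ofNat (a i + b i) := by
  obtain ⟨g, hg, e⟩ := ha
  obtain ⟨g', hg', e'⟩ := hb
  exact ⟨_, Feasible.append hF hg hg', fun i => by
    rw [e, e']; simp [ofNat_eq]⟩

theorem nat_sub (hF : Scale F) (ha : Comp F enc fun i => ofNat (a i))
    (hb : Comp F enc fun i => ofNat (b i)) : Comp F enc fun i => ofNat (a i - b i) := by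
  obtain ⟨g, hg, e⟩ := ha
  obtain ⟨g', hg', e'⟩ := hb
  exact ⟨_, Feasible.drop hF hg hg', fun i => by
    rw [e, e']; simp [ofNat_eq]⟩

theorem nat_const (hF : Scale F) (c : ℕ) : Comp F enc fun _ => ofNat c := const hF _

theorem sum (hF : Scale F) {α : I → Type*} {ea : ∀ i, α i → Data} {L : ∀ i, List (α i)}
    {f : ∀ i, α i → ℕ} (hL : Comp F enc fun i => encL (ea i) (L i))
    (hf : Comp F (ext enc ea) fun p => ofNat (f p.1 p.2)) :
    Comp F enc fun i => ofNat ((L i).map (f i)).sum := by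
  have := flatMap hF (eb := fun _ (_ : Unit) => Data.nil)
    (f := fun i a => List.replicate (f i a) ()) hL (hf.congr fun p => by simp [encL, ofNat_eq])
  refine this.congr fun i => ?_
  induction L i with
  | nil => rfl
  | cons a l ih =>
    simp only [List.flatMap_cons, List.map_cons, List.sum_cons, encL, List.map_append,
      ofNat_eq, List.replicate_add, List.map_replicate] at ih ⊢
    have := congrArg toL ih
    simp only [toL_ofList] at this
    rw [this]

theorem nat_mul (hF : Scale F) (ha : Comp F enc fun i => ofNat (a i))
    (hb : Comp F enc fun i => ofNat (b i)) : Comp F enc fun i => ofNat (a i * b i) := by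
  have h1 : Comp F enc fun i => encL (fun _ : Unit => Data.nil) (List.replicate (a i) ()) :=
    ha.congr fun i => by simp [encL, ofNat_eq]
  refine (sum hF (ea := fun _ (_ : Unit) => Data.nil) (f := fun i _ => b i) h1
    (weaken hF hb)).congr fun i => by simp

theorem int_pos (hF : Scale F) (hx : Comp F enc fun i => ofInt (x i)) :
    Comp F enc fun i => ofNat (x i).toNat := by
  have h : Feasible F fun x : Data => if x.hd ≠ .nil then .nil else x.tl :=
    Feasible.ite hF (Feasible.hd hF) (Feasible.nil hF) (Feasible.tl hF)
  refine (app hF h hx).congr fun i => ?_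
  rcases x i with m | m <;> simp [ofInt, ofNat, Int.toNat]

theorem int_neg (hF : Scale F) (hx : Comp F enc fun i => ofInt (x i)) :
    Comp F enc fun i => ofNat (-x i).toNat := by
  have h : Feasible F fun x : Data => if x.hd ≠ .nil then .cons .nil x.tl else .nil :=
    Feasible.ite hF (Feasible.hd hF) (Feasible.cons hF (Feasible.nil hF) (Feasible.tl hF))
      (Feasible.nil hF)
  refine (app hF h hx).congr fun i => ?_
  rcases x i with m | m
  · simp [ofInt, ofNat]
  · have e : (-Int.negSucc m).toNat = m + 1 := by rw [Int.neg_negSucc]; rfl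
    rw [e]
    simp [ofInt, ofNat]

/-- At least one of the two truncated differences is zero, and the other one shows the sign. The
code of a negative number stores its absolute value minus one, hence the second tail. -/
theorem int_diff (hF : Scale F) (ha : Comp F enc fun i => ofNat (a i))
    (hb : Comp F enc fun i => ofNat (b i)) : Comp F enc fun i => ofInt ((a i : ℤ) - b i) := by
  have h : Feasible F fun x : Data => if x.tl ≠ .nil then .cons (.cons .nil .nil) x.tl.tl
      else .cons .nil x.hd :=
    Feasible.ite hF (Feasible.tl hF) (Feasible.cons hF (Feasible.const hF _)
      (Feasible.comp hF (Feasible.tl hF) (Feasible.tl hF)))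
      (Feasible.cons hF (Feasible.nil hF) (Feasible.hd hF))
  refine (app hF h (cons hF (nat_sub hF ha hb) (nat_sub hF hb ha))).congr fun i => ?_
  rcases le_or_gt (b i) (a i) with hle | hlt
  · obtain ⟨c, hc⟩ := Nat.exists_eq_add_of_le hle
    have e : (a i : ℤ) - b i = Int.ofNat c := by rw [hc]; push_cast; simp
    rw [e]
    simp [hc, ofNat, ofInt]
  · obtain ⟨c, hc⟩ := Nat.exists_eq_add_of_lt hlt
    have e : (a i : ℤ) - b i = Int.negSucc c := by
      rw [hc, Int.negSucc_eq]; push_cast; ring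
    have e2 : b i - a i = c + 1 := by omega
    rw [e]
    simp [e2, ofNat, ofInt]

theorem int_add (hF : Scale F) (hx : Comp F enc fun i => ofInt (x i))
    (hy : Comp F enc fun i => ofInt (y i)) : Comp F enc fun i => ofInt (x i + y i) :=
  (int_diff hF (nat_add hF (int_pos hF hx) (int_pos hF hy))
    (nat_add hF (int_neg hF hx) (int_neg hF hy))).congr fun i => by
      congr 1; push_cast; omega

theorem int_sub (hF : Scale F) (hx : Comp F enc fun i => ofInt (x i))
    (hy : Comp F enc fun i => ofInt (y i)) : Comp F enc fun i => ofInt (x i - y i) :=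
  (int_diff hF (nat_add hF (int_pos hF hx) (int_neg hF hy))
    (nat_add hF (int_neg hF hx) (int_pos hF hy))).congr fun i => by
      congr 1; push_cast; omega

theorem int_natAbs (hF : Scale F) (hx : Comp F enc fun i => ofInt (x i)) :
    Comp F enc fun i => ofNat (x i).natAbs :=
  (nat_add hF (int_pos hF hx) (int_neg hF hx)).congr fun i => by congr 1; omega

theorem enat_toNat (hF : Scale F) {z : I → ℕ∞} (hz : Comp F enc fun i => ofENat (z i)) :
    Comp F enc fun i => ofNat (z i).toNat :=
  (tl hF hz).congr fun i => by
    rcases z i with _ | m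
    · rfl
    · rfl

end Numbers

section Loops

variable {α β : I → Type*} {ea : ∀ i, α i → Data} {eb : ∀ i, β i → Data}

/-- List and initial value may be elementary, but the body has to be polynomial: iterating
exponential growth could leave the elementary bounds. This is why the basic operations are proved
for all scales. -/
theorem foldl {L : ∀ i, List (α i)} {b : ∀ i, β i} {f : ∀ i, β i → α i → β i}
    (hL : Comp tower enc fun i => encL (ea i) (L i)) (hb : Comp tower enc fun i => eb i (b i))
    (hf : Comp polyScale (ext (ext enc eb) fun p a => ea p.1 a)
      fun q => eb q.1.1 (f q.1.1 q.1.2 q.2)) :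
    Comp tower enc fun i => eb i ((L i).foldl (f i) (b i)) := by
  obtain ⟨g, hg, e⟩ := hf
  refine (app scale_tower (Feasible.fold_elementary hg) (cons scale_tower hL
    (cons scale_tower hb (self scale_tower)))).congr fun i => ?_
  have h1 : ∀ b a, g (.cons (ea i a) (.cons (eb i b) (enc i))) = eb i (f i b a) :=
    fun b a => e ⟨⟨i, b⟩, a⟩
  simp only [hd_cons, tl_cons, encL, toL_ofList, Feasible.foldVal]
  generalize b i = b
  induction L i generalizing b with
  | nil => rfl
  | cons a l ih => simp only [List.map_cons, List.foldl_cons, h1, ih]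

theorem iterate {N : I → ℕ} {b : ∀ i, β i} {f : ∀ i, β i → β i}
    (hN : Comp tower enc fun i => ofNat (N i)) (hb : Comp tower enc fun i => eb i (b i))
    (hf : Comp polyScale (ext enc eb) fun p => eb p.1 (f p.1 p.2)) :
    Comp tower enc fun i => eb i ((f i)^[N i] (b i)) := by
  have h1 : Comp tower enc fun i => encL (fun _ : Unit => Data.nil) (List.replicate (N i) ()) :=
    hN.congr fun i => by simp [encL, ofNat_eq]
  have h2 := foldl (ea := fun _ (_ : Unit) => Data.nil) (eb := eb) (f := fun i b _ => f i b) h1 hb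
    (weaken scale_poly hf)
  refine h2.congr fun i => congrArg _ ?_
  generalize b i = b
  induction N i generalizing b with
  | zero => rfl
  | succ n ih => simpa [List.replicate_succ] using ih (f i b)

end Loops
end Comp

namespace CompP

open Data

variable {F : ℕ → ℕ → ℕ} {I J : Type*} {enc : I → Data} {G H : I → Data} {p q : I → Prop}

theorem congr (hp : CompP F enc p) (h : ∀ i, p i ↔ q i) : CompP F enc q :=
  Comp.congr hp fun i => by rw [propext (h i)]

theorem ne_nil (hF : Scale F) (hG : Comp F enc G) : CompP F enc fun i => G i ≠ .nil :=
  (Comp.app hF (Feasible.ite hF (Feasible.id hF) (Feasible.const hF (.cons .nil .nil))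
    (Feasible.nil hF)) hG).congr fun i => by
    unfold truth; split <;> simp_all

theorem not (hF : Scale F) (hp : CompP F enc p) : CompP F enc fun i => ¬ p i := by
  classical
  exact (Comp.ite hF hp (Comp.const hF .nil) (Comp.const hF (.cons .nil .nil))).congr fun i => by
    unfold truth; split <;> simp [*]

theorem and (hF : Scale F) (hp : CompP F enc p) (hq : CompP F enc q) :
    CompP F enc fun i => p i ∧ q i := by
  classical
  exact (Comp.ite hF hp hq (Comp.const hF .nil)).congr fun i => by
    unfold truth; split <;> simp [*]

theorem imp (hF : Scale F) (hp : CompP F enc p) (hq : CompP F enc q) :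
    CompP F enc fun i => p i → q i :=
  (not hF (and hF hp (not hF hq))).congr fun i => by tauto

theorem eq (hF : Scale F) (hG : Comp F enc G) (hH : Comp F enc H) :
    CompP F enc fun i => G i = H i := by
  obtain ⟨g, hg, e⟩ := hG
  obtain ⟨h, hh, e'⟩ := hH
  exact ⟨_, Feasible.eq hF hg hh, fun i => by unfold truth; rw [e, e']⟩

theorem nonempty (hF : Scale F) {α : I → Type*} {ea : ∀ i, α i → Data} {L : ∀ i, List (α i)}
    (hL : Comp F enc fun i => encL (ea i) (L i)) : CompP F enc fun i => L i ≠ [] :=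
  (ne_nil hF hL).congr fun i => by simp [encL, ofList_eq_nil]

theorem mem (hF : Scale F) {α : I → Type*} {ea : ∀ i, α i → Data} {L : ∀ i, List (α i)}
    {a : ∀ i, α i} (hi : ∀ i, Function.Injective (ea i))
    (hL : Comp F enc fun i => encL (ea i) (L i)) (ha : Comp F enc fun i => ea i (a i)) :
    CompP F enc fun i => a i ∈ L i := by
  classical
  refine (nonempty hF (Comp.filter hF (p := fun i b => ea i b = ea i (a i)) hL
    (eq hF (Comp.var hF) (Comp.weaken hF ha)))).congr fun i => ?_
  simp only [ne_eq, List.filter_eq_nil_iff, decide_eq_true_eq, (hi i).eq_iff]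
  push Not
  exact ⟨fun ⟨b, hb, e⟩ => e ▸ hb, fun h => ⟨_, h, rfl⟩⟩

end CompP
end NestedVAS

namespace NestedVAS

/-! ## The decomposition -/

section Construction

open Classical

variable {d n k : ℕ}

/-- The effects of bounded derivations of a symbol, given those of the nonterminals. -/
def symBases (cc : Fin k → Context d) (T : Fin n → List (Update d)) :
    Symbol (Fin k) (Fin n) → List (Update d)
  | .terminal c => [(cc c).base]
  | .nonterminal A => T A

/-- Derivations that are higher by one. -/
noncomputable def baseStep (s : Shell d n k) (cc : Fin k → Context d)
    (T : Fin n → List (Update d)) (A : Fin n) : List (Update d) :=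
  s.prods.flatMap fun p => if p.1 = A then
    (symBases cc T p.2.1).flatMap fun x => (symBases cc T p.2.2).map fun y => x + y
  else []

/-- The effect of a derivation of the symbol. -/
noncomputable def symBase (s : Shell d n k) (cc : Fin k → Context d)
    (σ : Symbol (Fin k) (Fin n)) : Update d :=
  -- After n rounds every productive nonterminal has an entry (`iterate_baseStep_ne_nil`), so the
  -- default value does not matter.
  (symBases cc ((baseStep s cc)^[n] fun _ => []) σ).headD 0

/-- Generators of the lattice of the differences of effects of derivations of equal symbols. -/
noncomputable def gens (s : Shell d n k) (cc : Fin k → Context d) : List (Update d) :=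
  ((List.finRange k).flatMap fun c => (cc c).periods) ++
    s.prods.map fun p => symBase s cc p.2.1 + symBase s cc p.2.2 - symBase s cc (.nonterminal p.1)

/-- All sums of `x` and some of the generators or their inverses. -/
def box (x : Update d) (gs : List (Update d)) : List (Update d) :=
  gs.foldl (fun cur g => cur.flatMap fun y => [y, y + g, y - g]) [x]

/-- The value before the symbol of a counter that is tracked on the given side. -/
def src (pk : Bool × Fin d) (X : CGSym d n k) : ℕ∞ := if pk.1 then X.lab.inn pk.2 else X.lab.pre pk.2

/-- The value after the symbol. -/
def tgt (pk : Bool × Fin d) (X : CGSym d n k) : ℕ∞ := if pk.1 then X.lab.post pk.2 else X.lab.out pk.2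

/-- A bound on the coefficients that are needed to reach a given effect on a counter. -/
noncomputable def width (s : Shell d n k) (cc : Fin k → Context d) (pk : Bool × Fin d)
    (X : CGSym d n k) : ℕ :=
  1 + (src pk X).toNat + (tgt pk X).toNat + (symBase s cc X.lab.sym pk.2).natAbs +
    ((gens s cc).map fun g => (g pk.2).natAbs).sum + ((gens s cc).map fun g => (g pk.2).natAbs).sum

/-- The generators with multiplicities. -/
noncomputable def gensRep (s : Shell d n k) (cc : Fin k → Context d) (pk : Bool × Fin d)
    (X : CGSym d n k) : List (Update d) :=
  (List.replicate (width s cc pk X) ()).flatMap fun _ => gens s cc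

/-- The effect is as the markings of the symbol require. -/
def Keeps (pk : Bool × Fin d) (X : CGSym d n k) (c : ℤ) (e : Update d) : Prop :=
  src pk X ≠ ⊤ ∧ tgt pk X ≠ ⊤ → e pk.2 = c

/-- Contexts for the symbol as a child.  Their restrictions cover the effects of all derivations
that respect the markings of the symbol. -/
noncomputable def cosets (s : Shell d n k) (cc : Fin k → Context d) (pk : Bool × Fin d)
    (X : CGSym d n k) : List (Context d) :=
  -- The bases are the bounded elements of the coset with the prescribed entry at the chosen
  -- counter, the periods are the bounded lattice elements with entry zero there. If an end of the
  -- symbol is ω, the entry is unconstrained.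
  ((box (symBase s cc X.lab.sym) (gensRep s cc pk X)).filter fun e =>
    Keeps pk X ((tgt pk X).toNat - (src pk X).toNat) e).map fun v =>
      { unc := s.bd.left
        base := v
        periods := (box 0 (gensRep s cc pk X)).filter fun e => Keeps pk X 0 e
        cin := s.inOf cc X.lab.sym
        cout := s.outOf cc X.lab.sym }

/-- The counters, with a side on which they are tracked by the symbol but not by the NGVAS. -/
noncomputable def picks (s : Shell d n k) (W : CGSym d n k) : List (Bool × Fin d) :=
  (((List.finRange d).filter fun i => i ∈ s.bd.left ∧ W.lab.inn i ≠ ⊤).map fun i => (true, i)) ++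
    ((List.finRange d).filter fun i => i ∈ s.bd.left ∧ W.lab.out i ≠ ⊤).map fun i => (false, i)

/-- A binary production of a coverability grammar, with contexts for the right-hand side. -/
structure Rule (d n k : ℕ) where
  lhs : CGSym d n k
  fst : CGSym d n k
  cfst : Context d
  snd : CGSym d n k
  csnd : Context d

/-- The pairs among the lists. -/
def pairsOf {α : Type*} : List α → List (α × α)
  | [x, y] => [(x, y)]
  | _ => []

/-- The singletons among the lists. -/
def singlesOf {α : Type*} : List α → List α
  | [x] => [x]
  | _ => []

/-- The binary productions with all choices of contexts. -/
noncomputable def rules (s : Shell d n k) (cc : Fin k → Context d) (G : CovGrammar d n k) :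
    List (Rule d n k) :=
  -- Only the first of the possible counters is used. It depends only on the entries ω of the
  -- left-hand side, so that a whole component uses the same one.
  G.prods.flatMap fun q => (pairsOf q.2).flatMap fun z => ((picks s q.1).take 1).flatMap fun pk =>
    (cosets s cc pk z.1).flatMap fun c => (cosets s cc pk z.2).map fun c' => ⟨q.1, z.1, c, z.2, c'⟩

/-- The unary productions. -/
def singles (G : CovGrammar d n k) : List (CGSym d n k × CGSym d n k) :=
  G.prods.flatMap fun q => (singlesOf q.2).map fun X => (q.1, X)

/-- One step of the computation of the reachable symbols. -/
noncomputable def succs (R : List (Rule d n k)) (cur : List (CGSym d n k)) : List (CGSym d n k) :=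
  cur ++ R.flatMap fun q => if q.lhs ∈ cur then [q.fst, q.snd] else []

/-- The symbols reachable by rules. -/
noncomputable def reach (R : List (Rule d n k)) (W : CGSym d n k) : List (CGSym d n k) :=
  (succs R)^[R.length + R.length] [W]

/-- The strongly connected component. -/
noncomputable def component (R : List (Rule d n k)) (W : CGSym d n k) : List (CGSym d n k) :=
  (reach R W).filter fun V => W ∈ reach R V

/-- An NGVAS of positive nesting depth without context information. -/
structure Pre (d : ℕ) where
  n : ℕ
  k : ℕ
  child : Fin k → NGVAS d
  start : Fin n
  prods : List (Fin n × Symbol (Fin k) (Fin n) × Symbol (Fin k) (Fin n))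
  bd : Boundedness d n

/-- Adding the context information. -/
def Pre.shell (P : Pre d) (c : Context d) : Shell d P.n P.k := ⟨P.start, P.prods, c, P.bd⟩

/-- Adding the context information. -/
def Pre.fill (P : Pre d) (c : Context d) : NGVAS d := .node P.child (P.shell c)

/-- An NGVAS without runs that has the given context information up to periods. -/
def emptyLeaf (c : Context d) : NGVAS d := .leaf [c.base + 1] { c with periods := [] }

/-- An NGVAS with empty runs. -/
def epsLeaf (D : Finset (Fin d)) (x : OMarking d) : NGVAS d := .leaf [] ⟨D, 0, [], x, x⟩

/-- A child as the exit of a linear NGVAS with one nonterminal. -/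
def wrap (child : Fin k → NGVAS d) (s : Shell d n k) (c : Fin k) : Pre d where
  n := 1
  k := 2
  child := ![child c, epsLeaf s.bd.left (child c).ctx.cout]
  start := 0
  prods := [(0, .terminal 0, .terminal 1)]
  bd := ⟨s.bd.left, s.bd.left, fun _ => (child c).ctx.cin, fun _ => (child c).ctx.cout⟩

/-- The NGVAS for a terminal. -/
def wraps (child : Fin k → NGVAS d) (s : Shell d n k) : Symbol (Fin k) (Fin n) → List (Pre d)
  | .terminal c => [wrap child s c]
  | .nonterminal _ => []

/-- Tables with the NGVAS that have been constructed for the symbols. -/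
abbrev Table (d n k : ℕ) := List (CGSym d n k × List (Pre d))

/-- The entries for a symbol. -/
noncomputable def lookup (T : Table d n k) (X : CGSym d n k) : List (Pre d) :=
  T.flatMap fun e => if e.1 = X then e.2 else []

/-- The NGVAS that may be used for a symbol with given context information. -/
noncomputable def alts (child : Fin k → NGVAS d) (s : Shell d n k) (T : Table d n k)
    (X : CGSym d n k) (c : Context d) : List (NGVAS d) :=
  -- The member without runs guarantees that every rule yields productions, so that the constructed
  -- grammars are strongly connected and have exits even if nothing has been constructed for some
  -- symbol.
  emptyLeaf c :: (wraps child s X.lab.sym ++ lookup T X).map fun P => P.fill c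

/-- The positions of a symbol. -/
noncomputable def idxs (l : List (CGSym d n k)) (X : CGSym d n k) : List (Fin l.length) :=
  (List.finRange l.length).filter fun j => l.get j = X

/-- Productions with one nonterminal and one child on the right-hand side. -/
structure OneItem (d m : ℕ) where
  lhs : Fin m
  left : Bool
  other : Fin m
  kid : NGVAS d

/-- Productions with two nonterminals on the right-hand side. -/
structure TwoItem (m : ℕ) where
  lhs : Fin m
  fst : Fin m
  snd : Fin m

/-- Productions with two children on the right-hand side. -/
structure ExitItem (d m : ℕ) where
  lhs : Fin m
  fst : NGVAS d
  snd : NGVAS d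

/-- The persisting productions with one child within a component. -/
noncomputable def ones (child : Fin k → NGVAS d) (s : Shell d n k) (T : Table d n k)
    (R : List (Rule d n k)) (l : List (CGSym d n k)) : List (OneItem d l.length) :=
  R.flatMap fun q => (idxs l q.lhs).flatMap fun v =>
    ((idxs l q.snd).flatMap fun y => (alts child s T q.fst q.cfst).map fun a => ⟨v, true, y, a⟩) ++
    (idxs l q.fst).flatMap fun x => (alts child s T q.snd q.csnd).map fun a => ⟨v, false, x, a⟩

/-- The persisting productions with two nonterminals within a component. -/
noncomputable def twos (R : List (Rule d n k)) (l : List (CGSym d n k)) :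
    List (TwoItem l.length) :=
  R.flatMap fun q => (idxs l q.lhs).flatMap fun v => (idxs l q.fst).flatMap fun x =>
    (idxs l q.snd).map fun y => ⟨v, x, y⟩

/-- The exit productions of a component. -/
noncomputable def exits (child : Fin k → NGVAS d) (s : Shell d n k) (T : Table d n k)
    (R : List (Rule d n k)) (l : List (CGSym d n k)) : List (ExitItem d l.length) :=
  R.flatMap fun q => (idxs l q.lhs).flatMap fun v =>
    (alts child s T q.fst q.cfst).flatMap fun a => (alts child s T q.snd q.csnd).map fun b =>
      ⟨v, a, b⟩

/-- An NGVAS with the given productions. -/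
def assemble (s : Shell d n k) (cc : Fin k → Context d) (l : List (CGSym d n k))
    (O : List (OneItem d l.length)) (T : List (TwoItem l.length)) (E : List (ExitItem d l.length))
    (w : Fin l.length) : Pre d where
  n := l.length
  k := O.length + (E.length + E.length)
  child := Fin.append (fun j => (O.get j).kid)
    (Fin.append (fun j => (E.get j).fst) fun j => (E.get j).snd)
  start := w
  prods :=
    ((List.finRange O.length).map fun j => if (O.get j).left then
        ((O.get j).lhs, .terminal (Fin.castAdd _ j), .nonterminal (O.get j).other)
      else ((O.get j).lhs, .nonterminal (O.get j).other, .terminal (Fin.castAdd _ j))) ++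
    ((T.map fun t => (t.lhs, .nonterminal t.fst, .nonterminal t.snd)) ++
    (List.finRange E.length).map fun j => ((E.get j).lhs,
      .terminal (Fin.natAdd _ (Fin.castAdd _ j)), .terminal (Fin.natAdd _ (Fin.natAdd _ j))))
  bd := ⟨s.bd.left, s.bd.left, fun j => s.inOf cc (l.get j).lab.sym,
    fun j => s.outOf cc (l.get j).lab.sym⟩

/-- The selections of exit productions: all of them for branching components, single ones for
linear components. -/
noncomputable def exitChoices (child : Fin k → NGVAS d) (s : Shell d n k) (T : Table d n k)
    (R : List (Rule d n k)) (l : List (CGSym d n k)) : List (List (ExitItem d l.length)) :=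
  -- An NGVAS with linear grammar has exactly one exit production, so a linear component gives one
  -- NGVAS per exit. A derivation of a branching component may need several exits at once, so there
  -- they stay together.
  if twos R l ≠ [] then [exits child s T R l] else (exits child s T R l).map fun e => [e]

/-- The NGVAS for a component, with start symbol `W`. -/
noncomputable def nodes (child : Fin k → NGVAS d) (s : Shell d n k) (T : Table d n k)
    (R : List (Rule d n k)) (W : CGSym d n k) (l : List (CGSym d n k)) : List (Pre d) :=
  (exitChoices child s T R l).flatMap fun E => (idxs l W).map fun w =>
    assemble s (fun c => (child c).ctx) l (ones child s T R l) (twos R l) E w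

/-- The NGVAS for a symbol that can be constructed from those in the table. -/
noncomputable def build (child : Fin k → NGVAS d) (s : Shell d n k) (T : Table d n k)
    (R : List (Rule d n k)) (S : List (CGSym d n k × CGSym d n k)) (W : CGSym d n k)
    (l : List (CGSym d n k)) : List (Pre d) :=
  -- A unary production adds no level of nesting: an NGVAS for the accelerated symbol serves the
  -- original symbol, since the context information is filled in later.
  (S.flatMap fun q => if q.1 = W then lookup T q.2 else []) ++ nodes child s T R W l

/-- One round of the construction. -/
noncomputable def tableStep (child : Fin k → NGVAS d) (s : Shell d n k)
    (R : List (Rule d n k)) (S : List (CGSym d n k × CGSym d n k))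
    (C : List (CGSym d n k × List (CGSym d n k))) (T : Table d n k) : Table d n k :=
  C.map fun e => (e.1, build child s T R S e.1 e.2)

/-- The number of rounds. -/
def rounds (d r : ℕ) : ℕ := (d + d + 1) * (r + r + 2)

/-- The symbols with their components. -/
noncomputable def plan (s : Shell d n k) (cc : Fin k → Context d) (G : CovGrammar d n k) :
    List (CGSym d n k × List (CGSym d n k)) :=
  G.nonterms.map fun W => (W, component (rules s cc G) W)

/-- The tables of the construction. -/
noncomputable def tableAt (child : Fin k → NGVAS d) (s : Shell d n k) (G : CovGrammar d n k)
    (r : ℕ) : Table d n k :=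
  (tableStep child s (rules s (fun c => (child c).ctx) G) (singles G)
    (plan s (fun c => (child c).ctx) G))^[r] []

/-- The decomposition of a variant. -/
noncomputable def decomposition (child : Fin k → NGVAS d) (s : Shell d n k) (μ ν : OMarking d)
    (G : CovGrammar d n k) : List (NGVAS d) :=
  (singles G).flatMap fun q => if q.1 = G.start then
    (lookup (tableAt child s G (rounds d (rules s (fun c => (child c).ctx) G).length)) q.2).map
      fun P => P.fill (variantCtx μ ν)
  else []

end Construction
end NestedVAS

namespace NestedVAS

/-! ## Feasibility of the decomposition: basic operations -/

namespace Data

theorem ofNat_injective : Function.Injective ofNat := fun a b h => by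
  simpa [ofNat_eq] using congrArg (fun x => x.toL.length) h

theorem ofList_injective : Function.Injective ofList :=
  Function.LeftInverse.injective toL_ofList

theorem ofENat_injective : Function.Injective ofENat := by
  rintro (_ | a) (_ | b) h
  · rfl
  · exact absurd h.symm (cons_ne_nil _ _)
  · exact absurd h (cons_ne_nil _ _)
  · exact congrArg some (ofNat_injective (congrArg tl h))

theorem ofENat_eq_nil {x : ℕ∞} : ofENat x = nil ↔ x = ⊤ := by
  rcases x with _ | a
  · exact ⟨fun _ => rfl, fun _ => rfl⟩
  · exact ⟨fun h => absurd h (cons_ne_nil _ _), fun h => absurd h (ENat.natCast_ne_top a)⟩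

theorem ofOMarking_injective {d : ℕ} : Function.Injective (ofOMarking (d := d)) := fun a b h => by
  have h1 := ofList_injective h
  rw [List.ofFn_inj] at h1
  exact funext fun i => ofENat_injective (congrFun h1 i)

theorem ofSymbol_injective {n k : ℕ} : Function.Injective (ofSymbol (n := n) (k := k)) := by
  rintro (a | a) (b | b) h
  · exact congrArg _ (Fin.val_injective (ofNat_injective (congrArg tl h)))
  · exact absurd (congrArg hd h).symm (cons_ne_nil _ _)
  · exact absurd (congrArg hd h) (cons_ne_nil _ _)
  · exact congrArg _ (Fin.val_injective (ofNat_injective (congrArg tl h)))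

theorem ofCGSym_injective {d n k : ℕ} : Function.Injective (ofCGSym (d := d) (n := n) (k := k)) := by
  rintro ⟨⟨a1, a2, a3, a4, a5⟩, a6⟩ ⟨⟨b1, b2, b3, b4, b5⟩, b6⟩ h
  have h := ofList_injective h
  simp only [List.cons.injEq, and_true] at h
  obtain ⟨h1, h2, h3, h4, h5, h6⟩ := h
  rw [ofOMarking_injective h1, ofOMarking_injective h2, ofSymbol_injective h3,
    ofOMarking_injective h4, ofOMarking_injective h5, ofNat_injective h6]

/-- An element of a list. -/
def item (j : ℕ) (x : Data) : Data := (tl^[j] x).hd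

end Data

namespace Comp

open Data

variable {F : ℕ → ℕ → ℕ} {I : Type*} {enc : I → Data} {G H : I → Data}

theorem item (hF : Scale F) (j : ℕ) (hG : Comp F enc G) : Comp F enc fun i => (G i).item j := by
  have : Comp F enc fun i => Data.tl^[j] (G i) := by
    induction j with
    | zero => exact hG
    | succ j ih => exact (tl hF ih).congr fun i => (Function.iterate_succ_apply' _ _ _).symm
  exact hd hF this

theorem symCases (hF : Scale F) {n k : I → ℕ} {σ : ∀ i, Symbol (Fin (k i)) (Fin (n i))}
    {f : ∀ i, Fin (k i) → Data} {g : ∀ i, Fin (n i) → Data}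
    (hσ : Comp F enc fun i => ofSymbol (σ i))
    (hf : Comp F (ext enc fun i (c : Fin (k i)) => ofNat c) fun p => f p.1 p.2)
    (hg : Comp F (ext enc fun i (c : Fin (n i)) => ofNat c) fun p => g p.1 p.2) :
    Comp F enc fun i => match σ i with
      | .terminal c => f i c
      | .nonterminal A => g i A := by
  obtain ⟨f', hf', ef⟩ := hf
  obtain ⟨g', hg', eg⟩ := hg
  have h : Feasible F fun x : Data => if x.hd.hd ≠ .nil then g' (.cons x.hd.tl x.tl)
      else f' (.cons x.hd.tl x.tl) := by
    have h1 := Feasible.cons hF (Feasible.comp hF (Feasible.tl hF) (Feasible.hd hF))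
      (Feasible.tl hF)
    exact Feasible.ite hF (Feasible.comp hF (Feasible.hd hF) (Feasible.hd hF))
      (Feasible.comp hF hg' h1) (Feasible.comp hF hf' h1)
  refine (app hF h (cons hF hσ (self hF))).congr fun i => ?_
  rcases hs : σ i with c | A
  · simpa [ofSymbol, ext] using ef ⟨i, c⟩
  · simpa [ofSymbol, ext] using eg ⟨i, A⟩

section Updates

variable {d : I → ℕ} {u v : ∀ i, Update (d i)}

theorem upd_apply (hF : Scale F) {j : ∀ i, Fin (d i)} (hu : Comp F enc fun i => ofUpdate (u i))
    (hj : Comp F enc fun i => ofNat (j i)) : Comp F enc fun i => ofInt (u i (j i)) :=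
  nth hF (f := fun i k => ofInt (u i k)) hu hj

theorem upd_add (hF : Scale F) (hd : Comp F enc fun i => ofNat (d i))
    (hu : Comp F enc fun i => ofUpdate (u i)) (hv : Comp F enc fun i => ofUpdate (v i)) :
    Comp F enc fun i => ofUpdate (u i + v i) :=
  ofFn hF (f := fun i k => ofInt (u i k + v i k)) hd
    (int_add hF (upd_apply hF (u := fun p : (Σ i, Fin (d i)) => u p.1) (j := fun p => p.2) (weaken hF hu) (var hF))
      (upd_apply hF (u := fun p : (Σ i, Fin (d i)) => v p.1) (j := fun p => p.2) (weaken hF hv) (var hF)))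

theorem upd_sub (hF : Scale F) (hd : Comp F enc fun i => ofNat (d i))
    (hu : Comp F enc fun i => ofUpdate (u i)) (hv : Comp F enc fun i => ofUpdate (v i)) :
    Comp F enc fun i => ofUpdate (u i - v i) :=
  ofFn hF (f := fun i k => ofInt (u i k - v i k)) hd
    (int_sub hF (upd_apply hF (u := fun p : (Σ i, Fin (d i)) => u p.1) (j := fun p => p.2) (weaken hF hu) (var hF))
      (upd_apply hF (u := fun p : (Σ i, Fin (d i)) => v p.1) (j := fun p => p.2) (weaken hF hv) (var hF)))

theorem upd_zero (hF : Scale F) (hd : Comp F enc fun i => ofNat (d i)) :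
    Comp F enc fun i => ofUpdate (0 : Update (d i)) :=
  ofFn hF (f := fun _ _ => ofInt 0) hd (const hF _)

theorem upd_one (hF : Scale F) (hd : Comp F enc fun i => ofNat (d i)) :
    Comp F enc fun i => ofUpdate (1 : Update (d i)) :=
  ofFn hF (f := fun _ _ => ofInt 1) hd (const hF _)

theorem omark_apply (hF : Scale F) {μ : ∀ i, OMarking (d i)} {j : ∀ i, Fin (d i)}
    (hu : Comp F enc fun i => ofOMarking (μ i))
    (hj : Comp F enc fun i => ofNat (j i)) : Comp F enc fun i => ofENat (μ i (j i)) :=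
  nth hF (f := fun i k => ofENat (μ i k)) hu hj

end Updates
end Comp

namespace CompP

open Data

variable {F : ℕ → ℕ → ℕ} {I : Type*} {enc : I → Data}

theorem ne_top (hF : Scale F) {x : I → ℕ∞} (hx : Comp F enc fun i => ofENat (x i)) :
    CompP F enc fun i => x i ≠ ⊤ :=
  (ne_nil hF hx).congr fun _ => ofENat_eq_nil.not

theorem mem_counters (hF : Scale F) {d : I → ℕ} {s : ∀ i, Finset (Fin (d i))} {j : ∀ i, Fin (d i)}
    (hs : Comp F enc fun i => ofCounters (s i)) (hj : Comp F enc fun i => ofNat (j i)) :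
    CompP F enc fun i => j i ∈ s i :=
  (ne_nil hF (Comp.nth hF (f := fun i k => if k ∈ s i then Data.cons .nil .nil else .nil)
    hs hj)).congr fun i => by split <;> simp [*]

theorem fin_eq (hF : Scale F) {n : I → ℕ} {a b : ∀ i, Fin (n i)}
    (ha : Comp F enc fun i => ofNat (a i)) (hb : Comp F enc fun i => ofNat (b i)) :
    CompP F enc fun i => a i = b i :=
  (eq hF ha hb).congr fun _ => ofNat_injective.eq_iff.trans Fin.val_injective.eq_iff

theorem cgsym_eq (hF : Scale F) {d n k : I → ℕ} {X Y : ∀ i, CGSym (d i) (n i) (k i)}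
    (hX : Comp F enc fun i => ofCGSym (X i)) (hY : Comp F enc fun i => ofCGSym (Y i)) :
    CompP F enc fun i => X i = Y i :=
  (eq hF hX hY).congr fun _ => ofCGSym_injective.eq_iff

end CompP

/-- The data of an NGVAS of positive nesting depth. -/
structure Gr where
  d : ℕ
  n : ℕ
  k : ℕ
  child : Fin k → NGVAS d
  s : Shell d n k

/-- The contexts of the children. -/
abbrev Gr.cc (γ : Gr) (c : Fin γ.k) : Context γ.d := (γ.child c).ctx

/-- Codes of NGVAS with their dimensions. -/
def encGr (γ : Gr) : Data := .cons (.ofNat γ.d) (.ofNGVAS (.node γ.child γ.s))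

/-- Codes of productions. -/
def encProd {n k : ℕ} (p : Fin n × Symbol (Fin k) (Fin n) × Symbol (Fin k) (Fin n)) : Data :=
  .ofList [.ofNat p.1, .ofSymbol p.2.1, .ofSymbol p.2.2]

section Accessors

open Data

variable {F : ℕ → ℕ → ℕ} {I : Type*} {enc : I → Data} {γ : I → Gr}

theorem comp_d (hF : Scale F) (h : Comp F enc fun i => encGr (γ i)) :
    Comp F enc fun i => ofNat (γ i).d := Comp.hd hF h

theorem comp_ngvas (hF : Scale F) (h : Comp F enc fun i => encGr (γ i)) :
    Comp F enc fun i => ofNGVAS (.node (γ i).child (γ i).s) := Comp.tl hF h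

theorem comp_children (hF : Scale F) (h : Comp F enc fun i => encGr (γ i)) :
    Comp F enc fun i => ofList (List.ofFn fun c => ofNGVAS ((γ i).child c)) :=
  (Comp.hd hF (Comp.tl hF (comp_ngvas hF h))).congr fun i => by rw [ofNGVAS]; rfl

theorem comp_shell (hF : Scale F) (h : Comp F enc fun i => encGr (γ i)) :
    Comp F enc fun i => ofShell (γ i).s :=
  (Comp.hd hF (Comp.tl hF (Comp.tl hF (comp_ngvas hF h)))).congr fun i => by rw [ofNGVAS]; rfl

theorem comp_n (hF : Scale F) (h : Comp F enc fun i => encGr (γ i)) :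
    Comp F enc fun i => ofNat (γ i).n := Comp.item hF 0 (comp_shell hF h)

theorem comp_k (hF : Scale F) (h : Comp F enc fun i => encGr (γ i)) :
    Comp F enc fun i => ofNat (γ i).k := Comp.item hF 1 (comp_shell hF h)

theorem comp_prods (hF : Scale F) (h : Comp F enc fun i => encGr (γ i)) :
    Comp F enc fun i => encL encProd (γ i).s.prods := Comp.item hF 3 (comp_shell hF h)

theorem comp_left (hF : Scale F) (h : Comp F enc fun i => encGr (γ i)) :
    Comp F enc fun i => ofCounters (γ i).s.bd.left := Comp.item hF 5 (comp_shell hF h)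

theorem comp_inn (hF : Scale F) (h : Comp F enc fun i => encGr (γ i)) :
    Comp F enc fun i => ofList (List.ofFn fun A => ofOMarking ((γ i).s.bd.inn A)) :=
  Comp.item hF 7 (comp_shell hF h)

theorem comp_out (hF : Scale F) (h : Comp F enc fun i => encGr (γ i)) :
    Comp F enc fun i => ofList (List.ofFn fun A => ofOMarking ((γ i).s.bd.out A)) :=
  Comp.item hF 8 (comp_shell hF h)

theorem comp_ctx (hF : Scale F) {d : I → ℕ} {N : ∀ i, NGVAS (d i)}
    (h : Comp F enc fun i => ofNGVAS (N i)) : Comp F enc fun i => ofContext (N i).ctx := by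
  classical
  refine (Comp.ite hF (CompP.ne_nil hF (Comp.hd hF h))
    (Comp.item hF 4 (Comp.item hF 1 (Comp.tl hF h))) (Comp.item hF 1 (Comp.tl hF h))).congr
    fun i => ?_
  cases N i with
  | leaf w c => rw [ofNGVAS, if_neg (by simp)]; rfl
  | node child s => rw [ofNGVAS, if_pos (by simp)]; rfl

theorem comp_cc (hF : Scale F) (h : Comp F enc fun i => encGr (γ i))
    {c : ∀ i, Fin (γ i).k} (hc : Comp F enc fun i => ofNat (c i)) :
    Comp F enc fun i => ofContext ((γ i).cc (c i)) :=
  comp_ctx hF (Comp.nth hF (f := fun i c => ofNGVAS ((γ i).child c)) (comp_children hF h) hc)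

theorem comp_inOf (hF : Scale F) (h : Comp F enc fun i => encGr (γ i))
    {σ : ∀ i, Symbol (Fin (γ i).k) (Fin (γ i).n)} (hσ : Comp F enc fun i => ofSymbol (σ i)) :
    Comp F enc fun i => ofOMarking ((γ i).s.inOf (γ i).cc (σ i)) := by
  refine (Comp.symCases hF (f := fun i c => ofOMarking ((γ i).cc c).cin)
    (g := fun i A => ofOMarking ((γ i).s.bd.inn A)) hσ
    (Comp.item hF 3 (comp_cc hF (γ := fun p : (Σ i, Fin (γ i).k) => γ p.1) (c := fun p => p.2) (Comp.weaken hF h)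
      (Comp.var hF)))
    (Comp.nth hF (f := fun (p : Σ i, Fin (γ i).n) A => ofOMarking ((γ p.1).s.bd.inn A))
      (j := fun p => p.2) (Comp.weaken hF (comp_inn hF h)) (Comp.var hF))).congr fun i => ?_
  cases σ i <;> rfl

theorem comp_outOf (hF : Scale F) (h : Comp F enc fun i => encGr (γ i))
    {σ : ∀ i, Symbol (Fin (γ i).k) (Fin (γ i).n)} (hσ : Comp F enc fun i => ofSymbol (σ i)) :
    Comp F enc fun i => ofOMarking ((γ i).s.outOf (γ i).cc (σ i)) := by
  refine (Comp.symCases hF (f := fun i c => ofOMarking ((γ i).cc c).cout)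
    (g := fun i A => ofOMarking ((γ i).s.bd.out A)) hσ
    (Comp.item hF 4 (comp_cc hF (γ := fun p : (Σ i, Fin (γ i).k) => γ p.1) (c := fun p => p.2) (Comp.weaken hF h)
      (Comp.var hF)))
    (Comp.nth hF (f := fun (p : Σ i, Fin (γ i).n) A => ofOMarking ((γ p.1).s.bd.out A))
      (j := fun p => p.2) (Comp.weaken hF (comp_out hF h)) (Comp.var hF))).congr fun i => ?_
  cases σ i <;> rfl

end Accessors
end NestedVAS

namespace NestedVAS

/-! ## Feasibility of the decomposition: effects -/

section Effects

open Data

variable {F : ℕ → ℕ → ℕ} {I : Type*} {enc : I → Data} {γ : I → Gr}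

/-- Codes of tables of effects. -/
def encT {d n : ℕ} (T : Fin n → List (Update d)) : Data :=
  ofList (List.ofFn fun A => encL ofUpdate (T A))

theorem comp_symBases (hF : Scale F) (h : Comp F enc fun i => encGr (γ i))
    {T : ∀ i, Fin (γ i).n → List (Update (γ i).d)} {σ : ∀ i, Symbol (Fin (γ i).k) (Fin (γ i).n)}
    (hT : Comp F enc fun i => encT (T i)) (hσ : Comp F enc fun i => ofSymbol (σ i)) :
    Comp F enc fun i => encL ofUpdate (symBases (γ i).cc (T i) (σ i)) := by
  refine (Comp.symCases hF (f := fun i c => encL ofUpdate [((γ i).cc c).base])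
    (g := fun i A => encL ofUpdate (T i A)) hσ
    (Comp.singleton hF (ea := fun p : (Σ i, Fin (γ i).k) => ofUpdate (d := (γ p.1).d))
      (a := fun p => ((γ p.1).cc p.2).base)
      (Comp.item hF 1 (comp_cc hF (γ := fun p : (Σ i, Fin (γ i).k) => γ p.1) (c := fun p => p.2)
        (Comp.weaken hF h) (Comp.var hF))))
    (Comp.nth hF (f := fun (p : Σ i, Fin (γ i).n) A => encL ofUpdate (T p.1 A))
      (j := fun p => p.2) (Comp.weaken hF hT) (Comp.var hF))).congr fun i => ?_
  cases σ i <;> rfl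

theorem comp_baseStep (hF : Scale F) (h : Comp F enc fun i => encGr (γ i))
    {T : ∀ i, Fin (γ i).n → List (Update (γ i).d)} (hT : Comp F enc fun i => encT (T i)) :
    Comp F enc fun i => encT (baseStep (γ i).s (γ i).cc (T i)) := by
  classical
  refine Comp.ofFn hF (f := fun i A => encL ofUpdate (baseStep (γ i).s (γ i).cc (T i) A))
    (comp_n hF h) ?_
  have h1 := Comp.weaken hF (ea := fun i (A : Fin (γ i).n) => ofNat A) h
  have hT1 := Comp.weaken hF (ea := fun i (A : Fin (γ i).n) => ofNat A) hT
  refine Comp.flatMap hF (ea := fun p : (Σ i, Fin (γ i).n) => encProd (n := (γ p.1).n)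
    (k := (γ p.1).k)) (eb := fun p => ofUpdate (d := (γ p.1).d)) (comp_prods hF h1) ?_
  have h2 := Comp.weaken hF (ea := fun p : (Σ i, Fin (γ i).n) => encProd (n := (γ p.1).n)
    (k := (γ p.1).k)) h1
  have hT2 := Comp.weaken hF (ea := fun p : (Σ i, Fin (γ i).n) => encProd (n := (γ p.1).n)
    (k := (γ p.1).k)) hT1
  have hv := Comp.var (enc := ext enc fun i (A : Fin (γ i).n) => ofNat A) hF
    (ea := fun p : (Σ i, Fin (γ i).n) => encProd (n := (γ p.1).n) (k := (γ p.1).k))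
  refine Comp.apply_ite' hF (CompP.fin_eq hF (Comp.item hF 0 hv) (Comp.weaken hF (Comp.var hF)))
    ?_ (Comp.nilL hF)
  refine Comp.flatMap hF (comp_symBases hF h2 hT2 (Comp.item hF 1 hv)) ?_
  refine Comp.map hF (Comp.weaken hF (comp_symBases hF h2 hT2 (Comp.item hF 2 hv))) ?_
  exact Comp.upd_add hF (Comp.weaken hF (Comp.weaken hF (comp_d hF h2)))
    (Comp.weaken hF (Comp.var hF)) (Comp.var hF)

/-- One round is polynomial in the grammar and the current table, so n rounds are elementary. -/
theorem comp_baseTable : Comp tower encGr fun γ : Gr =>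
    encT ((baseStep γ.s γ.cc)^[γ.n] fun _ => []) := by
  have h0 : ∀ {F}, Scale F → Comp F encGr fun γ : Gr => encGr γ := fun hF => Comp.self hF
  refine Comp.iterate (eb := fun γ : Gr => encT (d := γ.d) (n := γ.n))
    (f := fun γ => baseStep γ.s γ.cc) (comp_n scale_tower (h0 scale_tower)) ?_ ?_
  · exact Comp.ofFn scale_tower (f := fun _ _ => .nil) (comp_n scale_tower (h0 scale_tower))
      (Comp.const scale_tower .nil)
  · exact comp_baseStep scale_poly (γ := fun p : (Σ γ : Gr, (Fin γ.n → List (Update γ.d))) => p.1)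
      (T := fun p => p.2) (Comp.weaken scale_poly (h0 scale_poly)) (Comp.var scale_poly)

variable (h : Comp tower enc fun i => encGr (γ i))
include h

theorem comp_symBase {σ : ∀ i, Symbol (Fin (γ i).k) (Fin (γ i).n)}
    (hσ : Comp tower enc fun i => ofSymbol (σ i)) :
    Comp tower enc fun i => ofUpdate (symBase (γ i).s (γ i).cc (σ i)) :=
  Comp.headD scale_tower (comp_symBases scale_tower h
    (T := fun i => (baseStep (γ i).s (γ i).cc)^[(γ i).n] fun _ => [])
    (Comp.subst (φ := γ) scale_tower comp_baseTable h) hσ) (Comp.upd_zero scale_tower (comp_d scale_tower h))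

theorem comp_gens : Comp tower enc fun i => encL ofUpdate (gens (γ i).s (γ i).cc) := by
  have hF := scale_tower
  refine Comp.append hF (Comp.flatMap hF (ea := fun i (c : Fin (γ i).k) => ofNat c)
    (Comp.finRange hF (comp_k hF h)) ?_) (Comp.map hF (ea := fun i => encProd (n := (γ i).n)
      (k := (γ i).k)) (comp_prods hF h) ?_)
  · exact Comp.item hF 2 (comp_cc hF (γ := fun p : (Σ i, Fin (γ i).k) => γ p.1)
      (c := fun p => p.2) (Comp.weaken hF h) (Comp.var hF))
  · have h2 := Comp.weaken hF (ea := fun i => encProd (n := (γ i).n) (k := (γ i).k)) h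
    have hv := Comp.var (enc := enc) hF (ea := fun i => encProd (n := (γ i).n) (k := (γ i).k))
    have hd := comp_d hF h2
    refine Comp.upd_sub hF hd (Comp.upd_add hF hd (comp_symBase h2 (Comp.item hF 1 hv))
      (comp_symBase h2 (Comp.item hF 2 hv))) (comp_symBase h2 ?_)
    exact Comp.cons hF (Comp.const hF (.cons .nil .nil)) (Comp.item hF 0 hv)

-- The body of the loop is polynomial relative to the dimension, which is unavailable in a context
-- that provides the dimension only with an elementary bound. The auxiliary context `J` consists of
-- just the data of the loop.
omit h in
theorem comp_box {d : I → ℕ} {x : ∀ i, Update (d i)} {gs : ∀ i, List (Update (d i))}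
    (hd : Comp tower enc fun i => ofNat (d i)) (hx : Comp tower enc fun i => ofUpdate (x i))
    (hg : Comp tower enc fun i => encL ofUpdate (gs i)) :
    Comp tower enc fun i => encL ofUpdate (box (x i) (gs i)) := by
  let J := Σ d : ℕ, Update d × List (Update d)
  let encJ : J → Data := fun j => .cons (ofNat j.1) (.cons (ofUpdate j.2.1) (encL ofUpdate j.2.2))
  have key : Comp tower encJ fun j => encL ofUpdate (box j.2.1 j.2.2) := by
    refine Comp.foldl (enc := encJ) (ea := fun j => ofUpdate (d := j.1))
      (eb := fun j => encL (ofUpdate (d := j.1))) (L := fun j => j.2.2) (b := fun j => [j.2.1])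
      (f := fun j cur g => cur.flatMap fun y => [y, y + g, y - g])
      (Comp.tl scale_tower (Comp.tl scale_tower (Comp.self scale_tower)))
      (Comp.singleton scale_tower (Comp.hd scale_tower (Comp.tl scale_tower
        (Comp.self scale_tower)))) ?_
    have hF := scale_poly
    have hd : Comp polyScale encJ fun j => ofNat j.1 := Comp.hd hF (Comp.self hF)
    refine Comp.flatMap hF (ea := fun p : (Σ _ : (Σ j : J, List (Update j.1)), Update _) =>
      ofUpdate (d := p.1.1.1)) (eb := fun p => ofUpdate (d := p.1.1.1))
      (L := fun p => p.1.2) (f := fun p y => [y, y + p.2, y - p.2])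
      (Comp.weaken hF (Comp.var hF)) ?_
    have hd3 := Comp.weaken hF (ea := fun p : (Σ _ : (Σ j : J, List (Update j.1)), Update _) =>
      ofUpdate (d := p.1.1.1)) (Comp.weaken hF (ea := fun p : (Σ j : J, List (Update j.1)) =>
        ofUpdate (d := p.1.1)) (Comp.weaken hF (ea := fun j => encL (ofUpdate (d := j.1))) hd))
    have hy := Comp.var (enc := ext (ext encJ fun j => encL (ofUpdate (d := j.1)))
      fun p => ofUpdate (d := p.1.1)) hF (ea := fun p => ofUpdate (d := p.1.1.1))
    have hg := Comp.weaken hF (ea := fun p : (Σ _ : (Σ j : J, List (Update j.1)), Update _) =>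
      ofUpdate (d := p.1.1.1)) (Comp.var (enc := ext encJ fun j => encL (ofUpdate (d := j.1))) hF
        (ea := fun p => ofUpdate (d := p.1.1)))
    exact Comp.cons hF hy (Comp.cons hF (Comp.upd_add hF hd3 hy hg)
      (Comp.cons hF (Comp.upd_sub hF hd3 hy hg) (Comp.const hF .nil)))
  exact Comp.subst scale_tower (φ := fun i => (⟨d i, x i, gs i⟩ : J)) key
    (Comp.cons scale_tower hd (Comp.cons scale_tower hx hg))

/-- Codes of tracked counters. -/
noncomputable def encPick {d : ℕ} (pk : Bool × Fin d) : Data :=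
  .cons (truth (pk.1 = true)) (ofNat pk.2)

section Cosets

variable {pk : ∀ i, Bool × Fin (γ i).d} {X : ∀ i, CGSym (γ i).d (γ i).n (γ i).k}
  (hp : Comp tower enc fun i => encPick (pk i)) (hX : Comp tower enc fun i => ofCGSym (X i))
include hp hX

omit h in
theorem comp_src : Comp tower enc fun i => ofENat (src (pk i) (X i)) := by
  have hF := scale_tower
  refine (Comp.apply_ite' hF (ea := fun _ => ofENat) (p := fun i => (pk i).1 = true)
    (a := fun i => (X i).lab.inn (pk i).2) (b := fun i => (X i).lab.pre (pk i).2)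
    (Comp.hd hF hp) (Comp.omark_apply hF (Comp.item hF 0 hX) (Comp.tl hF hp))
    (Comp.omark_apply hF (Comp.item hF 3 hX) (Comp.tl hF hp)))

omit h in
theorem comp_tgt : Comp tower enc fun i => ofENat (tgt (pk i) (X i)) := by
  have hF := scale_tower
  refine (Comp.apply_ite' hF (ea := fun _ => ofENat) (p := fun i => (pk i).1 = true)
    (a := fun i => (X i).lab.post (pk i).2) (b := fun i => (X i).lab.out (pk i).2)
    (Comp.hd hF hp) (Comp.omark_apply hF (Comp.item hF 1 hX) (Comp.tl hF hp))
    (Comp.omark_apply hF (Comp.item hF 4 hX) (Comp.tl hF hp)))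

theorem comp_width : Comp tower enc fun i => ofNat (width (γ i).s (γ i).cc (pk i) (X i)) := by
  have hF := scale_tower
  have hs : Comp tower enc fun i =>
      ofNat ((gens (γ i).s (γ i).cc).map fun g => (g (pk i).2).natAbs).sum :=
    Comp.sum hF (ea := fun i => ofUpdate (d := (γ i).d)) (comp_gens h) (Comp.int_natAbs hF
      (Comp.upd_apply hF (d := fun p : (Σ i, Update (γ i).d) => (γ p.1).d) (u := fun p => p.2)
        (j := fun p => (pk p.1).2) (Comp.var hF) (Comp.weaken hF (Comp.tl hF hp))))
  refine Comp.nat_add hF (Comp.nat_add hF (Comp.nat_add hF (Comp.nat_add hF (Comp.nat_add hF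
    (Comp.nat_const hF 1) (Comp.enat_toNat hF (comp_src hp hX))) (Comp.enat_toNat hF
    (comp_tgt hp hX))) (Comp.int_natAbs hF (Comp.upd_apply hF (u := fun i => symBase (γ i).s
      (γ i).cc (X i).lab.sym) (j := fun i => (pk i).2) (comp_symBase h (Comp.item hF 2 hX))
      (Comp.tl hF hp)))) hs) hs

theorem comp_gensRep :
    Comp tower enc fun i => encL ofUpdate (gensRep (γ i).s (γ i).cc (pk i) (X i)) := by
  have hF := scale_tower
  refine Comp.flatMap hF (ea := fun _ (_ : Unit) => Data.nil) ?_ (Comp.weaken hF (comp_gens h))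
  exact (comp_width h hp hX).congr fun i => by simp [encL, ofNat_eq]

omit h in
theorem comp_keeps {c : I → ℤ} {e : ∀ i, Update (γ i).d} (hc : Comp tower enc fun i => ofInt (c i))
    (he : Comp tower enc fun i => ofUpdate (e i)) :
    CompP tower enc fun i => Keeps (pk i) (X i) (c i) (e i) := by
  have hF := scale_tower
  have hinj : Function.Injective ofInt := by
    rintro (a | a) (b | b) h
    · exact congrArg _ (ofNat_injective (congrArg tl h))
    · exact absurd (congrArg hd h).symm (cons_ne_nil _ _)
    · exact absurd (congrArg hd h) (cons_ne_nil _ _)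
    · exact congrArg _ (ofNat_injective (congrArg tl h))
  refine CompP.imp hF (CompP.and hF (CompP.ne_top hF (comp_src hp hX))
    (CompP.ne_top hF (comp_tgt hp hX))) ((CompP.eq hF (Comp.upd_apply hF (u := e)
      (j := fun i => (pk i).2) he (Comp.tl hF hp)) hc).congr fun i => hinj.eq_iff)

theorem comp_cosets :
    Comp tower enc fun i => encL ofContext (cosets (γ i).s (γ i).cc (pk i) (X i)) := by
  classical
  have hF := scale_tower
  have hsym := Comp.item hF 2 hX
  have w : ∀ {G : I → Data}, Comp tower enc G →
    Comp tower (ext enc fun i => ofUpdate (d := (γ i).d)) fun p => G p.1 :=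
    fun hG => Comp.weaken hF hG
  have hv : Comp tower (ext enc fun i => ofUpdate (d := (γ i).d)) fun p => ofUpdate p.2 :=
    Comp.var hF
  have hper : Comp tower enc fun i => encL ofUpdate ((box 0 (gensRep (γ i).s (γ i).cc (pk i)
      (X i))).filter fun e => Keeps (pk i) (X i) 0 e) :=
    Comp.filter hF (comp_box (comp_d hF h) (Comp.upd_zero hF (comp_d hF h))
      (comp_gensRep h hp hX)) (comp_keeps (γ := fun p : (Σ i, Update (γ i).d) => γ p.1)
      (pk := fun p => pk p.1) (X := fun p => X p.1) (c := fun _ => 0) (e := fun p => p.2)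
      (w hp) (w hX) (Comp.const hF _) hv)
  refine Comp.map hF (ea := fun i => ofUpdate (d := (γ i).d)) (Comp.filter hF
    (comp_box (comp_d hF h) (comp_symBase h hsym) (comp_gensRep h hp hX))
    (comp_keeps (γ := fun p : (Σ i, Update (γ i).d) => γ p.1)
      (pk := fun p => pk p.1) (X := fun p => X p.1) (e := fun p => p.2)
      (c := fun p => (tgt (pk p.1) (X p.1)).toNat - (src (pk p.1) (X p.1)).toNat)
      (w hp) (w hX) (Comp.int_diff hF (w (Comp.enat_toNat hF (comp_tgt hp hX)))
        (w (Comp.enat_toNat hF (comp_src hp hX)))) hv)) ?_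
  exact Comp.cons hF (w (comp_left hF h)) (Comp.cons hF hv (Comp.cons hF (w hper)
    (Comp.cons hF (w (comp_inOf hF h hsym)) (Comp.cons hF (w (comp_outOf hF h hsym))
      (Comp.const hF .nil)))))

end Cosets

omit h in
theorem comp_variantCtx {d : I → ℕ} {μ ν : ∀ i, OMarking (d i)}
    (hd : Comp tower enc fun i => ofNat (d i)) (hμ : Comp tower enc fun i => ofOMarking (μ i))
    (hν : Comp tower enc fun i => ofOMarking (ν i)) :
    Comp tower enc fun i => ofContext (variantCtx (μ i) (ν i)) := by
  classical
  have hF := scale_tower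
  have hu : Comp tower enc fun i => ofCounters (omegas (μ i) ∩ omegas (ν i)) := by
    refine Comp.ofFn hF (f := fun i j => if j ∈ omegas (μ i) ∩ omegas (ν i) then
      Data.cons .nil .nil else .nil) hd (Comp.ite hF (CompP.congr (CompP.and hF
        (CompP.not hF (CompP.ne_top hF (Comp.omark_apply hF (μ := fun p : (Σ i, Fin (d i)) => μ p.1)
          (j := fun p => p.2) (Comp.weaken hF hμ) (Comp.var hF))))
        (CompP.not hF (CompP.ne_top hF (Comp.omark_apply hF (μ := fun p : (Σ i, Fin (d i)) => ν p.1)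
          (j := fun p => p.2) (Comp.weaken hF hν) (Comp.var hF))))) fun p => ?_)
      (Comp.const hF _) (Comp.const hF _))
    simp [omegas]
  have hs : ∀ c : ℤ, Comp tower enc fun i => encL ofUpdate
      (List.ofFn fun j : Fin (d i) => (Pi.single j c : Update (d i))) := by
    intro c
    refine (Comp.ofFn hF (f := fun i j => ofUpdate (Pi.single j c : Update (d i))) hd
      (Comp.ofFn hF (f := fun (p : Σ i, Fin (d i)) l => ofInt ((Pi.single p.2 c : Update (d p.1)) l))
        (Comp.weaken hF hd) ?_)).congr fun i => by simp [encL, List.map_ofFn, Function.comp_def]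
    refine (Comp.ite hF (p := fun q : (Σ p : (Σ i, Fin (d i)), Fin (d p.1)) => q.2 = q.1.2)
      (CompP.fin_eq hF (Comp.var hF) (Comp.weaken hF (Comp.var hF)))
      (Comp.const hF (ofInt c)) (Comp.const hF (ofInt 0))).congr fun q => ?_
    simp only [Pi.single_apply]
    split <;> rfl
  exact Comp.cons hF hu (Comp.cons hF (Comp.upd_zero hF hd) (Comp.cons hF
    (Comp.append hF (hs 1) (hs (-1))) (Comp.cons hF hμ (Comp.cons hF hν (Comp.const hF .nil)))))

end Effects
end NestedVAS

namespace NestedVAS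

/-! ## Feasibility of the decomposition: rules and components -/

section Components

open Data

variable {F : ℕ → ℕ → ℕ} {I : Type*} {enc : I → Data} {γ : I → Gr}

/-- Codes of rules. -/
def encRule {d n k : ℕ} (q : Rule d n k) : Data :=
  ofList [ofCGSym q.lhs, ofCGSym q.fst, ofContext q.cfst, ofCGSym q.snd, ofContext q.csnd]

/-- Codes of productions of coverability grammars. -/
def encGProd {d n k : ℕ} (q : CGSym d n k × List (CGSym d n k)) : Data :=
  ofList [ofCGSym q.1, encL ofCGSym q.2]

/-- Codes of pairs. -/
def encPair {α β : Type*} (ea : α → Data) (eb : β → Data) (p : α × β) : Data :=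
  .cons (ea p.1) (eb p.2)

theorem comp_pairsOf (hF : Scale F) {α : I → Type*} {ea : ∀ i, α i → Data} {L : ∀ i, List (α i)}
    (hL : Comp F enc fun i => encL (ea i) (L i)) :
    Comp F enc fun i => encL (encPair (ea i) (ea i)) (pairsOf (L i)) := by
  classical
  have ht := Comp.tl hF hL
  refine (Comp.ite hF (CompP.and hF (CompP.ne_nil hF ht) (CompP.not hF (CompP.ne_nil hF
    (Comp.tl hF ht)))) (Comp.cons hF (Comp.cons hF (Comp.hd hF hL) (Comp.hd hF ht))
      (Comp.const hF .nil)) (Comp.const hF .nil)).congr fun i => ?_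
  rcases L i with _ | ⟨a, _ | ⟨b, _ | ⟨c, l⟩⟩⟩ <;> simp [pairsOf, encL, encPair]

theorem comp_singlesOf (hF : Scale F) {α : I → Type*} {ea : ∀ i, α i → Data}
    {L : ∀ i, List (α i)} (hL : Comp F enc fun i => encL (ea i) (L i)) :
    Comp F enc fun i => encL (ea i) (singlesOf (L i)) := by
  classical
  refine (Comp.ite hF (CompP.and hF (CompP.ne_nil hF hL) (CompP.not hF (CompP.ne_nil hF
    (Comp.tl hF hL)))) (Comp.cons hF (Comp.hd hF hL)
      (Comp.const hF .nil)) (Comp.const hF .nil)).congr fun i => ?_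
  rcases L i with _ | ⟨a, _ | ⟨b, l⟩⟩ <;> simp [singlesOf, encL]

theorem comp_picks (h : Comp tower enc fun i => encGr (γ i))
    {W : ∀ i, CGSym (γ i).d (γ i).n (γ i).k} (hW : Comp tower enc fun i => ofCGSym (W i)) :
    Comp tower enc fun i => encL encPick (picks (γ i).s (W i)) := by
  classical
  have hF := scale_tower
  have hd := comp_d hF h
  have w : ∀ {G : I → Data}, Comp tower enc G →
    Comp tower (ext enc fun i (j : Fin (γ i).d) => ofNat j) fun p => G p.1 :=
    fun hG => Comp.weaken hF hG
  have hv : Comp tower (ext enc fun i (j : Fin (γ i).d) => ofNat j) fun p => ofNat p.2 :=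
    Comp.var hF
  have hl := CompP.mem_counters hF (s := fun p : (Σ i, Fin (γ i).d) => (γ p.1).s.bd.left)
    (j := fun p => p.2) (w (comp_left hF h)) hv
  refine Comp.append hF (Comp.map hF (ea := fun i (j : Fin (γ i).d) => ofNat j)
    (Comp.filter hF (Comp.finRange hF hd) (CompP.and hF hl (CompP.ne_top hF (Comp.omark_apply hF
      (μ := fun p : (Σ i, Fin (γ i).d) => (W p.1).lab.inn) (j := fun p => p.2)
      (w (Comp.item hF 0 hW)) hv)))) (Comp.cons hF (Comp.const hF (truth (true = true))) hv))
    (Comp.map hF (ea := fun i (j : Fin (γ i).d) => ofNat j)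
    (Comp.filter hF (Comp.finRange hF hd) (CompP.and hF hl (CompP.ne_top hF (Comp.omark_apply hF
      (μ := fun p : (Σ i, Fin (γ i).d) => (W p.1).lab.out) (j := fun p => p.2)
      (w (Comp.item hF 4 hW)) hv)))) (Comp.cons hF (Comp.const hF (truth (false = true))) hv))

/-- The index of a context extended by a production and a pair of symbols. -/
abbrev PairIx (γ : I → Gr) := Σ p : (Σ i, CGSym (γ i).d (γ i).n (γ i).k ×
  List (CGSym (γ i).d (γ i).n (γ i).k)), CGSym (γ p.1).d (γ p.1).n (γ p.1).k ×
    CGSym (γ p.1).d (γ p.1).n (γ p.1).k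

theorem comp_rules (h : Comp tower enc fun i => encGr (γ i))
    {G : ∀ i, CovGrammar (γ i).d (γ i).n (γ i).k}
    (hG : Comp tower enc fun i => ofCovGrammar (G i)) :
    Comp tower enc fun i => encL encRule (rules (γ i).s (γ i).cc (G i)) := by
  have hF := scale_tower
  refine Comp.flatMap hF (ea := fun i => encGProd (d := (γ i).d) (n := (γ i).n) (k := (γ i).k))
    (Comp.item hF 3 hG) ?_
  have h1 := Comp.weaken hF (ea := fun i => encGProd (d := (γ i).d) (n := (γ i).n)
    (k := (γ i).k)) h
  have hq := Comp.var (enc := enc) hF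
    (ea := fun i => encGProd (d := (γ i).d) (n := (γ i).n) (k := (γ i).k))
  have hq1 := Comp.item hF 0 hq
  refine Comp.flatMap hF (comp_pairsOf hF (ea := fun p : (Σ i, CGSym (γ i).d (γ i).n (γ i).k ×
    List (CGSym (γ i).d (γ i).n (γ i).k)) => ofCGSym (d := (γ p.1).d) (n := (γ p.1).n)
    (k := (γ p.1).k)) (Comp.item hF 1 hq)) ?_
  have h2 := Comp.weaken hF (ea := fun p : (Σ i, CGSym (γ i).d (γ i).n (γ i).k ×
    List (CGSym (γ i).d (γ i).n (γ i).k)) => encPair (ofCGSym (d := (γ p.1).d) (n := (γ p.1).n)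
    (k := (γ p.1).k)) (ofCGSym (d := (γ p.1).d) (n := (γ p.1).n) (k := (γ p.1).k))) h1
  have hz := Comp.var (enc := ext enc fun i => encGProd (d := (γ i).d) (n := (γ i).n)
    (k := (γ i).k)) hF (ea := fun p : (Σ i, CGSym (γ i).d (γ i).n (γ i).k ×
    List (CGSym (γ i).d (γ i).n (γ i).k)) => encPair (ofCGSym (d := (γ p.1).d) (n := (γ p.1).n)
    (k := (γ p.1).k)) (ofCGSym (d := (γ p.1).d) (n := (γ p.1).n) (k := (γ p.1).k)))
  refine Comp.flatMap hF (ea := fun p : PairIx γ => encPick (d := (γ p.1.1).d)) (Comp.take_one hF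
    (comp_picks (γ := fun p : PairIx γ => γ p.1.1) (W := fun p => p.1.2.1) h2
      (Comp.weaken hF hq1))) ?_
  refine Comp.flatMap hF
    (ea := fun p : (Σ p : PairIx γ, Bool × Fin (γ p.1.1).d) => ofContext (d := (γ p.1.1.1).d))
    (comp_cosets (γ := fun p : (Σ p : PairIx γ, Bool × Fin (γ p.1.1).d) => γ p.1.1.1)
      (pk := fun p => p.2) (X := fun p => p.1.2.1)
      (Comp.weaken hF h2) (Comp.var hF) (Comp.weaken hF (Comp.hd hF hz))) ?_
  refine Comp.map hF (ea := fun p : (Σ p : (Σ p : PairIx γ, Bool × Fin (γ p.1.1).d),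
      Context (γ p.1.1.1).d) => ofContext (d := (γ p.1.1.1.1).d))
    (comp_cosets (γ := fun p : (Σ p : (Σ p : PairIx γ, Bool × Fin (γ p.1.1).d),
      Context (γ p.1.1.1).d) => γ p.1.1.1.1) (pk := fun p => p.1.2) (X := fun p => p.1.1.2.2)
      (Comp.weaken hF (Comp.weaken hF h2)) (Comp.weaken hF (Comp.var hF))
      (Comp.weaken hF (Comp.weaken hF (Comp.tl hF hz)))) ?_
  exact Comp.cons hF (Comp.weaken hF (Comp.weaken hF (Comp.weaken hF (Comp.weaken hF hq1))))
    (Comp.cons hF (Comp.weaken hF (Comp.weaken hF (Comp.weaken hF (Comp.hd hF hz))))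
    (Comp.cons hF (Comp.weaken hF (Comp.var hF))
    (Comp.cons hF (Comp.weaken hF (Comp.weaken hF (Comp.weaken hF (Comp.tl hF hz))))
    (Comp.cons hF (Comp.var hF) (Comp.const hF .nil)))))

theorem comp_singles {d n k : I → ℕ} {G : ∀ i, CovGrammar (d i) (n i) (k i)}
    (hG : Comp tower enc fun i => ofCovGrammar (G i)) :
    Comp tower enc fun i => encL (encPair ofCGSym ofCGSym) (singles (G i)) := by
  have hF := scale_tower
  refine Comp.flatMap hF (ea := fun i => encGProd (d := d i) (n := n i) (k := k i))
    (Comp.item hF 3 hG) ?_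
  have hq := Comp.var (enc := enc) hF (ea := fun i => encGProd (d := d i) (n := n i) (k := k i))
  exact Comp.map hF (ea := fun p : (Σ i, CGSym (d i) (n i) (k i) ×
    List (CGSym (d i) (n i) (k i))) => ofCGSym (d := d p.1) (n := n p.1) (k := k p.1))
    (comp_singlesOf hF (Comp.item hF 1 hq)) (Comp.cons hF (Comp.weaken hF (Comp.item hF 0 hq))
      (Comp.var hF))

section Reach

variable {d n k : I → ℕ} {R : ∀ i, List (Rule (d i) (n i) (k i))}
  {cur : ∀ i, List (CGSym (d i) (n i) (k i))} {W : ∀ i, CGSym (d i) (n i) (k i)}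

theorem comp_succs (hF : Scale F) (hR : Comp F enc fun i => encL encRule (R i))
    (hc : Comp F enc fun i => encL ofCGSym (cur i)) :
    Comp F enc fun i => encL ofCGSym (succs (R i) (cur i)) := by
  classical
  refine Comp.append hF hc (Comp.flatMap hF (ea := fun i => encRule (d := d i) (n := n i)
    (k := k i)) hR ?_)
  have hq := Comp.var (enc := enc) hF (ea := fun i => encRule (d := d i) (n := n i) (k := k i))
  exact Comp.apply_ite' hF (ea := fun p : (Σ i, Rule (d i) (n i) (k i)) =>
    encL (ofCGSym (d := d p.1) (n := n p.1) (k := k p.1)))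
    (CompP.mem hF (fun _ => ofCGSym_injective) (Comp.weaken hF hc) (Comp.item hF 0 hq))
    (Comp.cons hF (Comp.item hF 1 hq) (Comp.cons hF (Comp.item hF 3 hq) (Comp.const hF .nil)))
    (Comp.const hF .nil)

/-- The rules are themselves only elementary in the input, so the iteration is again carried out in
a context that contains them directly. -/
theorem comp_reach (hR : Comp tower enc fun i => encL encRule (R i))
    (hW : Comp tower enc fun i => ofCGSym (W i)) :
    Comp tower enc fun i => encL ofCGSym (reach (R i) (W i)) := by
  let J := Σ t : ℕ × ℕ × ℕ, List (Rule t.1 t.2.1 t.2.2) × CGSym t.1 t.2.1 t.2.2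
  let encJ : J → Data := fun j => .cons (encL encRule j.2.1) (ofCGSym j.2.2)
  have key : Comp tower encJ fun j => encL ofCGSym (reach j.2.1 j.2.2) := by
    have hR : ∀ {F}, Scale F → Comp F encJ fun j => encL encRule j.2.1 :=
      fun hF => Comp.hd hF (Comp.self hF)
    have hN := Comp.length scale_tower (hR scale_tower)
    refine Comp.iterate (enc := encJ) (eb := fun j => encL (ofCGSym (d := j.1.1) (n := j.1.2.1)
      (k := j.1.2.2))) (f := fun j => succs j.2.1) (b := fun j => [j.2.2])
      (Comp.nat_add scale_tower hN hN) (Comp.singleton scale_tower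
        (Comp.tl scale_tower (Comp.self scale_tower))) ?_
    exact comp_succs scale_poly (Comp.weaken scale_poly (hR scale_poly)) (Comp.var scale_poly)
  exact Comp.subst scale_tower (φ := fun i => (⟨(d i, n i, k i), R i, W i⟩ : J)) key
    (Comp.cons scale_tower hR hW)

theorem comp_component (hR : Comp tower enc fun i => encL encRule (R i))
    (hW : Comp tower enc fun i => ofCGSym (W i)) :
    Comp tower enc fun i => encL ofCGSym (component (R i) (W i)) := by
  classical
  have hF := scale_tower
  exact Comp.filter hF (comp_reach hR hW) (CompP.mem hF (fun _ => ofCGSym_injective)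
    (comp_reach (R := fun p : (Σ i, CGSym (d i) (n i) (k i)) => R p.1) (W := fun p => p.2)
      (Comp.weaken hF hR) (Comp.var hF)) (Comp.weaken hF hW))

end Reach

/-- Codes of symbols with their components. -/
def encPlan {d n k : ℕ} (p : CGSym d n k × List (CGSym d n k)) : Data :=
  encPair ofCGSym (encL ofCGSym) p

theorem comp_plan (h : Comp tower enc fun i => encGr (γ i))
    {G : ∀ i, CovGrammar (γ i).d (γ i).n (γ i).k}
    (hG : Comp tower enc fun i => ofCovGrammar (G i)) :
    Comp tower enc fun i => encL encPlan (plan (γ i).s (γ i).cc (G i)) := by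
  have hF := scale_tower
  refine Comp.map hF (ea := fun i => ofCGSym (d := (γ i).d) (n := (γ i).n) (k := (γ i).k))
    (Comp.item hF 0 hG) ?_
  exact Comp.cons hF (Comp.var hF) (comp_component (Comp.weaken hF (comp_rules h hG))
    (Comp.var hF))

end Components
end NestedVAS

namespace NestedVAS

/-! ## Feasibility of the decomposition: assembly -/

section Assembly

open Data

variable {F : ℕ → ℕ → ℕ} {I : Type*} {enc : I → Data} {γ : I → Gr}

/-- Codes of NGVAS without context information. -/
def encPre {d : ℕ} (P : Pre d) : Data :=
  ofList [ofList (List.ofFn fun c => ofNGVAS (P.child c)), ofNat P.n, ofNat P.k, ofNat P.start,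
    encL encProd P.prods, ofCounters P.bd.left, ofCounters P.bd.right,
    ofList (List.ofFn fun A => ofOMarking (P.bd.inn A)),
    ofList (List.ofFn fun A => ofOMarking (P.bd.out A))]

theorem Comp.ofList_cons (hF : Scale F) {a : I → Data} {l : I → List Data}
    (ha : Comp F enc a) (hl : Comp F enc fun i => ofList (l i)) :
    Comp F enc fun i => ofList (a i :: l i) := Comp.cons hF ha hl

theorem Comp.ofList_nil (hF : Scale F) : Comp F enc fun _ => ofList [] := Comp.const hF .nil

theorem comp_fill (hF : Scale F) {d : I → ℕ} {P : ∀ i, Pre (d i)} {c : ∀ i, Context (d i)}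
    (hP : Comp F enc fun i => encPre (P i)) (hc : Comp F enc fun i => ofContext (c i)) :
    Comp F enc fun i => ofNGVAS ((P i).fill (c i)) := by
  have h (j) := Comp.item hF j hP
  refine (Comp.cons hF (Comp.const hF (.cons .nil .nil)) (Comp.ofList_cons hF (h 0)
    (Comp.ofList_cons hF (Comp.ofList_cons hF (h 1) (Comp.ofList_cons hF (h 2)
    (Comp.ofList_cons hF (h 3) (Comp.ofList_cons hF (h 4) (Comp.ofList_cons hF hc
    (Comp.ofList_cons hF (h 5) (Comp.ofList_cons hF (h 6) (Comp.ofList_cons hF (h 7)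
    (Comp.ofList_cons hF (h 8) (Comp.ofList_nil hF)))))))))) (Comp.ofList_nil hF)))).congr
    fun i => ?_
  rw [Pre.fill, ofNGVAS]
  rfl

theorem comp_emptyLeaf (hF : Scale F) {d : I → ℕ} {c : ∀ i, Context (d i)}
    (hd : Comp F enc fun i => ofNat (d i)) (hc : Comp F enc fun i => ofContext (c i)) :
    Comp F enc fun i => ofNGVAS (emptyLeaf (c i)) := by
  have h (j) := Comp.item hF j hc
  refine (Comp.cons hF (Comp.const hF .nil) (Comp.ofList_cons hF
    (Comp.ofList_cons hF (Comp.upd_add hF (u := fun i => (c i).base) (v := fun i => 1) hd (h 1)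
      (Comp.upd_one hF hd)) (Comp.ofList_nil hF))
    (Comp.ofList_cons hF (Comp.ofList_cons hF (h 0) (Comp.ofList_cons hF (h 1)
    (Comp.ofList_cons hF (Comp.const hF .nil) (Comp.ofList_cons hF (h 3)
    (Comp.ofList_cons hF (h 4) (Comp.ofList_nil hF)))))) (Comp.ofList_nil hF)))).congr fun i => ?_
  rw [emptyLeaf, ofNGVAS]
  rfl

theorem comp_epsLeaf (hF : Scale F) {d : I → ℕ} {D : ∀ i, Finset (Fin (d i))}
    {x : ∀ i, OMarking (d i)} (hd : Comp F enc fun i => ofNat (d i))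
    (hD : Comp F enc fun i => ofCounters (D i)) (hx : Comp F enc fun i => ofOMarking (x i)) :
    Comp F enc fun i => ofNGVAS (epsLeaf (D i) (x i)) := by
  refine (Comp.cons hF (Comp.const hF .nil) (Comp.ofList_cons hF (Comp.const hF .nil)
    (Comp.ofList_cons hF (Comp.ofList_cons hF hD (Comp.ofList_cons hF (Comp.upd_zero hF hd)
    (Comp.ofList_cons hF (Comp.const hF .nil) (Comp.ofList_cons hF hx
    (Comp.ofList_cons hF hx (Comp.ofList_nil hF)))))) (Comp.ofList_nil hF)))).congr fun i => ?_
  rw [epsLeaf, ofNGVAS]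
  rfl

theorem comp_child (hF : Scale F) (h : Comp F enc fun i => encGr (γ i))
    {c : ∀ i, Fin (γ i).k} (hc : Comp F enc fun i => ofNat (c i)) :
    Comp F enc fun i => ofNGVAS ((γ i).child (c i)) :=
  Comp.nth hF (f := fun i c => ofNGVAS ((γ i).child c)) (comp_children hF h) hc

theorem comp_wrap (hF : Scale F) (h : Comp F enc fun i => encGr (γ i))
    {c : ∀ i, Fin (γ i).k} (hc : Comp F enc fun i => ofNat (c i)) :
    Comp F enc fun i => encPre (wrap (γ i).child (γ i).s (c i)) := by
  have hl := comp_left hF h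
  have hch := comp_cc hF h hc
  have ho := Comp.item hF 4 hch
  refine (Comp.ofList_cons hF (Comp.ofList_cons hF (comp_child hF h hc) (Comp.ofList_cons hF
    (comp_epsLeaf hF (x := fun i => ((γ i).cc (c i)).cout) (comp_d hF h) hl ho)
    (Comp.ofList_nil hF)))
    (Comp.ofList_cons hF (Comp.const hF (ofNat 1)) (Comp.ofList_cons hF (Comp.const hF (ofNat 2))
    (Comp.ofList_cons hF (Comp.const hF (ofNat 0)) (Comp.ofList_cons hF (Comp.const hF
      (encL (encProd (n := 1) (k := 2)) [(0, .terminal 0, .terminal 1)]))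
    (Comp.ofList_cons hF hl (Comp.ofList_cons hF hl (Comp.ofList_cons hF
      (Comp.ofList_cons hF (Comp.item hF 3 hch) (Comp.ofList_nil hF))
    (Comp.ofList_cons hF (Comp.ofList_cons hF ho (Comp.ofList_nil hF))
    (Comp.ofList_nil hF)))))))))).congr fun i => ?_
  simp only [wrap, encPre, List.ofFn_succ, List.ofFn_zero]
  rfl

theorem comp_wraps (hF : Scale F) (h : Comp F enc fun i => encGr (γ i))
    {σ : ∀ i, Symbol (Fin (γ i).k) (Fin (γ i).n)} (hσ : Comp F enc fun i => ofSymbol (σ i)) :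
    Comp F enc fun i => encL encPre (wraps (γ i).child (γ i).s (σ i)) := by
  refine (Comp.symCases hF (f := fun i c => encL encPre [wrap (γ i).child (γ i).s c])
    (g := fun _ _ => .nil) hσ (Comp.singleton hF
    (ea := fun p : (Σ i, Fin (γ i).k) => encPre (d := (γ p.1).d))
    (comp_wrap hF (γ := fun p : (Σ i, Fin (γ i).k) => γ p.1) (c := fun p => p.2)
      (Comp.weaken hF h) (Comp.var hF))) (Comp.const hF .nil)).congr fun i => ?_
  cases σ i <;> rfl

/-- Codes of the entries of tables. -/
def encEntry {d n k : ℕ} (e : CGSym d n k × List (Pre d)) : Data :=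
  encPair ofCGSym (encL encPre) e

section Tables

variable {d n k : I → ℕ} {X : ∀ i, CGSym (d i) (n i) (k i)} {T : ∀ i, Table (d i) (n i) (k i)}
  {l : ∀ i, List (CGSym (d i) (n i) (k i))} {R : ∀ i, List (Rule (d i) (n i) (k i))}

theorem comp_lookup (hF : Scale F) (hT : Comp F enc fun i => encL encEntry (T i))
    (hX : Comp F enc fun i => ofCGSym (X i)) :
    Comp F enc fun i => encL encPre (lookup (T i) (X i)) := by
  classical
  refine Comp.flatMap hF (ea := fun i => encEntry (d := d i) (n := n i) (k := k i)) hT ?_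
  have he := Comp.var (enc := enc) hF (ea := fun i => encEntry (d := d i) (n := n i) (k := k i))
  exact Comp.apply_ite' hF (ea := fun p : (Σ i, CGSym (d i) (n i) (k i) × List (Pre (d i))) =>
      encL (encPre (d := d p.1)))
    (CompP.cgsym_eq hF (Comp.hd hF he) (Comp.weaken hF hX)) (Comp.tl hF he) (Comp.const hF .nil)

theorem comp_idxs (hF : Scale F) (hl : Comp F enc fun i => encL ofCGSym (l i))
    (hX : Comp F enc fun i => ofCGSym (X i)) :
    Comp F enc fun i => encL (fun j : Fin (l i).length => ofNat j) (idxs (l i) (X i)) := by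
  classical
  refine Comp.filter hF (ea := fun i (j : Fin (l i).length) => ofNat j)
    (Comp.finRange hF (Comp.length hF hl)) ?_
  exact CompP.cgsym_eq hF (X := fun p : (Σ i, Fin (l i).length) => (l p.1).get p.2)
    (Comp.get hF (L := fun p : (Σ i, Fin (l i).length) => l p.1) (j := fun p => p.2)
      (Comp.weaken hF hl) (Comp.var hF)) (Comp.weaken hF hX)

end Tables

/-- Codes of persisting productions with one child. -/
noncomputable def encOne {d m : ℕ} (o : OneItem d m) : Data :=
  ofList [ofNat o.lhs, truth (o.left = true), ofNat o.other, ofNGVAS o.kid]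

/-- Codes of persisting productions with two nonterminals. -/
def encTwo {m : ℕ} (o : TwoItem m) : Data := ofList [ofNat o.lhs, ofNat o.fst, ofNat o.snd]

/-- Codes of exit productions. -/
def encExit {d m : ℕ} (o : ExitItem d m) : Data :=
  ofList [ofNat o.lhs, ofNGVAS o.fst, ofNGVAS o.snd]

section Items

variable {d m : I → ℕ} {v : ∀ i, Fin (m i)} {L L' : ∀ i, List (Fin (m i))}
  {K K' : ∀ i, List (NGVAS (d i))}

theorem comp_oneItems (hF : Scale F) (b : Bool) (hv : Comp F enc fun i => ofNat (v i))
    (hL : Comp F enc fun i => encL (fun j : Fin (m i) => ofNat j) (L i))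
    (hK : Comp F enc fun i => encL ofNGVAS (K i)) :
    Comp F enc fun i => encL encOne ((L i).flatMap fun y => (K i).map fun a =>
      (⟨v i, b, y, a⟩ : OneItem (d i) (m i))) := by
  refine Comp.flatMap hF (ea := fun i (j : Fin (m i)) => ofNat j) hL (Comp.map hF
    (ea := fun p : (Σ i, Fin (m i)) => ofNGVAS (d := d p.1)) (Comp.weaken hF hK) ?_)
  exact Comp.ofList_cons hF (Comp.weaken hF (Comp.weaken hF hv)) (Comp.ofList_cons hF
    (Comp.const hF (truth (b = true))) (Comp.ofList_cons hF (Comp.weaken hF (Comp.var hF))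
    (Comp.ofList_cons hF (Comp.var hF) (Comp.ofList_nil hF))))

theorem comp_twoItems (hF : Scale F) (hv : Comp F enc fun i => ofNat (v i))
    (hL : Comp F enc fun i => encL (fun j : Fin (m i) => ofNat j) (L i))
    (hL' : Comp F enc fun i => encL (fun j : Fin (m i) => ofNat j) (L' i)) :
    Comp F enc fun i => encL encTwo ((L i).flatMap fun x => (L' i).map fun y =>
      (⟨v i, x, y⟩ : TwoItem (m i))) := by
  refine Comp.flatMap hF (ea := fun i (j : Fin (m i)) => ofNat j) hL (Comp.map hF
    (ea := fun p : (Σ i, Fin (m i)) => fun j : Fin (m p.1) => ofNat j) (Comp.weaken hF hL') ?_)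
  exact Comp.ofList_cons hF (Comp.weaken hF (Comp.weaken hF hv)) (Comp.ofList_cons hF
    (Comp.weaken hF (Comp.var hF)) (Comp.ofList_cons hF (Comp.var hF) (Comp.ofList_nil hF)))

theorem comp_exitItems (hF : Scale F) (hv : Comp F enc fun i => ofNat (v i))
    (hK : Comp F enc fun i => encL ofNGVAS (K i)) (hK' : Comp F enc fun i => encL ofNGVAS (K' i)) :
    Comp F enc fun i => encL encExit ((K i).flatMap fun a => (K' i).map fun b =>
      (⟨v i, a, b⟩ : ExitItem (d i) (m i))) := by
  refine Comp.flatMap hF (ea := fun i => ofNGVAS (d := d i)) hK (Comp.map hF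
    (ea := fun p : (Σ i, NGVAS (d i)) => ofNGVAS (d := d p.1)) (Comp.weaken hF hK') ?_)
  exact Comp.ofList_cons hF (Comp.weaken hF (Comp.weaken hF hv)) (Comp.ofList_cons hF
    (Comp.weaken hF (Comp.var hF)) (Comp.ofList_cons hF (Comp.var hF) (Comp.ofList_nil hF)))

end Items

section Nodes

variable {T : ∀ i, Table (γ i).d (γ i).n (γ i).k} {X : ∀ i, CGSym (γ i).d (γ i).n (γ i).k}
  {c : ∀ i, Context (γ i).d} {R : ∀ i, List (Rule (γ i).d (γ i).n (γ i).k)}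
  {l : ∀ i, List (CGSym (γ i).d (γ i).n (γ i).k)}

theorem comp_alts (hF : Scale F) (h : Comp F enc fun i => encGr (γ i))
    (hT : Comp F enc fun i => encL encEntry (T i)) (hX : Comp F enc fun i => ofCGSym (X i))
    (hc : Comp F enc fun i => ofContext (c i)) :
    Comp F enc fun i => encL ofNGVAS (alts (γ i).child (γ i).s (T i) (X i) (c i)) := by
  refine Comp.consL hF (ea := fun i => ofNGVAS (d := (γ i).d)) (comp_emptyLeaf hF (comp_d hF h) hc)
    (Comp.map hF (ea := fun i => encPre (d := (γ i).d)) (Comp.append hF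
      (comp_wraps hF h (σ := fun i => (X i).lab.sym) (Comp.item hF 2 hX)) (comp_lookup hF hT hX))
      (comp_fill hF (d := fun p : (Σ i, Pre (γ i).d) => (γ p.1).d) (P := fun p => p.2)
        (c := fun p => c p.1) (Comp.var hF) (Comp.weaken hF hc)))

/-- The index of a context extended by a rule and a position. -/
abbrev RulePos (γ : I → Gr) (l : ∀ i, List (CGSym (γ i).d (γ i).n (γ i).k)) :=
  Σ p : (Σ i, Rule (γ i).d (γ i).n (γ i).k), Fin (l p.1).length

theorem comp_ones (hF : Scale F) (h : Comp F enc fun i => encGr (γ i))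
    (hT : Comp F enc fun i => encL encEntry (T i)) (hR : Comp F enc fun i => encL encRule (R i))
    (hl : Comp F enc fun i => encL ofCGSym (l i)) :
    Comp F enc fun i => encL encOne (ones (γ i).child (γ i).s (T i) (R i) (l i)) := by
  refine Comp.flatMap hF (ea := fun i => encRule (d := (γ i).d) (n := (γ i).n) (k := (γ i).k))
    hR ?_
  have hq := Comp.var (enc := enc) hF
    (ea := fun i => encRule (d := (γ i).d) (n := (γ i).n) (k := (γ i).k))
  refine Comp.flatMap hF
    (ea := fun (p : Σ i, Rule (γ i).d (γ i).n (γ i).k) (j : Fin (l p.1).length) => ofNat j)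
    (comp_idxs hF (X := fun p : (Σ i, Rule (γ i).d (γ i).n (γ i).k) => p.2.lhs)
      (l := fun p => l p.1) (Comp.weaken hF hl) (Comp.item hF 0 hq)) ?_
  have hl2 := Comp.weaken hF (ea := fun (p : Σ i, Rule (γ i).d (γ i).n (γ i).k)
    (j : Fin (l p.1).length) => ofNat j) (Comp.weaken hF
    (ea := fun i => encRule (d := (γ i).d) (n := (γ i).n) (k := (γ i).k)) hl)
  have hh := Comp.weaken hF (ea := fun (p : Σ i, Rule (γ i).d (γ i).n (γ i).k)
    (j : Fin (l p.1).length) => ofNat j) (Comp.weaken hF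
    (ea := fun i => encRule (d := (γ i).d) (n := (γ i).n) (k := (γ i).k)) h)
  have hT2 := Comp.weaken hF (ea := fun (p : Σ i, Rule (γ i).d (γ i).n (γ i).k)
    (j : Fin (l p.1).length) => ofNat j) (Comp.weaken hF
    (ea := fun i => encRule (d := (γ i).d) (n := (γ i).n) (k := (γ i).k)) hT)
  have hq2 := Comp.weaken hF (ea := fun (p : Σ i, Rule (γ i).d (γ i).n (γ i).k)
    (j : Fin (l p.1).length) => ofNat j) hq
  have hv := Comp.var (enc := ext enc fun i => encRule (d := (γ i).d) (n := (γ i).n)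
    (k := (γ i).k)) hF (ea := fun (p : Σ i, Rule (γ i).d (γ i).n (γ i).k)
    (j : Fin (l p.1).length) => ofNat j)
  exact Comp.append hF
    (ea := fun p : RulePos γ l => encOne (d := (γ p.1.1).d) (m := (l p.1.1).length))
    (comp_oneItems hF (v := fun p : RulePos γ l => p.2) true hv
      (comp_idxs hF (X := fun p : RulePos γ l => p.1.2.snd) (l := fun p => l p.1.1) hl2
        (Comp.item hF 3 hq2))
      (comp_alts hF (γ := fun p : RulePos γ l => γ p.1.1) (T := fun p => T p.1.1)
        (X := fun p => p.1.2.fst) (c := fun p => p.1.2.cfst) hh hT2 (Comp.item hF 1 hq2)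
        (Comp.item hF 2 hq2)))
    (comp_oneItems hF (v := fun p : RulePos γ l => p.2) false hv
      (comp_idxs hF (X := fun p : RulePos γ l => p.1.2.fst) (l := fun p => l p.1.1) hl2
        (Comp.item hF 1 hq2))
      (comp_alts hF (γ := fun p : RulePos γ l => γ p.1.1) (T := fun p => T p.1.1)
        (X := fun p => p.1.2.snd) (c := fun p => p.1.2.csnd) hh hT2 (Comp.item hF 3 hq2)
        (Comp.item hF 4 hq2)))

theorem comp_exits (hF : Scale F) (h : Comp F enc fun i => encGr (γ i))
    (hT : Comp F enc fun i => encL encEntry (T i)) (hR : Comp F enc fun i => encL encRule (R i))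
    (hl : Comp F enc fun i => encL ofCGSym (l i)) :
    Comp F enc fun i => encL encExit (exits (γ i).child (γ i).s (T i) (R i) (l i)) := by
  refine Comp.flatMap hF (ea := fun i => encRule (d := (γ i).d) (n := (γ i).n) (k := (γ i).k))
    hR ?_
  have hq := Comp.var (enc := enc) hF
    (ea := fun i => encRule (d := (γ i).d) (n := (γ i).n) (k := (γ i).k))
  refine Comp.flatMap hF
    (ea := fun (p : Σ i, Rule (γ i).d (γ i).n (γ i).k) (j : Fin (l p.1).length) => ofNat j)
    (comp_idxs hF (X := fun p : (Σ i, Rule (γ i).d (γ i).n (γ i).k) => p.2.lhs)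
      (l := fun p => l p.1) (Comp.weaken hF hl) (Comp.item hF 0 hq)) ?_
  have hh := Comp.weaken hF (ea := fun (p : Σ i, Rule (γ i).d (γ i).n (γ i).k)
    (j : Fin (l p.1).length) => ofNat j) (Comp.weaken hF
    (ea := fun i => encRule (d := (γ i).d) (n := (γ i).n) (k := (γ i).k)) h)
  have hT2 := Comp.weaken hF (ea := fun (p : Σ i, Rule (γ i).d (γ i).n (γ i).k)
    (j : Fin (l p.1).length) => ofNat j) (Comp.weaken hF
    (ea := fun i => encRule (d := (γ i).d) (n := (γ i).n) (k := (γ i).k)) hT)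
  have hq2 := Comp.weaken hF (ea := fun (p : Σ i, Rule (γ i).d (γ i).n (γ i).k)
    (j : Fin (l p.1).length) => ofNat j) hq
  have hv := Comp.var (enc := ext enc fun i => encRule (d := (γ i).d) (n := (γ i).n)
    (k := (γ i).k)) hF (ea := fun (p : Σ i, Rule (γ i).d (γ i).n (γ i).k)
    (j : Fin (l p.1).length) => ofNat j)
  exact comp_exitItems hF (v := fun p : RulePos γ l => p.2) hv
    (comp_alts hF (γ := fun p : RulePos γ l => γ p.1.1) (T := fun p => T p.1.1)
      (X := fun p => p.1.2.fst) (c := fun p => p.1.2.cfst) hh hT2 (Comp.item hF 1 hq2)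
      (Comp.item hF 2 hq2))
    (comp_alts hF (γ := fun p : RulePos γ l => γ p.1.1) (T := fun p => T p.1.1)
      (X := fun p => p.1.2.snd) (c := fun p => p.1.2.csnd) hh hT2 (Comp.item hF 3 hq2)
      (Comp.item hF 4 hq2))

theorem comp_twos (hF : Scale F) (hR : Comp F enc fun i => encL encRule (R i))
    (hl : Comp F enc fun i => encL ofCGSym (l i)) :
    Comp F enc fun i => encL encTwo (twos (R i) (l i)) := by
  refine Comp.flatMap hF (ea := fun i => encRule (d := (γ i).d) (n := (γ i).n) (k := (γ i).k))
    hR ?_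
  have hq := Comp.var (enc := enc) hF
    (ea := fun i => encRule (d := (γ i).d) (n := (γ i).n) (k := (γ i).k))
  refine Comp.flatMap hF
    (ea := fun (p : Σ i, Rule (γ i).d (γ i).n (γ i).k) (j : Fin (l p.1).length) => ofNat j)
    (comp_idxs hF (X := fun p : (Σ i, Rule (γ i).d (γ i).n (γ i).k) => p.2.lhs)
      (l := fun p => l p.1) (Comp.weaken hF hl) (Comp.item hF 0 hq)) ?_
  have hl2 := Comp.weaken hF (ea := fun (p : Σ i, Rule (γ i).d (γ i).n (γ i).k)
    (j : Fin (l p.1).length) => ofNat j) (Comp.weaken hF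
    (ea := fun i => encRule (d := (γ i).d) (n := (γ i).n) (k := (γ i).k)) hl)
  have hq2 := Comp.weaken hF (ea := fun (p : Σ i, Rule (γ i).d (γ i).n (γ i).k)
    (j : Fin (l p.1).length) => ofNat j) hq
  have hv := Comp.var (enc := ext enc fun i => encRule (d := (γ i).d) (n := (γ i).n)
    (k := (γ i).k)) hF (ea := fun (p : Σ i, Rule (γ i).d (γ i).n (γ i).k)
    (j : Fin (l p.1).length) => ofNat j)
  exact comp_twoItems hF (v := fun p : RulePos γ l => p.2) hv
    (comp_idxs hF (X := fun p : RulePos γ l => p.1.2.fst) (l := fun p => l p.1.1) hl2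
      (Comp.item hF 1 hq2))
    (comp_idxs hF (X := fun p : RulePos γ l => p.1.2.snd) (l := fun p => l p.1.1) hl2
      (Comp.item hF 3 hq2))

theorem comp_getItem (hF : Scale F) {α : I → Type*} {ea : ∀ i, α i → Data}
    {L : ∀ i, List (α i)} {G : (Σ i, Fin (L i).length) → Data}
    (hL : Comp F enc fun i => encL (ea i) (L i)) (j : ℕ)
    (hG : ∀ p, ((ea p.1 ((L p.1).get p.2)).item j) = G p) :
    Comp F (ext enc fun i (j : Fin (L i).length) => ofNat j) G :=
  (Comp.item hF j (Comp.get hF (L := fun p : (Σ i, Fin (L i).length) => L p.1)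
    (j := fun p => p.2) (Comp.weaken hF hL) (Comp.var hF))).congr hG

theorem ofList_ofFn_append {α : Type*} {a b : ℕ} (f : Fin a → α) (g : Fin b → α) (e : α → Data) :
    List.ofFn (fun c => e (Fin.append f g c)) =
      (List.ofFn fun c => e (f c)) ++ List.ofFn fun c => e (g c) := by
  rw [List.ofFn_add]
  simp

theorem comp_assemble (hF : Scale F) (h : Comp F enc fun i => encGr (γ i))
    (hl : Comp F enc fun i => encL ofCGSym (l i))
    {O : ∀ i, List (OneItem (γ i).d (l i).length)} {T : ∀ i, List (TwoItem (l i).length)}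
    {E : ∀ i, List (ExitItem (γ i).d (l i).length)} {w : ∀ i, Fin (l i).length}
    (hO : Comp F enc fun i => encL encOne (O i)) (hT : Comp F enc fun i => encL encTwo (T i))
    (hE : Comp F enc fun i => encL encExit (E i)) (hw : Comp F enc fun i => ofNat (w i)) :
    Comp F enc fun i => encPre (assemble (γ i).s (γ i).cc (l i) (O i) (T i) (E i) (w i)) := by
  classical
  have hm := Comp.length hF hl
  have ho := Comp.length hF hO
  have he := Comp.length hF hE
  have hD := comp_left hF h
  -- The order agrees with the numbering of terminals in `assemble`: children of persisting
  -- productions, first children of exits, second children of exits.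
  have c1 : Comp F enc fun i => encL (ofNGVAS (d := (γ i).d))
      (((O i).map fun o => o.kid) ++ (((E i).map fun e => e.fst) ++ (E i).map fun e => e.snd)) :=
    Comp.append hF (Comp.map hF (ea := fun i => encOne (d := (γ i).d) (m := (l i).length)) hO
        (Comp.item hF 3 (Comp.var hF)))
      (Comp.append hF (Comp.map hF (ea := fun i => encExit (d := (γ i).d) (m := (l i).length)) hE
        (Comp.item hF 1 (Comp.var hF)))
      (Comp.map hF (ea := fun i => encExit (d := (γ i).d) (m := (l i).length)) hE
        (Comp.item hF 2 (Comp.var hF))))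
  have nt : ∀ {J : Type _} {e : J → Data} {G : J → Data}, Comp F e G →
      Comp F e fun j => .cons (.cons .nil .nil) (G j) :=
    fun hG => Comp.cons hF (Comp.const hF _) hG
  have tm : ∀ {J : Type _} {e : J → Data} {G : J → Data}, Comp F e G →
      Comp F e fun j => .cons .nil (G j) := fun hG => Comp.cons hF (Comp.const hF _) hG
  have p1 : Comp F enc fun i => encL (encProd (n := (l i).length)
      (k := (O i).length + ((E i).length + (E i).length)))
      ((List.finRange (O i).length).map fun j => if ((O i).get j).left then
        (((O i).get j).lhs, .terminal (Fin.castAdd _ j), .nonterminal ((O i).get j).other)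
      else (((O i).get j).lhs, .nonterminal ((O i).get j).other, .terminal (Fin.castAdd _ j))) := by
    refine Comp.map hF (Comp.finRange hF ho) ?_
    refine (Comp.ite hF (p := fun p : (Σ i, Fin (O i).length) => ((O p.1).get p.2).left = true)
      (comp_getItem hF hO 1 fun p => rfl)
      (Comp.ofList_cons hF (comp_getItem hF hO 0 (G := fun p => ofNat ((O p.1).get p.2).lhs)
        fun p => rfl) (Comp.ofList_cons hF (tm (Comp.var hF))
        (Comp.ofList_cons hF (nt (comp_getItem hF hO 2
          (G := fun p => ofNat ((O p.1).get p.2).other) fun p => rfl)) (Comp.ofList_nil hF))))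
      (Comp.ofList_cons hF (comp_getItem hF hO 0 (G := fun p => ofNat ((O p.1).get p.2).lhs)
        fun p => rfl) (Comp.ofList_cons hF (nt (comp_getItem hF hO 2
          (G := fun p => ofNat ((O p.1).get p.2).other) fun p => rfl))
        (Comp.ofList_cons hF (tm (Comp.var hF)) (Comp.ofList_nil hF))))).congr fun p => ?_
    split <;> rfl
  have p2 : Comp F enc fun i => encL (encProd (n := (l i).length)
      (k := (O i).length + ((E i).length + (E i).length)))
      ((T i).map fun t => (t.lhs, .nonterminal t.fst, .nonterminal t.snd)) := by
    have hv := Comp.var (enc := enc) hF (ea := fun i => encTwo (m := (l i).length))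
    exact Comp.map hF hT (Comp.ofList_cons hF (Comp.item hF 0 hv) (Comp.ofList_cons hF
      (nt (Comp.item hF 1 hv)) (Comp.ofList_cons hF (nt (Comp.item hF 2 hv))
      (Comp.ofList_nil hF))))
  have p3 : Comp F enc fun i => encL (encProd (n := (l i).length)
      (k := (O i).length + ((E i).length + (E i).length)))
      ((List.finRange (E i).length).map fun j => (((E i).get j).lhs,
      .terminal (Fin.natAdd _ (Fin.castAdd _ j)), .terminal (Fin.natAdd _ (Fin.natAdd _ j)))) := by
    refine Comp.map hF (Comp.finRange hF he) ?_
    exact Comp.ofList_cons hF (comp_getItem hF hE 0 (G := fun p => ofNat ((E p.1).get p.2).lhs)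
      fun p => rfl) (Comp.ofList_cons hF (tm (Comp.nat_add hF (Comp.weaken hF ho) (Comp.var hF)))
        (Comp.ofList_cons hF (tm (Comp.nat_add hF (Comp.weaken hF ho)
          (Comp.nat_add hF (Comp.weaken hF he) (Comp.var hF)))) (Comp.ofList_nil hF)))
  refine (Comp.ofList_cons hF c1 (Comp.ofList_cons hF hm (Comp.ofList_cons hF
    (Comp.nat_add hF ho (Comp.nat_add hF he he)) (Comp.ofList_cons hF hw (Comp.ofList_cons hF
    (Comp.append hF p1 (Comp.append hF p2 p3)) (Comp.ofList_cons hF hD (Comp.ofList_cons hF hD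
    (Comp.ofList_cons hF (Comp.ofFn hF
      (f := fun i j => ofOMarking ((γ i).s.inOf (γ i).cc ((l i).get j).lab.sym)) hm
      (comp_inOf hF (γ := fun p : (Σ i, Fin (l i).length) => γ p.1)
        (σ := fun p => ((l p.1).get p.2).lab.sym) (Comp.weaken hF h)
        (comp_getItem hF hl 2 fun p => rfl)))
    (Comp.ofList_cons hF (Comp.ofFn hF
      (f := fun i j => ofOMarking ((γ i).s.outOf (γ i).cc ((l i).get j).lab.sym)) hm
      (comp_outOf hF (γ := fun p : (Σ i, Fin (l i).length) => γ p.1)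
        (σ := fun p => ((l p.1).get p.2).lab.sym) (Comp.weaken hF h)
        (comp_getItem hF hl 2 fun p => rfl)))
      (Comp.ofList_nil hF)))))))))).congr fun i => ?_
  have hc : (List.ofFn fun c => ofNGVAS
      ((assemble (γ i).s (γ i).cc (l i) (O i) (T i) (E i) (w i)).child c)) =
      (((O i).map fun o => o.kid) ++ (((E i).map fun e => e.fst) ++
        (E i).map fun e => e.snd)).map ofNGVAS := by
    unfold assemble
    dsimp only
    rw [ofList_ofFn_append, ofList_ofFn_append]
    have key : ∀ {α : Type} (L : List α) (f : α → NGVAS (γ i).d),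
        (List.ofFn fun j => ofNGVAS (f (L.get j))) = (L.map f).map ofNGVAS := fun L f =>
      List.ext_getElem (by simp) fun j h _ => by simp
    rw [key, key, key, List.map_append, List.map_append]
  rw [encPre, hc]
  rfl

theorem comp_nodes (hF : Scale F) (h : Comp F enc fun i => encGr (γ i))
    (hT : Comp F enc fun i => encL encEntry (T i)) (hR : Comp F enc fun i => encL encRule (R i))
    (hl : Comp F enc fun i => encL ofCGSym (l i)) (hX : Comp F enc fun i => ofCGSym (X i)) :
    Comp F enc fun i => encL encPre (nodes (γ i).child (γ i).s (T i) (R i) (X i) (l i)) := by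
  classical
  have h2 := comp_twos hF hR hl
  have he := comp_exits hF h hT hR hl
  have hc : Comp F enc fun i => encL (encL encExit)
      (exitChoices (γ i).child (γ i).s (T i) (R i) (l i)) := by
    refine Comp.apply_ite' hF (ea := fun i => encL (encL (encExit (d := (γ i).d)
      (m := (l i).length)))) (CompP.nonempty hF (ea := fun i => encTwo (m := (l i).length)) h2)
      (Comp.singleton hF (ea := fun i => encL (encExit (d := (γ i).d) (m := (l i).length))) he)
      (Comp.map hF (ea := fun i => encExit (d := (γ i).d) (m := (l i).length)) he ?_)
    exact Comp.singleton hF (ea := fun p : (Σ i, ExitItem (γ i).d (l i).length) =>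
      encExit (d := (γ p.1).d) (m := (l p.1).length)) (Comp.var hF)
  refine Comp.flatMap hF (ea := fun i => encL (encExit (d := (γ i).d) (m := (l i).length))) hc ?_
  refine Comp.map hF (ea := fun (p : Σ i, List (ExitItem (γ i).d (l i).length))
      (j : Fin (l p.1).length) => ofNat j)
    (comp_idxs hF (X := fun p : (Σ i, List (ExitItem (γ i).d (l i).length)) => X p.1)
      (l := fun p => l p.1) (Comp.weaken hF hl) (Comp.weaken hF hX)) ?_
  exact comp_assemble hF (γ := fun p : (Σ p : (Σ i, List (ExitItem (γ i).d (l i).length)),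
      Fin (l p.1).length) => γ p.1.1) (l := fun p => l p.1.1)
    (O := fun p => ones (γ p.1.1).child (γ p.1.1).s (T p.1.1) (R p.1.1) (l p.1.1))
    (T := fun p => twos (R p.1.1) (l p.1.1)) (E := fun p => p.1.2) (w := fun p => p.2)
    (Comp.weaken hF (Comp.weaken hF h)) (Comp.weaken hF (Comp.weaken hF hl))
    (Comp.weaken hF (Comp.weaken hF (comp_ones hF h hT hR hl)))
    (Comp.weaken hF (Comp.weaken hF h2)) (Comp.weaken hF (Comp.var hF)) (Comp.var hF)

variable {S : ∀ i, List (CGSym (γ i).d (γ i).n (γ i).k × CGSym (γ i).d (γ i).n (γ i).k)}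
  {C : ∀ i, List (CGSym (γ i).d (γ i).n (γ i).k × List (CGSym (γ i).d (γ i).n (γ i).k))}

theorem comp_build (hF : Scale F) (h : Comp F enc fun i => encGr (γ i))
    (hT : Comp F enc fun i => encL encEntry (T i)) (hR : Comp F enc fun i => encL encRule (R i))
    (hS : Comp F enc fun i => encL (encPair ofCGSym ofCGSym) (S i))
    (hX : Comp F enc fun i => ofCGSym (X i)) (hl : Comp F enc fun i => encL ofCGSym (l i)) :
    Comp F enc fun i =>
      encL encPre (build (γ i).child (γ i).s (T i) (R i) (S i) (X i) (l i)) := by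
  classical
  refine Comp.append hF (ea := fun i => encPre (d := (γ i).d)) (Comp.flatMap hF (ea := fun i =>
    encPair (ofCGSym (d := (γ i).d) (n := (γ i).n) (k := (γ i).k)) ofCGSym) hS ?_)
    (comp_nodes hF h hT hR hl hX)
  have hq := Comp.var (enc := enc) hF (ea := fun i =>
    encPair (ofCGSym (d := (γ i).d) (n := (γ i).n) (k := (γ i).k))
      (ofCGSym (d := (γ i).d) (n := (γ i).n) (k := (γ i).k)))
  exact Comp.apply_ite' hF (ea := fun p : (Σ i, CGSym (γ i).d (γ i).n (γ i).k ×
      CGSym (γ i).d (γ i).n (γ i).k) => encL (encPre (d := (γ p.1).d)))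
    (CompP.cgsym_eq hF (Comp.hd hF hq) (Comp.weaken hF hX))
    (comp_lookup hF (Comp.weaken hF hT) (Comp.tl hF hq)) (Comp.const hF .nil)

theorem comp_tableStep (hF : Scale F) (h : Comp F enc fun i => encGr (γ i))
    (hT : Comp F enc fun i => encL encEntry (T i)) (hR : Comp F enc fun i => encL encRule (R i))
    (hS : Comp F enc fun i => encL (encPair ofCGSym ofCGSym) (S i))
    (hC : Comp F enc fun i => encL encPlan (C i)) :
    Comp F enc fun i =>
      encL encEntry (tableStep (γ i).child (γ i).s (R i) (S i) (C i) (T i)) := by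
  refine Comp.map hF (ea := fun i => encPlan (d := (γ i).d) (n := (γ i).n) (k := (γ i).k)) hC ?_
  have hq := Comp.var (enc := enc) hF
    (ea := fun i => encPlan (d := (γ i).d) (n := (γ i).n) (k := (γ i).k))
  exact Comp.cons hF (Comp.hd hF hq) (comp_build hF (γ := fun p : (Σ i, CGSym (γ i).d (γ i).n
      (γ i).k × List (CGSym (γ i).d (γ i).n (γ i).k)) => γ p.1) (T := fun p => T p.1)
    (R := fun p => R p.1) (S := fun p => S p.1) (X := fun p => p.2.1) (l := fun p => p.2.2)
    (Comp.weaken hF h) (Comp.weaken hF hT) (Comp.weaken hF hR) (Comp.weaken hF hS)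
    (Comp.hd hF hq) (Comp.tl hF hq))

end Nodes

/-- The data that remain constant while tables are computed. -/
structure Setup where
  γ : Gr
  R : List (Rule γ.d γ.n γ.k)
  S : List (CGSym γ.d γ.n γ.k × CGSym γ.d γ.n γ.k)
  C : List (CGSym γ.d γ.n γ.k × List (CGSym γ.d γ.n γ.k))

/-- Codes of setups. -/
def encSetup (σ : Setup) : Data :=
  ofList [encGr σ.γ, encL encRule σ.R, encL (encPair ofCGSym ofCGSym) σ.S, encL encPlan σ.C]

/-- Rules and components are computed before the loop and become part of its context. What remains
in a round is polynomial in the context and in the table. -/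
theorem comp_tables : Comp tower encSetup fun σ => encL encEntry
    ((tableStep σ.γ.child σ.γ.s σ.R σ.S σ.C)^[rounds σ.γ.d σ.R.length] []) := by
  have hs : ∀ {F}, Scale F → Comp F encSetup encSetup := fun hF => Comp.self hF
  have hF := scale_tower
  have hd := comp_d hF (γ := fun σ : Setup => σ.γ) (Comp.item hF 0 (hs hF))
  have hr := Comp.length hF (L := fun σ : Setup => σ.R) (Comp.item hF 1 (hs hF))
  refine Comp.iterate (eb := fun σ : Setup =>
      encL (encEntry (d := σ.γ.d) (n := σ.γ.n) (k := σ.γ.k)))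
    (f := fun σ : Setup => tableStep σ.γ.child σ.γ.s σ.R σ.S σ.C) (b := fun _ => [])
    (N := fun σ : Setup => rounds σ.γ.d σ.R.length)
    (Comp.nat_mul hF (Comp.nat_add hF (Comp.nat_add hF hd hd) (Comp.nat_const hF 1))
      (Comp.nat_add hF (Comp.nat_add hF hr hr) (Comp.nat_const hF 2))) (Comp.const hF .nil) ?_
  have hP := scale_poly
  have w := fun j => Comp.item hP j (Comp.weaken hP (ea := fun σ : Setup =>
      encL (encEntry (d := σ.γ.d) (n := σ.γ.n) (k := σ.γ.k))) (hs hP))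
  exact comp_tableStep hP (γ := fun p : (Σ σ : Setup, Table σ.γ.d σ.γ.n σ.γ.k) => p.1.γ)
    (T := fun p => p.2) (R := fun p => p.1.R) (S := fun p => p.1.S) (C := fun p => p.1.C)
    (w 0) (Comp.var hP) (w 1) (w 2) (w 3)

/-- Inputs of the decomposition. -/
structure Inp where
  γ : Gr
  μ : OMarking γ.d
  A : Fin γ.n
  ν : OMarking γ.d
  G : CovGrammar γ.d γ.n γ.k

/-- Codes of inputs. -/
def encInp (x : Inp) : Data := ofInput (.node x.γ.child x.γ.s) x.μ x.A x.ν x.G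

theorem comp_decomposition : Comp tower encInp fun x =>
    encL ofNGVAS (decomposition x.γ.child x.γ.s x.μ x.ν x.G) := by
  classical
  have hF := scale_tower
  have h (j) := Comp.item hF j (Comp.self (enc := encInp) hF)
  have hγ : Comp tower encInp fun x => encGr x.γ := Comp.cons hF (h 0) (h 1)
  have hR := comp_rules (γ := fun x : Inp => x.γ) (G := fun x => x.G) hγ (h 5)
  have hS := comp_singles (G := fun x : Inp => x.G) (h 5)
  have hC := comp_plan (γ := fun x : Inp => x.γ) (G := fun x => x.G) hγ (h 5)
  have hT : Comp tower encInp fun x => encL encEntry (tableAt x.γ.child x.γ.s x.G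
      (rounds x.γ.d (rules x.γ.s (fun c => (x.γ.child c).ctx) x.G).length)) :=
    Comp.subst hF (φ := fun x : Inp => (⟨x.γ, rules x.γ.s x.γ.cc x.G, singles x.G,
      plan x.γ.s x.γ.cc x.G⟩ : Setup)) comp_tables (Comp.ofList_cons hF hγ
      (Comp.ofList_cons hF hR (Comp.ofList_cons hF hS (Comp.ofList_cons hF hC
        (Comp.ofList_nil hF)))))
  refine Comp.flatMap hF (ea := fun x : Inp =>
    encPair (ofCGSym (d := x.γ.d) (n := x.γ.n) (k := x.γ.k)) ofCGSym) hS ?_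
  have hq := Comp.var (enc := encInp) hF (ea := fun x : Inp =>
    encPair (ofCGSym (d := x.γ.d) (n := x.γ.n) (k := x.γ.k))
      (ofCGSym (d := x.γ.d) (n := x.γ.n) (k := x.γ.k)))
  refine Comp.apply_ite' hF (ea := fun p : (Σ x : Inp, CGSym x.γ.d x.γ.n x.γ.k ×
      CGSym x.γ.d x.γ.n x.γ.k) => encL (ofNGVAS (d := p.1.γ.d)))
    (CompP.cgsym_eq hF (Comp.hd hF hq) (Comp.weaken hF (Comp.item hF 2 (h 5)))) ?_
    (Comp.const hF .nil)
  refine Comp.map hF (ea := fun p : (Σ x : Inp, CGSym x.γ.d x.γ.n x.γ.k ×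
      CGSym x.γ.d x.γ.n x.γ.k) => encPre (d := p.1.γ.d))
    (comp_lookup hF (T := fun p : (Σ x : Inp, CGSym x.γ.d x.γ.n x.γ.k ×
      CGSym x.γ.d x.γ.n x.γ.k) => tableAt p.1.γ.child p.1.γ.s p.1.G
      (rounds p.1.γ.d (rules p.1.γ.s (fun c => (p.1.γ.child c).ctx) p.1.G).length))
      (X := fun p => p.2.2) (Comp.weaken hF hT) (Comp.tl hF hq)) ?_
  exact comp_fill hF (d := fun p : (Σ p : (Σ x : Inp, CGSym x.γ.d x.γ.n x.γ.k ×
      CGSym x.γ.d x.γ.n x.γ.k), Pre p.1.γ.d) => p.1.1.γ.d) (P := fun p => p.2)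
    (c := fun p => variantCtx p.1.1.μ p.1.1.ν) (Comp.var hF) (Comp.weaken hF (Comp.weaken hF
    (comp_variantCtx (μ := fun x : Inp => x.μ) (ν := fun x => x.ν) (h 0) (h 2) (h 4))))

theorem exists_program : ∃ (P : Prog) (e : ℕ), ∀ (d n k : ℕ) (child : Fin k → NGVAS d)
    (s : Shell d n k) (μ : OMarking d) (A : Fin n) (ν : OMarking d) (G : CovGrammar d n k),
    P.ComputesWithin (ofInput (.node child s) μ A ν G)
      (ofList ((decomposition child s μ ν G).map ofNGVAS))
      (tower e (ofInput (.node child s) μ A ν G).size) := by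
  obtain ⟨g, hg, e⟩ := comp_decomposition
  obtain ⟨P, a, hP⟩ := hg.computesWithin
  refine ⟨P, a, fun d n k child s μ A ν G => ?_⟩
  have h := hP (encInp ⟨⟨d, n, k, child, s⟩, μ, A, ν, G⟩)
  rw [e ⟨⟨d, n, k, child, s⟩, μ, A, ν, G⟩] at h
  exact h

end Assembly
end NestedVAS

namespace NestedVAS

/-! ## Derivations and runs -/

section Derivations

variable {d n k : ℕ} {s : Shell d n k}

/-- The symbol derives the terminal word. -/
inductive Yields (s : Shell d n k) : Symbol (Fin k) (Fin n) → List (Fin k) → Prop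
  | terminal (c : Fin k) : Yields s (.terminal c) [c]
  | node {A : Fin n} {σ τ : Symbol (Fin k) (Fin n)} {u v : List (Fin k)} :
      (A, σ, τ) ∈ s.prods → Yields s σ u → Yields s τ v → Yields s (.nonterminal A) (u ++ v)

/-- The sentential form derives the terminal word. -/
inductive YieldsL (s : Shell d n k) : List (Symbol (Fin k) (Fin n)) → List (Fin k) → Prop
  | nil : YieldsL s [] []
  | cons {σ : Symbol (Fin k) (Fin n)} {f : List (Symbol (Fin k) (Fin n))} {u w : List (Fin k)} :
      Yields s σ u → YieldsL s f w → YieldsL s (σ :: f) (u ++ w)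

theorem YieldsL.append {f g : List (Symbol (Fin k) (Fin n))} {u v : List (Fin k)}
    (hf : YieldsL s f u) (hg : YieldsL s g v) : YieldsL s (f ++ g) (u ++ v) := by
  induction hf with
  | nil => exact hg
  | cons h _ ih => rw [List.append_assoc]; exact .cons h ih

theorem YieldsL.split {f g : List (Symbol (Fin k) (Fin n))} {w : List (Fin k)}
    (h : YieldsL s (f ++ g) w) : ∃ u v, YieldsL s f u ∧ YieldsL s g v ∧ w = u ++ v := by
  induction f generalizing w with
  | nil => exact ⟨[], w, .nil, h, rfl⟩
  | cons σ f ih =>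
    obtain _ | ⟨h1, h2⟩ := h
    obtain ⟨u, v, hu, hv, rfl⟩ := ih h2
    exact ⟨_, v, .cons h1 hu, hv, by simp⟩

theorem yieldsL_singleton {σ : Symbol (Fin k) (Fin n)} {w : List (Fin k)} :
    YieldsL s [σ] w ↔ Yields s σ w := by
  constructor
  · intro h
    obtain _ | ⟨h1, h2⟩ := h
    cases h2
    simpa using h1
  · intro h
    simpa using YieldsL.cons h .nil

theorem yieldsL_terminals (w : List (Fin k)) : YieldsL s (w.map Symbol.terminal) w := by
  induction w with
  | nil => exact .nil
  | cons c w ih => exact .cons (.terminal c) ih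

theorem mem_rules {r : ContextFreeRule (Fin k) (Fin n)} :
    r ∈ s.cfg.rules ↔ ∃ p ∈ s.prods, r = ⟨p.1, [p.2.1, p.2.2]⟩ := by
  simp only [Shell.cfg, List.mem_toFinset, List.mem_map, eq_comm]

theorem produces_iff {f g : List (Symbol (Fin k) (Fin n))} : s.cfg.Produces f g ↔
    ∃ p ∈ s.prods, ∃ x y, f = x ++ [Symbol.nonterminal p.1] ++ y ∧
      g = x ++ [p.2.1, p.2.2] ++ y := by
  constructor
  · rintro ⟨r, hr, h⟩
    obtain ⟨p, hp, rfl⟩ := mem_rules.mp hr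
    obtain ⟨x, y, h1, h2⟩ := h.exists_parts
    exact ⟨p, hp, x, y, h1, h2⟩
  · rintro ⟨p, hp, x, y, rfl, rfl⟩
    exact ⟨_, mem_rules.mpr ⟨p, hp, rfl⟩, ContextFreeRule.rewrites_of_exists_parts _ x y⟩

theorem derives_prod {p : Fin n × Symbol (Fin k) (Fin n) × Symbol (Fin k) (Fin n)}
    (hp : p ∈ s.prods) : s.Derives p.1 [p.2.1, p.2.2] :=
  ContextFreeGrammar.Produces.single (produces_iff.mpr ⟨p, hp, [], [], rfl, rfl⟩)

theorem derives_append {f f' g g' : List (Symbol (Fin k) (Fin n))} (h : s.cfg.Derives f f')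
    (h' : s.cfg.Derives g g') : s.cfg.Derives (f ++ g) (f' ++ g') :=
  (h.append_right g).trans (h'.append_left f')

theorem Yields.derives {σ : Symbol (Fin k) (Fin n)} {w : List (Fin k)} (h : Yields s σ w) :
    s.cfg.Derives [σ] (w.map Symbol.terminal) := by
  induction h with
  | terminal c => exact ContextFreeGrammar.Derives.refl _
  | node hp _ _ ih ih' =>
    rw [List.map_append]
    exact (derives_prod hp).trans (derives_append ih ih')

theorem YieldsL.derives {f : List (Symbol (Fin k) (Fin n))} {w : List (Fin k)}
    (h : YieldsL s f w) : s.cfg.Derives f (w.map Symbol.terminal) := by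
  induction h with
  | nil => exact ContextFreeGrammar.Derives.refl _
  | cons h _ ih => rw [List.map_append]; exact derives_append h.derives ih

theorem yieldsL_of_derives {f g : List (Symbol (Fin k) (Fin n))} {w : List (Fin k)}
    (h : s.cfg.Derives f g) (hg : YieldsL s g w) : YieldsL s f w := by
  induction h using Relation.ReflTransGen.head_induction_on with
  | refl => exact hg
  | head h _ ih =>
    obtain ⟨p, hp, x, y, rfl, rfl⟩ := produces_iff.mp h
    obtain ⟨u, v, hu, hv, rfl⟩ := ih.split
    obtain ⟨u1, u2, hu1, hu2, rfl⟩ := hu.split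
    refine (hu1.append (yieldsL_singleton.mpr ?_)).append hv
    obtain ⟨a, b, ha, hb, rfl⟩ := YieldsL.split (f := [p.2.1]) (g := [p.2.2]) hu2
    exact .node hp (yieldsL_singleton.mp ha) (yieldsL_singleton.mp hb)

theorem derives_iff_yieldsL {f : List (Symbol (Fin k) (Fin n))} {w : List (Fin k)} :
    s.cfg.Derives f (w.map Symbol.terminal) ↔ YieldsL s f w :=
  ⟨fun h => yieldsL_of_derives h (yieldsL_terminals w), YieldsL.derives⟩

theorem derives_iff_yields {σ : Symbol (Fin k) (Fin n)} {w : List (Fin k)} :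
    s.cfg.Derives [σ] (w.map Symbol.terminal) ↔ Yields s σ w :=
  derives_iff_yieldsL.trans yieldsL_singleton

theorem derives_induction {A : Fin n} {w : List (Symbol (Fin k) (Fin n))}
    {C : List (Symbol (Fin k) (Fin n)) → Prop} (h : s.Derives A w)
    (h0 : C [.nonterminal A]) (h1 : ∀ p ∈ s.prods, ∀ x y,
      C (x ++ [Symbol.nonterminal p.1] ++ y) → C (x ++ [p.2.1, p.2.2] ++ y)) : C w := by
  induction h with
  | refl => exact h0
  | tail _ h ih =>
    obtain ⟨p, hp, x, y, rfl, rfl⟩ := produces_iff.mp h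
    exact h1 p hp x y ih

end Derivations

section Runs

variable {d n k : ℕ} {child : Fin k → NGVAS d} {s : Shell d n k}

theorem mem_concatRuns_append {L L' : List (Set (Run d))} {r : Run d} :
    r ∈ concatRuns (L ++ L') ↔ ∃ m u v, (r.1, u, m) ∈ concatRuns L ∧
      (m, v, r.2.2) ∈ concatRuns L' ∧ r.2.1 = u ++ v := by
  induction L generalizing r with
  | nil =>
    constructor
    · intro h
      exact ⟨r.1, [], r.2.1, ⟨rfl, rfl⟩, h, rfl⟩
    · rintro ⟨m, u, v, ⟨h1, h2⟩, h3, h4⟩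
      obtain ⟨a, b, c⟩ := r
      dsimp only at h1 h2 h3 h4
      subst h1 h2
      simpa [h4] using h3
  | cons R L ih =>
    constructor
    · rintro ⟨m, u, v, h1, h2, h3⟩
      obtain ⟨m', u', v', h4, h5, h6⟩ := ih.mp h2
      exact ⟨m', u ++ u', v', ⟨m, u, u', h1, h4, rfl⟩, h5, by simp_all⟩
    · rintro ⟨m, u, v, ⟨m', u', v', h1, h2, h3⟩, h4, h5⟩
      exact ⟨m', u', v' ++ v, h1, ih.mpr ⟨m, v', v, h2, h4, rfl⟩, by simp_all⟩

theorem concatRuns_singleton (R : Set (Run d)) : concatRuns [R] = R := by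
  ext ⟨a, b, c⟩
  constructor
  · rintro ⟨m, u, v, h1, ⟨h2, h3⟩, h4⟩
    dsimp only at *
    subst h2 h3 h4
    simpa using h1
  · intro h
    exact ⟨c, b, [], h, ⟨rfl, rfl⟩, by simp⟩

theorem mem_symRuns {σ : Symbol (Fin k) (Fin n)} {r : Run d} : r ∈ symRuns child s σ ↔
    ∃ w, Yields s σ w ∧ r ∈ concatRuns (w.map fun c => (child c).runs) := by
  cases σ with
  | terminal c =>
    constructor
    · intro h
      exact ⟨[c], .terminal c, by rw [List.map_singleton, concatRuns_singleton]; exact h⟩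
    · rintro ⟨w, hw, h⟩
      cases hw
      rwa [List.map_singleton, concatRuns_singleton] at h
  | nonterminal A =>
    simp only [← derives_iff_yields]
    rfl

theorem mem_symRuns_node {A : Fin n} {σ τ : Symbol (Fin k) (Fin n)} (hp : (A, σ, τ) ∈ s.prods)
    {a b c : Marking d} {u v : List (Update d)} (h : (a, u, b) ∈ symRuns child s σ)
    (h' : (b, v, c) ∈ symRuns child s τ) :
    (a, u ++ v, c) ∈ symRuns child s (.nonterminal A) := by
  obtain ⟨w, hw, h⟩ := mem_symRuns.mp h
  obtain ⟨w', hw', h'⟩ := mem_symRuns.mp h'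
  refine mem_symRuns.mpr ⟨w ++ w', .node hp hw hw', ?_⟩
  rw [List.map_append]
  exact mem_concatRuns_append.mpr ⟨b, u, v, h, h', rfl⟩

theorem mem_runs_node {r : Run d} : r ∈ (NGVAS.node child s).runs ↔
    r ∈ symRuns child s (.nonterminal s.start) ∧ s.ctx.Admits r := by
  rw [NGVAS.runs]
  rfl

/-- Derivation trees with runs. -/
inductive RTree (d n k : ℕ) : Type
  | leaf (c : Fin k) (r : Run d) : RTree d n k
  | node (A : Fin n) (l r : RTree d n k) : RTree d n k

namespace RTree

/-- The symbol at the root. -/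
def sym : RTree d n k → Symbol (Fin k) (Fin n)
  | leaf c _ => .terminal c
  | node A _ _ => .nonterminal A

/-- The run of the tree. -/
def run : RTree d n k → Run d
  | leaf _ r => r
  | node _ l r => (l.run.1, l.run.2.1 ++ r.run.2.1, r.run.2.2)

/-- The tree is a derivation tree of a run. -/
def Valid (child : Fin k → NGVAS d) (s : Shell d n k) : RTree d n k → Prop
  | leaf c r => r ∈ (child c).runs
  | node A l r => (A, l.sym, r.sym) ∈ s.prods ∧ l.Valid child s ∧ r.Valid child s ∧
      l.run.2.2 = r.run.1

theorem exists_of_mem {σ : Symbol (Fin k) (Fin n)} {r : Run d} (h0 : r ∈ symRuns child s σ) :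
    ∃ t : RTree d n k, t.Valid child s ∧ t.sym = σ ∧ t.run = r := by
  obtain ⟨w, hw, h⟩ := mem_symRuns.mp h0
  clear h0
  induction hw generalizing r with
  | terminal c =>
    rw [List.map_singleton, concatRuns_singleton] at h
    exact ⟨leaf c r, h, rfl, rfl⟩
  | @node A σ τ u v hp _ _ ih ih' =>
    rw [List.map_append] at h
    obtain ⟨m, x, y, h1, h2, h3⟩ := mem_concatRuns_append.mp h
    obtain ⟨t, ht, rfl, e⟩ := ih h1
    obtain ⟨t', ht', rfl, e'⟩ := ih' h2
    exact ⟨node A t t', ⟨hp, ht, ht', by rw [e, e']⟩, rfl, by simp [run, e, e', ← h3]⟩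

end RTree

/-- The induction behind the soundness of the constructed NGVAS: there, I assigns to each new symbol
the runs of the symbol of N that labels it. -/
theorem symRuns_subset {I : Symbol (Fin k) (Fin n) → Set (Run d)}
    (ht : ∀ c, (child c).runs ⊆ I (.terminal c))
    (hp : ∀ p ∈ s.prods, ∀ a b c u v, (a, u, b) ∈ I p.2.1 → (b, v, c) ∈ I p.2.2 →
      (a, u ++ v, c) ∈ I (.nonterminal p.1)) (σ : Symbol (Fin k) (Fin n)) :
    symRuns child s σ ⊆ I σ := by
  intro r h0
  obtain ⟨t, h, rfl, rfl⟩ := RTree.exists_of_mem h0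
  clear h0
  induction t with
  | leaf c r => exact ht c h
  | node A l r ihl ihr =>
    obtain ⟨h1, h2, h3, h4⟩ := h
    refine hp _ h1 _ l.run.2.2 _ _ _ (ihl h2) ?_
    rw [h4]
    exact ihr h3

theorem mem_runs_sum {M : NGVAS d} {r : Run d} (h : r ∈ M.runs) : r.2.1.sum ∈ M.ctx.restr := by
  cases M <;> rw [NGVAS.runs] at h <;> exact h.2.1

theorem updRuns_effect {u : Update d} {r : Run d} (h : r ∈ updRuns u) (i : Fin d) :
    (r.2.2 i : ℤ) = r.1 i + r.2.1.sum i := by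
  rw [h.2 i, h.1]; simp

theorem concatRuns_effect {L : List (Set (Run d))}
    (hL : ∀ R ∈ L, ∀ r ∈ R, ∀ i, (r.2.2 i : ℤ) = r.1 i + r.2.1.sum i) {r : Run d}
    (h : r ∈ concatRuns L) (i : Fin d) : (r.2.2 i : ℤ) = r.1 i + r.2.1.sum i := by
  induction L generalizing r with
  | nil => obtain ⟨h1, h2⟩ := h; simp [h1, h2]
  | cons R L ih =>
    obtain ⟨m, u, v, h1, h2, h3⟩ := h
    have e1 := hL R (by simp) _ h1 i
    have e2 := ih (fun R hR => hL R (by simp [hR])) h2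
    dsimp only at e1 e2
    rw [h3, List.sum_append, e2, e1, Pi.add_apply]
    ring

theorem runs_effect {M : NGVAS d} {r : Run d} (h : r ∈ M.runs) (i : Fin d) :
    (r.2.2 i : ℤ) = r.1 i + r.2.1.sum i := by
  induction M generalizing r i with
  | leaf w c =>
    rw [NGVAS.runs] at h
    refine concatRuns_effect ?_ h.1 i
    simp only [List.mem_map]
    rintro _ ⟨u, _, rfl⟩ r hr
    exact updRuns_effect hr
  | node child s ih =>
    rw [NGVAS.runs] at h
    obtain ⟨⟨w, _, h⟩, _⟩ := h
    refine concatRuns_effect ?_ h i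
    simp only [List.mem_map]
    rintro _ ⟨c, _, rfl⟩ r hr j
    exact ih c hr j

end Runs
end NestedVAS

namespace NestedVAS

/-! ## Effects of derivations and the cycle space -/

/-- As long as the chain grows, each step adds an element of U, so two neighbours agree after at
most |U| - |f 0| steps; by `hs` the chain is constant from there on. This yields the number of
rounds for both fixed points computed below. -/
theorem subset_of_stable {α : Type*} [DecidableEq α] (f : ℕ → Finset α) (U : Finset α)
    (hm : ∀ m, f m ⊆ f (m + 1)) (hs : ∀ m, f m = f (m + 1) → f (m + 1) = f (m + 2))
    (hU : ∀ m, f m ⊆ U) (m : ℕ) : f m ⊆ f (U.card - (f 0).card) := by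
  have mono : Monotone f := monotone_nat_of_le_succ hm
  have key : ∀ m, (∃ j < m, f j = f (j + 1)) ∨ m + (f 0).card ≤ (f m).card := by
    intro m
    induction m with
    | zero => right; simp
    | succ m ih =>
      rcases ih with ⟨j, hj, e⟩ | h
      · exact .inl ⟨j, by omega, e⟩
      · by_cases e : f m = f (m + 1)
        · exact .inl ⟨m, by omega, e⟩
        · have := Finset.card_lt_card ((hm m).ssubset_of_ne e)
          right; omega
  have h0 := Finset.card_le_card (hU 0)
  rcases key (U.card - (f 0).card + 1) with ⟨j, hj, e⟩ | h
  · have st : ∀ i, f (j + i) = f (j + i + 1) := by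
      intro i
      induction i with
      | zero => exact e
      | succ i ih => exact hs _ ih
    have eq : ∀ i, f (j + i) = f j := by
      intro i
      induction i with
      | zero => rfl
      | succ i ih => rw [← ih]; exact (st i).symm
    have h1 : f m ⊆ f j := by
      rcases le_total m j with h | h
      · exact mono h
      · obtain ⟨i, rfl⟩ := Nat.exists_eq_add_of_le h
        rw [eq]
    exact h1.trans (mono (by omega))
  · have := Finset.card_le_card (hU (U.card - (f 0).card + 1))
    omega

section Effects

variable {d n k : ℕ} {s : Shell d n k} {cc : Fin k → Context d}

theorem ceff_nil : (0 : Update d) ∈ ceff cc [] := ⟨[], .nil, rfl⟩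

theorem ceff_append {u v : List (Fin k)} {x y : Update d} (hx : x ∈ ceff cc u)
    (hy : y ∈ ceff cc v) : x + y ∈ ceff cc (u ++ v) := by
  obtain ⟨l, hl, rfl⟩ := hx
  obtain ⟨l', hl', rfl⟩ := hy
  exact ⟨l ++ l', List.rel_append hl hl', by simp⟩

theorem ceff_split {u v : List (Fin k)} {z : Update d} (hz : z ∈ ceff cc (u ++ v)) :
    ∃ x ∈ ceff cc u, ∃ y ∈ ceff cc v, z = x + y := by
  induction u generalizing z with
  | nil => exact ⟨0, ceff_nil, z, hz, by simp⟩
  | cons c u ih =>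
    obtain ⟨l, hl, rfl⟩ := hz
    obtain _ | ⟨h1, h2⟩ := hl
    obtain ⟨x, ⟨l1, h3, rfl⟩, y, hy, e⟩ := ih ⟨_, h2, rfl⟩
    exact ⟨_, ⟨_ :: l1, .cons h1 h3, rfl⟩, y, hy, by rw [List.sum_cons, e, List.sum_cons, add_assoc]⟩

theorem ceff_singleton {c : Fin k} {x : Update d} : x ∈ ceff cc [c] ↔ x ∈ (cc c).restr := by
  constructor
  · rintro ⟨l, hl, rfl⟩
    obtain _ | ⟨h1, h2⟩ := hl
    cases h2
    simpa using h1
  · intro h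
    exact ⟨[x], .cons h .nil, by simp⟩

theorem base_mem_restr (c : Context d) : c.base ∈ c.restr := ⟨0, zero_mem _, by simp⟩

theorem exists_ceff (w : List (Fin k)) : ∃ x, x ∈ ceff cc w := by
  induction w with
  | nil => exact ⟨0, ceff_nil⟩
  | cons c w ih =>
    obtain ⟨x, hx⟩ := ih
    exact ⟨_, ceff_append (u := [c]) (ceff_singleton.mpr (base_mem_restr _)) hx⟩

/-- Effects of derivations of terminal words from a symbol. -/
def Eff (s : Shell d n k) (cc : Fin k → Context d) (σ : Symbol (Fin k) (Fin n))
    (x : Update d) : Prop := ∃ w, Yields s σ w ∧ x ∈ ceff cc w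

/-- Effects of derivations of terminal words from a sentential form. -/
def EffL (s : Shell d n k) (cc : Fin k → Context d) (f : List (Symbol (Fin k) (Fin n)))
    (x : Update d) : Prop := ∃ w, YieldsL s f w ∧ x ∈ ceff cc w

theorem Eff.terminal {c : Fin k} {x : Update d} (h : x ∈ (cc c).restr) :
    Eff s cc (.terminal c) x := ⟨[c], .terminal c, ceff_singleton.mpr h⟩

theorem Eff.node {p : Fin n × Symbol (Fin k) (Fin n) × Symbol (Fin k) (Fin n)} (hp : p ∈ s.prods)
    {x y : Update d} (hx : Eff s cc p.2.1 x) (hy : Eff s cc p.2.2 y) :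
    Eff s cc (.nonterminal p.1) (x + y) := by
  obtain ⟨u, hu, hx⟩ := hx
  obtain ⟨v, hv, hy⟩ := hy
  exact ⟨u ++ v, .node hp hu hv, ceff_append hx hy⟩

theorem Eff.induction {C : Symbol (Fin k) (Fin n) → Update d → Prop}
    (h0 : ∀ c, ∀ x ∈ (cc c).restr, C (.terminal c) x)
    (h1 : ∀ p ∈ s.prods, ∀ x y, C p.2.1 x → C p.2.2 y → C (.nonterminal p.1) (x + y))
    {σ : Symbol (Fin k) (Fin n)} {x : Update d} (h : Eff s cc σ x) : C σ x := by
  obtain ⟨w, hw, hx⟩ := h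
  induction hw generalizing x with
  | terminal c => exact h0 c x (ceff_singleton.mp hx)
  | node hp _ _ ih ih' =>
    obtain ⟨y, hy, z, hz, rfl⟩ := ceff_split hx
    exact h1 _ hp y z (ih hy) (ih' hz)

theorem EffL.nil : EffL s cc [] 0 := ⟨[], .nil, ceff_nil⟩

theorem effL_singleton {σ : Symbol (Fin k) (Fin n)} {x : Update d} :
    EffL s cc [σ] x ↔ Eff s cc σ x := by
  simp only [EffL, Eff, yieldsL_singleton]

theorem EffL.append {f g : List (Symbol (Fin k) (Fin n))} {x y : Update d} (hx : EffL s cc f x)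
    (hy : EffL s cc g y) : EffL s cc (f ++ g) (x + y) := by
  obtain ⟨u, hu, hx⟩ := hx
  obtain ⟨v, hv, hy⟩ := hy
  exact ⟨u ++ v, hu.append hv, ceff_append hx hy⟩

theorem EffL.of_derives {f : List (Symbol (Fin k) (Fin n))} {A : Fin n} {x : Update d}
    (h : s.Derives A f) (hx : EffL s cc f x) : Eff s cc (.nonterminal A) x := by
  obtain ⟨w, hw, hx⟩ := hx
  exact ⟨w, yieldsL_singleton.mp (yieldsL_of_derives h hw), hx⟩

theorem exists_effL (hp : ∀ A, ∃ w, Yields s (.nonterminal A) w)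
    (f : List (Symbol (Fin k) (Fin n))) : ∃ x, EffL s cc f x := by
  induction f with
  | nil => exact ⟨0, .nil⟩
  | cons σ f ih =>
    obtain ⟨x, hx⟩ := ih
    have : ∃ y, Eff s cc σ y := by
      cases σ with
      | terminal c => exact ⟨_, .terminal (base_mem_restr _)⟩
      | nonterminal A =>
        obtain ⟨w, hw⟩ := hp A
        obtain ⟨y, hy⟩ := exists_ceff (cc := cc) w
        exact ⟨y, w, hw, hy⟩
    obtain ⟨y, hy⟩ := this
    exact ⟨y + x, (effL_singleton.mpr hy).append hx⟩

theorem Shell.Strong.productive (h : s.Strong) (A : Fin n) : ∃ w, Yields s (.nonterminal A) w := by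
  obtain ⟨u, v, w, _, hw⟩ := h.useful A
  obtain ⟨x, y, hx, _, rfl⟩ := (derives_iff_yieldsL.mp hw).split
  obtain ⟨a, b, _, hb, rfl⟩ := hx.split
  exact ⟨b, yieldsL_singleton.mp hb⟩

theorem exists_mem_iff_ne_nil {α : Type*} {l : List α} : (∃ x, x ∈ l) ↔ l ≠ [] :=
  ⟨fun ⟨_, h⟩ => List.ne_nil_of_mem h, List.exists_mem_of_ne_nil l⟩

/-! ### Effects of derivations by fixed-point iteration -/

section Productive

theorem mem_baseStep {T : Fin n → List (Update d)} {A : Fin n} {z : Update d} :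
    z ∈ baseStep s cc T A ↔ ∃ p ∈ s.prods, p.1 = A ∧ ∃ x ∈ symBases cc T p.2.1,
      ∃ y ∈ symBases cc T p.2.2, x + y = z := by
  simp only [baseStep, List.mem_flatMap]
  constructor
  · rintro ⟨p, hp, h⟩
    split at h
    · next e =>
      simp only [List.mem_flatMap, List.mem_map] at h
      exact ⟨p, hp, e, h⟩
    · simp at h
  · rintro ⟨p, hp, e, h⟩
    refine ⟨p, hp, ?_⟩
    rw [if_pos e]
    simpa only [List.mem_flatMap, List.mem_map] using h

theorem eff_of_mem_iterate (m : ℕ) {σ : Symbol (Fin k) (Fin n)} {x : Update d}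
    (h : x ∈ symBases cc ((baseStep s cc)^[m] fun _ => []) σ) : Eff s cc σ x := by
  induction m generalizing σ x with
  | zero =>
    cases σ with
    | terminal c => rw [List.mem_singleton.mp h]; exact .terminal (base_mem_restr _)
    | nonterminal A => simp [symBases] at h
  | succ m ih =>
    cases σ with
    | terminal c => rw [List.mem_singleton.mp h]; exact .terminal (base_mem_restr _)
    | nonterminal A =>
      rw [symBases, Function.iterate_succ_apply'] at h
      obtain ⟨p, hp, rfl, x, hx, y, hy, rfl⟩ := mem_baseStep.mp h
      exact .node hp (ih hx) (ih hy)

theorem symBases_mono {T T' : Fin n → List (Update d)} (h : ∀ A, T A ⊆ T' A)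
    (σ : Symbol (Fin k) (Fin n)) : symBases cc T σ ⊆ symBases cc T' σ := by
  cases σ with
  | terminal c => exact fun _ h => h
  | nonterminal A => exact h A

theorem baseStep_mono {T T' : Fin n → List (Update d)} (h : ∀ A, T A ⊆ T' A) (A : Fin n) :
    baseStep s cc T A ⊆ baseStep s cc T' A := by
  intro z hz
  obtain ⟨p, hp, e, x, hx, y, hy, e'⟩ := mem_baseStep.mp hz
  exact mem_baseStep.mpr ⟨p, hp, e, x, symBases_mono h _ hx, y, symBases_mono h _ hy, e'⟩

theorem iterate_baseStep_mono (m : ℕ) (A : Fin n) :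
    (baseStep s cc)^[m] (fun _ => []) A ⊆ (baseStep s cc)^[m + 1] (fun _ => []) A := by
  induction m generalizing A with
  | zero => intro x hx; simp at hx
  | succ m ih =>
    rw [Function.iterate_succ_apply' _ (m + 1)]
    conv_lhs => rw [Function.iterate_succ_apply']
    exact baseStep_mono ih A

theorem Eff.exists_iterate {σ : Symbol (Fin k) (Fin n)} {x : Update d} (h : Eff s cc σ x) :
    ∃ m, symBases cc ((baseStep s cc)^[m] fun _ => []) σ ≠ [] := by
  refine Eff.induction (C := fun σ _ => ∃ m, symBases cc ((baseStep s cc)^[m] fun _ => []) σ ≠ [])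
    (fun c x _ => ⟨0, by simp [symBases]⟩) ?_ h
  rintro p hp - - ⟨m, hm⟩ ⟨m', hm'⟩
  have mono : ∀ a b (A : Fin n), a ≤ b →
      (baseStep s cc)^[a] (fun _ => []) A ⊆ (baseStep s cc)^[b] (fun _ => []) A := by
    intro a b A hab
    induction hab with
    | refl => exact fun _ h => h
    | step _ ih => exact fun _ h => iterate_baseStep_mono _ A (ih h)
  refine ⟨max m m' + 1, ?_⟩
  obtain ⟨x, hx⟩ := List.exists_mem_of_ne_nil _ hm
  obtain ⟨y, hy⟩ := List.exists_mem_of_ne_nil _ hm'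
  refine List.ne_nil_of_mem (a := x + y) ?_
  rw [symBases, Function.iterate_succ_apply']
  exact mem_baseStep.mpr ⟨p, hp, rfl, x, symBases_mono (fun A => mono _ _ A (le_max_left _ _)) _ hx,
    y, symBases_mono (fun A => mono _ _ A (le_max_right _ _)) _ hy, rfl⟩

/-- The nonterminals with nonempty entry form an increasing chain of subsets of an n-element set, it
starts with the empty set, and each member depends only on the previous one. It is therefore
complete after n rounds. -/
theorem iterate_baseStep_ne_nil {A : Fin n} {w : List (Fin k)} (h : Yields s (.nonterminal A) w) :
    (baseStep s cc)^[n] (fun _ => []) A ≠ [] := by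
  classical
  obtain ⟨x, hx⟩ := exists_ceff (cc := cc) w
  obtain ⟨m, hm⟩ := Eff.exists_iterate (cc := cc) ⟨w, h, hx⟩
  let f : ℕ → Finset (Fin n) := fun m =>
    Finset.univ.filter fun A => (baseStep s cc)^[m] (fun _ => []) A ≠ []
  have hf : ∀ m A, A ∈ f (m + 1) ↔ ∃ p ∈ s.prods, p.1 = A ∧
      (∀ B, p.2.1 = .nonterminal B → B ∈ f m) ∧ ∀ B, p.2.2 = .nonterminal B → B ∈ f m := by
    intro m A
    have hsym : ∀ σ : Symbol (Fin k) (Fin n), (∃ x, x ∈ symBases cc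
        ((baseStep s cc)^[m] fun _ => []) σ) ↔ ∀ B, σ = .nonterminal B → B ∈ f m := by
      intro σ
      cases σ with
      | terminal c => simp [symBases]
      | nonterminal B => simp [symBases, f, exists_mem_iff_ne_nil (α := Update d)]
    simp only [← hsym]
    simp only [f, Finset.mem_filter, Finset.mem_univ, true_and, Function.iterate_succ_apply']
    rw [← exists_mem_iff_ne_nil]
    simp only [mem_baseStep]
    constructor
    · rintro ⟨_, p, hp, e, x, hx, y, hy, -⟩
      exact ⟨p, hp, e, ⟨x, hx⟩, ⟨y, hy⟩⟩
    · rintro ⟨p, hp, e, ⟨x, hx⟩, ⟨y, hy⟩⟩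
      exact ⟨_, p, hp, e, x, hx, y, hy, rfl⟩
  have h1 := subset_of_stable f Finset.univ (fun m A hA => by
      simp only [f, Finset.mem_filter, Finset.mem_univ, true_and] at hA ⊢
      exact fun h => hA (List.subset_nil.mp (h.subst (motive := fun l =>
        (baseStep s cc)^[m] (fun _ => []) A ⊆ l) (iterate_baseStep_mono m A))))
    (fun m e => by ext A; rw [hf m, hf (m + 1), ← e]) (fun m => Finset.subset_univ _) m
    (by simpa [f, symBases] using hm)
  have e0 : f 0 = ∅ := by simp [f]
  rw [e0] at h1
  simpa [f] using h1

theorem eff_symBase (hp : ∀ A, ∃ w, Yields s (.nonterminal A) w) (σ : Symbol (Fin k) (Fin n)) :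
    Eff s cc σ (symBase s cc σ) := by
  have h : symBases cc ((baseStep s cc)^[n] fun _ => []) σ ≠ [] := by
    cases σ with
    | terminal c => simp [symBases]
    | nonterminal A =>
      obtain ⟨w, hw⟩ := hp A
      exact iterate_baseStep_ne_nil hw
  obtain ⟨a, l, e⟩ := List.exists_cons_of_ne_nil h
  refine eff_of_mem_iterate n ?_
  rw [symBase, e]
  simp

end Productive

/-- Integral vectors as real ones. -/
def real (x : Update d) : Fin d → ℝ := fun i => (x i : ℝ)

theorem real_add (x y : Update d) : real (x + y) = real x + real y := by
  funext i; simp [real]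

theorem real_sub (x y : Update d) : real (x - y) = real x - real y := by
  funext i; simp [real]

theorem real_zero : real (0 : Update d) = 0 := by
  funext i; simp [real]

theorem real_neg (x : Update d) : real (-x) = -real x := by
  funext i; simp [real]

/-- The differences of effects of derivations of equal symbols. -/
def lattice (s : Shell d n k) (cc : Fin k → Context d) : AddSubgroup (Update d) :=
  AddSubgroup.closure {g | g ∈ gens s cc}

/-- The deviation from the base effect is collected along the derivation: a terminal contributes a
sum of periods, and a production A → σ.τ contributes the generator base σ + base τ - base A. -/
theorem Eff.sub_symBase_mem {σ : Symbol (Fin k) (Fin n)} {x : Update d} (h : Eff s cc σ x) :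
    x - symBase s cc σ ∈ lattice s cc := by
  refine Eff.induction (C := fun σ x => x - symBase s cc σ ∈ lattice s cc) ?_ ?_ h
  · rintro c x ⟨y, hy, rfl⟩
    have : symBase s cc (.terminal c) = (cc c).base := rfl
    rw [this, add_sub_cancel_left]
    have hle : AddSubmonoid.closure {p | p ∈ (cc c).periods} ≤ (lattice s cc).toAddSubmonoid := by
      refine AddSubmonoid.closure_le.mpr fun p hp => ?_
      exact AddSubgroup.subset_closure
        (List.mem_append_left _ (List.mem_flatMap.mpr ⟨c, List.mem_finRange c, hp⟩))
    exact hle hy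
  · intro p hp x y hx hy
    have hg : symBase s cc p.2.1 + symBase s cc p.2.2 - symBase s cc (.nonterminal p.1) ∈
        lattice s cc := by
      refine AddSubgroup.subset_closure ?_
      exact List.mem_append_right _ (List.mem_map.mpr ⟨p, hp, rfl⟩)
    have := add_mem (add_mem hx hy) hg
    convert this using 1
    abel

/-- The definition of the cycle space speaks of terminal words next to A. Every nonterminal is
productive, so sentential forms on both sides can be completed to such words. -/
theorem cycle_mem_lcyclespace (hp : ∀ A, ∃ w, Yields s (.nonterminal A) w) {A : Fin n}
    {u v : List (Symbol (Fin k) (Fin n))} (h : s.Derives A (u ++ [.nonterminal A] ++ v))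
    {x : Update d} (hx : EffL s cc u x) : real x ∈ s.lcyclespace cc := by
  obtain ⟨w, hw, hx⟩ := hx
  obtain ⟨y, w', hw', hy⟩ := exists_effL (cc := cc) hp v
  refine Submodule.subset_span ⟨A, w, w', ?_, x, hx, rfl⟩
  exact h.trans (derives_append (derives_append hw.derives (ContextFreeGrammar.Derives.refl _))
    hw'.derives)

/-! ### Effects and the cycle space of a branching grammar -/

section Branching

variable (hb : s.Branching) (hs : s.Strong) (hocc : ∀ c, ∃ p ∈ s.prods,
  p.2.1 = Symbol.terminal c ∨ p.2.2 = Symbol.terminal c)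

include hb hs

/-- A production with two nonterminals is reached from A by strong connectivity, and both of its
nonterminals lead back to A. -/
theorem exists_double (A : Fin n) : ∃ x y z, s.Derives A
    (x ++ [.nonterminal A] ++ (y ++ [.nonterminal A] ++ z)) := by
  obtain ⟨⟨C, σ, τ⟩, hp, B, B', e, e'⟩ := hb
  dsimp only at e e'
  subst e e'
  obtain ⟨u, v, h⟩ := hs.conn A C
  obtain ⟨u1, v1, h1⟩ := hs.conn B A
  obtain ⟨u2, v2, h2⟩ := hs.conn B' A
  refine ⟨u ++ u1, v1 ++ u2, v2 ++ v, ?_⟩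
  have e : u ++ u1 ++ [.nonterminal A] ++ (v1 ++ u2 ++ [.nonterminal A] ++ (v2 ++ v)) =
      u ++ ((u1 ++ [.nonterminal A] ++ v1) ++ (u2 ++ [.nonterminal A] ++ v2)) ++ v := by simp
  rw [e]
  refine h.trans (derives_append (derives_append (ContextFreeGrammar.Derives.refl _) ?_)
    (ContextFreeGrammar.Derives.refl _))
  exact (derives_prod hp).trans (derives_append (f := [_]) (g := [_]) h1 h2)

/-- In A →* u.A.v.A.w the second occurrence of A is kept as the end of a cycle, and the first one is
derived with effect x or with effect y. The left effects of the two cycles differ by x - y. -/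
theorem Eff.sub_mem_of_nonterminal {A : Fin n} {x y : Update d}
    (hx : Eff s cc (.nonterminal A) x) (hy : Eff s cc (.nonterminal A) y) :
    real (x - y) ∈ s.lcyclespace cc := by
  have hp := hs.productive
  obtain ⟨u, v, w, h⟩ := exists_double hb hs A
  obtain ⟨a, ha⟩ := exists_effL (cc := cc) hp u
  obtain ⟨b, hb⟩ := exists_effL (cc := cc) hp v
  rw [← List.append_assoc, ← List.append_assoc] at h
  have h1 := cycle_mem_lcyclespace hp h ((ha.append (effL_singleton.mpr hx)).append hb)
  have h2 := cycle_mem_lcyclespace hp h ((ha.append (effL_singleton.mpr hy)).append hb)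
  convert sub_mem h1 h2 using 1
  rw [← real_sub]
  congr 1
  abel

-- A terminal occurs in some production; fixing an effect of its sibling turns a difference of
-- effects of the terminal into one of effects of the left-hand side.
include hocc in
theorem Eff.sub_mem {σ : Symbol (Fin k) (Fin n)} {x y : Update d}
    (hx : Eff s cc σ x) (hy : Eff s cc σ y) : real (x - y) ∈ s.lcyclespace cc := by
  have hp := hs.productive
  cases σ with
  | nonterminal A => exact hx.sub_mem_of_nonterminal hb hs hy
  | terminal c =>
    obtain ⟨p, hpp, e | e⟩ := hocc c
    · obtain ⟨z, hz⟩ := exists_effL (cc := cc) hp [p.2.2]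
      have hz := effL_singleton.mp hz
      convert (Eff.node hpp (e ▸ hx) hz).sub_mem_of_nonterminal hb hs
        (Eff.node hpp (e ▸ hy) hz) using 2
      abel
    · obtain ⟨z, hz⟩ := exists_effL (cc := cc) hp [p.2.1]
      have hz := effL_singleton.mp hz
      convert (Eff.node hpp hz (e ▸ hx)).sub_mem_of_nonterminal hb hs
        (Eff.node hpp hz (e ▸ hy)) using 2
      abel

/-- For a cycle A →* u.A.v with left effect z and right effect x, and an effect y of A, also z + y +
x is an effect of A. The difference z + x lies in the space, and z does as a left effect. -/
theorem right_mem_lcyclespace {A : Fin n} {u v : List (Fin k)} (h : s.Cycle A u v) {x : Update d}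
    (hx : x ∈ ceff cc v) : real x ∈ s.lcyclespace cc := by
  have hp := hs.productive
  obtain ⟨y, hy⟩ := exists_effL (cc := cc) hp [.nonterminal A]
  obtain ⟨z, hz⟩ := exists_ceff (cc := cc) u
  have hz' : EffL s cc (u.map Symbol.terminal) z := ⟨u, yieldsL_terminals u, hz⟩
  have h1 := cycle_mem_lcyclespace hp h hz'
  have h2 := EffL.of_derives h ((hz'.append hy).append ⟨v, yieldsL_terminals v, hx⟩)
  have h3 := h2.sub_mem_of_nonterminal hb hs (effL_singleton.mp hy)
  convert sub_mem h3 h1 using 1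
  rw [← real_sub]
  congr 1
  abel

-- Each generator is a difference of two effects of the same symbol: base plus period against base
-- for a terminal, and the two sides of a production for a nonterminal.
include hocc in
theorem real_mem_of_mem_lattice {x : Update d} (hx : x ∈ lattice s cc) :
    real x ∈ s.lcyclespace cc := by
  have hp := hs.productive
  induction hx using AddSubgroup.closure_induction with
  | mem g hg =>
    rcases List.mem_append.mp hg with hg | hg
    · obtain ⟨c, _, hg⟩ := List.mem_flatMap.mp hg
      have h1 : Eff s cc (.terminal c) ((cc c).base + g) :=
        .terminal ⟨g, AddSubmonoid.subset_closure hg, rfl⟩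
      convert h1.sub_mem hb hs hocc (Eff.terminal (base_mem_restr _)) using 2
      abel
    · obtain ⟨p, hpp, rfl⟩ := List.mem_map.mp hg
      exact (Eff.node hpp (eff_symBase hp _) (eff_symBase hp _)).sub_mem hb hs hocc
        (eff_symBase hp _)
  | zero => rw [real_zero]; exact zero_mem _
  | add x y _ _ h h' => rw [real_add]; exact add_mem h h'
  | neg x _ h => rw [real_neg]; exact neg_mem h

-- The base effects are effects of actual derivations, so their sum over u is a left effect of the
-- cycle. Together with the lattice this locates the effects of the new NGVAS.
omit hb in
theorem sum_symBase_mem {A : Fin n} {u v : List (Symbol (Fin k) (Fin n))}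
    (h : s.Derives A (u ++ [.nonterminal A] ++ v)) :
    real (u.map (symBase s cc)).sum ∈ s.lcyclespace cc := by
  have hp := hs.productive
  refine cycle_mem_lcyclespace hp h ?_
  clear h
  induction u with
  | nil => exact .nil
  | cons σ u ih => exact (effL_singleton.mpr (eff_symBase hp σ)).append ih

/-- A counter in D that is concrete in the context cannot be fixed on that side, as it would be
rigid without being tracked. Some cycle then changes it, and right effects are in the space as well.
-/
theorem exists_mem_lcyclespace_ne_zero (hr : s.RigidTracked cc) {i : Fin d}
    (hi : (s.ctx.cin i ≠ ⊤ ∧ i ∈ s.bd.left) ∨ (s.ctx.cout i ≠ ⊤ ∧ i ∈ s.bd.right)) :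
    ∃ x ∈ s.lcyclespace cc, x i ≠ 0 := by
  rcases hi with ⟨h1, h2⟩ | ⟨h1, h2⟩
  · have : ¬ s.FixedLeft cc i := fun h => (hr i).1 h h1 h2
    unfold Shell.FixedLeft at this
    push Not at this
    obtain ⟨A, u, v, h, x, hx, hne⟩ := this
    exact ⟨real x, Submodule.subset_span ⟨A, u, v, h, x, hx, rfl⟩, by simpa [real] using hne⟩
  · have : ¬ s.FixedRight cc i := fun h => (hr i).2 h h1 h2
    unfold Shell.FixedRight at this
    push Not at this
    obtain ⟨A, u, v, h, x, hx, hne⟩ := this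
    exact ⟨real x, right_mem_lcyclespace hb hs h hx, by simpa [real] using hne⟩

end Branching
end Effects
end NestedVAS

namespace NestedVAS

/-! ## Covering effects by linear sets -/

section Box

variable {d : ℕ}

theorem mem_box_step {cur gs : List (Update d)} {y : Update d}
    (h : y ∈ gs.foldl (fun cur g => cur.flatMap fun y => [y, y + g, y - g]) cur) :
    ∃ x ∈ cur, y - x ∈ AddSubgroup.closure {g | g ∈ gs} := by
  induction gs generalizing cur with
  | nil => exact ⟨y, h, by simp⟩
  | cons g gs ih =>
    obtain ⟨x, hx, h⟩ := ih h
    obtain ⟨z, hz, hx⟩ := List.mem_flatMap.mp hx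
    refine ⟨z, hz, ?_⟩
    have h1 : y - x ∈ AddSubgroup.closure {g' | g' ∈ g :: gs} :=
      AddSubgroup.closure_mono (fun g' hg' => List.mem_cons_of_mem _ hg') h
    have h2 : g ∈ AddSubgroup.closure {g' | g' ∈ g :: gs} :=
      AddSubgroup.subset_closure List.mem_cons_self
    simp only [List.mem_cons, List.not_mem_nil, or_false] at hx
    rcases hx with rfl | rfl | rfl
    · exact h1
    · convert add_mem h1 h2 using 1; abel
    · convert sub_mem h1 h2 using 1; abel

theorem box_step_mem (gs : List (Update d)) (a : Fin gs.length → ℤ) (ha : ∀ j, |a j| ≤ 1)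
    {cur : List (Update d)} {x : Update d} (hx : x ∈ cur) :
    x + ∑ j, a j • gs.get j ∈
      gs.foldl (fun cur g => cur.flatMap fun y => [y, y + g, y - g]) cur := by
  induction gs generalizing cur x with
  | nil => simpa using hx
  | cons g gs ih =>
    have h0 := abs_le.mp (ha 0)
    have hm : x + a 0 • g ∈ cur.flatMap fun y => [y, y + g, y - g] := by
      refine List.mem_flatMap.mpr ⟨x, hx, ?_⟩
      obtain h | h | h : a 0 = -1 ∨ a 0 = 0 ∨ a 0 = 1 := by omega
      · simp [h, sub_eq_add_neg]
      · simp [h]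
      · simp [h]
    have := ih (fun j => a j.succ) (fun j => ha _) hm
    have e : x + ∑ j, a j • (g :: gs).get j = x + a 0 • g + ∑ j, a j.succ • gs.get j := by
      rw [add_assoc]
      congr 1
      exact Fin.sum_univ_succ (n := gs.length) fun j => a j • (g :: gs).get j
    rw [e]
    exact this

/-- Each copy of the generators moves every coefficient by its sign towards zero, so m copies
suffice for coefficients of absolute value at most m. -/
theorem box_replicate_mem (gs : List (Update d)) (m : ℕ) (a : Fin gs.length → ℤ)
    (ha : ∀ j, |a j| ≤ m) {cur : List (Update d)} {x : Update d} (hx : x ∈ cur) :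
    x + ∑ j, a j • gs.get j ∈ ((List.replicate m ()).flatMap fun _ => gs).foldl
      (fun cur g => cur.flatMap fun y => [y, y + g, y - g]) cur := by
  induction m generalizing a cur x with
  | zero =>
    have : ∀ j, a j = 0 := fun j => by simpa using ha j
    simpa [this] using hx
  | succ m ih =>
    rw [List.replicate_succ, List.flatMap_cons, List.foldl_append]
    have h1 := box_step_mem gs (fun j => (a j).sign) (fun j => by
      rcases lt_trichotomy (a j) 0 with h | h | h
      · simp [Int.sign_eq_neg_one_of_neg h]
      · simp [h]
      · simp [Int.sign_eq_one_of_pos h]) hx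
    have h2 := ih (fun j => a j - (a j).sign) (fun j => by
      have := ha j
      push_cast at this
      rcases lt_trichotomy (a j) 0 with h | h | h
      · rw [Int.sign_eq_neg_one_of_neg h, abs_le]
        rw [abs_le] at this
        constructor <;> omega
      · simp [h]
      · rw [Int.sign_eq_one_of_pos h, abs_le]
        rw [abs_le] at this
        constructor <;> omega) h1
    convert h2 using 1
    rw [add_assoc, ← Finset.sum_add_distrib]
    congr 1
    refine Finset.sum_congr rfl fun j _ => ?_
    rw [← add_smul]
    congr 1
    ring

theorem exists_coefficients {gs : List (Update d)} {x : Update d}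
    (h : x ∈ AddSubgroup.closure {g | g ∈ gs}) : ∃ a : Fin gs.length → ℤ,
      x = ∑ j, a j • gs.get j := by
  induction h using AddSubgroup.closure_induction with
  | mem g hg =>
    obtain ⟨j, rfl⟩ := List.mem_iff_get.mp hg
    exact ⟨Pi.single j 1, by simp [Pi.single_apply, ite_smul]⟩
  | zero => exact ⟨0, by simp⟩
  | add x y _ _ h h' =>
    obtain ⟨a, rfl⟩ := h
    obtain ⟨b, rfl⟩ := h'
    exact ⟨a + b, by simp [add_smul, Finset.sum_add_distrib]⟩
  | neg x _ h =>
    obtain ⟨a, rfl⟩ := h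
    exact ⟨-a, by simp⟩

theorem zsmul_mem_closure {M : Type*} [AddCommGroup M] {P : Set M} {x : M} (h : x ∈ P)
    (h' : -x ∈ P) (z : ℤ) : z • x ∈ AddSubmonoid.closure P := by
  obtain ⟨m, rfl | rfl⟩ := z.eq_nat_or_neg
  · rw [natCast_zsmul]
    exact nsmul_mem (AddSubmonoid.subset_closure h) m
  · rw [neg_smul, ← smul_neg, natCast_zsmul]
    exact nsmul_mem (AddSubmonoid.subset_closure h') m

/-- Every solution of a linear equation is the sum of a small solution and of small solutions of
the homogeneous equation. -/
theorem exists_small_solution {m : ℕ} (g a : Fin m → ℤ) (c : ℤ) (hc : ∑ j, a j * g j = c) (K : ℕ)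
    (hK : 1 + |c| + ∑ j, |g j| ≤ K) : ∃ r : Fin m → ℤ, (∀ j, |r j| ≤ (K : ℤ)) ∧
      ∑ j, r j * g j = c ∧
      a - r ∈ AddSubmonoid.closure {w : Fin m → ℤ | (∀ j, |w j| ≤ (K : ℤ)) ∧ ∑ j, w j * g j = 0} := by
  set P : Set (Fin m → ℤ) := {w | (∀ j, |w j| ≤ (K : ℤ)) ∧ ∑ j, w j * g j = 0} with hP
  have hneg : ∀ w ∈ P, -w ∈ P := fun w hw =>
    ⟨fun j => by simpa using hw.1 j, by simpa [Finset.sum_neg_distrib] using hw.2⟩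
  have hle : ∀ j, |g j| ≤ ∑ j, |g j| := fun j =>
    Finset.single_le_sum (f := fun j => |g j|) (fun j _ => abs_nonneg _) (Finset.mem_univ j)
  have hc0 := abs_nonneg c
  have hs0 : 0 ≤ ∑ j, |g j| := Finset.sum_nonneg fun j _ => abs_nonneg _
  -- Without coefficients the equation is void, and the unit vectors and their negatives generate
  -- everything.
  by_cases h0 : ∀ j, g j = 0
  · refine ⟨0, fun j => by simp, ?_, ?_⟩
    · rw [← hc]; simp [h0]
    · have e : a - 0 = ∑ j, a j • (Pi.single j 1 : Fin m → ℤ) := by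
        funext i
        simp [Finset.sum_apply, Pi.single_apply]
      rw [e]
      refine sum_mem fun j _ => ?_
      have : (Pi.single j 1 : Fin m → ℤ) ∈ P := by
        refine ⟨fun i => ?_, by simp [h0]⟩
        by_cases h : i = j
        · subst h; rw [Pi.single_eq_same, abs_one]; omega
        · rw [Pi.single_eq_of_ne h, abs_zero]; omega
      exact zsmul_mem_closure this (hneg _ this) _
  · push Not at h0
    obtain ⟨j0, h0⟩ := h0
    -- The vectors g_{j0} e_j - g_j e_{j0} solve the homogeneous equation. Subtracting multiples of
    -- them reduces all entries of the solution other than entry j0 modulo g_{j0}.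
    let w : Fin m → Fin m → ℤ := fun j => Pi.single j (g j0) - Pi.single j0 (g j)
    let q : Fin m → ℤ := fun j => if j = j0 then 0 else a j / g j0
    have hw0 : ∀ j, ∑ i, w j i * g i = 0 := fun j => by
      simp only [w, Pi.sub_apply, sub_mul, Finset.sum_sub_distrib, Pi.single_apply, ite_mul,
        zero_mul, Finset.sum_ite_eq', Finset.mem_univ, if_true]
      ring
    have hw : ∀ j, j ≠ j0 → w j ∈ P := fun j hj => by
      refine ⟨fun i => ?_, hw0 j⟩
      simp only [w, Pi.sub_apply, Pi.single_apply]
      have h1 := hle j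
      have h2 := hle j0
      by_cases hi : i = j
      · rw [if_pos hi, if_neg (fun e => hj (hi.symm.trans e)), sub_zero]; omega
      · rw [if_neg hi, zero_sub, abs_neg]
        split
        · omega
        · rw [abs_zero]; omega
    have hr : ∀ i, i ≠ j0 → (a - ∑ j, q j • w j) i = a i % g j0 := fun i hi => by
      have : (∑ j, q j • w j) i = q i * g j0 := by
        simp only [Finset.sum_apply, Pi.smul_apply, smul_eq_mul, w, Pi.sub_apply, Pi.single_apply,
          if_neg hi, sub_zero, mul_ite, mul_zero, Finset.sum_ite_eq, Finset.mem_univ, if_true]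
      rw [Pi.sub_apply, this]
      simp only [q, if_neg hi]
      have := Int.emod_add_mul_ediv (a i) (g j0)
      rw [mul_comm] at this
      omega
    have hsum : ∑ i, (a - ∑ j, q j • w j) i * g i = c := by
      have e : ∑ i, (∑ j, q j • w j) i * g i = 0 := by
        simp only [Finset.sum_apply, Pi.smul_apply, smul_eq_mul, Finset.sum_mul]
        rw [Finset.sum_comm]
        refine Finset.sum_eq_zero fun j _ => ?_
        simp only [mul_assoc, ← Finset.mul_sum, hw0, mul_zero]
      simp only [Pi.sub_apply, sub_mul, Finset.sum_sub_distrib, hc]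
      rw [e, sub_zero]
    have hb : ∀ i, i ≠ j0 → |(a - ∑ j, q j • w j) i| ≤ |g j0| := fun i hi => by
      rw [hr i hi, abs_of_nonneg (Int.emod_nonneg _ h0)]
      exact (Int.emod_lt_abs _ h0).le
    refine ⟨a - ∑ j, q j • w j, fun i => ?_, hsum, ?_⟩
    -- Entry j0 is not reduced, but the equation determines it: r_{j0} g_{j0} is c minus terms
    -- bounded by |g_{j0}| · |g_j|, and division by |g_{j0}| leaves |c| + ∑ |g_j|.
    · by_cases hi : i = j0
      · subst hi
        set r := a - ∑ j, q j • w j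
        have hpos : 0 < |g i| := abs_pos.mpr h0
        rw [← Finset.add_sum_erase _ _ (Finset.mem_univ i)] at hsum
        have h1 : |∑ j ∈ Finset.univ.erase i, r j * g j| ≤ |g i| * ∑ j, |g j| := by
          refine (Finset.abs_sum_le_sum_abs _ _).trans ?_
          rw [Finset.mul_sum]
          refine (Finset.sum_le_sum (g := fun j => |g i| * |g j|) fun j hj => ?_).trans
            (Finset.sum_le_univ_sum_of_nonneg fun j => by positivity)
          rw [abs_mul]
          exact mul_le_mul_of_nonneg_right (hb j (Finset.ne_of_mem_erase hj)) (abs_nonneg _)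
        have h2 : |r i| * |g i| ≤ |g i| * (|c| + ∑ j, |g j|) := by
          rw [← abs_mul]
          have : r i * g i = c - ∑ j ∈ Finset.univ.erase i, r j * g j := by
            rw [← hsum]; ring
          rw [this, mul_add]
          refine (abs_sub _ _).trans (add_le_add ?_ h1)
          exact le_mul_of_one_le_left hc0 hpos
        rw [mul_comm] at h2
        have := le_of_mul_le_mul_left h2 hpos
        omega
      · have := hb i hi
        have := hle j0
        omega
    · rw [sub_sub_cancel]
      refine sum_mem fun j _ => ?_
      by_cases hj : j = j0
      · simp [q, hj]
      · exact zsmul_mem_closure (hw j hj) (hneg _ (hw j hj)) _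

end Box

/-! ### The restrictions of the new children -/

section Cosets

variable {d n k : ℕ} {s : Shell d n k} {cc : Fin k → Context d} {pk : Bool × Fin d}
  {X : CGSym d n k}

theorem closure_gensRep_le :
    AddSubgroup.closure {g | g ∈ gensRep s cc pk X} ≤ lattice s cc := by
  refine AddSubgroup.closure_mono fun g hg => ?_
  obtain ⟨_, _, hg⟩ := List.mem_flatMap.mp hg
  exact hg

theorem cosets_ctx {c : Context d} (h : c ∈ cosets s cc pk X) : c.unc = s.bd.left ∧
    c.cin = s.inOf cc X.lab.sym ∧ c.cout = s.outOf cc X.lab.sym := by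
  obtain ⟨v, _, rfl⟩ := List.mem_map.mp h
  exact ⟨rfl, rfl, rfl⟩

/-- Both conditions hold for the base, their homogeneous versions hold for the periods, and they are
preserved by sums. The first keeps the cycle space within that of N, the second forces the chosen
counter. -/
theorem cosets_sound {c : Context d} (h : c ∈ cosets s cc pk X) {e : Update d}
    (he : e ∈ c.restr) : e - symBase s cc X.lab.sym ∈ lattice s cc ∧
      Keeps pk X ((tgt pk X).toNat - (src pk X).toNat) e := by
  classical
  obtain ⟨v, hv, rfl⟩ := List.mem_map.mp h
  obtain ⟨y, hy, rfl⟩ := he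
  rw [List.mem_filter, decide_eq_true_eq] at hv
  have h1 : v - symBase s cc X.lab.sym ∈ lattice s cc := by
    obtain ⟨x, hx, h⟩ := mem_box_step hv.1
    rw [List.mem_singleton.mp hx] at h
    exact closure_gensRep_le h
  have h2 : y ∈ lattice s cc ∧ Keeps pk X 0 y := by
    dsimp only at hy
    induction hy using AddSubmonoid.closure_induction with
    | mem p hp =>
      rw [Set.mem_ofPred_eq, List.mem_filter, decide_eq_true_eq] at hp
      obtain ⟨x, hx, h⟩ := mem_box_step hp.1
      rw [List.mem_singleton.mp hx, sub_zero] at h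
      exact ⟨closure_gensRep_le h, hp.2⟩
    | zero => exact ⟨zero_mem _, fun _ => rfl⟩
    | add x y _ _ h h' =>
      exact ⟨add_mem h.1 h'.1, fun hh => by rw [Pi.add_apply, h.2 hh, h'.2 hh, add_zero]⟩
  refine ⟨?_, fun hh => ?_⟩
  · dsimp only
    convert add_mem h1 h2.1 using 1
    abel
  · dsimp only
    rw [Pi.add_apply, hv.2 hh, h2.2 hh, add_zero]

theorem sum_abs_gens_eq : ∑ j, |((gens s cc).get j) pk.2| =
    (((gens s cc).map fun g => (g pk.2).natAbs).sum : ℕ) := by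
  have : ∀ l : List (Update d), ∑ j, |(l.get j) pk.2| =
      ((l.map fun g => (g pk.2).natAbs).sum : ℕ) := by
    intro l
    induction l with
    | nil => simp
    | cons g l ih =>
      rw [List.map_cons, List.sum_cons, Nat.cast_add, ← ih]
      refine (Fin.sum_univ_succ (n := l.length) fun j => |((g :: l).get j) pk.2|).trans ?_
      simp only [Int.natCast_natAbs]
      rfl
  exact this _

/-- Over coefficient vectors, the condition on the chosen counter is a single linear equation. Its
solution splits into a small one, which yields the base, and small homogeneous ones, which yield the
periods; `width` bounds both. -/
theorem exists_coset {e : Update d} (he : e - symBase s cc X.lab.sym ∈ lattice s cc)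
    (hk : Keeps pk X ((tgt pk X).toNat - (src pk X).toNat) e) :
    ∃ c ∈ cosets s cc pk X, e ∈ c.restr := by
  classical
  set b := symBase s cc X.lab.sym with hb
  set gs := gens s cc with hgs
  set K := width s cc pk X with hKdef
  obtain ⟨a, ha⟩ := exists_coefficients he
  have happ : ∀ (x : Update d) (w : Fin gs.length → ℤ), (x + ∑ j, w j • gs.get j) pk.2 =
      x pk.2 + ∑ j, w j * (gs.get j) pk.2 := fun x w => by simp
  have key : ∃ r : Fin gs.length → ℤ, (∀ j, |r j| ≤ (K : ℤ)) ∧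
      Keeps pk X ((tgt pk X).toNat - (src pk X).toNat) (b + ∑ j, r j • gs.get j) ∧
      a - r ∈ AddSubmonoid.closure {w : Fin gs.length → ℤ | (∀ j, |w j| ≤ (K : ℤ)) ∧
        Keeps pk X 0 (∑ j, w j • gs.get j)} := by
    -- If one end is ω, the counter is unconstrained, and the same decomposition is applied to the
    -- equation with zero coefficients.
    by_cases hf : src pk X ≠ ⊤ ∧ tgt pk X ≠ ⊤
    · have hc : ∑ j, a j * (gs.get j) pk.2 = (tgt pk X).toNat - (src pk X).toNat - b pk.2 := by
        have h1 := hk hf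
        have h2 : e = b + ∑ j, a j • gs.get j := by rw [← ha]; abel
        rw [h2, happ] at h1
        linarith
      obtain ⟨r, h1, h2, h3⟩ := exists_small_solution (fun j => (gs.get j) pk.2) a _ hc K (by
        have := sum_abs_gens_eq (s := s) (cc := cc) (pk := pk)
        rw [this, hKdef, width]
        generalize ((gens s cc).map fun g => (g pk.2).natAbs).sum = N
        push_cast
        have h1 : |((tgt pk X).toNat : ℤ) - (src pk X).toNat - b pk.2| ≤
            (tgt pk X).toNat + (src pk X).toNat + |b pk.2| := by
          refine (abs_sub _ _).trans (add_le_add_left ((abs_sub _ _).trans ?_) _)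
          simp
        rw [← hb]
        omega)
      refine ⟨r, h1, fun _ => by rw [happ, h2]; ring, ?_⟩
      refine (show AddSubmonoid.closure _ ≤ AddSubmonoid.closure _ from
        AddSubmonoid.closure_mono ?_) h3
      intro w hw
      refine ⟨hw.1, fun _ => ?_⟩
      have := happ 0 w
      rw [zero_add] at this
      rw [this]
      simpa using hw.2
    · obtain ⟨r, h1, h2, h3⟩ := exists_small_solution (fun _ : Fin gs.length => 0) a 0 (by simp) K
        (by
          rw [hKdef, width]
          generalize ((gens s cc).map fun g => (g pk.2).natAbs).sum = N
          have := abs_nonneg (symBase s cc X.lab.sym pk.2)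
          simp
          omega)
      refine ⟨r, h1, fun h => (hf h).elim, ?_⟩
      refine (show AddSubmonoid.closure _ ≤ AddSubmonoid.closure _ from
        AddSubmonoid.closure_mono ?_) h3
      exact fun w hw => ⟨hw.1, fun h => (hf h).elim⟩
  obtain ⟨r, h1, h2, h3⟩ := key
  refine ⟨_, List.mem_map.mpr ⟨b + ∑ j, r j • gs.get j, ?_, rfl⟩, e - (b + ∑ j, r j • gs.get j),
    ?_, by simp⟩
  · rw [List.mem_filter, decide_eq_true_eq]
    exact ⟨box_replicate_mem gs K r h1 (List.mem_singleton.mpr rfl), h2⟩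
  · have e1 : e - (b + ∑ j, r j • gs.get j) = ∑ j, (a - r) j • gs.get j := by
      simp only [Pi.sub_apply, sub_smul, Finset.sum_sub_distrib]
      rw [← ha]
      abel
    rw [e1]
    dsimp only
    generalize a - r = w at h3
    induction h3 using AddSubmonoid.closure_induction with
    | mem w hw =>
      refine AddSubmonoid.subset_closure ?_
      rw [Set.mem_ofPred_eq, List.mem_filter, decide_eq_true_eq]
      refine ⟨?_, hw.2⟩
      have := box_replicate_mem gs K w hw.1 (List.mem_singleton.mpr (rfl : (0 : Update d) = 0))
      rwa [zero_add] at this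
    | zero => simp
    | add x y _ _ h h' =>
      simp only [Pi.add_apply, add_smul, Finset.sum_add_distrib]
      exact add_mem h h'

end Cosets
end NestedVAS

namespace NestedVAS

/-! ## Invariants of coverability grammars -/

section Markings

variable {d : ℕ} {x y z : OMarking d}

theorem mem_omegas {i : Fin d} : i ∈ omegas x ↔ x i = ⊤ := by simp [omegas]

theorem Spec.refl (x : OMarking d) : Spec x x := fun _ => .inr rfl

theorem Spec.trans (h : Spec x y) (h' : Spec y z) : Spec x z := fun i => by
  rcases h' i with e | e
  · exact .inl e
  · rcases h i with e' | e'
    · exact .inl (e ▸ e')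
    · exact .inr (e'.trans e)

theorem Spec.omegas_subset (h : Spec x y) : omegas x ⊆ omegas y := fun i hi => by
  rw [mem_omegas] at hi ⊢
  rcases h i with e | e
  · exact e
  · exact e ▸ hi

theorem Spec.eq_of_ne_top (h : Spec x y) {i : Fin d} (hi : y i ≠ ⊤) : x i = y i :=
  (h i).resolve_left hi

theorem spec_accel_left (x y : OMarking d) : Spec y (accel x y) := fun i => by
  unfold accel
  split <;> simp

theorem spec_accel (hx : Spec x z) (hy : Spec y z) : Spec (accel x y) z := fun i => by
  by_cases hz : z i = ⊤
  · exact .inl hz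
  · right
    have h1 := hx.eq_of_ne_top hz
    have h2 := hy.eq_of_ne_top hz
    simp [accel, h1, h2]

theorem omegas_accel_ssubset {i : Fin d} (h : x i < y i) (hi : y i ≠ ⊤) :
    omegas y ⊂ omegas (accel x y) := by
  refine Finset.ssubset_iff_of_subset (spec_accel_left x y).omegas_subset |>.mpr ⟨i, ?_, ?_⟩
  · simp [mem_omegas, accel, h]
  · simpa [mem_omegas] using hi

end Markings

section Consistency

variable {d n k : ℕ} {s : Shell d n k} {cc : Fin k → Context d}

theorem Shell.Valid.prod (h : s.Valid cc) (hb : s.Branching)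
    {p : Fin n × Symbol (Fin k) (Fin n) × Symbol (Fin k) (Fin n)} (hp : p ∈ s.prods) :
    s.bd.inn p.1 = s.inOf cc p.2.1 ∧ s.outOf cc p.2.1 = s.inOf cc p.2.2 ∧
      s.outOf cc p.2.2 = s.bd.out p.1 :=
  let ⟨h1, h2, h3, _⟩ := (h.consistent p hp).1 (.inr hb)
  ⟨h1, h2, h3⟩

/-- Every production of a branching grammar must match the boundedness information exactly. Hence D
is the set of unconstrained counters and of entries ω for every child, as it is for nonterminals. -/
theorem Shell.Valid.child (h : s.Valid cc) (hb : s.Branching) (c : Fin k) :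
    (cc c).unc = s.bd.left ∧ omegas (cc c).cin = s.bd.left ∧ omegas (cc c).cout = s.bd.left := by
  obtain ⟨p, hp, e⟩ := h.occurs c
  obtain ⟨h1, h2, h3, h4⟩ := (h.consistent p hp).1 (.inr hb)
  obtain ⟨h5, h6⟩ := h4 c e
  have h7 : (cc c).unc = s.bd.left := by
    rcases e with e | e
    · rw [← h5, ← h.bd_in p.1, h1, e]; rfl
    · rw [← h6, h.bd_mid hb, ← h.bd_out p.1, ← h3, e]; rfl
  exact ⟨h7, h5.trans h7, h6.trans h7⟩

theorem Shell.Valid.omegas_inOf (h : s.Valid cc) (hb : s.Branching)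
    (σ : Symbol (Fin k) (Fin n)) : omegas (s.inOf cc σ) = s.bd.left := by
  cases σ with
  | terminal c => exact (h.child hb c).2.1
  | nonterminal A => exact h.bd_in A

theorem Shell.Valid.omegas_outOf (h : s.Valid cc) (hb : s.Branching)
    (σ : Symbol (Fin k) (Fin n)) : omegas (s.outOf cc σ) = s.bd.left := by
  cases σ with
  | terminal c => exact (h.child hb c).2.2
  | nonterminal A => exact (h.bd_out A).trans (h.bd_mid hb).symm

end Consistency

section Invariants

variable {d n k : ℕ} {child : Fin k → NGVAS d} {s : Shell d n k} {post pre : Approx d n k}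
  {S : CGSym d n k}

/-- The markings of the label are compatible with the NGVAS. -/
structure GoodLabel (child : Fin k → NGVAS d) (s : Shell d n k) (X : CGLabel d n k) : Prop where
  inn : Spec X.inn (s.inOf (fun c => (child c).ctx) X.sym)
  out : Spec X.out (s.outOf (fun c => (child c).ctx) X.sym)
  cin : omegas s.ctx.cin ⊆ omegas X.inn
  cout : omegas s.ctx.cout ⊆ omegas X.out

/-- The markings are those of a symbol after acceleration, or those of the start symbol. -/
structure Accelerated (child : Fin k → NGVAS d) (s : Shell d n k) (S W : CGSym d n k)
    (x y : OMarking d) : Prop where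
  inn : Spec W.lab.inn x
  out : Spec W.lab.out y
  spec_inn : Spec x (s.inOf (fun c => (child c).ctx) W.lab.sym)
  spec_out : Spec y (s.outOf (fun c => (child c).ctx) W.lab.sym)
  -- A unary production behind the start symbol strictly adds entries ω; this bounds the number of
  -- unary productions along a derivation.
  start_or : (W = S ∧ x = W.lab.inn ∧ y = W.lab.out) ∨
    (omegas W.lab.inn).card + (omegas W.lab.out).card < (omegas x).card + (omegas y).card

/-- The words of labels that are used as right-hand sides for the symbol. -/
def Chosen (child : Fin k → NGVAS d) (s : Shell d n k) (post pre : Approx d n k)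
    (S W : CGSym d n k) (R : Set (List (CGLabel d n k))) : Prop :=
  (∃ x y, Accelerated child s S W x y ∧ R = pumpWords post pre x W.lab.sym y) ∨
    (W ≠ S ∧ R = simWords s post pre W.lab)

/-- The invariant of the construction. -/
structure Invariant (child : Fin k → NGVAS d) (s : Shell d n k) (post pre : Approx d n k)
    (S : CGSym d n k) (st : CGState d n k) : Prop where
  start : S ∈ st.nonterms
  todo : st.todo ⊆ st.nonterms
  label : ∀ X ∈ st.nonterms, X.IsNT ∧ GoodLabel child s X.lab
  prods : ∀ V w, (V, w) ∈ st.prods → V ∈ st.nonterms ∧ V ∉ st.todo ∧ ∀ X ∈ w,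
    X ≠ S ∧ (X.IsNT → X ∈ st.nonterms) ∧ GoodLabel child s X.lab
  done : ∀ W ∈ st.nonterms, W ∉ st.todo → ∃ R, Chosen child s post pre S W R ∧
    (∀ r ∈ R, ∃ w, (W, w) ∈ st.prods ∧ w.map CGSym.lab = r) ∧
    ∀ w, (W, w) ∈ st.prods → w.map CGSym.lab ∈ R

/-- The value of an approximator specializes the output marking of the first symbol, which is the
input marking of the second one, and symmetrically from the right. Entries ω are never lost, so
those of the context of N persist. -/
theorem Chosen.goodLabel (hv : s.Valid fun c => (child c).ctx) (hb : s.Branching)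
    (hpost : IsPostApprox child s post) (hpre : IsPreApprox child s pre) {W : CGSym d n k}
    (hW : GoodLabel child s W.lab) {R : Set (List (CGLabel d n k))}
    (hR : Chosen child s post pre S W R) : ∀ r ∈ R, ∀ X ∈ r, GoodLabel child s X := by
  have hlr := hv.bd_mid hb
  rcases hR with ⟨x, y, h, rfl⟩ | ⟨-, rfl⟩
  · rintro _ ⟨p, hp, q, hq, rfl⟩ X hX
    rw [List.mem_singleton.mp hX]
    exact ⟨h.spec_inn, h.spec_out, hW.cin.trans h.inn.omegas_subset,
      hW.cout.trans h.out.omegas_subset⟩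
  · rintro _ ⟨A, σ, τ, hp, hA, p', hp', p'', hp'', q', hq', q'', hq'', h1, h2, -, rfl⟩ X hX
    obtain ⟨e1, e2, e3⟩ := hv.prod hb hp
    have hin := hW.inn
    have hout := hW.out
    rw [hA] at hin hout
    change Spec _ (s.bd.inn A) at hin
    change Spec _ (s.bd.out A) at hout
    have hl : omegas W.lab.inn ⊆ s.bd.left := hin.omegas_subset.trans (hv.bd_in A).subset
    have hr : omegas W.lab.out ⊆ s.bd.right := hout.omegas_subset.trans (hv.bd_out A).subset
    obtain ⟨g1, g2⟩ := hpost.sound _ _ hl p' hp'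
    obtain ⟨g3, g4⟩ := hpre.sound _ _ hr q' hq'
    simp only [List.mem_cons, List.not_mem_nil, or_false] at hX
    dsimp only at e1 e2 e3
    rcases hX with rfl | rfl
    · exact ⟨e1 ▸ hin, by rw [e2]; exact g3, hW.cin, hW.cout.trans g4⟩
    · exact ⟨by rw [← e2]; exact g1, e3 ▸ hout, hW.cin.trans g2, hW.cout⟩

theorem Invariant.expand (hv : s.Valid fun c => (child c).ctx) (hb : s.Branching)
    (hpost : IsPostApprox child s post) (hpre : IsPreApprox child s pre) {st st' : CGState d n k}
    (h : Invariant child s post pre S st) {W : CGSym d n k} (hW : W ∈ st.todo)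
    {R : Set (List (CGLabel d n k))} (hR : Chosen child s post pre S W R)
    {back : CGSym d n k → Prop} (hback : ∀ Z, back Z → Z ∈ st.nonterms ∧ Z ≠ S)
    (he : st.Expand W R back st') : Invariant child s post pre S st' := by
  obtain ⟨inst, hi1, hi2, -, e1, -, e3, e4⟩ := he
  have hgood := hR.goodLabel hv hb hpost hpre (h.label W (h.todo hW)).2
  have hlab : ∀ r ∈ R, ∀ X ∈ inst r, GoodLabel child s X.lab := fun r hr X hX =>
    hgood r hr _ (hi1 r hr ▸ List.mem_map_of_mem hX)
  -- A reused symbol is different from S by the choice of `back`; a fresh one has an unused history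
  -- component, while that of S is in use.
  have hS : ∀ r ∈ R, ∀ X ∈ inst r, X ≠ S := by
    rintro r hr X hX rfl
    obtain ⟨h1, h2⟩ := hi2 r hr X hX
    by_cases hc : X.IsNT ∧ ∃ Z, back Z ∧ Z.lab = X.lab
    · exact (hback _ (h1 hc)).2 rfl
    · exact h2 hc ⟨X, .inl h.start, rfl⟩
  have hWnot : W ∉ st'.todo := by
    rw [e4]
    rintro (⟨_, h2⟩ | ⟨_, h2⟩)
    · exact h2 rfl
    · exact h2 (h.todo hW)
  -- Only new nonterminals are added to the queue, so a treated one never returns to it and keeps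
  -- its productions.
  have htodo : ∀ X ∈ st.nonterms, X ∈ st'.todo → X ∈ st.todo := by
    intro X hX hX'
    rw [e4] at hX'
    rcases hX' with hX' | hX'
    · exact hX'.1
    · exact (hX'.2 hX).elim
  refine ⟨?_, ?_, ?_, ?_, ?_⟩
  · rw [e1]; exact .inl h.start
  · rw [e4, e1]
    rintro X (hX | hX)
    · exact .inl (h.todo hX.1)
    · exact .inr hX.1
  · rw [e1]
    rintro X (hX | ⟨hX, r, hr, hXr⟩)
    · exact h.label X hX
    · exact ⟨hX, hlab r hr X hXr⟩
  · intro V w hVw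
    rw [e3] at hVw
    rcases hVw with hVw | ⟨r, hr, hVw⟩
    · obtain ⟨h1, h2, h3⟩ := h.prods V w hVw
      refine ⟨e1 ▸ .inl h1, fun hh => h2 (htodo V h1 hh), fun X hX => ?_⟩
      obtain ⟨h4, h5, h6⟩ := h3 X hX
      exact ⟨h4, fun hh => e1 ▸ .inl (h5 hh), h6⟩
    · obtain ⟨rfl, rfl⟩ := Prod.mk.inj hVw
      exact ⟨e1 ▸ .inl (h.todo hW), hWnot, fun X hX => ⟨hS r hr X hX,
        fun hh => e1 ▸ .inr ⟨hh, r, hr, hX⟩, hlab r hr X hX⟩⟩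
  · intro V hV hV'
    by_cases hVW : V = W
    · subst hVW
      refine ⟨R, hR, fun r hr => ⟨inst r, e3 ▸ .inr ⟨r, hr, rfl⟩, hi1 r hr⟩, fun w hw => ?_⟩
      rw [e3] at hw
      rcases hw with hw | ⟨r, hr, hw⟩
      · exact ((h.prods V w hw).2.1 hW).elim
      · obtain ⟨-, rfl⟩ := Prod.mk.inj hw
        rwa [hi1 r hr]
    · have hVn : V ∈ st.nonterms := by
        rw [e1] at hV
        rcases hV with hV | hV
        · exact hV
        · by_contra hc
          exact hV' (e4 ▸ .inr ⟨hV, hc⟩)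
      have hVt : V ∉ st.todo := fun hh => hV' (e4 ▸ .inl ⟨hh, hVW⟩)
      obtain ⟨R', h1, h2, h3⟩ := h.done V hVn hVt
      refine ⟨R', h1, fun r hr => ?_, fun w hw => ?_⟩
      · obtain ⟨w, hw, e⟩ := h2 r hr
        exact ⟨w, e3 ▸ .inl hw, e⟩
      · rw [e3] at hw
        rcases hw with hw | ⟨r, hr, hw⟩
        · exact h3 w hw
        · exact (hVW (Prod.mk.inj hw).1).elim

theorem Invariant.step (hv : s.Valid fun c => (child c).ctx) (hb : s.Branching)
    (hpost : IsPostApprox child s post) (hpre : IsPreApprox child s pre) {st st' : CGState d n k}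
    (h : Invariant child s post pre S st) (hst : CGState.Step s post pre S st st') :
    Invariant child s post pre S st' := by
  obtain ⟨W, hW, hst⟩ := hst
  have hWl := (h.label W (h.todo hW)).2
  rcases hst with ⟨rfl, he⟩ | ⟨hne, V, hV, he⟩ | ⟨hne, -, he⟩
  · exact h.expand hv hb hpost hpre hW (.inl ⟨_, _, ⟨Spec.refl _, Spec.refl _, hWl.inn, hWl.out,
      .inl ⟨rfl, rfl, rfl⟩⟩, rfl⟩) (fun _ hf => hf.elim) he
  · obtain ⟨h1, -, h3, h4, h5, i, h6⟩ := hV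
    have hVl := (h.label V h1).2
    refine h.expand hv hb hpost hpre hW (.inl ⟨_, _, ⟨spec_accel_left _ _, spec_accel_left _ _,
      spec_accel (h3 ▸ hVl.inn) hWl.inn, spec_accel (h3 ▸ hVl.out) hWl.out, .inr ?_⟩, rfl⟩)
      (fun _ hf => hf.elim) he
    have g1 := Finset.card_le_card (spec_accel_left V.lab.inn W.lab.inn).omegas_subset
    have g2 := Finset.card_le_card (spec_accel_left V.lab.out W.lab.out).omegas_subset
    rcases h6 with ⟨h6, h7⟩ | ⟨h6, h7⟩
    · have := Finset.card_lt_card (omegas_accel_ssubset h6 h7)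
      omega
    · have := Finset.card_lt_card (omegas_accel_ssubset h6 h7)
      omega
  · exact h.expand hv hb hpost hpre hW (.inr ⟨hne, rfl⟩) (fun Z hZ => ⟨hZ.1, hZ.2.1⟩) he

/-- The properties of coverability grammars that the decomposition relies on. -/
structure CovSpec (child : Fin k → NGVAS d) (s : Shell d n k) (post pre : Approx d n k)
    (G : CovGrammar d n k) : Prop where
  start : G.start ∈ G.nonterms
  label : ∀ X ∈ G.nonterms, X.IsNT ∧ GoodLabel child s X.lab
  prods : ∀ V w, (V, w) ∈ G.prods → V ∈ G.nonterms ∧ ∀ X ∈ w,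
    X ≠ G.start ∧ (X.IsNT → X ∈ G.nonterms) ∧ GoodLabel child s X.lab
  done : ∀ W ∈ G.nonterms, ∃ R, Chosen child s post pre G.start W R ∧
    (∀ r ∈ R, ∃ w, (W, w) ∈ G.prods ∧ w.map CGSym.lab = r) ∧
    ∀ w, (W, w) ∈ G.prods → w.map CGSym.lab ∈ R

/-- The invariant holds initially by the relevance of the variant. At the end the queue is empty, so
every nonterminal has received its productions. -/
theorem IsCovGrammar.covSpec (hv : s.Valid fun c => (child c).ctx) (hb : s.Branching)
    (hpost : IsPostApprox child s post) (hpre : IsPreApprox child s pre) {μ ν : OMarking d}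
    {A : Fin n} (hvar : s.IsVariant μ A ν) (hrel : s.Relevant μ ν) {G : CovGrammar d n k}
    (hG : IsCovGrammar s post pre μ A ν G) : CovSpec child s post pre G := by
  obtain ⟨hS, st, hst, h1, h2, -, h4⟩ := hG
  have h0 : Invariant child s post pre G.start ⟨{G.start}, ∅, ∅, {G.start}⟩ := by
    refine ⟨rfl, fun _ h => h, ?_, ?_, ?_⟩
    · rintro X rfl
      rw [hS]
      exact ⟨⟨A, rfl⟩, hvar.1, hvar.2, hrel.1.1, hrel.2.1⟩
    · intro V w h
      exact h.elim
    · intro W h h'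
      exact (h' h).elim
  have h : Invariant child s post pre G.start st := by
    clear h1 h2 h4
    induction hst with
    | refl => exact h0
    | tail _ hs ih => exact ih.step hv hb hpost hpre hs
  have en : ∀ X, X ∈ G.nonterms ↔ X ∈ st.nonterms := fun X => by rw [← h2]; rfl
  have ep : ∀ q, q ∈ G.prods ↔ q ∈ st.prods := fun X => by rw [← h4]; rfl
  refine ⟨(en _).mpr h.start, fun X hX => h.label X ((en X).mp hX), fun V w hw => ?_,
    fun W hW => ?_⟩
  · obtain ⟨g1, -, g3⟩ := h.prods V w ((ep _).mp hw)
    refine ⟨(en V).mpr g1, fun X hX => ?_⟩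
    obtain ⟨g4, g5, g6⟩ := g3 X hX
    exact ⟨g4, fun hh => (en X).mpr (g5 hh), g6⟩
  · obtain ⟨R, g1, g2, g3⟩ := h.done W ((en W).mp hW) (by rw [h1]; exact fun h => h)
    refine ⟨R, g1, fun r hr => ?_, fun w hw => g3 w ((ep _).mp hw)⟩
    obtain ⟨w, hw, e⟩ := g2 r hr
    exact ⟨w, (ep _).mpr hw, e⟩

end Invariants
end NestedVAS

namespace NestedVAS

/-! ## Rules and components -/

section Rules

variable {d n k : ℕ} {child : Fin k → NGVAS d} {s : Shell d n k} {cc : Fin k → Context d}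
  {post pre : Approx d n k} {G : CovGrammar d n k}

theorem mem_pairsOf {α : Type*} {l : List α} {z : α × α} : z ∈ pairsOf l ↔ l = [z.1, z.2] := by
  obtain ⟨x, y⟩ := z
  rcases l with _ | ⟨a, _ | ⟨b, _ | ⟨c, l⟩⟩⟩ <;>
    (simp [pairsOf]; try grind)

theorem mem_singlesOf {α : Type*} {l : List α} {x : α} : x ∈ singlesOf l ↔ l = [x] := by
  rcases l with _ | ⟨a, _ | ⟨b, l⟩⟩ <;> simp [singlesOf, eq_comm]

theorem mem_rules' {q : Rule d n k} : q ∈ rules s cc G ↔ (q.lhs, [q.fst, q.snd]) ∈ G.prods ∧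
    ∃ pk ∈ (picks s q.lhs).take 1, q.cfst ∈ cosets s cc pk q.fst ∧
      q.csnd ∈ cosets s cc pk q.snd := by
  simp only [rules, List.mem_flatMap, List.mem_map]
  constructor
  · rintro ⟨⟨V, w⟩, hp, ⟨x, y⟩, hz, pk, hpk, c, hc, c', hc', rfl⟩
    have := mem_pairsOf.mp hz
    dsimp only at this hp ⊢
    subst this
    exact ⟨hp, pk, hpk, hc, hc'⟩
  · rintro ⟨hp, pk, hpk, hc, hc'⟩
    exact ⟨_, hp, (q.fst, q.snd), mem_pairsOf.mpr rfl, pk, hpk, _, hc, _, hc', rfl⟩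

theorem mem_singles {q : CGSym d n k × CGSym d n k} :
    q ∈ singles G ↔ (q.1, [q.2]) ∈ G.prods := by
  simp only [singles, List.mem_flatMap, List.mem_map]
  constructor
  · rintro ⟨⟨V, w⟩, hp, x, hx, rfl⟩
    have := mem_singlesOf.mp hx
    dsimp only at this hp ⊢
    subst this
    exact hp
  · intro hp
    exact ⟨_, hp, _, mem_singlesOf.mpr rfl, rfl⟩

/-- The relation of the labels in a production that simulates a production of the NGVAS. -/
structure Splits (s : Shell d n k) (V X Y : CGLabel d n k) : Prop where
  prod : ∃ A, V.sym = .nonterminal A ∧ (A, X.sym, Y.sym) ∈ s.prods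
  inn : X.inn = V.inn
  fst_post : omegas X.inn ⊆ omegas X.post
  mid_post : X.post = Y.inn
  snd_post : omegas Y.inn ⊆ omegas Y.post
  post : Spec Y.post V.post
  out : Y.out = V.out
  snd_pre : omegas Y.out ⊆ omegas Y.pre
  mid_pre : Y.pre = X.out
  fst_pre : omegas X.out ⊆ omegas X.pre
  pre : Spec X.pre V.pre

theorem splits_of_mem_simWords (hv : s.Valid fun c => (child c).ctx) (hb : s.Branching)
    (hpost : IsPostApprox child s post) (hpre : IsPreApprox child s pre) {V X Y : CGLabel d n k}
    (hV : GoodLabel child s V) (h : [X, Y] ∈ simWords s post pre V) : Splits s V X Y := by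
  obtain ⟨A, σ, τ, hp, hA, p', hp', p'', hp'', q', hq', q'', hq'', h1, h2, -, e⟩ := h
  have hlr := hv.bd_mid hb
  simp only [List.cons.injEq, and_true] at e
  obtain ⟨rfl, rfl⟩ := e
  have hl : omegas V.inn ⊆ s.bd.left :=
    hV.inn.omegas_subset.trans (hv.omegas_inOf hb _).subset
  have hr : omegas V.out ⊆ s.bd.right :=
    hlr ▸ hV.out.omegas_subset.trans (hv.omegas_outOf hb _).subset
  obtain ⟨g1, g2⟩ := hpost.sound _ _ hl p' hp'
  obtain ⟨g3, g4⟩ := hpre.sound _ _ hr q' hq'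
  obtain ⟨g5, g6⟩ := hpost.sound _ _ (g1.omegas_subset.trans (hv.omegas_outOf hb _).subset) p'' hp''
  obtain ⟨g7, g8⟩ := hpre.sound _ _
    (hlr ▸ g3.omegas_subset.trans (hv.omegas_inOf hb _).subset) q'' hq''
  exact ⟨⟨A, hA, hp⟩, rfl, g2, rfl, g6, h1, rfl, g4, rfl, g8, h2⟩

theorem length_of_mem_pumpWords {x y : OMarking d} {σ : Symbol (Fin k) (Fin n)}
    {r : List (CGLabel d n k)} (h : r ∈ pumpWords post pre x σ y) : r.length = 1 := by
  obtain ⟨p, -, q, -, rfl⟩ := h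
  rfl

theorem length_of_mem_simWords {W : CGLabel d n k} {r : List (CGLabel d n k)}
    (h : r ∈ simWords s post pre W) : r.length = 2 := by
  obtain ⟨A, σ, τ, hp, hA, p', hp', p'', hp'', q', hq', q'', hq'', h1, h2, -, rfl⟩ := h
  rfl

/-- The symbol has the productions that simulate those of the NGVAS. -/
structure SimDone (s : Shell d n k) (post pre : Approx d n k) (G : CovGrammar d n k)
    (W : CGSym d n k) : Prop where
  exists_prod : ∀ r ∈ simWords s post pre W.lab, ∃ w, (W, w) ∈ G.prods ∧ w.map CGSym.lab = r

theorem CovSpec.pair (h : CovSpec child s post pre G) {V X Y : CGSym d n k}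
    (hq : (V, [X, Y]) ∈ G.prods) :
    SimDone s post pre G V ∧ [X.lab, Y.lab] ∈ simWords s post pre V.lab := by
  obtain ⟨R, hR, h1, h2⟩ := h.done V (h.prods _ _ hq).1
  have h3 := h2 _ hq
  rcases hR with ⟨x, y, -, rfl⟩ | ⟨-, rfl⟩
  · have := length_of_mem_pumpWords h3
    simp at this
  · exact ⟨⟨h1⟩, h3⟩

theorem CovSpec.single (h : CovSpec child s post pre G) {V X : CGSym d n k}
    (hq : (V, [X]) ∈ G.prods) : ∃ x y, Accelerated child s G.start V x y ∧
      X.lab.sym = V.lab.sym ∧ X.lab.inn = x ∧ X.lab.out = y := by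
  obtain ⟨R, hR, h1, h2⟩ := h.done V (h.prods _ _ hq).1
  have h3 := h2 _ hq
  rcases hR with ⟨x, y, hacc, rfl⟩ | ⟨hne, rfl⟩
  · obtain ⟨p, -, q, -, e⟩ := h3
    simp only [List.map_cons, List.map_nil, List.cons.injEq, and_true] at e
    exact ⟨x, y, hacc, by rw [e], by rw [e], by rw [e]⟩
  · have := length_of_mem_simWords h3
    simp at this

theorem mem_picks {W : CGSym d n k} {pk : Bool × Fin d} : pk ∈ picks s W ↔ pk.2 ∈ s.bd.left ∧
    ((pk.1 = true ∧ W.lab.inn pk.2 ≠ ⊤) ∨ (pk.1 = false ∧ W.lab.out pk.2 ≠ ⊤)) := by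
  obtain ⟨b, i⟩ := pk
  cases b <;> simp [picks]

/-- Thus all symbols of a strongly connected component, which agree in their entries ω, use the same
counter. -/
theorem picks_congr {W V : CGSym d n k} (h : omegas W.lab.inn = omegas V.lab.inn)
    (h' : omegas W.lab.out = omegas V.lab.out) : picks s W = picks s V := by
  have e1 : ∀ i, W.lab.inn i = ⊤ ↔ V.lab.inn i = ⊤ := fun i => by
    rw [← mem_omegas, h, mem_omegas]
  have e2 : ∀ i, W.lab.out i = ⊤ ↔ V.lab.out i = ⊤ := fun i => by
    rw [← mem_omegas, h', mem_omegas]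
  simp only [picks, ne_eq, e1, e2]

/-- This is what boundedness is for. The markings specialize those of N, so they can differ from
them only at counters in D; if none of these were concrete on either side, the nonterminal would be
of the forbidden form. -/
theorem exists_pick (hv : s.Valid fun c => (child c).ctx) (hb : s.Branching)
    (h : CovSpec child s post pre G) (hbd : G.RemainsBounded s) {W : CGSym d n k}
    (hW : W ∈ G.nonterms) : ∃ pk, pk ∈ (picks s W).take 1 := by
  obtain ⟨⟨B, hB⟩, hl⟩ := h.label W hW
  have h1 := hbd W hW B hB
  have hin := hl.inn
  have hout := hl.out
  rw [hB] at hin hout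
  change Spec _ (s.bd.inn B) at hin
  change Spec _ (s.bd.out B) at hout
  have : picks s W ≠ [] := by
    intro hn
    have hno : ∀ pk, pk ∉ picks s W := fun pk => by rw [hn]; simp
    refine h1 ⟨funext fun i => ?_, funext fun i => ?_⟩
    · rcases hin i with e | e
      · by_contra hc
        refine hno (true, i) (mem_picks.mpr ⟨?_, .inl ⟨rfl, fun e' => hc (e'.trans e.symm)⟩⟩)
        rw [← hv.bd_in B]
        exact mem_omegas.mpr e
      · exact e
    · rcases hout i with e | e
      · by_contra hc
        refine hno (false, i) (mem_picks.mpr ⟨?_, .inr ⟨rfl, fun e' => hc (e'.trans e.symm)⟩⟩)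
        rw [hv.bd_mid hb, ← hv.bd_out B]
        exact mem_omegas.mpr e
      · exact e
  obtain ⟨a, l, e⟩ := List.exists_cons_of_ne_nil this
  exact ⟨a, by rw [e]; simp⟩

end Rules

/-! ### Reachability by rules and strongly connected components -/

section Reach

variable {d n k : ℕ} {R : List (Rule d n k)} {V W X : CGSym d n k}

/-- The second symbol is used in a rule for the first one. -/
def Edge (R : List (Rule d n k)) (V X : CGSym d n k) : Prop :=
  ∃ q ∈ R, q.lhs = V ∧ (q.fst = X ∨ q.snd = X)

theorem mem_succs {cur : List (CGSym d n k)} :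
    X ∈ succs R cur ↔ X ∈ cur ∨ ∃ V ∈ cur, Edge R V X := by
  simp only [succs, List.mem_append, List.mem_flatMap, Edge]
  refine or_congr Iff.rfl ⟨?_, ?_⟩
  · rintro ⟨q, hq, h⟩
    split at h
    · next hl =>
      simp only [List.mem_cons, List.not_mem_nil, or_false] at h
      exact ⟨_, hl, q, hq, rfl, h.imp Eq.symm Eq.symm⟩
    · simp at h
  · rintro ⟨V, hV, q, hq, rfl, h⟩
    refine ⟨q, hq, ?_⟩
    rw [if_pos hV]
    simpa using h.imp Eq.symm Eq.symm

/-- Besides W only the symbols on right-hand sides can be reached, at most 2|R| of them, which is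
the number of iterations. Since the initial set contains W, `subset_of_stable` applies with this
number. -/
theorem mem_reach : X ∈ reach R W ↔ Relation.ReflTransGen (Edge R) W X := by
  classical
  have sound : ∀ m, ∀ X ∈ (succs R)^[m] [W], Relation.ReflTransGen (Edge R) W X := by
    intro m
    induction m with
    | zero =>
      intro X hX
      rw [List.mem_singleton.mp hX]
    | succ m ih =>
      intro X hX
      rw [Function.iterate_succ_apply'] at hX
      rcases mem_succs.mp hX with h | ⟨V, hV, h⟩
      · exact ih X h
      · exact (ih V hV).tail h
  refine ⟨sound _ X, fun h => ?_⟩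
  let f : ℕ → Finset (CGSym d n k) := fun m => ((succs R)^[m] [W]).toFinset
  have hf : ∀ m X, X ∈ f (m + 1) ↔ X ∈ f m ∨ ∃ V ∈ f m, Edge R V X := fun m X => by
    simp only [f, List.mem_toFinset, Function.iterate_succ_apply', mem_succs]
  let U : Finset (CGSym d n k) :=
    insert W ((R.map fun q => q.fst) ++ R.map fun q => q.snd).toFinset
  have hU : ∀ m, f m ⊆ U := by
    intro m
    induction m with
    | zero => intro X hX; simp_all [f, U]
    | succ m ih =>
      intro X hX
      rcases (hf m X).mp hX with h | ⟨V, -, q, hq, -, h⟩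
      · exact ih h
      · refine Finset.mem_insert_of_mem ?_
        rw [List.mem_toFinset, List.mem_append, List.mem_map, List.mem_map]
        exact h.imp (fun e => ⟨q, hq, e⟩) fun e => ⟨q, hq, e⟩
  have hst := subset_of_stable f U (fun m X hX => (hf m X).mpr (.inl hX))
    (fun m e => by ext X; rw [hf m, hf (m + 1), ← e]) hU
  have hcard : U.card - (f 0).card ≤ R.length + R.length := by
    have h1 := Finset.card_insert_le W ((R.map fun q => q.fst) ++ R.map fun q => q.snd).toFinset
    have h2 := List.toFinset_card_le ((R.map fun q => q.fst) ++ R.map fun q => q.snd)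
    have h3 : (f 0).card = 1 := by simp [f]
    have h4 : U.card = (insert W ((R.map fun q => q.fst) ++
      R.map fun q => q.snd).toFinset).card := rfl
    rw [List.length_append, List.length_map, List.length_map] at h2
    omega
  have mono : Monotone f := monotone_nat_of_le_succ fun m X hX => (hf m X).mpr (.inl hX)
  have hex : ∃ m, X ∈ f m := by
    induction h with
    | refl => exact ⟨0, by simp [f]⟩
    | tail _ h ih =>
      obtain ⟨m, hm⟩ := ih
      exact ⟨m + 1, (hf m _).mpr (.inr ⟨_, hm, h⟩)⟩
  obtain ⟨m, hm⟩ := hex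
  exact List.mem_toFinset.mp (mono hcard (hst m hm))

theorem card_reach_le [DecidableEq (CGSym d n k)] :
    (reach R W).toFinset.card ≤ R.length + R.length + 1 := by
  have hsub : (reach R W).toFinset ⊆
      insert W ((R.map fun q => q.fst) ++ R.map fun q => q.snd).toFinset := by
    intro X hX
    rcases Relation.ReflTransGen.cases_tail (mem_reach.mp (List.mem_toFinset.mp hX)) with
      rfl | ⟨V, -, q, hq, -, h⟩
    · exact Finset.mem_insert_self _ _
    · refine Finset.mem_insert_of_mem ?_
      rw [List.mem_toFinset, List.mem_append, List.mem_map, List.mem_map]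
      exact h.imp (fun e => ⟨q, hq, e⟩) fun e => ⟨q, hq, e⟩
  have h1 := Finset.card_le_card hsub
  have h2 := Finset.card_insert_le W ((R.map fun q => q.fst) ++ R.map fun q => q.snd).toFinset
  have h3 := List.toFinset_card_le ((R.map fun q => q.fst) ++ R.map fun q => q.snd)
  rw [List.length_append, List.length_map, List.length_map] at h3
  omega

theorem mem_component : V ∈ component R W ↔ Relation.ReflTransGen (Edge R) W V ∧
    Relation.ReflTransGen (Edge R) V W := by
  simp only [component, List.mem_filter, decide_eq_true_eq, mem_reach]

/-- Each element behind the head was appended because of a rule, so it is reached from W by a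
nonempty path. This holds for later occurrences of W itself, too. -/
theorem component_eq_cons : ∃ l, component R W = W :: l ∧
    ∀ V ∈ l, Relation.TransGen (Edge R) W V := by
  have : ∀ m, ∃ l, (succs R)^[m] [W] = W :: l ∧ ∀ V ∈ l, Relation.TransGen (Edge R) W V := by
    intro m
    induction m with
    | zero => exact ⟨[], rfl, by simp⟩
    | succ m ih =>
      obtain ⟨l, e, h⟩ := ih
      rw [Function.iterate_succ_apply', e]
      refine ⟨_, rfl, fun V hV => ?_⟩
      rcases List.mem_append.mp hV with hV | hV
      · exact h V hV
      · obtain ⟨q, hq, hV⟩ := List.mem_flatMap.mp hV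
        split at hV
        · next hl =>
          have he : Edge R q.lhs V := ⟨q, hq, rfl, by simpa [eq_comm] using hV⟩
          rcases List.mem_cons.mp hl with e | hl
          · exact .single (e ▸ he)
          · exact (h _ hl).tail he
        · simp at hV
  obtain ⟨l, e, h⟩ := this (R.length + R.length)
  classical
  refine ⟨l.filter fun V => W ∈ reach R V, ?_, fun V hV => h V (List.mem_of_mem_filter hV)⟩
  · unfold component
    rw [show reach R W = W :: l from e, List.filter_cons_of_pos]
    rw [decide_eq_true_eq, mem_reach]

/-- The nonterminals of the new NGVAS are positions of the list, which may repeat a symbol. Strong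
connectivity therefore requires nonempty paths also between different positions of the same symbol.
A position other than the first provides one, since its symbol was appended by a rule. -/
theorem component_get_trans {i j : Fin (component R W).length} (h : i ≠ j) :
    Relation.TransGen (Edge R) ((component R W).get i) ((component R W).get j) := by
  obtain ⟨l, e, hl⟩ := component_eq_cons (R := R) (W := W)
  have hpos : ∀ i : Fin (component R W).length, (i : ℕ) ≠ 0 →
      Relation.TransGen (Edge R) W ((component R W).get i) := by
    intro i hi
    obtain ⟨m, hm⟩ := Nat.exists_eq_succ_of_ne_zero hi
    refine hl _ ?_
    have : (component R W).get i = l[m]'(by have := i.2; simp only [e, List.length_cons] at this; omega) := by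
      simp [e, hm]
    rw [this]
    exact List.getElem_mem _
  have hzero : ∀ i : Fin (component R W).length, (i : ℕ) = 0 → (component R W).get i = W := by
    intro i hi
    simp [e, hi]
  have hi := (mem_component.mp (List.get_mem (component R W) i)).2
  by_cases hj : (j : ℕ) = 0
  · rw [hzero j hj]
    have hi0 : (i : ℕ) ≠ 0 := fun h0 => h (Fin.ext (h0.trans hj.symm))
    rcases Relation.reflTransGen_iff_eq_or_transGen.mp hi with e' | h'
    · have := hpos i hi0
      rwa [← e'] at this ⊢
    · exact h'
  · exact Relation.TransGen.trans_right hi (hpos j hj)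

end Reach
end NestedVAS

namespace NestedVAS

/-! ## The constructed NGVAS -/

section Membership

variable {d n k : ℕ} {child : Fin k → NGVAS d} {s : Shell d n k} {T : Table d n k}
  {R : List (Rule d n k)} {l : List (CGSym d n k)} {X : CGSym d n k} {c : Context d}

theorem mem_idxs {j : Fin l.length} : j ∈ idxs l X ↔ l.get j = X := by
  simp [idxs]

theorem mem_lookup {P : Pre d} : P ∈ lookup T X ↔ ∃ L, (X, L) ∈ T ∧ P ∈ L := by
  simp only [lookup, List.mem_flatMap]
  constructor
  · rintro ⟨⟨Y, L⟩, hT, h⟩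
    split at h
    · next e => exact ⟨L, e ▸ hT, h⟩
    · simp at h
  · rintro ⟨L, hT, h⟩
    exact ⟨_, hT, by rw [if_pos rfl]; exact h⟩

theorem mem_alts {K : NGVAS d} : K ∈ alts child s T X c ↔ K = emptyLeaf c ∨
    ∃ P, (P ∈ wraps child s X.lab.sym ∨ P ∈ lookup T X) ∧ K = P.fill c := by
  simp only [alts, List.mem_cons, List.mem_map, List.mem_append, eq_comm]

theorem mem_ones {o : OneItem d l.length} : o ∈ ones child s T R l ↔
    ∃ q ∈ R, l.get o.lhs = q.lhs ∧
      ((o.left = true ∧ l.get o.other = q.snd ∧ o.kid ∈ alts child s T q.fst q.cfst) ∨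
        (o.left = false ∧ l.get o.other = q.fst ∧ o.kid ∈ alts child s T q.snd q.csnd)) := by
  simp only [ones, List.mem_flatMap, List.mem_append, List.mem_map, mem_idxs]
  constructor
  · rintro ⟨q, hq, v, hv, ⟨y, hy, a, ha, rfl⟩ | ⟨y, hy, a, ha, rfl⟩⟩
    · exact ⟨q, hq, hv, .inl ⟨rfl, hy, ha⟩⟩
    · exact ⟨q, hq, hv, .inr ⟨rfl, hy, ha⟩⟩
  · obtain ⟨v, b, y, a⟩ := o
    rintro ⟨q, hq, hv, ⟨rfl, hy, ha⟩ | ⟨rfl, hy, ha⟩⟩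
    · exact ⟨q, hq, v, hv, .inl ⟨y, hy, a, ha, rfl⟩⟩
    · exact ⟨q, hq, v, hv, .inr ⟨y, hy, a, ha, rfl⟩⟩

theorem mem_twos {o : TwoItem l.length} : o ∈ twos R l ↔
    ∃ q ∈ R, l.get o.lhs = q.lhs ∧ l.get o.fst = q.fst ∧ l.get o.snd = q.snd := by
  simp only [twos, List.mem_flatMap, List.mem_map, mem_idxs]
  constructor
  · rintro ⟨q, hq, v, hv, x, hx, y, hy, rfl⟩
    exact ⟨q, hq, hv, hx, hy⟩
  · obtain ⟨v, x, y⟩ := o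
    rintro ⟨q, hq, hv, hx, hy⟩
    exact ⟨q, hq, v, hv, x, hx, y, hy, rfl⟩

theorem mem_exits {o : ExitItem d l.length} : o ∈ exits child s T R l ↔
    ∃ q ∈ R, l.get o.lhs = q.lhs ∧ o.fst ∈ alts child s T q.fst q.cfst ∧
      o.snd ∈ alts child s T q.snd q.csnd := by
  simp only [exits, List.mem_flatMap, List.mem_map, mem_idxs]
  constructor
  · rintro ⟨q, hq, v, hv, a, ha, b, hb, rfl⟩
    exact ⟨q, hq, hv, ha, hb⟩
  · obtain ⟨v, a, b⟩ := o
    rintro ⟨q, hq, hv, ha, hb⟩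
    exact ⟨q, hq, v, hv, a, ha, b, hb, rfl⟩

end Membership

/-! ### Leaves without runs and with empty runs -/

section Leaves

variable {d : ℕ} {c : Context d}

/-- The only word has effect base + 1, whereas the restriction consists of base alone. The two
differ as soon as there is a counter. -/
theorem emptyLeaf_runs (hd : 0 < d) : (emptyLeaf c).runs = ∅ := by
  ext r
  simp only [Set.mem_empty_iff_false, iff_false]
  intro h
  rw [emptyLeaf, NGVAS.runs] at h
  obtain ⟨h1, ⟨y, hy, e⟩, -⟩ := h
  rw [List.map_singleton, concatRuns_singleton] at h1
  rw [h1.1] at e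
  have hy0 : y = 0 := by
    have : {p : Update d | p ∈ ([] : List (Update d))} = ∅ := by ext; simp
    dsimp only at hy
    rw [this, AddSubmonoid.closure_empty] at hy
    exact hy
  have := congrFun e ⟨0, hd⟩
  rw [hy0] at this
  simp at this

theorem emptyLeaf_restr : (emptyLeaf c).ctx.restr ⊆ c.restr := by
  rintro _ ⟨y, hy, rfl⟩
  have hy0 : y = 0 := by
    have : {p : Update d | p ∈ ([] : List (Update d))} = ∅ := by ext; simp
    simp only [emptyLeaf, NGVAS.ctx] at hy
    rw [this, AddSubmonoid.closure_empty] at hy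
    exact hy
  rw [hy0, add_zero]
  exact base_mem_restr c

theorem emptyLeaf_isNGVAS (h : c.unc ⊆ omegas c.cin ∩ omegas c.cout) :
    (emptyLeaf c).IsNGVAS := by
  refine ⟨?_, trivial⟩
  rw [emptyLeaf, NGVAS.Weak]
  exact ⟨by simp, h⟩

theorem epsLeaf_runs {D : Finset (Fin d)} {x : OMarking d} {r : Run d}
    (h : r ∈ (epsLeaf D x).runs) : r.2.1 = [] ∧ r.1 = r.2.2 := by
  rw [epsLeaf, NGVAS.runs] at h
  exact h.1

end Leaves

/-! ### Soundness and ranks of the constructed NGVAS -/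

section Good

variable {d n k : ℕ} {child : Fin k → NGVAS d} {s : Shell d n k} {T : Table d n k}
  {R : List (Rule d n k)} {X : CGSym d n k} {σ : Symbol (Fin k) (Fin n)} {c : Context d}
  {j0 : ℕ}

/-- Sums of a rank without significant entries and a rank of a branch of a child. -/
def Below (child : Fin k → NGVAS d) (j0 : ℕ) (y : LRank d) : Prop :=
  ∃ x z : LRank d, y = x + z ∧ (∀ j : Fin (d + 1), (j : ℕ) ≤ j0 → ofLex x j = 0) ∧
    (z = 0 ∨ ∃ c, z ∈ (child c).branchRanks)

theorem Below.zero : Below child j0 0 := ⟨0, 0, by simp, fun _ _ => rfl, .inl rfl⟩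

theorem Below.add {x y : LRank d} (hx : ∀ j : Fin (d + 1), (j : ℕ) ≤ j0 → ofLex x j = 0)
    (hy : Below child j0 y) : Below child j0 (x + y) := by
  obtain ⟨x', z, rfl, h1, h2⟩ := hy
  refine ⟨x + x', z, (add_assoc _ _ _).symm, fun j hj => ?_, h2⟩
  rw [ofLex_add, Pi.add_apply, hx j hj, h1 j hj]

theorem mem_branchRanks_node {m q : ℕ} {ch : Fin q → NGVAS d} {t : Shell d m q} {y : LRank d} :
    y ∈ (NGVAS.node ch t).branchRanks ↔ y = t.lrank (fun c => (ch c).ctx) ∨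
      ∃ c, ∃ z ∈ (ch c).branchRanks, y = t.lrank (fun c => (ch c).ctx) + z := by
  rw [NGVAS.branchRanks]
  simp only [Finset.mem_insert, Finset.mem_image, Finset.mem_biUnion, Finset.mem_univ, true_and]
  refine or_congr Iff.rfl ⟨?_, ?_⟩
  · rintro ⟨z, ⟨c, hc⟩, rfl⟩
    exact ⟨c, z, hc, rfl⟩
  · rintro ⟨c, z, hc, rfl⟩
    exact ⟨z, ⟨c, hc⟩, rfl⟩

theorem below_node {m q : ℕ} {ch : Fin q → NGVAS d} {t : Shell d m q}
    (h0 : ∀ j : Fin (d + 1), (j : ℕ) ≤ j0 → ofLex (t.lrank fun c => (ch c).ctx) j = 0)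
    (hc : ∀ c, ∀ z ∈ (ch c).branchRanks, Below child j0 z) :
    ∀ y ∈ (NGVAS.node ch t).branchRanks, Below child j0 y := by
  intro y hy
  rcases mem_branchRanks_node.mp hy with rfl | ⟨c, z, hz, rfl⟩
  · exact ⟨_, 0, (add_zero _).symm, h0, .inl rfl⟩
  · exact (hc c z hz).add h0

/-- The NGVAS may be used for the symbol. -/
structure GoodPre (child : Fin k → NGVAS d) (s : Shell d n k) (j0 : ℕ)
    (σ : Symbol (Fin k) (Fin n)) (P : Pre d) : Prop where
  isNGVAS : ∀ c : Context d, c.unc ⊆ omegas c.cin ∩ omegas c.cout → c.unc ⊆ s.bd.left →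
    Spec c.cin (s.inOf (fun c => (child c).ctx) σ) →
    Spec c.cout (s.outOf (fun c => (child c).ctx) σ) → (P.fill c).IsNGVAS
  sound : ∀ c, symRuns P.child (P.shell c) (.nonterminal P.start) ⊆ symRuns child s σ
  rank : ∀ c, ∀ y ∈ (P.fill c).branchRanks, Below child j0 y

/-- A terminal needs a wrapper because the new parent imposes another restriction on it. The wrapper
is linear and thus has local rank zero, and its second child only adds empty runs, so neither ranks
nor runs grow. -/
theorem goodPre_wrap (hv : s.Valid fun c => (child c).ctx) (hb : s.Branching)
    (hch : ∀ c, (child c).IsNGVAS) (c : Fin k) :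
    GoodPre child s j0 (.terminal c) (wrap child s c) := by
  obtain ⟨hc1, hc2, hc3⟩ := hv.child hb c
  have hex : ¬ Persisting ((0, .terminal 0, .terminal 1) :
      Fin 1 × Symbol (Fin 2) (Fin 1) × Symbol (Fin 2) (Fin 1)) := by
    rintro ⟨B, h | h⟩ <;> cases h
  have hp1 : ∀ p : Fin 1 × Symbol (Fin 2) (Fin 1) × Symbol (Fin 2) (Fin 1),
      p ∈ (wrap child s c).prods ↔ p = (0, .terminal 0, .terminal 1) :=
    fun p => List.mem_singleton
  have hnb : ∀ x, ¬ ((wrap child s c).shell x).Branching := by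
    rintro x ⟨p, hp, B, C, h1, h2⟩
    rw [(hp1 p).mp hp] at h1
    cases h1
  refine ⟨fun x hx hxD hin hout => ⟨?_, ?_⟩, fun x => ?_, fun x => below_node ?_ ?_⟩
  · rw [Pre.fill, NGVAS.Weak]
    refine ⟨fun a => ?_, ?_⟩
    · revert a
      refine Fin.forall_fin_two.mpr ⟨(hch c).1, ?_⟩
      change (epsLeaf s.bd.left (child c).ctx.cout).Weak
      rw [epsLeaf, NGVAS.Weak]
      exact ⟨by simp, by simp [hc3]⟩
    · refine ⟨?_, hx, ?_, ?_, fun _ => hc2, fun _ => hc3, fun _ => rfl, hin, hout, ?_⟩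
      · refine Fin.forall_fin_two.mpr ⟨⟨_, (hp1 _).mpr rfl, .inl rfl⟩, ⟨_, (hp1 _).mpr rfl, .inr rfl⟩⟩
      · refine Fin.forall_fin_two.mpr ⟨?_, hxD⟩
        change x.unc ⊆ (child c).ctx.unc
        rw [hc1]
        exact hxD
      · exact Finset.subset_inter hxD hxD
      · intro p hp
        refine ⟨fun h => ?_, fun _ => ?_⟩
        · rcases h with h | h
          · exact (hex ((hp1 p).mp hp ▸ h)).elim
          · exact (hnb x h).elim
        · rw [(hp1 p).mp hp]
          exact ⟨Spec.refl _, rfl, Spec.refl _⟩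
  · rw [Pre.fill, NGVAS.Strong]
    refine ⟨Fin.forall_fin_two.mpr ⟨(hch c).2, trivial⟩, ?_, ?_, ?_⟩
    · intro A B
      refine ⟨[], [], ?_⟩
      rw [Subsingleton.elim (α := Fin 1) B A]
      exact ContextFreeGrammar.Derives.refl _
    · intro A
      refine ⟨[], [], ([0, 1] : List (Fin 2)), ?_, ?_⟩
      · rw [Subsingleton.elim (α := Fin 1) A ((wrap child s c).shell x).start]
        exact ContextFreeGrammar.Derives.refl _
      · have := derives_prod (s := (wrap child s c).shell x) ((hp1 _).mpr rfl)
        rw [Subsingleton.elim (α := Fin 1) A 0]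
        exact this
    · intro _
      exact ⟨_, ⟨(hp1 _).mpr rfl, hex⟩, fun p hp => (hp1 p).mp hp.1⟩
  · let I : Symbol (Fin 2) (Fin 1) → Set (Run d) := fun σ => match σ with
      | .terminal a => if a = 0 then (child c).runs else {r | r.2.1 = [] ∧ r.1 = r.2.2}
      | .nonterminal _ => (child c).runs
    refine symRuns_subset (I := I) ?_ ?_ (.nonterminal 0)
    · refine Fin.forall_fin_two.mpr ⟨?_, ?_⟩
      · simp only [I, if_true]
        exact fun r h => h
      · simp only [I, if_neg (one_ne_zero : (1 : Fin 2) ≠ 0)]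
        exact fun r h => epsLeaf_runs h
    · intro p hp a b e u v h1 h2
      rw [(hp1 p).mp hp] at h1 h2
      simp only [I, if_true, if_neg (one_ne_zero : (1 : Fin 2) ≠ 0)] at h1 h2 ⊢
      obtain ⟨h3, h4⟩ := h2
      dsimp only at h3 h4
      subst h3 h4
      simpa using h1
  · intro j _
    rw [Shell.lrank, if_neg (hnb x)]
    rfl
  · refine Fin.forall_fin_two.mpr ⟨fun z hz => ?_, fun z hz => ?_⟩
    · exact ⟨0, z, (zero_add z).symm, fun _ _ => rfl, .inr ⟨c, hz⟩⟩
    · have hz : z ∈ ({0} : Finset (LRank d)) := by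
        have := hz
        change z ∈ (epsLeaf s.bd.left (child c).ctx.cout).branchRanks at this
        rwa [epsLeaf, NGVAS.branchRanks] at this
      rw [Finset.mem_singleton.mp hz]
      exact Below.zero

/-- All entries of the table may be used for their symbols. -/
def GoodTable (child : Fin k → NGVAS d) (s : Shell d n k) (j0 : ℕ) (T : Table d n k) : Prop :=
  ∀ X P, P ∈ lookup T X → GoodPre child s j0 X.lab.sym P

/-- The context is suitable for the symbol. -/
structure KidContext (child : Fin k → NGVAS d) (s : Shell d n k) (σ : Symbol (Fin k) (Fin n))
    (c : Context d) : Prop where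
  unc : c.unc = s.bd.left
  cin : c.cin = s.inOf (fun c => (child c).ctx) σ
  cout : c.cout = s.outOf (fun c => (child c).ctx) σ

/-- The properties of the children of the constructed NGVAS. -/
structure Kid (child : Fin k → NGVAS d) (s : Shell d n k) (j0 : ℕ) (σ : Symbol (Fin k) (Fin n))
    (c : Context d) (K : NGVAS d) : Prop extends KidContext child s σ K.ctx where
  isNGVAS : K.IsNGVAS
  runs : K.runs ⊆ symRuns child s σ
  rank : ∀ y ∈ K.branchRanks, Below child j0 y
  restr : K.ctx.restr ⊆ c.restr

theorem goodPre_of_mem (hv : s.Valid fun c => (child c).ctx) (hb : s.Branching)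
    (hch : ∀ c, (child c).IsNGVAS) (hT : GoodTable child s j0 T) {P : Pre d}
    (hP : P ∈ wraps child s X.lab.sym ∨ P ∈ lookup T X) :
    GoodPre child s j0 X.lab.sym P := by
  rcases hP with hP | hP
  · cases hs : X.lab.sym with
    | terminal c =>
      rw [hs] at hP
      rw [List.mem_singleton.mp hP]
      exact goodPre_wrap hv hb hch c
    | nonterminal A => rw [hs] at hP; simp [wraps] at hP
  · exact hT X P hP

/-- Filling in a context of the right markings makes an entry of the table a child with the runs of
the symbol at most; the leaf without runs satisfies all requirements trivially. -/
theorem kid_of_mem_alts (hd : 0 < d) (hv : s.Valid fun c => (child c).ctx) (hb : s.Branching)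
    (hch : ∀ c, (child c).IsNGVAS) (hT : GoodTable child s j0 T)
    (hc : KidContext child s X.lab.sym c) {K : NGVAS d} (hK : K ∈ alts child s T X c) :
    Kid child s j0 X.lab.sym c K := by
  have hω : c.unc ⊆ omegas c.cin ∩ omegas c.cout := by
    rw [hc.unc, hc.cin, hc.cout, hv.omegas_inOf hb, hv.omegas_outOf hb, Finset.inter_self]
  rcases mem_alts.mp hK with rfl | ⟨P, hP, rfl⟩
  · refine ⟨⟨hc.unc, hc.cin, hc.cout⟩, emptyLeaf_isNGVAS hω, ?_, fun y hy => ?_, emptyLeaf_restr⟩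
    · rw [emptyLeaf_runs hd]
      exact Set.empty_subset _
    · rw [emptyLeaf, NGVAS.branchRanks, Finset.mem_singleton] at hy
      rw [hy]
      exact Below.zero
  · have hG := goodPre_of_mem hv hb hch hT hP
    refine ⟨⟨hc.unc, hc.cin, hc.cout⟩, hG.isNGVAS c hω hc.unc.subset (hc.cin ▸ Spec.refl _)
      (hc.cout ▸ Spec.refl _), fun r hr => ?_, hG.rank c, fun _ h => h⟩
    exact hG.sound c (mem_runs_node.mp hr).1

/-- The properties of the rules. -/
def GoodRules (child : Fin k → NGVAS d) (s : Shell d n k) (R : List (Rule d n k)) : Prop :=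
  ∀ q ∈ R, Splits s q.lhs.lab q.fst.lab q.snd.lab ∧ ∃ pk ∈ (picks s q.lhs).take 1,
    q.cfst ∈ cosets s (fun c => (child c).ctx) pk q.fst ∧
    q.csnd ∈ cosets s (fun c => (child c).ctx) pk q.snd

theorem kidContext_of_mem_cosets {pk : Bool × Fin d}
    (h : c ∈ cosets s (fun c => (child c).ctx) pk X) : KidContext child s X.lab.sym c :=
  ⟨(cosets_ctx h).1, (cosets_ctx h).2.1, (cosets_ctx h).2.2⟩

/-- The productions are those of rules, up to the labelling of symbols. -/
structure Simulates (child : Fin k → NGVAS d) (s : Shell d n k) (T : Table d n k)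
    (R : List (Rule d n k)) (P : Pre d) (lab : Symbol (Fin P.k) (Fin P.n) → CGSym d n k) :
    Prop where
  prod : ∀ p ∈ P.prods, ∃ q ∈ R, q.lhs = lab (.nonterminal p.1) ∧ q.fst = lab p.2.1 ∧
    q.snd = lab p.2.2 ∧ (∀ c, p.2.1 = .terminal c → P.child c ∈ alts child s T q.fst q.cfst) ∧
    ∀ c, p.2.2 = .terminal c → P.child c ∈ alts child s T q.snd q.csnd
  occurs : ∀ c, ∃ p ∈ P.prods, p.2.1 = .terminal c ∨ p.2.2 = .terminal c
  left : P.bd.left = s.bd.left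
  right : P.bd.right = s.bd.left
  inn : ∀ A, P.bd.inn A = s.inOf (fun c => (child c).ctx) (lab (.nonterminal A)).lab.sym
  out : ∀ A, P.bd.out A = s.outOf (fun c => (child c).ctx) (lab (.nonterminal A)).lab.sym

variable {P : Pre d} {lab : Symbol (Fin P.k) (Fin P.n) → CGSym d n k}

theorem Simulates.kid (h : Simulates child s T R P lab) (hd : 0 < d)
    (hv : s.Valid fun c => (child c).ctx) (hb : s.Branching) (hch : ∀ c, (child c).IsNGVAS)
    (hT : GoodTable child s j0 T) (hR : GoodRules child s R) (c : Fin P.k) :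
    ∃ x, Kid child s j0 (lab (.terminal c)).lab.sym x (P.child c) := by
  obtain ⟨p, hp, e⟩ := h.occurs c
  obtain ⟨q, hq, -, h2, h3, h4, h5⟩ := h.prod p hp
  obtain ⟨-, pk, -, h6, h7⟩ := hR q hq
  rcases e with e | e
  · rw [e] at h2
    exact ⟨_, h2 ▸ kid_of_mem_alts hd hv hb hch hT (kidContext_of_mem_cosets h6) (h4 c e)⟩
  · rw [e] at h3
    exact ⟨_, h3 ▸ kid_of_mem_alts hd hv hb hch hT (kidContext_of_mem_cosets h7) (h5 c e)⟩

/-- All markings of the new NGVAS are those of N at the labels, so validity is inherited from the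
productions of N. Mapping each symbol to the runs of its label proves soundness, as every production
is labelled by one of N. -/
theorem Simulates.goodPre (h : Simulates child s T R P lab) (hd : 0 < d)
    (hv : s.Valid fun c => (child c).ctx) (hb : s.Branching) (hch : ∀ c, (child c).IsNGVAS)
    (hT : GoodTable child s j0 T) (hR : GoodRules child s R)
    (hstrong : ∀ x, (P.shell x).Strong)
    (hrank : ∀ x, ∀ j : Fin (d + 1), (j : ℕ) ≤ j0 →
      ofLex ((P.shell x).lrank fun c => (P.child c).ctx) j = 0) :
    GoodPre child s j0 (lab (.nonterminal P.start)).lab.sym P := by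
  choose x hk using h.kid hd hv hb hch hT hR
  have hin : ∀ y σ, (P.shell y).inOf (fun c => (P.child c).ctx) σ =
      s.inOf (fun c => (child c).ctx) (lab σ).lab.sym := by
    intro y σ
    cases σ with
    | terminal c => exact (hk c).cin
    | nonterminal A => exact h.inn A
  have hout : ∀ y σ, (P.shell y).outOf (fun c => (P.child c).ctx) σ =
      s.outOf (fun c => (child c).ctx) (lab σ).lab.sym := by
    intro y σ
    cases σ with
    | terminal c => exact (hk c).cout
    | nonterminal A => exact h.out A
  have hprod : ∀ p ∈ P.prods, Splits s (lab (.nonterminal p.1)).lab (lab p.2.1).lab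
      (lab p.2.2).lab := by
    intro p hp
    obtain ⟨q, hq, h1, h2, h3, -⟩ := h.prod p hp
    rw [← h1, ← h2, ← h3]
    exact (hR q hq).1
  refine ⟨fun y hy hyD hcin hcout => ⟨?_, ?_⟩, fun y => ?_, fun y =>
    below_node (hrank y) fun c => (hk c).rank⟩
  · rw [Pre.fill, NGVAS.Weak]
    refine ⟨fun c => (hk c).isNGVAS.1, h.occurs, hy, fun c => ?_, ?_, fun A => ?_, fun A => ?_,
      fun _ => h.left.trans h.right.symm, ?_, ?_, fun p hp => ?_⟩
    · rw [(hk c).unc]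
      exact hyD
    · change y.unc ⊆ P.bd.left ∩ P.bd.right
      rw [h.left, h.right, Finset.inter_self]
      exact hyD
    · change omegas (P.bd.inn A) = P.bd.left
      rw [h.inn, h.left, hv.omegas_inOf hb]
    · change omegas (P.bd.out A) = P.bd.right
      rw [h.out, h.right, hv.omegas_outOf hb]
    · change Spec y.cin (P.bd.inn P.start)
      rw [h.inn]
      exact hcin
    · change Spec y.cout (P.bd.out P.start)
      rw [h.out]
      exact hcout
    · have hc : (P.shell y).bd.inn p.1 = (P.shell y).inOf (fun c => (P.child c).ctx) p.2.1 ∧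
          (P.shell y).outOf (fun c => (P.child c).ctx) p.2.1 =
            (P.shell y).inOf (fun c => (P.child c).ctx) p.2.2 ∧
          (P.shell y).outOf (fun c => (P.child c).ctx) p.2.2 = (P.shell y).bd.out p.1 := by
        obtain ⟨A, hA, hp'⟩ := (hprod p hp).prod
        obtain ⟨e1, e2, e3⟩ := hv.prod hb hp'
        rw [hin, hout, hin, hout]
        refine ⟨(h.inn p.1).trans ?_, e2, e3.trans (Eq.trans ?_ (h.out p.1).symm)⟩
        · rw [hA]; exact e1
        · rw [hA]; rfl
      refine ⟨fun _ => ⟨hc.1, hc.2.1, hc.2.2, fun c _ => ?_⟩, fun _ =>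
        ⟨hc.1 ▸ Spec.refl _, hc.2.1, hc.2.2 ▸ Spec.refl _⟩⟩
      rw [(hk c).unc, (hk c).cin, (hk c).cout]
      exact ⟨hv.omegas_inOf hb _, hv.omegas_outOf hb _⟩
  · rw [Pre.fill, NGVAS.Strong]
    exact ⟨fun c => (hk c).isNGVAS.2, hstrong y⟩
  · refine symRuns_subset (I := fun σ => symRuns child s (lab σ).lab.sym) (fun c => (hk c).runs) ?_
      (.nonterminal P.start)
    intro p hp a b e u v h1 h2
    obtain ⟨A, hA, hp'⟩ := (hprod p hp).prod
    rw [hA]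
    exact mem_symRuns_node hp' h1 h2

end Good
end NestedVAS

namespace NestedVAS

/-! ## Components as NGVAS -/

section Rank

variable {d n k : ℕ} {child : Fin k → NGVAS d} {s : Shell d n k} {T : Table d n k}
  {R : List (Rule d n k)} {P : Pre d} {lab : Symbol (Fin P.k) (Fin P.n) → CGSym d n k} {j0 : ℕ}
  {pk : Bool × Fin d}

/-- The values of the markings match along the word. -/
def Chain {σ : Type*} (f g : σ → ℕ∞) : List σ → ℕ∞ → ℕ∞ → Prop
  | [], a, b => a = b
  | x :: w, a, b => f x = a ∧ Chain f g w (g x) b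

theorem chain_append {σ : Type*} {f g : σ → ℕ∞} {u v : List σ} {a b : ℕ∞} :
    Chain f g (u ++ v) a b ↔ ∃ m, Chain f g u a m ∧ Chain f g v m b := by
  induction u generalizing a with
  | nil => simp [Chain]
  | cons x u ih =>
    simp only [List.cons_append, Chain, ih]
    exact ⟨fun ⟨h, m, h1, h2⟩ => ⟨m, ⟨h, h1⟩, h2⟩, fun ⟨m, ⟨h, h1⟩, h2⟩ => ⟨h, m, h1, h2⟩⟩

/-- The counter is tracked along the rule. -/
structure Tracked (pk : Bool × Fin d) (q : Rule d n k) : Prop where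
  fst : src pk q.fst = src pk q.lhs
  mid : tgt pk q.fst = src pk q.snd
  snd : tgt pk q.snd = tgt pk q.lhs
  src_fst : src pk q.fst ≠ ⊤
  tgt_fst : tgt pk q.fst ≠ ⊤
  tgt_snd : tgt pk q.snd ≠ ⊤

/-- Deviations from the bases add up in the subgroup, and the differences of values telescope along
a word with matching values. -/
theorem ceff_chain {q m : ℕ} {cc : Fin q → Context d} {L : AddSubgroup (Update d)}
    {b : Fin q → Update d} {f g : Symbol (Fin q) (Fin m) → ℕ∞} {i : Fin d}
    (h : ∀ c, ∀ e ∈ (cc c).restr, e - b c ∈ L ∧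
      e i = (g (.terminal c)).toNat - (f (.terminal c)).toNat) (u : List (Fin q)) (e : Update d)
    (he : e ∈ ceff cc u) : e - (u.map b).sum ∈ L ∧
      ∀ x y, Chain f g (u.map Symbol.terminal) x y → e i = y.toNat - x.toNat := by
  induction u generalizing e with
  | nil =>
    obtain ⟨l, hl, rfl⟩ := he
    cases hl
    refine ⟨by simp, fun x y hxy => ?_⟩
    rw [show x = y from hxy]
    simp
  | cons c u ih =>
    obtain ⟨x, hx, z, hz, rfl⟩ := ceff_split (u := [c]) he
    obtain ⟨h1, h2⟩ := h c x (ceff_singleton.mp hx)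
    obtain ⟨h3, h4⟩ := ih z hz
    refine ⟨?_, ?_⟩
    · rw [List.map_cons, List.sum_cons, add_sub_add_comm]
      exact add_mem h1 h3
    · rintro x' y ⟨h5, h6⟩
      rw [Pi.add_apply, h2, h4 _ _ h6, ← h5]
      ring

/-- A cycle of the new NGVAS becomes a cycle of N when its symbols are replaced by their labels. Its
left effect is the sum of the base effects of the left labels, which is in the cycle space of N,
plus a lattice element, which is there too. On the chosen counter the effects telescope from the
value before A to the value before the inner occurrence of A, which is the same. -/
theorem Simulates.lcyclespace_le (h : Simulates child s T R P lab) (hd : 0 < d)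
    (hv : s.Valid fun c => (child c).ctx) (hs : s.Strong) (hb : s.Branching)
    (hch : ∀ c, (child c).IsNGVAS) (hT : GoodTable child s j0 T) (hR : GoodRules child s R)
    (hnt : ∀ A, (lab (.nonterminal A)).IsNT)
    (hpk : ∀ q ∈ R, ∀ A, q.lhs = lab (.nonterminal A) →
      (∀ pk' ∈ (picks s q.lhs).take 1, pk' = pk) ∧ Tracked pk q) (y : Context d) :
    (P.shell y).lcyclespace (fun c => (P.child c).ctx) ≤
      s.lcyclespace (fun c => (child c).ctx) ⊓ LinearMap.ker (LinearMap.proj pk.2) := by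
  have hkid : ∀ c, ∀ e ∈ (P.child c).ctx.restr,
      e - symBase s (fun c => (child c).ctx) (lab (.terminal c)).lab.sym ∈
        lattice s (fun c => (child c).ctx) ∧
      e pk.2 = (tgt pk (lab (.terminal c))).toNat - (src pk (lab (.terminal c))).toNat := by
    intro c e he
    obtain ⟨p, hp, e'⟩ := h.occurs c
    obtain ⟨q, hq, h1, h2, h3, h4, h5⟩ := h.prod p hp
    obtain ⟨-, pk', hpk', h6, h7⟩ := hR q hq
    obtain ⟨h8, h9⟩ := hpk q hq _ h1
    rw [h8 pk' hpk'] at h6 h7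
    rcases e' with e' | e'
    · have hk := kid_of_mem_alts hd hv hb hch hT (kidContext_of_mem_cosets h6) (h4 c e')
      have := cosets_sound h6 (hk.restr he)
      rw [e'] at h2
      rw [← h2]
      exact ⟨this.1, this.2 ⟨h9.src_fst, h9.tgt_fst⟩⟩
    · have hk := kid_of_mem_alts hd hv hb hch hT (kidContext_of_mem_cosets h7) (h5 c e')
      have := cosets_sound h7 (hk.restr he)
      rw [e'] at h3
      rw [← h3]
      exact ⟨this.1, this.2 ⟨h9.mid ▸ h9.tgt_fst, h9.tgt_snd⟩⟩
  have hword : ∀ (u : List (Fin P.k)) (e : Update d), e ∈ ceff (fun c => (P.child c).ctx) u →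
      (e - (u.map fun c => symBase s (fun c => (child c).ctx) (lab (.terminal c)).lab.sym).sum ∈
        lattice s fun c => (child c).ctx) ∧
      ∀ a b, Chain (fun σ => src pk (lab σ)) (fun σ => tgt pk (lab σ)) (u.map Symbol.terminal) a b →
        e pk.2 = b.toNat - a.toNat :=
    fun u e he => ceff_chain (L := lattice s fun c => (child c).ctx)
      (b := fun c => symBase s (fun c => (child c).ctx) (lab (.terminal c)).lab.sym)
      (fun c e he => hkid c e he) u e he
  refine Submodule.span_le.mpr ?_
  rintro _ ⟨A, u, v, hcyc, e, he, rfl⟩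
  obtain ⟨B, hB⟩ := hnt A
  -- Both invariants of sentential forms are proved together: the labels form a derivation of N, and
  -- the values of the chosen counter match from symbol to symbol.
  have hform := derives_induction (C := fun w =>
    s.Derives B (w.map fun σ => (lab σ).lab.sym) ∧
      Chain (fun σ => src pk (lab σ)) (fun σ => tgt pk (lab σ)) w (src pk (lab (.nonterminal A)))
        (tgt pk (lab (.nonterminal A)))) hcyc
    ⟨by rw [List.map_singleton, hB]; exact ContextFreeGrammar.Derives.refl _, rfl, rfl⟩ (by
      rintro p hp x z ⟨h1, h2⟩
      obtain ⟨q, hq, e1, e2, e3, -⟩ := h.prod p hp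
      obtain ⟨C, hC, hp'⟩ := (hR q hq).1.prod
      obtain ⟨-, ht⟩ := hpk q hq _ e1
      rw [e1] at hC
      rw [e2, e3] at hp'
      refine ⟨h1.trans ?_, ?_⟩
      · simp only [List.map_append, List.map_cons, List.map_nil, hC]
        exact derives_append (derives_append (ContextFreeGrammar.Derives.refl _) (derives_prod hp'))
          (ContextFreeGrammar.Derives.refl _)
      · obtain ⟨m, h3, h4⟩ := chain_append.mp h2
        obtain ⟨m', h5, h6, h7⟩ := chain_append.mp h3
        refine chain_append.mpr ⟨m, chain_append.mpr ⟨m', h5, ?_, ?_, ?_⟩, h4⟩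
        · dsimp only
          rw [← e2, ht.fst, e1]
          exact h6
        · dsimp only
          rw [← e2, ← e3]
          exact ht.mid.symm
        · dsimp only
          rw [← e3, ht.snd, e1]
          exact h7)
  obtain ⟨hder, hchain⟩ := hform
  obtain ⟨h1, h2⟩ := hword u e he
  refine ⟨?_, ?_⟩
  · have h3 := real_mem_of_mem_lattice hb hs hv.occurs h1
    simp only [List.map_append, List.map_cons, List.map_nil, hB, List.map_map] at hder
    have h4 := sum_symBase_mem (cc := fun c => (child c).ctx) hs hder
    have h5 := add_mem h3 h4
    rw [← real_add, List.map_map] at h5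
    have e5 : ∀ x z : Update d, x - z + z = x := fun x z => sub_add_cancel x z
    simp only [Function.comp_def] at h5
    rw [e5] at h5
    exact h5
  · obtain ⟨m, h3, -⟩ := chain_append.mp hchain
    obtain ⟨m', h5, h6, -⟩ := chain_append.mp h3
    have h7 := h2 _ _ h5
    dsimp only at h6
    rw [← h6, sub_self] at h7
    rw [SetLike.mem_coe, LinearMap.mem_ker, LinearMap.proj_apply]
    exact_mod_cast h7

/-- The only nonzero entry has index d minus the dimension of the cycle space, so a dimension below
d - `j0` puts it behind index `j0`. -/
theorem Shell.lrank_apply_of_lt {m q : ℕ} {t : Shell d m q} {cc : Fin q → Context d}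
    (h : t.Branching → d - j0 > Module.finrank ℝ (t.lcyclespace cc))
    (j : Fin (d + 1)) (hj : (j : ℕ) ≤ j0) : ofLex (t.lrank cc) j = 0 := by
  rw [Shell.lrank]
  split
  · next hb =>
    have := h hb
    rw [ofLex_toLex]
    refine Pi.single_eq_of_ne (fun e => ?_) _
    have := congrArg Fin.val e
    dsimp only at this
    omega
  · rfl

end Rank

/-! ### Propagation of ω along rules -/

section Monotone

variable {d n k : ℕ} {child : Fin k → NGVAS d} {s : Shell d n k}
  {R : List (Rule d n k)} {V W X : CGSym d n k}

/-- The counters with value `ω` change monotonically. -/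
structure Grows (V X : CGSym d n k) : Prop where
  inn : omegas V.lab.inn ⊆ omegas X.lab.inn
  out : omegas V.lab.out ⊆ omegas X.lab.out
  post : omegas X.lab.post ⊆ omegas V.lab.post
  pre : omegas X.lab.pre ⊆ omegas V.lab.pre

/-- Input markings pass through the first symbol to the second one, and approximators only add
entries ω; symmetrically for output markings. The final approximations of the right-hand side are
bounded by those of the left-hand side. -/
theorem grows_of_edge (hR : GoodRules child s R) (h : Edge R V X) : Grows V X := by
  obtain ⟨q, hq, rfl, h⟩ := h
  obtain ⟨h1, -⟩ := hR q hq
  rcases h with rfl | rfl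
  · refine ⟨h1.inn ▸ subset_rfl, ?_, ?_, h1.pre.omegas_subset⟩
    · rw [← h1.mid_pre, ← h1.out]
      exact h1.snd_pre
    · rw [h1.mid_post]
      exact h1.snd_post.trans h1.post.omegas_subset
  · refine ⟨?_, h1.out ▸ subset_rfl, h1.post.omegas_subset, ?_⟩
    · rw [← h1.mid_post, ← h1.inn]
      exact h1.fst_post
    · rw [h1.mid_pre]
      exact h1.fst_pre.trans h1.pre.omegas_subset

theorem grows_of_reach (hR : GoodRules child s R) (h : Relation.ReflTransGen (Edge R) V X) :
    Grows V X := by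
  induction h with
  | refl => exact ⟨subset_rfl, subset_rfl, subset_rfl, subset_rfl⟩
  | tail _ h ih =>
    have := grows_of_edge hR h
    exact ⟨ih.inn.trans this.inn, ih.out.trans this.out, this.post.trans ih.post,
      this.pre.trans ih.pre⟩

/-- The counters with value `ω` agree. -/
structure SameOmegas (V X : CGSym d n k) : Prop where
  inn : omegas V.lab.inn = omegas X.lab.inn
  out : omegas V.lab.out = omegas X.lab.out
  post : omegas V.lab.post = omegas X.lab.post
  pre : omegas V.lab.pre = omegas X.lab.pre

theorem sameOmegas_of_mem (hR : GoodRules child s R) (hV : V ∈ component R W)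
    (hX : X ∈ component R W) : SameOmegas V X := by
  obtain ⟨h1, h2⟩ := mem_component.mp hV
  obtain ⟨h3, h4⟩ := mem_component.mp hX
  have g1 := grows_of_reach hR (h2.trans h3)
  have g2 := grows_of_reach hR (h4.trans h1)
  exact ⟨g1.inn.antisymm g2.inn, g1.out.antisymm g2.out, g2.post.antisymm g1.post,
    g2.pre.antisymm g1.pre⟩

/-- If both symbols of a rule are in the component, the value after the first is the input of the
second. So input and forward approximation have the same entries ω throughout the component, and
likewise output and backward approximation. A counter concrete at the input is then concrete in the
forward approximation of every left-hand side. That forces concrete and matching values on each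
right-hand side, also for symbols outside the component. -/
theorem tracked_of_branching (hR : GoodRules child s R) {q0 : Rule d n k} (hq0 : q0 ∈ R)
    (h1 : q0.fst ∈ component R W) (h2 : q0.snd ∈ component R W)
    {pk : Bool × Fin d} (hpk : pk ∈ (picks s W).take 1) {q : Rule d n k} (hq : q ∈ R)
    (hl : q.lhs ∈ component R W) :
    (∀ pk' ∈ (picks s q.lhs).take 1, pk' = pk) ∧ Tracked pk q := by
  have hW : W ∈ component R W := mem_component.mpr ⟨.refl, .refl⟩
  have e1 : omegas q.lhs.lab.inn = omegas q.lhs.lab.post := by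
    rw [(sameOmegas_of_mem hR hl h2).inn, ← (hR q0 hq0).1.mid_post,
      (sameOmegas_of_mem hR hl h1).post]
  have e2 : omegas q.lhs.lab.out = omegas q.lhs.lab.pre := by
    rw [(sameOmegas_of_mem hR hl h1).out, ← (hR q0 hq0).1.mid_pre,
      (sameOmegas_of_mem hR hl h2).pre]
  have hs := sameOmegas_of_mem hR hW hl
  refine ⟨fun pk' hpk' => ?_, ?_⟩
  · rw [← picks_congr hs.inn hs.out] at hpk'
    rcases hp : picks s W with _ | ⟨a, l⟩
    · rw [hp] at hpk; simp at hpk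
    · rw [hp] at hpk hpk'
      simp only [List.take_succ_cons, List.take_zero, List.mem_singleton] at hpk hpk'
      rw [hpk, hpk']
  · have hS := (hR q hq).1
    obtain ⟨b, i⟩ := pk
    obtain ⟨-, hb⟩ := mem_picks.mp (List.mem_of_mem_take hpk)
    rcases hb with ⟨hb, hi⟩ | ⟨hb, hi⟩
    · dsimp only at hb hi
      subst hb
      have g1 : i ∉ omegas q.lhs.lab.inn := by rw [← hs.inn, mem_omegas]; exact hi
      have g2 : i ∉ omegas q.lhs.lab.post := e1 ▸ g1
      have g3 : i ∉ omegas q.snd.lab.post := fun h => g2 (hS.post.omegas_subset h)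
      have g4 : i ∉ omegas q.fst.lab.post := fun h => g3 (hS.snd_post (hS.mid_post ▸ h))
      rw [mem_omegas] at g1 g2 g3 g4
      constructor
      · simp only [src, if_true]; rw [hS.inn]
      · simp only [src, tgt, if_true]; rw [hS.mid_post]
      · simp only [tgt, if_true]; exact hS.post.eq_of_ne_top g2
      · simp only [src, if_true]; rw [hS.inn]; exact g1
      · simp only [tgt, if_true]; exact g4
      · simp only [tgt, if_true]; exact g3
    · dsimp only at hb hi
      subst hb
      have g1 : i ∉ omegas q.lhs.lab.out := by rw [← hs.out, mem_omegas]; exact hi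
      have g2 : i ∉ omegas q.lhs.lab.pre := e2 ▸ g1
      have g3 : i ∉ omegas q.fst.lab.pre := fun h => g2 (hS.pre.omegas_subset h)
      have g4 : i ∉ omegas q.snd.lab.pre := fun h => g3 (hS.fst_pre (hS.mid_pre ▸ h))
      rw [mem_omegas] at g1 g2 g3 g4
      constructor
      · simp [src]; exact hS.pre.eq_of_ne_top g2
      · simp [src, tgt]; rw [hS.mid_pre]
      · simp [tgt]; rw [hS.out]
      · simp [src]; exact g3
      · simp [tgt]; rw [← hS.mid_pre]; exact g4
      · simp [tgt]; rw [hS.out]; exact g1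

end Monotone
end NestedVAS

namespace NestedVAS

/-! ## The NGVAS of a component -/

section Paths

variable {d m q : ℕ} {t : Shell d m q} {A B C : Fin m} {u v u' v' : List (Fin q)}

theorem derives_inside {f : List (Symbol (Fin q) (Fin m))} (h : t.Derives B f) :
    t.cfg.Derives (u.map Symbol.terminal ++ [.nonterminal B] ++ v.map Symbol.terminal)
      (u.map Symbol.terminal ++ f ++ v.map Symbol.terminal) :=
  derives_append (derives_append (ContextFreeGrammar.Derives.refl _) h)
    (ContextFreeGrammar.Derives.refl _)

theorem derives_path (h1 : t.Derives A (u.map Symbol.terminal ++ [.nonterminal B] ++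
    v.map Symbol.terminal)) (h2 : t.Derives B (u'.map Symbol.terminal ++ [.nonterminal C] ++
    v'.map Symbol.terminal)) : t.Derives A ((u ++ u').map Symbol.terminal ++ [.nonterminal C] ++
    (v' ++ v).map Symbol.terminal) := by
  have := h1.trans (derives_inside h2)
  unfold Shell.Derives
  simpa only [List.map_append, List.append_assoc] using this

theorem derives_word {w : List (Fin q)} (h : t.Derives B (w.map Symbol.terminal)) :
    t.cfg.Derives (u.map Symbol.terminal ++ [.nonterminal B] ++ v.map Symbol.terminal)
      ((u ++ w ++ v).map Symbol.terminal) := by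
  simpa only [List.map_append] using derives_inside h

end Paths

section Assemble

variable {d n k : ℕ} {child : Fin k → NGVAS d} {s : Shell d n k} {T : Table d n k}
  {R : List (Rule d n k)} {l : List (CGSym d n k)} {E : List (ExitItem d l.length)}
  {w : Fin l.length} {j0 : ℕ}

/-- The NGVAS for a component and a choice of exit productions. -/
noncomputable abbrev node (child : Fin k → NGVAS d) (s : Shell d n k) (T : Table d n k)
    (R : List (Rule d n k)) (l : List (CGSym d n k)) (E : List (ExitItem d l.length))
    (w : Fin l.length) : Pre d :=
  assemble s (fun c => (child c).ctx) l (ones child s T R l) (twos R l) E w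

theorem mem_assemble_prods {cc : Fin k → Context d} {O : List (OneItem d l.length)}
    {T : List (TwoItem l.length)}
    {p : Fin l.length × Symbol (Fin (O.length + (E.length + E.length))) (Fin l.length) ×
      Symbol (Fin (O.length + (E.length + E.length))) (Fin l.length)} :
    p ∈ (assemble s cc l O T E w).prods ↔
      (∃ j, p = if (O.get j).left then
          ((O.get j).lhs, .terminal (Fin.castAdd _ j), .nonterminal (O.get j).other)
        else ((O.get j).lhs, .nonterminal (O.get j).other, .terminal (Fin.castAdd _ j))) ∨
      (∃ t ∈ T, p = (t.lhs, .nonterminal t.fst, .nonterminal t.snd)) ∨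
      ∃ j, p = ((E.get j).lhs,
        .terminal (Fin.natAdd _ (Fin.castAdd _ j)), .terminal (Fin.natAdd _ (Fin.natAdd _ j))) := by
  refine List.mem_append.trans (or_congr ?_ (List.mem_append.trans (or_congr ?_ ?_)))
  · refine List.mem_map.trans ?_
    simp only [List.mem_finRange, true_and, eq_comm (b := p)]
  · refine List.mem_map.trans ?_
    simp only [eq_comm (b := p)]
  · refine List.mem_map.trans ?_
    simp only [List.mem_finRange, true_and, eq_comm (b := p)]

theorem node_child_one (j : Fin (ones child s T R l).length) :
    (node child s T R l E w).child (Fin.castAdd _ j) = ((ones child s T R l).get j).kid :=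
  Fin.append_left (fun j => ((ones child s T R l).get j).kid)
    (Fin.append (fun j => (E.get j).fst) fun j => (E.get j).snd) j

theorem node_child_fst (j : Fin E.length) :
    (node child s T R l E w).child (Fin.natAdd _ (Fin.castAdd _ j)) = (E.get j).fst :=
  (Fin.append_right (fun j => ((ones child s T R l).get j).kid)
    (Fin.append (fun j => (E.get j).fst) fun j => (E.get j).snd) _).trans
    (Fin.append_left (fun j => (E.get j).fst) (fun j => (E.get j).snd) j)

theorem node_child_snd (j : Fin E.length) :
    (node child s T R l E w).child (Fin.natAdd _ (Fin.natAdd _ j)) = (E.get j).snd :=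
  (Fin.append_right (fun j => ((ones child s T R l).get j).kid)
    (Fin.append (fun j => (E.get j).fst) fun j => (E.get j).snd) _).trans
    (Fin.append_right (fun j => (E.get j).fst) (fun j => (E.get j).snd) j)

theorem node_simulates (hE : ∀ e ∈ E, e ∈ exits child s T R l) :
    ∃ lab : Symbol (Fin (node child s T R l E w).k) (Fin l.length) → CGSym d n k,
      (∀ j, lab (.nonterminal j) = l.get j) ∧
      Simulates child s T R (node child s T R l E w) lab := by
  choose qo hqo hlo ho using fun j => mem_ones.mp (List.get_mem (ones child s T R l) j)
  choose qe hqe hle he using fun j => mem_exits.mp (hE _ (List.get_mem E j))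
  -- A new terminal is labelled by the symbol that it replaces in the rule of its production.
  let f : Fin (node child s T R l E w).k → CGSym d n k :=
    Fin.append (fun j => if ((ones child s T R l).get j).left then (qo j).fst else (qo j).snd)
      (Fin.append (fun j => (qe j).fst) fun j => (qe j).snd)
  refine ⟨fun | .terminal c => f c | .nonterminal j => l.get j, fun j => rfl, ?_, ?_, rfl, rfl,
    fun _ => rfl, fun _ => rfl⟩
  · intro p hp
    rcases mem_assemble_prods.mp hp with ⟨j, rfl⟩ | ⟨t, ht, rfl⟩ | ⟨j, rfl⟩
    · refine ⟨qo j, hqo j, ?_⟩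
      rcases ho j with ⟨h1, h2, h3⟩ | ⟨h1, h2, h3⟩
      · rw [if_pos h1]
        refine ⟨(hlo j).symm, ?_, h2.symm, ?_, ?_⟩
        · simp only [f, Fin.append_left, if_pos h1]
        · rintro c ⟨⟩
          exact (node_child_one j).symm ▸ h3
        · rintro c ⟨⟩
      · rw [if_neg (by rw [h1]; simp)]
        refine ⟨(hlo j).symm, h2.symm, ?_, ?_, ?_⟩
        · simp only [f, Fin.append_left, h1, Bool.false_eq_true, if_false]
        · rintro c ⟨⟩
        · rintro c ⟨⟩
          exact (node_child_one j).symm ▸ h3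
    · obtain ⟨q, hq, h1, h2, h3⟩ := mem_twos.mp ht
      refine ⟨q, hq, h1.symm, h2.symm, h3.symm, ?_, ?_⟩ <;> rintro c ⟨⟩
    · refine ⟨qe j, hqe j, (hle j).symm, ?_, ?_, ?_, ?_⟩
      · simp only [f, Fin.append_right, Fin.append_left]
      · simp only [f, Fin.append_right]
      · rintro c ⟨⟩
        exact (node_child_fst j).symm ▸ (he j).1
      · rintro c ⟨⟩
        exact (node_child_snd j).symm ▸ (he j).2
  · intro c
    have hm : ∀ p, p ∈ (node child s T R l E w).prods ↔ _ := fun p => mem_assemble_prods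
    revert c
    refine Fin.addCases (fun j => ?_) (Fin.addCases (fun j => ?_) fun j => ?_)
    · refine ⟨_, (hm _).mpr (.inl ⟨j, rfl⟩), ?_⟩
      split
      · exact .inl rfl
      · exact .inr rfl
    · exact ⟨_, (hm _).mpr (.inr (.inr ⟨j, rfl⟩)), .inl rfl⟩
    · exact ⟨_, (hm _).mpr (.inr (.inr ⟨j, rfl⟩)), .inr rfl⟩

theorem node_branching (y : Context d) :
    ((node child s T R l E w).shell y).Branching ↔ twos R l ≠ [] := by
  constructor
  · rintro ⟨p, hp, B, C, h1, h2⟩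
    rcases mem_assemble_prods.mp hp with ⟨j, rfl⟩ | ⟨t, ht, rfl⟩ | ⟨j, rfl⟩
    · split at h1
      · cases h1
      · next h => rw [if_neg h] at h2; cases h2
    · exact List.ne_nil_of_mem ht
    · cases h1
  · intro h
    obtain ⟨t, ht⟩ := List.exists_mem_of_ne_nil _ h
    exact ⟨_, mem_assemble_prods.mpr (.inr (.inl ⟨t, ht, rfl⟩)), _, _, rfl, rfl⟩

/-- The left-hand side of a rule derives each of its symbols within the component. -/
theorem node_edge (y : Context d) {i j : Fin l.length} (h : Edge R (l.get i) (l.get j)) :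
    ∃ u v : List (Fin (node child s T R l E w).k),
      ((node child s T R l E w).shell y).Derives i
        (u.map Symbol.terminal ++ [.nonterminal j] ++ v.map Symbol.terminal) := by
  obtain ⟨q, hq, h1, h2⟩ := h
  -- The sibling is replaced by the leaf without runs. Strong connectivity concerns the grammar
  -- only, so this is harmless.
  have hone : ∃ o : OneItem d l.length, o ∈ ones child s T R l ∧ o.lhs = i ∧ o.other = j := by
    rcases h2 with h2 | h2
    · exact ⟨⟨i, false, j, emptyLeaf q.csnd⟩, mem_ones.mpr ⟨q, hq, h1.symm, .inr ⟨rfl, h2.symm,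
        mem_alts.mpr (.inl rfl)⟩⟩, rfl, rfl⟩
    · exact ⟨⟨i, true, j, emptyLeaf q.cfst⟩, mem_ones.mpr ⟨q, hq, h1.symm, .inl ⟨rfl, h2.symm,
        mem_alts.mpr (.inl rfl)⟩⟩, rfl, rfl⟩
  obtain ⟨o, ho, rfl, rfl⟩ := hone
  obtain ⟨a, ha⟩ := List.get_of_mem ho
  have hp : _ ∈ ((node child s T R l E w).shell y).prods :=
    mem_assemble_prods.mpr (.inl ⟨a, rfl⟩)
  have hd := derives_prod hp
  rw [ha] at hd
  cases hl : o.left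
  · rw [if_neg (by rw [hl]; simp)] at hd
    exact ⟨[], [_], hd⟩
  · rw [if_pos hl] at hd
    exact ⟨[_], [], hd⟩

theorem node_conn (y : Context d) {W : CGSym d n k} {E : List (ExitItem d (component R W).length)}
    {w : Fin (component R W).length} (i j : Fin (component R W).length) :
    ∃ u v : List (Fin (node child s T R (component R W) E w).k),
      ((node child s T R (component R W) E w).shell y).Derives i
        (u.map Symbol.terminal ++ [.nonterminal j] ++ v.map Symbol.terminal) := by
  by_cases hij : i = j
  · exact ⟨[], [], hij ▸ ContextFreeGrammar.Derives.refl _⟩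
  · have key : ∀ V, Relation.TransGen (Edge R) V ((component R W).get j) →
        ∀ i, (component R W).get i = V →
        ∃ u v : List (Fin (node child s T R (component R W) E w).k),
        ((node child s T R (component R W) E w).shell y).Derives i
        (u.map Symbol.terminal ++ [.nonterminal j] ++ v.map Symbol.terminal) := by
      intro V h
      induction h using Relation.TransGen.head_induction_on with
      | single h =>
        rintro i rfl
        exact node_edge y h
      | @head a b h h' ih =>
        rintro i rfl
        have hb : b ∈ component R W := by
          obtain ⟨h1, h2⟩ := mem_component.mp (List.get_mem (component R W) i)
          obtain ⟨h3, h4⟩ := mem_component.mp (List.get_mem (component R W) j)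
          exact mem_component.mpr ⟨h1.tail h, h'.to_reflTransGen.trans h4⟩
        obtain ⟨m, rfl⟩ := List.get_of_mem hb
        obtain ⟨u, v, h1⟩ := node_edge (child := child) (s := s) (T := T) (E := E) (w := w) y h
        obtain ⟨u', v', h2⟩ := ih m rfl
        exact ⟨u ++ u', v' ++ v, derives_path h1 h2⟩
    exact key _ (component_get_trans hij) i rfl

/-- Every nonterminal leads to the left-hand side of some exit production along contexts that
consist of terminals, so a single exit makes all nonterminals useful. -/
theorem node_strong (y : Context d) {W : CGSym d n k}
    {E : List (ExitItem d (component R W).length)} {w : Fin (component R W).length}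
    (hE : E ≠ []) (hE1 : twos R (component R W) = [] → E.length = 1) :
    ((node child s T R (component R W) E w).shell y).Strong := by
  have hexit : ∀ a, ((E.get a).lhs, .terminal (Fin.natAdd _ (Fin.castAdd _ a)),
      .terminal (Fin.natAdd _ (Fin.natAdd _ a))) ∈
      ((node child s T R (component R W) E w).shell y).prods :=
    fun a => mem_assemble_prods.mpr (.inr (.inr ⟨a, rfl⟩))
  obtain ⟨e, he⟩ := List.exists_mem_of_ne_nil _ hE
  obtain ⟨a, rfl⟩ := List.get_of_mem he
  refine ⟨fun i j => ?_, fun i => ?_, fun hb => ?_⟩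
  · obtain ⟨u, v, h⟩ := node_conn (child := child) (s := s) (T := T) (E := E) (w := w) y i j
    exact ⟨_, _, h⟩
  · obtain ⟨u, v, h1⟩ := node_conn (child := child) (s := s) (T := T) (E := E) (w := w) y w i
    obtain ⟨u', v', h2⟩ := node_conn (child := child) (s := s) (T := T) (E := E) (w := w) y i
      (E.get a).lhs
    have h3 := derives_word (u := u') (v := v') (w := [_, _]) (derives_prod (hexit a))
    exact ⟨_, _, _, h1, derives_word (h2.trans h3)⟩
  · rw [node_branching, not_not] at hb
    have hl := hE1 hb
    refine ⟨_, ⟨hexit a, ?_⟩, ?_⟩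
    · rintro ⟨B, h | h⟩ <;> cases h
    · rintro p ⟨hp, hn⟩
      rcases mem_assemble_prods.mp hp with ⟨j, rfl⟩ | ⟨t, ht, rfl⟩ | ⟨j, rfl⟩
      · refine (hn ?_).elim
        split
        · exact ⟨_, .inr rfl⟩
        · exact ⟨_, .inl rfl⟩
      · exact (hn ⟨_, .inl rfl⟩).elim
      · have : j = a := Fin.ext (by have := j.2; have := a.2; omega)
        subst this
        rfl

variable {W : CGSym d n k}

theorem isNT_of_mem_component (hR : GoodRules child s R) (hW : W.IsNT) {V : CGSym d n k}
    (hV : V ∈ component R W) : V.IsNT := by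
  rcases Relation.ReflTransGen.cases_head (mem_component.mp hV).2 with rfl | ⟨X, ⟨q, hq, rfl, -⟩, -⟩
  · exact hW
  · obtain ⟨A, hA, -⟩ := (hR q hq).1.prod
    exact ⟨A, hA⟩

/-- The crucial part is the rank of a branching component: its cycle space is contained in that of N
and in the hyperplane of the chosen counter, and N has a cycle that leaves the hyperplane. -/
theorem goodPre_node (hd : 0 < d) (hv : s.Valid fun c => (child c).ctx) (hs : s.Strong)
    (hb : s.Branching) (hr : s.RigidTracked fun c => (child c).ctx)
    (hch : ∀ c, (child c).IsNGVAS)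
    (hj : j0 = d - Module.finrank ℝ (s.lcyclespace fun c => (child c).ctx))
    (hT : GoodTable child s j0 T) (hR : GoodRules child s R) (hW : W.IsNT)
    (hl : GoodLabel child s W.lab) {P : Pre d} (hP : P ∈ nodes child s T R W (component R W)) :
    GoodPre child s j0 W.lab.sym P := by
  obtain ⟨E, hE, hP⟩ := List.mem_flatMap.mp hP
  obtain ⟨w, hw, rfl⟩ := List.mem_map.mp hP
  rw [mem_idxs] at hw
  have hE' : (∀ e ∈ E, e ∈ exits child s T R (component R W)) ∧ E ≠ [] ∧
      (twos R (component R W) = [] → E.length = 1) := by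
    unfold exitChoices at hE
    split at hE
    · next h =>
      rw [List.mem_singleton.mp hE]
      refine ⟨fun _ h => h, ?_, fun h' => (h h').elim⟩
      obtain ⟨t, ht⟩ := List.exists_mem_of_ne_nil _ h
      obtain ⟨q, hq, h1, -⟩ := mem_twos.mp ht
      -- A branching component has an exit: any of its rules with two leaves without runs in place
      -- of its symbols.
      have hm : (⟨t.lhs, emptyLeaf q.cfst, emptyLeaf q.csnd⟩ : ExitItem d _) ∈
          exits child s T R (component R W) :=
        mem_exits.mpr ⟨q, hq, h1, mem_alts.mpr (.inl rfl), mem_alts.mpr (.inl rfl)⟩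
      exact List.ne_nil_of_mem hm
    · obtain ⟨e, he, rfl⟩ := List.mem_map.mp hE
      refine ⟨fun e' he' => ?_, by simp, fun _ => rfl⟩
      rw [List.mem_singleton.mp he']
      exact he
  obtain ⟨hE1, hE2, hE3⟩ := hE'
  obtain ⟨lab, hlab, hsim⟩ := node_simulates (w := w) hE1
  have hmem : ∀ A, lab (.nonterminal A) ∈ component R W := fun A =>
    Eq.mpr (congrArg (· ∈ component R W) (hlab A)) (List.get_mem _ A)
  have hgood := hsim.goodPre hd hv hb hch hT hR (fun y => node_strong y hE2 hE3) ?_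
  · have e : lab (.nonterminal w) = W := (hlab w).trans hw
    have e' : W.lab.sym = (lab (.nonterminal w)).lab.sym := by rw [e]
    rw [e']
    exact hgood
  · intro y
    refine Shell.lrank_apply_of_lt fun hbr => ?_
    rw [node_branching] at hbr
    obtain ⟨t, ht⟩ := List.exists_mem_of_ne_nil _ hbr
    obtain ⟨q0, hq0, h0, h1, h2⟩ := mem_twos.mp ht
    have h0 := h0 ▸ List.get_mem (component R W) t.lhs
    have h1 := h1 ▸ List.get_mem (component R W) t.fst
    have h2 := h2 ▸ List.get_mem (component R W) t.snd
    obtain ⟨-, pk, hpk, -⟩ := hR q0 hq0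
    have hWW : W ∈ component R W := mem_component.mpr ⟨.refl, .refl⟩
    have hso := sameOmegas_of_mem hR h0 hWW
    rw [picks_congr hso.inn hso.out] at hpk
    have hle := hsim.lcyclespace_le (pk := pk) hd hv hs hb hch hT hR
      (fun A => isNT_of_mem_component hR hW (hmem A))
      (fun q hq A hA => tracked_of_branching hR hq0 h1 h2 hpk hq
        (by rw [hA]; exact hmem A)) y
    obtain ⟨hpl, hp⟩ := mem_picks.mp (List.mem_of_mem_take hpk)
    -- Entries ω of the context of N are ω in every label. Hence a counter that is concrete in the
    -- label is concrete in the context of N.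
    obtain ⟨x, hx, hxi⟩ := exists_mem_lcyclespace_ne_zero hb hs hr (i := pk.2) (by
      rcases hp with ⟨-, hp⟩ | ⟨-, hp⟩
      · exact .inl ⟨fun h => hp (mem_omegas.mp (hl.cin (mem_omegas.mpr h))), hpl⟩
      · exact .inr ⟨fun h => hp (mem_omegas.mp (hl.cout (mem_omegas.mpr h))),
          hv.bd_mid hb ▸ hpl⟩)
    have hlt := Submodule.finrank_lt_finrank_of_lt
      (lt_of_le_of_ne (hle.trans inf_le_left) fun e => hxi ((hle.trans inf_le_right) (e ▸ hx)))
    have hfd := Submodule.finrank_le (s.lcyclespace fun c => (child c).ctx)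
    rw [Module.finrank_fin_fun] at hfd
    rw [hj, Nat.sub_sub_self hfd]
    exact hlt

end Assemble

/-! ### The tables contain only suitable NGVAS -/

section Tables

variable {d n k : ℕ} {child : Fin k → NGVAS d} {s : Shell d n k} {post pre : Approx d n k}
  {G : CovGrammar d n k} {j0 : ℕ}

theorem goodRules (hv : s.Valid fun c => (child c).ctx) (hb : s.Branching)
    (hpost : IsPostApprox child s post) (hpre : IsPreApprox child s pre)
    (h : CovSpec child s post pre G) : GoodRules child s (rules s (fun c => (child c).ctx) G) := by
  intro q hq
  obtain ⟨hp, hpk⟩ := mem_rules'.mp hq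
  exact ⟨splits_of_mem_simWords hv hb hpost hpre (h.label _ (h.prods _ _ hp).1).2 (h.pair hp).2,
    hpk⟩

theorem mem_lookup_tableStep {T : Table d n k} {W : CGSym d n k} {P : Pre d} :
    P ∈ lookup (tableStep child s (rules s (fun c => (child c).ctx) G) (singles G)
      (plan s (fun c => (child c).ctx) G) T) W ↔ W ∈ G.nonterms ∧
      ((∃ X, (W, [X]) ∈ G.prods ∧ P ∈ lookup T X) ∨
        P ∈ nodes child s T (rules s (fun c => (child c).ctx) G) W
          (component (rules s (fun c => (child c).ctx) G) W)) := by
  rw [mem_lookup]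
  simp only [tableStep, plan, List.map_map, List.mem_map, Function.comp_apply, Prod.mk.injEq]
  have hb : ∀ l, P ∈ build child s T (rules s (fun c => (child c).ctx) G) (singles G) W l ↔
      (∃ X, (W, [X]) ∈ G.prods ∧ P ∈ lookup T X) ∨
        P ∈ nodes child s T (rules s (fun c => (child c).ctx) G) W l := by
    intro l
    rw [build, List.mem_append, List.mem_flatMap]
    refine or_congr ⟨?_, ?_⟩ Iff.rfl
    · rintro ⟨⟨V, X⟩, hq, hP⟩
      split at hP
      · next e =>
        dsimp only at e
        exact ⟨X, e ▸ mem_singles.mp hq, hP⟩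
      · simp at hP
    · rintro ⟨X, hX, hP⟩
      exact ⟨(W, X), mem_singles.mpr hX, by rw [if_pos rfl]; exact hP⟩
  constructor
  · rintro ⟨L, ⟨V, hV, rfl, rfl⟩, hP⟩
    exact ⟨hV, (hb _).mp hP⟩
  · rintro ⟨hW, hP⟩
    exact ⟨_, ⟨W, hW, rfl, rfl⟩, (hb _).mpr hP⟩

theorem goodTable (hd : 0 < d) (hv : s.Valid fun c => (child c).ctx) (hs : s.Strong)
    (hb : s.Branching) (hr : s.RigidTracked fun c => (child c).ctx)
    (hch : ∀ c, (child c).IsNGVAS)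
    (hj : j0 = d - Module.finrank ℝ (s.lcyclespace fun c => (child c).ctx))
    (hpost : IsPostApprox child s post) (hpre : IsPreApprox child s pre)
    (h : CovSpec child s post pre G) (r : ℕ) : GoodTable child s j0 (tableAt child s G r) := by
  induction r with
  | zero =>
    intro X P hP
    simp [tableAt, lookup] at hP
  | succ r ih =>
    intro X P hP
    rw [tableAt, Function.iterate_succ_apply', mem_lookup_tableStep] at hP
    obtain ⟨hX, ⟨Y, hY, hP⟩ | hP⟩ := hP
    · obtain ⟨_, _, -, e, -⟩ := h.single hY
      rw [← e]
      exact ih Y P hP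
    · exact goodPre_node hd hv hs hb hr hch hj ih (goodRules hv hb hpost hpre h) (h.label X hX).1
        (h.label X hX).2 hP

end Tables
end NestedVAS

namespace NestedVAS

/-! ## The rank -/

section Rank

variable {d n k : ℕ} {child : Fin k → NGVAS d} {s : Shell d n k} {σ : Symbol (Fin k) (Fin n)}
  {P : Pre d} {c : Context d} {j0 : ℕ} {μ ν : OMarking d} {A : Fin n}

/-- A maximal branch of the new NGVAS has rank x + z with x zero up to index `j0`. N has a branch of
rank l + z, where l is its local rank, with n > 0 at `j0` and zeros before. The ranks agree before
`j0`, and there the second is larger. -/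
theorem GoodPre.srank_lt (h : GoodPre child s j0 σ P) (hn : 0 < n) {t : Shell d n k}
    (hb : t.Branching)
    (hj : j0 = d - Module.finrank ℝ (t.lcyclespace fun c => (child c).ctx)) :
    (P.fill c).srank < (NGVAS.node child t).srank := by
  obtain ⟨x, z, e, hx, hz⟩ := h.rank c _ (Finset.max'_mem _ (P.fill c).branchRanks_nonempty)
  have hL : t.lrank (fun c => (child c).ctx) = toLex (Pi.single ⟨j0, by omega⟩ n) := by
    rw [Shell.lrank, if_pos hb]
    simp only [← hj]
  have hm : t.lrank (fun c => (child c).ctx) + z ∈ (NGVAS.node child t).branchRanks := by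
    rw [mem_branchRanks_node]
    rcases hz with rfl | ⟨c, hz⟩
    · exact .inl (add_zero _)
    · exact .inr ⟨c, z, hz, rfl⟩
  refine lt_of_lt_of_le ?_ (Finset.le_max' _ _ hm)
  have hlt : j0 < d + 1 := by omega
  rw [NGVAS.srank, e, hL]
  refine ⟨⟨j0, hlt⟩, fun j hj => ?_, ?_⟩
  · change ofLex x j + ofLex z j = (Pi.single ⟨j0, _⟩ n : Fin (d + 1) → ℕ) j + ofLex z j
    rw [hx j (Fin.lt_def.mp hj).le, Pi.single_eq_of_ne hj.ne]
  · change ofLex x ⟨j0, hlt⟩ + ofLex z ⟨j0, hlt⟩ <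
      (Pi.single ⟨j0, _⟩ n : Fin (d + 1) → ℕ) ⟨j0, hlt⟩ + ofLex z ⟨j0, hlt⟩
    rw [hx _ le_rfl, Pi.single_eq_same]
    omega

theorem derives_of_prods {t : Shell d n k} (h : s.prods = t.prods) {B : Fin n}
    {f : List (Symbol (Fin k) (Fin n))} (hd : s.Derives B f) : t.Derives B f := by
  exact derives_induction (C := fun f => t.Derives B f) hd (ContextFreeGrammar.Derives.refl _)
    fun p hp x y ih => Relation.ReflTransGen.tail ih (produces_iff.mpr ⟨p, h ▸ hp, x, y, rfl, rfl⟩)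

/-- More unconstrained counters can only lower the first component, and otherwise the system rank
decides; local indices are never compared. -/
theorem recrank_lt_of_srank {M N : NGVAS d} (h : N.ctx.unc ⊆ M.ctx.unc) (h' : M.srank < N.srank) :
    M.recrank < N.recrank := by
  rw [NGVAS.recrank, NGVAS.recrank, Prod.Lex.toLex_lt_toLex, Prod.Lex.toLex_lt_toLex]
  rcases lt_or_eq_of_le (Finset.card_le_card (Finset.compl_subset_compl.mpr h)) with h1 | h1
  · exact .inl h1
  · exact .inr ⟨h1, .inl h'⟩

theorem lcyclespace_variant {cc : Fin k → Context d} :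
    (s.variant μ A ν).lcyclespace cc = s.lcyclespace cc := by
  have : ∀ B u v, (s.variant μ A ν).Cycle B u v ↔ s.Cycle B u v := fun B u v =>
    ⟨derives_of_prods rfl, derives_of_prods rfl⟩
  simp only [Shell.lcyclespace, this]

theorem symRuns_variant : symRuns child (s.variant μ A ν) σ = symRuns child s σ := by
  cases σ with
  | terminal c => rfl
  | nonterminal B =>
    ext r
    exact ⟨fun ⟨w, h, h'⟩ => ⟨w, derives_of_prods rfl h, h'⟩,
      fun ⟨w, h, h'⟩ => ⟨w, derives_of_prods rfl h, h'⟩⟩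

theorem GoodPre.recrank_lt_variant (h : GoodPre child s j0 σ P) (hn : 0 < n) (hb : s.Branching)
    (hj : j0 = d - Module.finrank ℝ (s.lcyclespace fun c => (child c).ctx)) :
    (P.fill (variantCtx μ ν)).recrank < (NGVAS.node child (s.variant μ A ν)).recrank :=
  recrank_lt_of_srank subset_rfl
    (h.srank_lt hn (t := s.variant μ A ν) hb (hj.trans (by rw [lcyclespace_variant])))

theorem GoodPre.recrank_lt (h : GoodPre child s j0 σ P) (hn : 0 < n) (hb : s.Branching)
    (hv : s.Valid fun c => (child c).ctx) (hrel : s.Relevant μ ν)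
    (hj : j0 = d - Module.finrank ℝ (s.lcyclespace fun c => (child c).ctx)) :
    (P.fill (variantCtx μ ν)).recrank < (NGVAS.node child s).recrank :=
  recrank_lt_of_srank (hv.unc_ctx.trans (Finset.inter_subset_inter hrel.1.1 hrel.2.1))
    (h.srank_lt hn hb hj)

theorem variantCtx_restr (v : Update d) : v ∈ (variantCtx μ ν).restr := by
  refine ⟨v, ?_, by simp [variantCtx]⟩
  have h1 : ∀ i, (Pi.single i 1 : Update d) ∈
      AddSubmonoid.closure {p | p ∈ (variantCtx μ ν).periods} := fun i =>
    AddSubmonoid.subset_closure (by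
      simp only [variantCtx, Set.mem_ofPred_eq, List.mem_append, List.mem_ofFn]
      exact .inl ⟨i, rfl⟩)
  have h2 : ∀ i, (Pi.single i (-1) : Update d) ∈
      AddSubmonoid.closure {p | p ∈ (variantCtx μ ν).periods} := fun i =>
    AddSubmonoid.subset_closure (by
      simp only [variantCtx, Set.mem_ofPred_eq, List.mem_append, List.mem_ofFn]
      exact .inr ⟨i, rfl⟩)
  rw [← Finset.univ_sum_single v]
  refine sum_mem fun i _ => ?_
  rcases Int.eq_nat_or_neg (v i) with ⟨m, e | e⟩
  · have := nsmul_mem (h1 i) m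
    rwa [← Pi.single_smul, nsmul_one, ← e] at this
  · have := nsmul_mem (h2 i) m
    rwa [← Pi.single_smul, smul_neg, nsmul_one, ← e] at this

end Rank
end NestedVAS

namespace NestedVAS

/-! ## Derivation trees and approximators -/

section Support

variable {d n k : ℕ} {child : Fin k → NGVAS d} {s : Shell d n k} {post pre : Approx d n k}

/-- The approximation from left to right of the runs of the subtrees ends in the last marking. -/
def PostFits (post : Approx d n k) : RTree d n k → OMarking d → OMarking d → Prop
  | .leaf c r, μ, p => p ∈ post μ (.terminal c) ∧ Spec r.2.2.lift p
  | .node A l r, μ, p => p ∈ post μ (.nonterminal A) ∧ ∃ p' p'', PostFits post l μ p' ∧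
      PostFits post r p' p'' ∧ Spec p'' p

/-- The approximation from right to left of the runs of the subtrees ends in the last marking. -/
def PreFits (pre : Approx d n k) : RTree d n k → OMarking d → OMarking d → Prop
  | .leaf c r, ν, q => q ∈ pre ν (.terminal c) ∧ Spec r.1.lift q
  | .node A l r, ν, q => q ∈ pre ν (.nonterminal A) ∧ ∃ q' q'', PreFits pre r ν q' ∧
      PreFits pre l q' q'' ∧ Spec q'' q

theorem PostFits.mem {t : RTree d n k} {μ p : OMarking d} (h : PostFits post t μ p) :
    p ∈ post μ t.sym := by
  cases t <;> exact h.1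

theorem PreFits.mem {t : RTree d n k} {ν q : OMarking d} (h : PreFits pre t ν q) :
    q ∈ pre ν t.sym := by
  cases t <;> exact h.1

theorem PostFits.spec {t : RTree d n k} {μ p : OMarking d} (h : PostFits post t μ p) :
    Spec t.run.2.2.lift p := by
  induction t generalizing μ p with
  | leaf c r => exact h.2
  | node A l r _ ih =>
    obtain ⟨-, p', p'', -, h2, h3⟩ := h
    exact (ih h2).trans h3

theorem PreFits.spec {t : RTree d n k} {ν q : OMarking d} (h : PreFits pre t ν q) :
    Spec t.run.1.lift q := by
  induction t generalizing ν q with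
  | leaf c r => exact h.2
  | node A l r ih _ =>
    obtain ⟨-, q', q'', -, h2, h3⟩ := h
    exact (ih h2).trans h3

/-- The annotation is built from the leaves, where the approximator covers runs of children; its
compatibility with productions supplies the value at inner nodes. A tree is annotated as a whole
because the values at the subtrees must be below the one already fixed at the root. -/
theorem exists_postFits (hv : s.Valid fun c => (child c).ctx) (hb : s.Branching)
    (hpost : IsPostApprox child s post) {t : RTree d n k} (ht : t.Valid child s) {μ : OMarking d}
    (hμ : omegas μ ⊆ s.bd.left) (h : Spec t.run.1.lift μ) : ∃ p, PostFits post t μ p := by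
  induction t generalizing μ with
  | leaf c r =>
    obtain ⟨p, hp, h'⟩ := hpost.covers μ (.terminal c) hμ r ht h
    exact ⟨p, hp, h'⟩
  | node A l r ihl ihr =>
    obtain ⟨h1, h2, h3, h4⟩ := ht
    obtain ⟨p', hp'⟩ := ihl h2 hμ h
    have hs := (hpost.sound μ _ hμ p' hp'.mem).1
    obtain ⟨p'', hp''⟩ := ihr h3 (hs.omegas_subset.trans (hv.omegas_outOf hb _).subset)
      (h4 ▸ hp'.spec)
    obtain ⟨p, hp, h5⟩ := hpost.compat _ h1 μ hμ p' hp'.mem p'' hp''.mem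
    exact ⟨p, hp, p', p'', hp', hp'', h5⟩

theorem exists_preFits (hv : s.Valid fun c => (child c).ctx) (hb : s.Branching)
    (hpre : IsPreApprox child s pre) {t : RTree d n k} (ht : t.Valid child s) {ν : OMarking d}
    (hν : omegas ν ⊆ s.bd.right) (h : Spec t.run.2.2.lift ν) : ∃ q, PreFits pre t ν q := by
  induction t generalizing ν with
  | leaf c r =>
    obtain ⟨q, hq, h'⟩ := hpre.covers ν (.terminal c) hν r ht h
    exact ⟨q, hq, h'⟩
  | node A l r ihl ihr =>
    obtain ⟨h1, h2, h3, h4⟩ := ht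
    obtain ⟨q', hq'⟩ := ihr h3 hν h
    have hs := (hpre.sound ν _ hν q' hq'.mem).1
    obtain ⟨q'', hq''⟩ := ihl h2
      (hs.omegas_subset.trans ((hv.omegas_inOf hb _).trans (hv.bd_mid hb)).subset)
      (h4.symm ▸ hq'.spec)
    obtain ⟨q, hq, h5⟩ := hpre.compat _ h1 ν hν q' hq'.mem q'' hq''.mem
    exact ⟨q, hq, q', q'', hq', hq'', h5⟩

/-- The run of the tree is possible for the label. -/
structure Fits (child : Fin k → NGVAS d) (s : Shell d n k) (post pre : Approx d n k)
    (t : RTree d n k) (X : CGLabel d n k) : Prop where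
  valid : t.Valid child s
  sym : t.sym = X.sym
  inn : Spec t.run.1.lift X.inn
  out : Spec t.run.2.2.lift X.out
  post : PostFits post t X.inn X.post
  pre : PreFits pre t X.out X.pre

/-- The forward value after the first symbol and the backward value before the second one both
describe the actual marking in between, so simulation does not discard the production. -/
theorem compat_of_spec {m : Marking d} {x y : OMarking d} (h : Spec m.lift x)
    (h' : Spec m.lift y) : Compat x y := fun i => by
  rcases h i with e | e
  · exact .inr (.inl e)
  · rcases h' i with e' | e'
    · exact .inr (.inr e')
    · exact .inl (e.symm.trans e')

/-- The annotations stored for the two subtrees are precisely the choices that a simulating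
production asks for. -/
theorem Fits.split {A : Fin n} {l r : RTree d n k} {W : CGLabel d n k}
    (h : Fits child s post pre (.node A l r) W) : ∃ X Y, [X, Y] ∈ simWords s post pre W ∧
      Fits child s post pre l X ∧ Fits child s post pre r Y := by
  obtain ⟨⟨h1, h2, h3, h4⟩, hs, hin, hout, ⟨-, p', p'', g1, g2, g3⟩, ⟨-, q', q'', g4, g5, g6⟩⟩ := h
  exact ⟨⟨W.inn, p', l.sym, q'', q'⟩, ⟨p', p'', r.sym, q', W.out⟩,
    ⟨A, l.sym, r.sym, h1, hs.symm, p', g1.mem, p'', g2.mem, q', g4.mem, q'', g5.mem, g3, g6,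
      compat_of_spec g1.spec (h4.symm ▸ g4.spec), rfl⟩,
    ⟨h2, rfl, hin, h4.symm ▸ g4.spec, g1, g5⟩, ⟨h3, rfl, h4 ▸ g1.spec, hout, g2, g4⟩⟩

theorem Fits.eq_node {t : RTree d n k} {W : CGSym d n k} (h : Fits child s post pre t W.lab)
    (hW : W.IsNT) : ∃ A l r, t = .node A l r := by
  cases t with
  | leaf c r =>
    obtain ⟨A, hA⟩ := hW
    have := h.sym.trans hA
    cases this
  | node A l r => exact ⟨A, l, r, rfl⟩

theorem RTree.Valid.eff {t : RTree d n k} (h : t.Valid child s) :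
    Eff s (fun c => (child c).ctx) t.sym t.run.2.1.sum := by
  induction t with
  | leaf c r => exact .terminal (mem_runs_sum h)
  | node A l r ihl ihr =>
    obtain ⟨h1, h2, h3, -⟩ := h
    have := Eff.node h1 (ihl h2) (ihr h3)
    rwa [← List.sum_append] at this

theorem RTree.Valid.effect {t : RTree d n k} (h : t.Valid child s) (i : Fin d) :
    (t.run.2.2 i : ℤ) = t.run.1 i + t.run.2.1.sum i := by
  induction t with
  | leaf c r => exact runs_effect h i
  | node A l r ihl ihr =>
    obtain ⟨h1, h2, h3, h4⟩ := h
    have e1 := ihl h2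
    have e2 := ihr h3
    simp only [RTree.run, List.sum_append, Pi.add_apply]
    rw [e2, ← h4, e1]
    ring

theorem Spec.toNat_eq {m : Marking d} {x : OMarking d} (h : Spec m.lift x) {i : Fin d}
    (hi : x i ≠ ⊤) : (x i).toNat = m i := by
  rw [← h.eq_of_ne_top hi]
  exact ENat.toNat_natCast _

/-- The effect of the run is an effect of a derivation, so it lies in the coset of the symbol. Where
source and target values are concrete they are the actual ones, so the run has the prescribed
effect. -/
theorem Fits.exists_context {t : RTree d n k} {X : CGSym d n k}
    (h : Fits child s post pre t X.lab) (pk : Bool × Fin d) :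
    ∃ c ∈ cosets s (fun c => (child c).ctx) pk X, t.run.2.1.sum ∈ c.restr := by
  refine exists_coset ?_ ?_
  · rw [← h.sym]
    exact h.valid.eff.sub_symBase_mem
  · rintro ⟨h1, h2⟩
    have e := h.valid.effect pk.2
    obtain ⟨b, i⟩ := pk
    cases b
    · simp only [src, tgt, Bool.false_eq_true, if_false] at h1 h2 ⊢
      rw [h.pre.spec.toNat_eq h1, h.out.toNat_eq h2]
      linarith
    · simp only [src, tgt, if_true] at h1 h2 ⊢
      rw [h.inn.toNat_eq h1, h.post.spec.toNat_eq h2]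
      linarith

/-- The run of the tree is a run of an NGVAS that may be used for the symbol. -/
def Covered (child : Fin k → NGVAS d) (s : Shell d n k) (T : Table d n k) (X : CGSym d n k)
    (t : RTree d n k) : Prop :=
  ∃ P, (P ∈ wraps child s X.lab.sym ∨ P ∈ lookup T X) ∧
    ∀ c, t.run ∈ symRuns P.child (P.shell c) (.nonterminal P.start)

/-- The run is known before context information is filled in. The context then admits it, since the
label specializes the markings and the restriction was selected for its effect. -/
theorem Covered.exists_kid {T : Table d n k} {X : CGSym d n k} {t : RTree d n k} {c : Context d}
    (h : Covered child s T X t) (ht : Fits child s post pre t X.lab)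
    (hX : GoodLabel child s X.lab) (hc : KidContext child s X.lab.sym c)
    (he : t.run.2.1.sum ∈ c.restr) : ∃ K ∈ alts child s T X c, t.run ∈ K.runs := by
  obtain ⟨P, hP, hr⟩ := h
  refine ⟨P.fill c, mem_alts.mpr (.inr ⟨P, hP, rfl⟩), mem_runs_node.mpr ⟨hr c, he, ?_, ?_⟩⟩
  · change Spec _ c.cin
    rw [hc.cin]
    exact ht.inn.trans hX.inn
  · change Spec _ c.cout
    rw [hc.cout]
    exact ht.out.trans hX.out

theorem covered_of_terminal {T : Table d n k} {X : CGSym d n k} {t : RTree d n k}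
    (ht : Fits child s post pre t X.lab) (hX : ¬ X.IsNT) : Covered child s T X t := by
  cases t with
  | node A l r => exact (hX ⟨A, ht.sym.symm⟩).elim
  | leaf c r =>
    refine ⟨wrap child s c, .inl ?_, fun y => ?_⟩
    · rw [← ht.sym]
      exact List.mem_singleton.mpr rfl
    · have hr : r ∈ (child c).runs := ht.valid
      have hout : Spec r.2.2.lift (child c).ctx.cout := by
        generalize child c = M at hr
        cases M <;> rw [NGVAS.runs] at hr <;> exact hr.2.2.2
      have heps : ((r.2.2, [], r.2.2) : Run d) ∈
          (epsLeaf s.bd.left (child c).ctx.cout).runs := by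
        rw [epsLeaf, NGVAS.runs]
        exact ⟨⟨rfl, rfl⟩, ⟨0, zero_mem _, by simp⟩, hout, hout⟩
      have hp : ((0, .terminal 0, .terminal 1) :
          Fin 1 × Symbol (Fin 2) (Fin 1) × Symbol (Fin 2) (Fin 1)) ∈
          ((wrap child s c).shell y).prods := List.mem_singleton.mpr rfl
      have := mem_symRuns_node (child := (wrap child s c).child) hp (a := r.1) (b := r.2.2)
        (c := r.2.2) (u := r.2.1) (v := []) hr heps
      rwa [List.append_nil] at this

end Support
end NestedVAS

namespace NestedVAS

/-! ## All runs are covered -/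

section Node

variable {d n k : ℕ} {child : Fin k → NGVAS d} {s : Shell d n k} {T : Table d n k}
  {R : List (Rule d n k)} {l : List (CGSym d n k)} {E : List (ExitItem d l.length)}
  {w : Fin l.length} {y : Context d} {a b c : Marking d} {u v : List (Update d)}

/-- The runs of a position of a component. -/
def nodeRuns (child : Fin k → NGVAS d) (s : Shell d n k) (T : Table d n k) (R : List (Rule d n k))
    (l : List (CGSym d n k)) (E : List (ExitItem d l.length)) (w : Fin l.length) (y : Context d)
    (j : Fin l.length) : Set (Run d) :=
  symRuns (node child s T R l E w).child ((node child s T R l E w).shell y) (.nonterminal j)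

theorem nodeRuns_left {o : OneItem d l.length} (ho : o ∈ ones child s T R l) (hl : o.left = true)
    (h : (a, u, b) ∈ o.kid.runs) (h' : (b, v, c) ∈ nodeRuns child s T R l E w y o.other) :
    (a, u ++ v, c) ∈ nodeRuns child s T R l E w y o.lhs := by
  obtain ⟨j, rfl⟩ := List.get_of_mem ho
  have hp : _ ∈ ((node child s T R l E w).shell y).prods :=
    mem_assemble_prods.mpr (.inl ⟨j, (if_pos hl).symm⟩)
  exact mem_symRuns_node hp
    (show (a, u, b) ∈ ((node child s T R l E w).child _).runs from (node_child_one j).symm ▸ h) h'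

theorem nodeRuns_right {o : OneItem d l.length} (ho : o ∈ ones child s T R l)
    (hl : o.left = false) (h : (a, u, b) ∈ nodeRuns child s T R l E w y o.other)
    (h' : (b, v, c) ∈ o.kid.runs) :
    (a, u ++ v, c) ∈ nodeRuns child s T R l E w y o.lhs := by
  obtain ⟨j, rfl⟩ := List.get_of_mem ho
  have hp : _ ∈ ((node child s T R l E w).shell y).prods :=
    mem_assemble_prods.mpr (.inl ⟨j, (if_neg (by rw [hl]; exact Bool.false_ne_true)).symm⟩)
  exact mem_symRuns_node hp h
    (show (b, v, c) ∈ ((node child s T R l E w).child _).runs from (node_child_one j).symm ▸ h')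

theorem nodeRuns_two {t : TwoItem l.length} (ht : t ∈ twos R l)
    (h : (a, u, b) ∈ nodeRuns child s T R l E w y t.fst)
    (h' : (b, v, c) ∈ nodeRuns child s T R l E w y t.snd) :
    (a, u ++ v, c) ∈ nodeRuns child s T R l E w y t.lhs := by
  have hp : _ ∈ ((node child s T R l E w).shell y).prods :=
    mem_assemble_prods.mpr (.inr (.inl ⟨t, ht, rfl⟩))
  exact mem_symRuns_node hp h h'

theorem nodeRuns_exit {e : ExitItem d l.length} (he : e ∈ E) (h : (a, u, b) ∈ e.fst.runs)
    (h' : (b, v, c) ∈ e.snd.runs) : (a, u ++ v, c) ∈ nodeRuns child s T R l E w y e.lhs := by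
  obtain ⟨j, rfl⟩ := List.get_of_mem he
  have hp : _ ∈ ((node child s T R l E w).shell y).prods :=
    mem_assemble_prods.mpr (.inr (.inr ⟨j, rfl⟩))
  exact mem_symRuns_node hp
    (show (a, u, b) ∈ ((node child s T R l E w).child _).runs from (node_child_fst j).symm ▸ h)
    (show (b, v, c) ∈ ((node child s T R l E w).child _).runs from (node_child_snd j).symm ▸ h')

end Node

/-! ### Every run is found after sufficiently many rounds -/

section Cover

variable {d n k : ℕ} {child : Fin k → NGVAS d} {s : Shell d n k} {post pre : Approx d n k}
  {G : CovGrammar d n k} {T : Table d n k} {l : List (CGSym d n k)}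

/-- The tree is followed as long as it stays within the component; subtrees at symbols outside are
runs of children. In a linear component the tree has one exit, which selects E. In a branching one
there is only one selection, so the two subtrees agree on it. -/
theorem exists_nodeRuns (h : CovSpec child s post pre G) (hv : s.Valid fun c => (child c).ctx)
    (hb : s.Branching) (hbd : G.RemainsBounded s)
    (hl : ∀ V ∈ l, V ∈ G.nonterms ∧ SimDone s post pre G V)
    (hout : ∀ V ∈ l, ∀ X, Edge (rules s (fun c => (child c).ctx) G) V X → X ∉ l →
      ∀ t, Fits child s post pre t X.lab → Covered child s T X t)
    {t : RTree d n k} {V : CGSym d n k} (hV : V ∈ l) (ht : Fits child s post pre t V.lab)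
    (j : Fin l.length) (hj : l.get j = V) :
    ∃ E ∈ exitChoices child s T (rules s (fun c => (child c).ctx) G) l, ∀ w y,
      t.run ∈ nodeRuns child s T (rules s (fun c => (child c).ctx) G) l E w y j := by
  induction t generalizing V j with
  | leaf c r =>
    obtain ⟨A, l, r, e⟩ := ht.eq_node (h.label V (hl V hV).1).1
    cases e
  | node A t1 t2 ih1 ih2 =>
    obtain ⟨hVn, hVs⟩ := hl V hV
    obtain ⟨x, y, hxy, hx, hy⟩ := ht.split
    obtain ⟨w, hw, hw'⟩ := hVs.exists_prod _ hxy
    obtain ⟨X, Y, rfl, rfl, rfl⟩ : ∃ X Y : CGSym d n k, w = [X, Y] ∧ X.lab = x ∧ Y.lab = y := by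
      obtain _ | ⟨X, _ | ⟨Y, _ | ⟨Z, w⟩⟩⟩ := w <;> simp at hw'
      exact ⟨X, Y, rfl, hw'.1, hw'.2⟩
    have hXY := (h.prods _ _ hw).2
    obtain ⟨pk, hpk⟩ := exists_pick hv hb h hbd hVn
    obtain ⟨c, hc, hce⟩ := hx.exists_context pk
    obtain ⟨c', hc', hce'⟩ := hy.exists_context pk
    have hq : (⟨V, X, c, Y, c'⟩ : Rule d n k) ∈ rules s (fun c => (child c).ctx) G :=
      mem_rules'.mpr ⟨hw, pk, hpk, hc, hc'⟩
    have hm : t1.run.2.2 = t2.run.1 := ht.valid.2.2.2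
    have hkX : X ∉ l → ∃ K ∈ alts child s T X c, t1.run ∈ K.runs := fun hX =>
      (hout V hV X ⟨_, hq, rfl, .inl rfl⟩ hX t1 hx).exists_kid hx (hXY X (by simp)).2.2
        (kidContext_of_mem_cosets hc) hce
    have hkY : Y ∉ l → ∃ K ∈ alts child s T Y c', t2.run ∈ K.runs := fun hY =>
      (hout V hV Y ⟨_, hq, rfl, .inr rfl⟩ hY t2 hy).exists_kid hy (hXY Y (by simp)).2.2
        (kidContext_of_mem_cosets hc') hce'
    by_cases hX : X ∈ l
    · obtain ⟨i, hi⟩ := List.get_of_mem hX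
      obtain ⟨E, hE, h1⟩ := ih1 hX hx i hi
      by_cases hY : Y ∈ l
      · obtain ⟨i', hi'⟩ := List.get_of_mem hY
        obtain ⟨E', hE', h2⟩ := ih2 hY hy i' hi'
        have h3 : (⟨j, i, i'⟩ : TwoItem l.length) ∈ twos (rules s (fun c => (child c).ctx) G) l :=
          mem_twos.mpr ⟨_, hq, hj, hi, hi'⟩
        have e : E = E' := by
          rw [exitChoices, if_pos (List.ne_nil_of_mem h3), List.mem_singleton] at hE hE'
          rw [hE, hE']
        subst e
        exact ⟨E, hE, fun w y => nodeRuns_two h3 (h1 w y) (hm ▸ h2 w y)⟩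
      · obtain ⟨K, hK, h2⟩ := hkY hY
        have h3 : (⟨j, false, i, K⟩ : OneItem d l.length) ∈
            ones child s T (rules s (fun c => (child c).ctx) G) l :=
          mem_ones.mpr ⟨_, hq, hj, .inr ⟨rfl, hi, hK⟩⟩
        exact ⟨E, hE, fun w y => nodeRuns_right h3 rfl (h1 w y) (hm ▸ h2)⟩
    · obtain ⟨K, hK, h1⟩ := hkX hX
      by_cases hY : Y ∈ l
      · obtain ⟨i', hi'⟩ := List.get_of_mem hY
        obtain ⟨E, hE, h2⟩ := ih2 hY hy i' hi'
        have h3 : (⟨j, true, i', K⟩ : OneItem d l.length) ∈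
            ones child s T (rules s (fun c => (child c).ctx) G) l :=
          mem_ones.mpr ⟨_, hq, hj, .inl ⟨rfl, hi', hK⟩⟩
        exact ⟨E, hE, fun w y => nodeRuns_left h3 rfl h1 (hm ▸ h2 w y)⟩
      · obtain ⟨K', hK', h2⟩ := hkY hY
        have h3 : (⟨j, K, K'⟩ : ExitItem d l.length) ∈
            exits child s T (rules s (fun c => (child c).ctx) G) l :=
          mem_exits.mpr ⟨_, hq, hj, hK, hK'⟩
        have h4 : ∃ E ∈ exitChoices child s T (rules s (fun c => (child c).ctx) G) l,
            (⟨j, K, K'⟩ : ExitItem d l.length) ∈ E := by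
          unfold exitChoices
          split
          · exact ⟨_, List.mem_singleton.mpr rfl, h3⟩
          · exact ⟨_, List.mem_map.mpr ⟨_, h3, rfl⟩, List.mem_singleton.mpr rfl⟩
        obtain ⟨E, hE, h4⟩ := h4
        exact ⟨E, hE, fun w y => nodeRuns_exit h4 h1 (hm ▸ h2)⟩

open Classical in
/-- A bound on the number of rounds after which the NGVAS for the symbol are complete. -/
noncomputable def height (R : List (Rule d n k)) (W : CGSym d n k) : ℕ :=
  -- Each entry that is not yet ω is worth 2|R| + 2, more than the largest possible number 2|R| + 1
  -- of reachable symbols. So the height drops when an entry becomes ω, whatever happens to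
  -- reachability.
  (d + d - (omegas W.lab.inn).card - (omegas W.lab.out).card) * (R.length + R.length + 2) +
    (reach R W).toFinset.card

theorem height_le_rounds {R : List (Rule d n k)} {W : CGSym d n k} :
    height R W ≤ rounds d R.length := by
  classical
  have h1 := card_reach_le (R := R) (W := W)
  have h2 : d + d - (omegas W.lab.inn).card - (omegas W.lab.out).card ≤ d + d := by omega
  have h3 := Nat.mul_le_mul_right (R.length + R.length + 2) h2
  unfold height rounds
  rw [Nat.add_mul (d + d)]
  have h4 : (reach R W).toFinset.card ≤ R.length + R.length + 1 := by convert h1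
  omega

theorem height_lt_of_card {R : List (Rule d n k)} {V W : CGSym d n k}
    (h : (omegas W.lab.inn).card + (omegas W.lab.out).card <
      (omegas V.lab.inn).card + (omegas V.lab.out).card) : height R V < height R W := by
  classical
  have h1 := card_reach_le (R := R) (W := V)
  have h4 : (reach R V).toFinset.card ≤ R.length + R.length + 1 := by convert h1
  have c1 := card_finset_fin_le (omegas V.lab.inn)
  have c2 := card_finset_fin_le (omegas V.lab.out)
  obtain ⟨a, ha⟩ : ∃ a, a = d + d - (omegas V.lab.inn).card - (omegas V.lab.out).card := ⟨_, rfl⟩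
  have h2 : a + 1 ≤ d + d - (omegas W.lab.inn).card - (omegas W.lab.out).card := by omega
  have h3 := Nat.mul_le_mul_right (R.length + R.length + 2) h2
  unfold height
  rw [← ha]
  rw [Nat.add_mul a] at h3
  omega

/-- A symbol outside the component does not reach back to W, so it reaches strictly fewer symbols,
and the number of entries ω does not decrease. -/
theorem height_lt_of_edge {R : List (Rule d n k)} (hR : GoodRules child s R)
    {V W X : CGSym d n k} (hV : V ∈ component R W) (hX : Edge R V X) (hn : X ∉ component R W) :
    height R X < height R W := by
  classical
  have hWX : Relation.ReflTransGen (Edge R) W X := (mem_component.mp hV).1.tail hX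
  have hg := grows_of_reach hR hWX
  have c1 := Finset.card_le_card hg.inn
  have c2 := Finset.card_le_card hg.out
  have h2 : d + d - (omegas X.lab.inn).card - (omegas X.lab.out).card ≤
      d + d - (omegas W.lab.inn).card - (omegas W.lab.out).card := by omega
  have h3 := Nat.mul_le_mul_right (R.length + R.length + 2) h2
  unfold height
  refine Nat.add_lt_add_of_le_of_lt h3 (Finset.card_lt_card ?_)
  refine Finset.ssubset_iff_of_subset (fun Y hY => ?_) |>.mpr ⟨W, ?_, fun hW => hn ?_⟩
  · rw [List.mem_toFinset, mem_reach] at hY ⊢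
    exact hWX.trans hY
  · rw [List.mem_toFinset, mem_reach]
  · rw [List.mem_toFinset, mem_reach] at hW
    exact mem_component.mpr ⟨hWX, hW⟩

/-- Induction on the rounds. A unary production has a symbol of smaller height, for which the tree
is annotated anew because its markings have changed. Otherwise the tree is followed through the
component, and the symbols that leave it have smaller height, so the previous table covers them. -/
theorem covered_tableAt (h : CovSpec child s post pre G) (hv : s.Valid fun c => (child c).ctx)
    (hb : s.Branching) (hpost : IsPostApprox child s post) (hpre : IsPreApprox child s pre)
    (hbd : G.RemainsBounded s) {r : ℕ} {W : CGSym d n k} (hW : W ∈ G.nonterms)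
    (hWS : W ≠ G.start) (hr : height (rules s (fun c => (child c).ctx) G) W ≤ r)
    {t : RTree d n k} (ht : Fits child s post pre t W.lab) :
    ∃ P ∈ lookup (tableAt child s G r) W,
      ∀ c, t.run ∈ symRuns P.child (P.shell c) (.nonterminal P.start) := by
  have hR := goodRules hv hb hpost hpre h
  have hlr := hv.bd_mid hb
  induction r generalizing W t with
  | zero =>
    classical
    have : 0 < (reach (rules s (fun c => (child c).ctx) G) W).toFinset.card :=
      Finset.card_pos.mpr ⟨W, List.mem_toFinset.mpr (mem_reach.mpr .refl)⟩
    unfold height at hr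
    have : (reach (rules s (fun c => (child c).ctx) G) W).toFinset.card ≤ 0 := by
      convert (Nat.le_add_left _ _).trans hr
    omega
  | succ r ih =>
    have hstep : tableAt child s G (r + 1) = tableStep child s (rules s (fun c => (child c).ctx) G)
      (singles G) (plan s (fun c => (child c).ctx) G) (tableAt child s G r) :=
      Function.iterate_succ_apply' _ _ _
    rw [hstep]
    simp only [mem_lookup_tableStep]
    obtain ⟨S, hS, h1, -⟩ := h.done W hW
    rcases hS with ⟨x, y, hacc, rfl⟩ | ⟨-, rfl⟩
    · have hxr : omegas x ⊆ s.bd.left :=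
        hacc.spec_inn.omegas_subset.trans (hv.omegas_inOf hb _).subset
      have hyr : omegas y ⊆ s.bd.right :=
        hlr ▸ hacc.spec_out.omegas_subset.trans (hv.omegas_outOf hb _).subset
      obtain ⟨p, hp⟩ := exists_postFits hv hb hpost ht.valid hxr (ht.inn.trans hacc.inn)
      obtain ⟨q, hq⟩ := exists_preFits hv hb hpre ht.valid hyr (ht.out.trans hacc.out)
      obtain ⟨w, hw, hw'⟩ := h1 [⟨x, p, W.lab.sym, q, y⟩]
        ⟨p, ht.sym ▸ hp.mem, q, ht.sym ▸ hq.mem, rfl⟩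
      obtain ⟨X, rfl, hX⟩ : ∃ X : CGSym d n k, w = [X] ∧ X.lab = ⟨x, p, W.lab.sym, q, y⟩ := by
        obtain _ | ⟨X, _ | ⟨Y, w⟩⟩ := w <;> simp at hw'
        exact ⟨X, rfl, hw'⟩
      obtain ⟨g1, g2, -⟩ := (h.prods _ _ hw).2 X (by simp)
      obtain ⟨B, hB⟩ := (h.label W hW).1
      -- Only the start symbol has a unary production that need not add an ω, and it is excluded
      -- here.
      have hcard := hacc.start_or.resolve_left fun e => hWS e.1
      have hlt : height (rules s (fun c => (child c).ctx) G) X <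
          height (rules s (fun c => (child c).ctx) G) W :=
        height_lt_of_card (by rw [hX]; exact hcard)
      obtain ⟨P, hP, hP'⟩ := ih (g2 ⟨B, by rw [hX]; exact hB⟩) g1 (by omega) (t := t)
        (by rw [hX]; exact ⟨ht.valid, ht.sym, ht.inn.trans hacc.inn, ht.out.trans hacc.out, hp, hq⟩)
      exact ⟨P, ⟨hW, .inl ⟨X, hw, hP⟩⟩, hP'⟩
    · have hWW : W ∈ component (rules s (fun c => (child c).ctx) G) W :=
        mem_component.mpr ⟨.refl, .refl⟩
      have hdone : ∀ V ∈ component (rules s (fun c => (child c).ctx) G) W,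
          V ∈ G.nonterms ∧ SimDone s post pre G V := by
        intro V hV
        rcases Relation.ReflTransGen.cases_head (mem_component.mp hV).2 with
          rfl | ⟨X, ⟨q, hq, rfl, -⟩, -⟩
        · exact ⟨hW, ⟨h1⟩⟩
        · have hp := (mem_rules'.mp hq).1
          exact ⟨(h.prods _ _ hp).1, (h.pair hp).1⟩
      have hout : ∀ V ∈ component (rules s (fun c => (child c).ctx) G) W, ∀ X,
          Edge (rules s (fun c => (child c).ctx) G) V X →
          X ∉ component (rules s (fun c => (child c).ctx) G) W →
          ∀ t, Fits child s post pre t X.lab → Covered child s (tableAt child s G r) X t := by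
        intro V hV X hX hn t ht
        by_cases hXn : X.IsNT
        · have hlt := height_lt_of_edge hR hV hX hn
          obtain ⟨q, hq, -, hqX⟩ := hX
          obtain ⟨g1, g2, -⟩ := (h.prods _ _ (mem_rules'.mp hq).1).2 X (by
            rcases hqX with rfl | rfl <;> simp)
          obtain ⟨P, hP, hP'⟩ := ih (g2 hXn) g1 (by omega) ht
          exact ⟨P, .inr hP, hP'⟩
        · exact covered_of_terminal ht hXn
      obtain ⟨w, hw⟩ := List.get_of_mem hWW
      obtain ⟨E, hE, h2⟩ := exists_nodeRuns h hv hb hbd hdone hout hWW ht w hw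
      exact ⟨_, ⟨hW, .inr (List.mem_flatMap.mpr ⟨E, hE, List.mem_map.mpr
        ⟨w, mem_idxs.mpr hw, rfl⟩⟩)⟩, fun c => h2 w c⟩

end Cover
end NestedVAS

namespace NestedVAS

/-! ## The decomposition is correct -/

section Decomposition

variable {d n k : ℕ} {child : Fin k → NGVAS d} {s : Shell d n k} {post pre : Approx d n k}
  {μ ν : OMarking d} {A : Fin n} {G : CovGrammar d n k}

theorem mem_decomposition {N : NGVAS d} : N ∈ decomposition child s μ ν G ↔
    ∃ X, (G.start, [X]) ∈ G.prods ∧ ∃ P ∈ lookup (tableAt child s G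
      (rounds d (rules s (fun c => (child c).ctx) G).length)) X, N = P.fill (variantCtx μ ν) := by
  simp only [decomposition, List.mem_flatMap]
  constructor
  · rintro ⟨⟨V, X⟩, hq, hN⟩
    split at hN
    · next e =>
      dsimp only at e
      subst e
      obtain ⟨P, hP, rfl⟩ := List.mem_map.mp hN
      exact ⟨X, mem_singles.mp hq, P, hP, rfl⟩
    · simp at hN
  · rintro ⟨X, hX, P, hP, rfl⟩
    exact ⟨(G.start, X), mem_singles.mpr hX, by
      rw [if_pos rfl]; exact List.mem_map.mpr ⟨P, hP, rfl⟩⟩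

theorem isDecomposition (hv : s.Valid fun c => (child c).ctx) (hs : s.Strong) (hb : s.Branching)
    (hr : s.RigidTracked fun c => (child c).ctx) (hch : ∀ c, (child c).IsNGVAS)
    (hvar : s.IsVariant μ A ν) (hrel : s.Relevant μ ν) (hpost : IsPostApprox child s post)
    (hpre : IsPreApprox child s pre) (hG : IsCovGrammar s post pre μ A ν G)
    (hbd : G.RemainsBounded s) :
    IsDecomposition (.node child (s.variant μ A ν)) (decomposition child s μ ν G) ∧
      ∀ N ∈ decomposition child s μ ν G, N.recrank < (NGVAS.node child s).recrank := by
  have h := hG.covSpec hv hb hpost hpre hvar hrel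
  -- A chosen counter shows that the dimension is positive, which the leaves without runs rely on.
  obtain ⟨pk, -⟩ := exists_pick hv hb h hbd h.start
  have hd : 0 < d := pk.2.pos
  have hn : 0 < n := A.pos
  have hgood : ∀ N ∈ decomposition child s μ ν G, ∃ P, N = P.fill (variantCtx μ ν) ∧
      GoodPre child s (d - Module.finrank ℝ (s.lcyclespace fun c => (child c).ctx))
        (.nonterminal A) P := by
    intro N hN
    obtain ⟨X, hX, P, hP, rfl⟩ := mem_decomposition.mp hN
    refine ⟨P, rfl, ?_⟩
    obtain ⟨-, -, -, e, -⟩ := h.single hX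
    have := goodTable hd hv hs hb hr hch rfl hpost hpre h _ X P hP
    rw [e, hG.1] at this
    exact this
  have hctx : ∀ N ∈ decomposition child s μ ν G, N.ctx = variantCtx μ ν := by
    intro N hN
    obtain ⟨P, rfl, -⟩ := hgood N hN
    rfl
  refine ⟨⟨fun N hN => ?_, ?_, fun N hN => ?_, fun N hN => ?_, fun N hN => ?_, fun N hN => ?_,
    fun N hN => ?_⟩, fun N hN => ?_⟩
  · obtain ⟨P, rfl, hP⟩ := hgood N hN
    exact hP.isNGVAS _ subset_rfl (Finset.inter_subset_left.trans hrel.1.2) hvar.1 hvar.2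
  · ext r
    simp only [Set.mem_iUnion, exists_prop]
    rw [mem_runs_node, symRuns_variant]
    constructor
    · rintro ⟨hrun, hadm⟩
      change r ∈ symRuns child s (.nonterminal A) at hrun
      change (variantCtx μ ν).Admits r at hadm
      obtain ⟨t, ht, hsym, rfl⟩ := RTree.exists_of_mem hrun
      -- The label of the start symbol does not carry values of the approximators. Its unary
      -- productions offer all of them, and the annotation of the tree selects one.
      obtain ⟨S, hS, h1, -⟩ := h.done _ h.start
      obtain ⟨x, y, hacc, rfl⟩ := hS.resolve_right fun e => e.1 rfl
      have hinn : Spec t.run.1.lift x := by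
        have h2 := hacc.inn
        rw [hG.1] at h2
        exact hadm.2.1.trans h2
      have hout : Spec t.run.2.2.lift y := by
        have h2 := hacc.out
        rw [hG.1] at h2
        exact hadm.2.2.trans h2
      have hsym' : t.sym = G.start.lab.sym := by rw [hsym, hG.1]; rfl
      obtain ⟨p, hp⟩ := exists_postFits hv hb hpost ht
        (hacc.spec_inn.omegas_subset.trans (hv.omegas_inOf hb _).subset) hinn
      obtain ⟨q, hq⟩ := exists_preFits hv hb hpre ht
        (hacc.spec_out.omegas_subset.trans
          ((hv.omegas_outOf hb _).trans (hv.bd_mid hb)).subset) hout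
      obtain ⟨w, hw, hw'⟩ := h1 [⟨x, p, G.start.lab.sym, q, y⟩]
        ⟨p, hsym' ▸ hp.mem, q, hsym' ▸ hq.mem, rfl⟩
      obtain ⟨X, rfl, hX⟩ : ∃ X : CGSym d n k, w = [X] ∧
          X.lab = ⟨x, p, G.start.lab.sym, q, y⟩ := by
        obtain _ | ⟨X, _ | ⟨Y, w⟩⟩ := w <;> simp at hw'
        exact ⟨X, rfl, hw'⟩
      obtain ⟨g1, g2, -⟩ := (h.prods _ _ hw).2 X (by simp)
      obtain ⟨B, hB⟩ := (h.label _ h.start).1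
      obtain ⟨P, hP, hP'⟩ := covered_tableAt h hv hb hpost hpre hbd
        (g2 ⟨B, by rw [hX]; exact hB⟩) g1 height_le_rounds (t := t)
        (by rw [hX]; exact ⟨ht, hsym', hinn, hout, hp, hq⟩)
      exact ⟨_, mem_decomposition.mpr ⟨X, hw, P, hP, rfl⟩, mem_runs_node.mpr ⟨hP' _, hadm⟩⟩
    · rintro ⟨N, hN, hrun⟩
      obtain ⟨P, rfl, hP⟩ := hgood N hN
      obtain ⟨h1, h2⟩ := mem_runs_node.mp hrun
      exact ⟨hP.sound _ h1, h2⟩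
  · rw [hctx N hN]
    exact subset_rfl
  · rw [hctx N hN]
    exact Spec.refl _
  · rw [hctx N hN]
    exact Spec.refl _
  · exact fun v _ => variantCtx_restr v
  · obtain ⟨P, rfl, hP⟩ := hgood N hN
    exact hP.recrank_lt_variant hn hb rfl
  · obtain ⟨P, rfl, hP⟩ := hgood N hN
    exact hP.recrank_lt hn hb hv hrel rfl

end Decomposition
end NestedVAS

theorem mainTheorem8 :
    ∃ (P : Prog) (e : ℕ), ∀ (d n k : ℕ) (child : Fin k → NGVAS d) (s : Shell d n k),
      (NGVAS.node child s).IsNGVAS → s.Branching → s.RigidTracked (fun c => (child c).ctx) →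
      ∀ (μ : OMarking d) (A : Fin n) (ν : OMarking d), s.IsVariant μ A ν → s.Relevant μ ν →
      ∀ post pre : Approx d n k, IsPostApprox child s post → IsPreApprox child s pre →
      ∀ G : CovGrammar d n k, IsCovGrammar s post pre μ A ν G → G.RemainsBounded s →
      ∃ D : List (NGVAS d),
        P.ComputesWithin (Data.ofInput (.node child s) μ A ν G) (Data.ofList (D.map Data.ofNGVAS))
          (tower e (Data.ofInput (.node child s) μ A ν G).size) ∧
        IsDecomposition (.node child (s.variant μ A ν)) D ∧
        ∀ N' ∈ D, N'.recrank < (NGVAS.node child s).recrank := by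
  obtain ⟨P, e, hP⟩ := exists_program
  refine ⟨P, e, fun d n k child s hN hb hr μ A ν hv hrel post pre hpost hpre G hG hbd =>
    ⟨decomposition child s μ ν G, hP d n k child s μ A ν G, ?_⟩⟩
  obtain ⟨hweak, hstrong⟩ := hN
  rw [NGVAS.Weak] at hweak
  rw [NGVAS.Strong] at hstrong
  exact isDecomposition hweak.2 hstrong.2 hb hr (fun c => ⟨hweak.1 c, hstrong.1 c⟩) hv hrel hpost
    hpre hG hbd
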